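/- Let $M$ be an $n$-dimensional manifold with a volume form $\nu$ (by which it is oriented), $E\to M$ a smooth vector bundle, and $J^\infty E$ its infinite jet bundle, with local coordinates $(x^i,u^a_I)$. Let $Loc_E$ be the algebra of local functions (smooth functions pulled back from some finite jet bundle $J^pE$), let $\Omega^{k,0}$ be the space of horizontal $k$-forms $\alpha=\alpha_I\,dx^I$ on $J^\infty E$ with local coefficients, and let $d_H\alpha=D_i\alpha_I\,dx^i\wedge dx^I$, where $D_i=\partial/\partial x^i+u^a_{iJ}\,\partial/\partial u^a_J$. The Euler--Lagrange operator is $\mathbf E(L\,d^nx)=\mathbf E_a(L)\,\theta^a\wedge d^nx$, $\mathbf E_a(L)=(-D)_I(\partial L/\partial u^a_I)$, $\theta^a=du^a-u^a_i\,dx^i$; its values lie in the $Loc_E$-module $\Omega^{n,1}_0$ that is locally generated by the forms $\theta^a\wedge d^nx$. For $k<n$ let $\Omega^{k,0}_c\subset\Omega^{k,0}$ consist of the forms $\alpha$ such that $(j^\infty\phi)^*\alpha$ has compact support for every compactly supported section $\phi$ of $E$; let $\Omega^{n,0}_c$ consist of the $\lambda\in\Omega^{n,0}$ for which, moreover, $\mathbf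 E(\lambda)$ has compact support along $j^\infty\phi$ for every such $\phi$. Let $\omega:\Omega^{n,1}_0\times\Omega^{n,1}_0\to Loc_E$ be skew-symmetric and $Loc_E$-linear in each variable, and put $\tilde l_2(\lambda,\mu)=\omega(\mathbf E(\lambda),\mathbf E(\mu))\,\nu$. Assume that the Poisson bracket $\{\int_M\lambda,\int_M\mu\}(\phi)=\int_M(j^\infty\phi)^*\tilde l_2(\lambda,\mu)$ of the local functionals $\phi\mapsto\int_M(j^\infty\phi)^*\lambda$, $\lambda\in\Omega^{n,0}_c$, on compactly supported sections satisfies the Jacobi identity. Let $G$ be a group (for example a Lie group) acting on $E$ by smooth, fibre preserving automorphisms $\psi_g$ that cover the identity of $M$. Assume that the action is canonical: for all $g\in G$ the map $\Psi_g(\mathcal P)(\phi)=\mathcal P(\psi_g\circ\phi)$ satisfies $\{\Psi_g\mathcal P,\Psi_g\mathcal Q\}=\Psi_g\{\mathcal P,\mathcal Q\}$ for all local functionals $\mathcal P=\int\alpha$, $\mathcal Q=\int\beta$ with $\alpha$, $\beta$, $(j\psi_g)^*\alpha$, $(j\psi_g)^*\beta$ in $\Omega^{n,0}_c$. Let $\pi:J^\infty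 E\to J^\infty E/G$ be the projection, where $J^\infty E/G$ carries the quotient smooth structure, so that a horizontal form on $J^\infty E/G$ is smooth exactly when its pullback by $\pi$ is, and let $\Omega^{k,0}_c(J^\infty E/G)$ be the space of horizontal forms $h$ on $J^\infty E/G$ such that $\pi^*h$ is a $G$-invariant element of $\Omega^{k,0}_c$. Assume the reduction hypothesis: every $G$-invariant form $d_H\gamma$ with $\gamma\in\Omega^{k,0}_c$ equals $d_H\gamma'$ for some $G$-invariant $\gamma'\in\Omega^{k,0}_c$. Then the reduced differential $\hat d_H=(\pi^*)^{-1}d_H\,\pi^*$ and the map $\hat l_2(f,h)=(\pi^*)^{-1}\tilde l_2(\pi^*f,\pi^*h)$ on $\Omega^{n,0}_c(J^\infty E/G)$ are well defined, and there is a bilinear, skew-symmetric bracket $[\cdot,\cdot]$ on the top cohomology $$H^n(\Omega^{*,0}_c(J^\infty E/G),\hat d_H)=\Omega^{n,0}_c(J^\infty E/G)\,/\,\hat d_H\,\Omega^{n-1,0}_c(J^\infty E/G)$$ that is induced by $\hat l_2$, that is, the bracket of the classes of $f$ and $h$ is the class of $\hat l_2(f,h)$, and that satisfies the Jacobi identity.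 -/

import Mathlib

open Set Bundle Manifold
open scoped ContDiff Topology Manifold

set_option linter.unusedSectionVars false

namespace JetReduction

noncomputable section

/-! ### Calculus in the coordinates `(xⁱ, uᵃ_I)` of an infinite jet space -/

/-- The standard `n`-dimensional space. -/
abbrev Rn (n : ℕ) : Type := EuclideanSpace ℝ (Fin n)

/-- Coordinates `(xⁱ, uᵃ_I)` on the infinite jet space of maps from `ℝⁿ` to `ℝᵐ`; the symmetric
multi-index `I : Fin n → ℕ` counts how often each direction occurs, and its order is `∑ i, I i`. -/
abbrev JetCoord (n m : ℕ) : Type := Rn n × (Fin m × (Fin n → ℕ) → ℝ)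

/-- The multi-index `I` written out as a nondecreasing list `i₁, …, i_r` of directions. -/
def idxList {n : ℕ} (I : Fin n → ℕ) : List (Fin n) :=
  (List.finRange n).flatMap fun i => List.replicate (I i) i

/-- The multi-indices of order at most `r`. -/
def multiIdx (n r : ℕ) : Finset (Fin n → ℕ) :=
  (Finset.Iic fun _ => r).filter fun I => ∑ i, I i ≤ r

/-- The partial derivative `∂_I fᵃ` at the point `y`. -/
def partialDeriv {n m : ℕ} (f : Rn n → Rn m) (y : Rn n) (a : Fin m) (I : Fin n → ℕ) : ℝ :=
  iteratedFDeriv ℝ (idxList I).length f y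
    (fun j => EuclideanSpace.single ((idxList I).get j) (1 : ℝ)) a

section Coordinates

variable {n m : ℕ} {W : Type*} [NormedAddCommGroup W] [NormedSpace ℝ W]

/-- `p` is, over the open set `U`, a smooth function of `x` and of the finitely many `uᵃ_I` with
`I` of order at most `r`. -/
def SmoothOfOrder (r : ℕ) (U : Set (Rn n)) (p : JetCoord n m → W) : Prop :=
  ∃ q : Rn n × (Fin m × multiIdx n r → ℝ) → W,
    ContDiffOn ℝ ∞ q (U ×ˢ univ) ∧
      ∀ y ∈ U, ∀ u, p (y, u) = q (y, fun aI => u (aI.1, aI.2))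

/-- `∂p/∂xⁱ`. -/
def dX (i : Fin n) (p : JetCoord n m → W) (z : JetCoord n m) : W :=
  lineDeriv ℝ p z (EuclideanSpace.single i (1 : ℝ), 0)

/-- `∂p/∂uᵃ_I`. -/
def dU (a : Fin m) (I : Fin n → ℕ) (p : JetCoord n m → W) (z : JetCoord n m) : W :=
  lineDeriv ℝ p z (0, Pi.single (a, I) (1 : ℝ))

/-- The total derivative `D_i = ∂/∂xⁱ + uᵃ_{iJ} ∂/∂uᵃ_J`. -/
def totalD (i : Fin n) (p : JetCoord n m → W) (z : JetCoord n m) : W :=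
  dX i p z + ∑ᶠ aJ : Fin m × (Fin n → ℕ), z.2 (aJ.1, aJ.2 + Pi.single i 1) • dU aJ.1 aJ.2 p z

/-- The iterated total derivative `D_I`. -/
def multiD (I : Fin n → ℕ) (p : JetCoord n m → W) : JetCoord n m → W :=
  (idxList I).foldr totalD p

/-- The component `E_a(p) = (-D)_I (∂p/∂uᵃ_I)` of the Euler-Lagrange operator. -/
def eulerCoord (a : Fin m) (p : JetCoord n m → W) (z : JetCoord n m) : W :=
  ∑ᶠ I : Fin n → ℕ, (-1 : ℝ) ^ (∑ i, I i) • multiD I (dU a I p) z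

/-- The horizontal differential `dxⁱ ∧ D_i p` of a `k`-form `p` in coordinates. -/
def dHCoord {k : ℕ} (p : JetCoord n m → Rn n [⋀^Fin k]→L[ℝ] ℝ) (z : JetCoord n m) :
    Rn n [⋀^Fin (k + 1)]→L[ℝ] ℝ :=
  .alternatizeUncurryFin
    (∑ i, (EuclideanSpace.proj i : Rn n →L[ℝ] ℝ).smulRight (totalD i p z))

end Coordinates

/-! ### Jets, horizontal forms and the Euler-Lagrange operator of a vector bundle -/

theorem symm_center_mem {n m : ℕ} {M : Type*} [TopologicalSpace M] [ChartedSpace (Rn n) M]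
    {V : M → Type*} [∀ x, TopologicalSpace (V x)]
    [TopologicalSpace (TotalSpace (Rn m) V)] [FiberBundle (Rn m) V] (x : M) :
    (extChartAt (𝓡 n) x).symm (extChartAt (𝓡 n) x x) ∈
      (trivializationAt (Rn m) V x).baseSet := by
  rw [extChartAt_to_inv]; exact mem_baseSet_trivializationAt (Rn m) V x

section Bundle

variable (n m : ℕ) {M : Type*} [TopologicalSpace M] [ChartedSpace (Rn n) M]
  (V : M → Type*) [∀ x, AddCommGroup (V x)] [∀ x, Module ℝ (V x)] [∀ x, TopologicalSpace (V x)]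
  [TopologicalSpace (TotalSpace (Rn m) V)] [FiberBundle (Rn m) V]

/-- Smooth global sections of the bundle. -/
abbrev Sec : Type _ := ContMDiffSection (𝓡 n) (Rn m) ∞ V

variable {V}

/-- A section in the preferred chart and the preferred trivialization at `x₀`. -/
def localSec (x₀ : M) (φ : Sec n m V) (y : Rn n) : Rn m :=
  (trivializationAt (Rn m) V x₀
    ⟨(extChartAt (𝓡 n) x₀).symm y, φ ((extChartAt (𝓡 n) x₀).symm y)⟩).2

/-- The coordinates `(xⁱ, uᵃ_I)` of the jet of `φ` at `x`, with respect to the chart and the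
trivialization at `x₀`. -/
def jetCoordAt (x₀ : M) (φ : Sec n m V) (x : M) : JetCoord n m :=
  (extChartAt (𝓡 n) x₀ x,
    fun aI => partialDeriv (localSec n m x₀ φ) (extChartAt (𝓡 n) x₀ x) aI.1 aI.2)

variable (V)

/-- Two sections have the same infinite jet at `x` when all their derivatives agree at `x`. -/
def jetSetoid (x : M) : Setoid (Sec n m V) where
  r φ φ' := ∀ k : ℕ,
    iteratedFDeriv ℝ k (localSec n m x φ) (extChartAt (𝓡 n) x x) =
      iteratedFDeriv ℝ k (localSec n m x φ') (extChartAt (𝓡 n) x x)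
  iseqv := ⟨fun _ _ => rfl, fun h k => (h k).symm, fun h h' k => (h k).trans (h' k)⟩

/-- The infinite jet bundle `J^∞E`, as pairs of a point and a jet of sections there. -/
def Jet : Type _ := Σ x : M, Quotient (jetSetoid n m V x)

variable {V}

/-- The jet `j^∞φ(x)`. -/
def jet (φ : Sec n m V) (x : M) : Jet n m V := ⟨x, Quotient.mk (jetSetoid n m V x) φ⟩

/-- The coordinates of a jet in the preferred chart and trivialization at its base point. -/
def Jet.coord (θ : Jet n m V) : JetCoord n m :=
  Quotient.lift (s := jetSetoid n m V θ.1) (fun φ => jetCoordAt n m θ.1 φ θ.1)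
    (fun φ φ' h => by
      have h' : ∀ k : ℕ, iteratedFDeriv ℝ k (localSec n m θ.1 φ) (extChartAt (𝓡 n) θ.1 θ.1) =
        iteratedFDeriv ℝ k (localSec n m θ.1 φ') (extChartAt (𝓡 n) θ.1 θ.1) := h
      simp only [jetCoordAt, partialDeriv, h']) θ.2

variable (V)

/-- The domain of the local coordinates at `x₀`. -/
def coordSource (x₀ : M) : Set M :=
  (chartAt (Rn n) x₀).source ∩ (trivializationAt (Rn m) V x₀).baseSet

/-- The image of `coordSource` in `ℝⁿ`. -/
def coordTarget (x₀ : M) : Set (Rn n) :=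
  (extChartAt (𝓡 n) x₀).target ∩
    (extChartAt (𝓡 n) x₀).symm ⁻¹' (trivializationAt (Rn m) V x₀).baseSet

variable {V}

/-- `p` expresses, in the coordinates at `x₀`, the quantity `f x φ` depending on a point and a
section. -/
def Represents {W : Type*} (x₀ : M) (f : M → Sec n m V → W) (p : JetCoord n m → W) : Prop :=
  ∀ x ∈ coordSource n m V x₀, ∀ φ : Sec n m V, f x φ = p (jetCoordAt n m x₀ φ x)

/-- The family `f` of local expressions (`f x₀` in the coordinates at `x₀`) consists of smooth
functions on one finite jet bundle `J^rE`. -/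
def IsLocal {W : Type*} [NormedAddCommGroup W] [NormedSpace ℝ W]
    (f : M → M → Sec n m V → W) : Prop :=
  ∃ r : ℕ, ∀ x₀ : M, ∃ p : JetCoord n m → W,
    SmoothOfOrder r (coordTarget n m V x₀) p ∧ Represents n m x₀ (f x₀) p

/-- The local functions `Loc_E`. -/
def IsLoc (P : Jet n m V → ℝ) : Prop := IsLocal n m fun _ x φ => P (jet n m φ x)

/-- A covector of degree `k` at `x`, written in the chart at `x₀`. -/
def toChart {k : ℕ} (x₀ x : M) (β : TangentSpace (𝓡 n) x [⋀^Fin k]→L[ℝ] ℝ) :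
    Rn n [⋀^Fin k]→L[ℝ] ℝ :=
  β.compContinuousLinearMap
    (mfderiv 𝓘(ℝ, Rn n) (𝓡 n) (extChartAt (𝓡 n) x₀).symm (extChartAt (𝓡 n) x₀ x) :
      Rn n →L[ℝ] TangentSpace (𝓡 n) x)

/-- A form on `ℝⁿ`, in the preferred chart at `x`, as a covector at `x`. -/
def ofChart {k : ℕ} (x : M) (β : Rn n [⋀^Fin k]→L[ℝ] ℝ) :
    TangentSpace (𝓡 n) x [⋀^Fin k]→L[ℝ] ℝ :=
  β.compContinuousLinearMap
    (mfderiv (𝓡 n) 𝓘(ℝ, Rn n) (extChartAt (𝓡 n) x) x : TangentSpace (𝓡 n) x →L[ℝ] Rn n)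

variable (V)

/-- Horizontal `k`-forms on `J^∞E`, not necessarily smooth: they assign to each jet over `x` an
alternating `k`-form on `T_xM`. -/
abbrev HForm (k : ℕ) : Type _ := ∀ θ : Jet n m V, TangentSpace (𝓡 n) θ.1 [⋀^Fin k]→L[ℝ] ℝ

/-- Forms of the type `f_a θᵃ ∧ dⁿx`, not necessarily smooth. The value at a jet over `x` is the
linear map `v ↦ f_a vᵃ dⁿx` from `E_x` to the `n`-forms on `T_xM`. -/
abbrev SourceForm : Type _ :=
  ∀ θ : Jet n m V, V θ.1 →ₗ[ℝ] (TangentSpace (𝓡 n) θ.1 [⋀^Fin n]→L[ℝ] ℝ)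

variable {V} {k : ℕ}

/-- The pullback of a horizontal form by `j^∞φ`, a `k`-form on `M`. -/
def pullSec (φ : Sec n m V) (α : HForm n m V k) (x : M) :
    TangentSpace (𝓡 n) x [⋀^Fin k]→L[ℝ] ℝ := α (jet n m φ x)

/-- Smooth horizontal forms, `Ω^{k,0}(J^∞E)`. -/
def IsSmoothForm (α : HForm n m V k) : Prop :=
  IsLocal n m fun x₀ x φ => toChart n x₀ x (pullSec n m φ α x)

/-- The coefficient function of a smooth horizontal form in the coordinates at `x₀`. -/
def coordRep (x₀ : M) (α : HForm n m V k) : JetCoord n m → Rn n [⋀^Fin k]→L[ℝ] ℝ :=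
  open Classical in
  if h : ∃ p : JetCoord n m → Rn n [⋀^Fin k]→L[ℝ] ℝ,
      (∃ r, SmoothOfOrder r (coordTarget n m V x₀) p) ∧
        Represents n m x₀ (fun x φ => toChart n x₀ x (pullSec n m φ α x)) p
  then h.choose else 0

/-- The horizontal differential `d_H`. -/
def dH (α : HForm n m V k) : HForm n m V (k + 1) := fun θ =>
  ofChart n θ.1 (dHCoord (coordRep n m θ.1 α) (θ.coord n m))

/-- The forms in `Ω^{n,1}_0(J^∞E)`: locally `f_a θᵃ ∧ dⁿx` with local functions `f_a`. -/
def IsSmoothSource [VectorBundle ℝ (Rn m) V] (η : SourceForm n m V) : Prop :=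
  ∀ a : Fin m, IsLocal n m fun x₀ x φ =>
    toChart n x₀ x (η (jet n m φ x)
      ((trivializationAt (Rn m) V x₀).symmₗ ℝ x (EuclideanSpace.single a (1 : ℝ))))

/-- The Euler-Lagrange operator `E(L dⁿx) = E_a(L) θᵃ ∧ dⁿx`. -/
def euler [VectorBundle ℝ (Rn m) V] (lam : HForm n m V n) : SourceForm n m V := fun θ =>
  ∑ a : Fin m,
    ((EuclideanSpace.proj a : Rn m →L[ℝ] ℝ).toLinearMap ∘ₗ
      (trivializationAt (Rn m) V θ.1).linearMapAt ℝ θ.1).smulRight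
        (ofChart n θ.1 (eulerCoord a (coordRep n m θ.1 lam) (θ.coord n m)))

/-- Compactly supported sections. -/
def CompactSec (φ : Sec n m V) : Prop := ∃ K : Set M, IsCompact K ∧ ∀ x ∉ K, φ x = 0

/-- `α ∈ Ω^{k,0}` such that `(j^∞φ)^* α` has compact support for all compactly supported `φ`. -/
def IsCompactForm (α : HForm n m V k) : Prop :=
  IsSmoothForm n m α ∧ ∀ φ : Sec n m V, CompactSec n m φ →
    ∃ K : Set M, IsCompact K ∧ ∀ x ∉ K, pullSec n m φ α x = 0

/-- `Ω^{n,0}_c`: here `E(λ)` too has compact support along each compactly supported section. -/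
def IsCompactTop [VectorBundle ℝ (Rn m) V] (lam : HForm n m V n) : Prop :=
  IsCompactForm n m lam ∧ ∀ φ : Sec n m V, CompactSec n m φ →
    ∃ K : Set M, IsCompact K ∧ ∀ x ∉ K, euler n m lam (jet n m φ x) = 0

/-! ### The Poisson bracket of local functionals -/

/-- A smooth nowhere vanishing `n`-form on `M`. -/
def IsVolumeForm (ν : ∀ x : M, TangentSpace (𝓡 n) x [⋀^Fin n]→L[ℝ] ℝ) : Prop :=
  (∀ x, ν x ≠ 0) ∧ ∀ x₀ : M,
    ContDiffOn ℝ ∞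
      (fun y => toChart n x₀ ((extChartAt (𝓡 n) x₀).symm y) (ν ((extChartAt (𝓡 n) x₀).symm y)))
      (extChartAt (𝓡 n) x₀).target

variable (V) in
/-- A skew-symmetric pairing `ω` of `Ω^{n,1}_0` with itself into `Loc_E`, linear over `Loc_E`; a
`Loc_E`-bilinear pairing is the same as a smooth family of bilinear forms, one at each jet. -/
structure SkewPairing [VectorBundle ℝ (Rn m) V] where
  /-- the value of the pairing at a jet -/
  form : ∀ θ : Jet n m V,
    (V θ.1 →ₗ[ℝ] (TangentSpace (𝓡 n) θ.1 [⋀^Fin n]→L[ℝ] ℝ)) →ₗ[ℝ]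
      (V θ.1 →ₗ[ℝ] (TangentSpace (𝓡 n) θ.1 [⋀^Fin n]→L[ℝ] ℝ)) →ₗ[ℝ] ℝ
  skew : ∀ θ ξ ξ', form θ ξ ξ' = - form θ ξ' ξ
  smooth : ∀ η η' : SourceForm n m V, IsSmoothSource n m η → IsSmoothSource n m η' →
    IsLoc n m fun θ => form θ (η θ) (η' θ)

/-- `l̃₂(λ, μ) = ω(E(λ), E(μ)) ν`. -/
def l2 [VectorBundle ℝ (Rn m) V] (om : SkewPairing n m V)
    (ν : ∀ x : M, TangentSpace (𝓡 n) x [⋀^Fin n]→L[ℝ] ℝ) (lam mu : HForm n m V n) :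
    HForm n m V n := fun θ =>
  om.form θ (euler n m lam θ) (euler n m mu θ) • ν θ.1

section Integral

variable (M) [IsManifold (𝓡 n) ∞ M] [T2Space M] [SigmaCompactSpace M]

/-- There is a partition of unity subordinate to the preferred charts. -/
theorem exists_partition : ∃ ρ : SmoothPartitionOfUnity M (𝓡 n) M univ,
    ρ.IsSubordinate fun x₀ => (chartAt (Rn n) x₀).source :=
  SmoothPartitionOfUnity.exists_isSubordinate (𝓡 n) isClosed_univ _
    (fun x₀ => (chartAt (Rn n) x₀).open_source)
    (fun x _ => mem_iUnion.2 ⟨x, mem_chart_source (Rn n) x⟩)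

/-- A partition of unity subordinate to the preferred charts. -/
def chartPartition : SmoothPartitionOfUnity M (𝓡 n) M univ := (exists_partition n M).choose

variable {M}

/-- The integral `∫_M β` of a compactly supported `n`-form over `M`, oriented by the volume form
`ν`, by means of charts and a partition of unity; `β = b dⁿx` contributes `± ∫ ρ b dx` in a chart,
the sign being that of `ν`. -/
def formIntegral (ν β : ∀ x : M, TangentSpace (𝓡 n) x [⋀^Fin n]→L[ℝ] ℝ) : ℝ :=
  ∑ᶠ x₀ : M, ∫ y in (extChartAt (𝓡 n) x₀).target,
    chartPartition n M x₀ ((extChartAt (𝓡 n) x₀).symm y) *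
      (toChart n x₀ ((extChartAt (𝓡 n) x₀).symm y) (β ((extChartAt (𝓡 n) x₀).symm y))
          (fun i => EuclideanSpace.single i 1) *
        (SignType.sign (toChart n x₀ ((extChartAt (𝓡 n) x₀).symm y)
          (ν ((extChartAt (𝓡 n) x₀).symm y)) (fun i => EuclideanSpace.single i 1)) : ℝ))

/-- The local functional `φ ↦ ∫_M (j^∞φ)^* λ`. -/
def functional (ν : ∀ x : M, TangentSpace (𝓡 n) x [⋀^Fin n]→L[ℝ] ℝ) (lam : HForm n m V n)
    (φ : Sec n m V) : ℝ :=
  formIntegral n ν (pullSec n m φ lam)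

/-- The Poisson bracket of local functionals,
`{∫ λ, ∫ μ} (φ) = ∫_M (j^∞φ)^* (ω(E(λ), E(μ)) ν)`, satisfies the Jacobi identity. -/
def PoissonJacobi [VectorBundle ℝ (Rn m) V] (om : SkewPairing n m V)
    (ν : ∀ x : M, TangentSpace (𝓡 n) x [⋀^Fin n]→L[ℝ] ℝ) : Prop :=
  ∀ α β γ : HForm n m V n, IsCompactTop n m α → IsCompactTop n m β → IsCompactTop n m γ →
    ∀ φ : Sec n m V, CompactSec n m φ →
      functional n m ν (l2 n m om ν (l2 n m om ν α β) γ) φ +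
        functional n m ν (l2 n m om ν (l2 n m om ν β γ) α) φ +
        functional n m ν (l2 n m om ν (l2 n m om ν γ α) β) φ = 0

end Integral

/-! ### Group actions and reduction -/

variable (V) in
/-- An action of a group on `E` by smooth automorphisms that cover the identity of `M`. -/
structure BundleAction (G : Type*) [Group G] where
  /-- the action on the fibres -/
  act : G → ∀ x, V x → V x
  one : ∀ x v, act 1 x v = v
  mul : ∀ g h x v, act (g * h) x v = act g x (act h x v)
  smooth : ∀ g, ContMDiff ((𝓡 n).prod 𝓘(ℝ, Rn m)) ((𝓡 n).prod 𝓘(ℝ, Rn m)) ∞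
    (fun e : TotalSpace (Rn m) V => (⟨e.1, act g e.1 e.2⟩ : TotalSpace (Rn m) V))

variable {n m} {G : Type*} [Group G] (ψ : BundleAction n m V G)

/-- The action `φ ↦ ψ_g ∘ φ` on sections. -/
def BundleAction.onSec (g : G) (φ : Sec n m V) : Sec n m V where
  toFun x := ψ.act g x (φ x)
  contMDiff_toFun := (ψ.smooth g).comp φ.contMDiff_toFun

section JetAction

variable [IsManifold (𝓡 n) ∞ M] [VectorBundle ℝ (Rn m) V]
  [ContMDiffVectorBundle ∞ (Rn m) V (𝓡 n)]

/-- The action of `g` in local coordinates at `x`. -/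
def BundleAction.coordMap (g : G) (x : M) (z : Rn n × Rn m) : Rn m :=
  (trivializationAt (Rn m) V x
    ⟨_, ψ.act g _ ((trivializationAt (Rn m) V x).toOpenPartialHomeomorph.symm
      ((extChartAt (𝓡 n) x).symm z.1, z.2)).2⟩).2

theorem contMDiffAt_symm_center (x : M) :
    ContMDiffAt 𝓘(ℝ, Rn n) (𝓡 n) ∞ (extChartAt (𝓡 n) x).symm (extChartAt (𝓡 n) x x) :=
  (contMDiffOn_extChartAt_symm x).contMDiffAt (extChartAt_target_mem_nhds x)

theorem localSec_contDiffAt (φ : Sec n m V) (x : M) :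
    ContDiffAt ℝ ∞ (localSec n m x φ) (extChartAt (𝓡 n) x x) := by
  rw [← contMDiffAt_iff_contDiffAt]
  have h1 : ContMDiffAt 𝓘(ℝ, Rn n) ((𝓡 n).prod 𝓘(ℝ, Rn m)) ∞
      (fun y => (⟨(extChartAt (𝓡 n) x).symm y, φ ((extChartAt (𝓡 n) x).symm y)⟩ :
        TotalSpace (Rn m) V)) (extChartAt (𝓡 n) x x) :=
    (φ.contMDiff_toFun _).comp _ (contMDiffAt_symm_center x)
  have h2 := ((trivializationAt (Rn m) V x).contMDiffOn (IB := 𝓡 n) (n := ∞)).contMDiffAt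
    ((trivializationAt (Rn m) V x).open_source.mem_nhds
      ((trivializationAt (Rn m) V x).mem_source.2 (symm_center_mem (n := n) (m := m) (V := V) x) :
        (⟨_, φ _⟩ : TotalSpace (Rn m) V) ∈ _))
  exact (ContMDiffAt.comp_of_eq h2 h1 rfl).snd

theorem BundleAction.coordMap_contDiffAt (g : G) (x : M) (v : Rn m) :
    ContDiffAt ℝ ∞ (ψ.coordMap g x) (extChartAt (𝓡 n) x x, v) := by
  rw [← contMDiffAt_iff_contDiffAt]
  have h1 : ContMDiffAt 𝓘(ℝ, Rn n × Rn m) ((𝓡 n).prod 𝓘(ℝ, Rn m)) ∞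
      (fun z : Rn n × Rn m => ((extChartAt (𝓡 n) x).symm z.1, z.2))
      (extChartAt (𝓡 n) x x, v) :=
    (ContMDiffAt.comp_of_eq (contMDiffAt_symm_center x) contDiffAt_fst.contMDiffAt rfl).prodMk
      contDiffAt_snd.contMDiffAt
  have ht : ((extChartAt (𝓡 n) x).symm (extChartAt (𝓡 n) x x), v) ∈
      (trivializationAt (Rn m) V x).target :=
    (trivializationAt (Rn m) V x).mem_target.2 (symm_center_mem (n := n) (m := m) (V := V) x)
  have h2 := ((trivializationAt (Rn m) V x).contMDiffOn_symm (IB := 𝓡 n) (n := ∞)).contMDiffAt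
    ((trivializationAt (Rn m) V x).open_target.mem_nhds ht)
  have hs : (⟨_, ψ.act g _ ((trivializationAt (Rn m) V x).toOpenPartialHomeomorph.symm
      ((extChartAt (𝓡 n) x).symm (extChartAt (𝓡 n) x x), v)).2⟩ : TotalSpace (Rn m) V) ∈
      (trivializationAt (Rn m) V x).source := by
    rw [Trivialization.mem_source]
    change ((trivializationAt (Rn m) V x).toOpenPartialHomeomorph.symm _).proj ∈ _
    rw [(trivializationAt (Rn m) V x).proj_symm_apply ht]
    exact symm_center_mem (n := n) (m := m) (V := V) x
  have h3 := ((trivializationAt (Rn m) V x).contMDiffOn (IB := 𝓡 n) (n := ∞)).contMDiffAt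
    ((trivializationAt (Rn m) V x).open_source.mem_nhds hs)
  have h4 := ContMDiffAt.comp_of_eq h2 h1 rfl
  have h5 := ContMDiffAt.comp_of_eq (ψ.smooth g _) h4 rfl
  exact (ContMDiffAt.comp_of_eq h3 h5 rfl).snd

theorem BundleAction.localSec_onSec (g : G) (φ : Sec n m V) (x : M) :
    localSec n m x (ψ.onSec g φ) =ᶠ[𝓝 (extChartAt (𝓡 n) x x)]
      ψ.coordMap g x ∘ fun y => (y, localSec n m x φ y) := by
  have : (extChartAt (𝓡 n) x).symm ⁻¹' (trivializationAt (Rn m) V x).baseSet ∈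
      𝓝 (extChartAt (𝓡 n) x x) :=
    (contMDiffAt_symm_center x).continuousAt.preimage_mem_nhds
      ((trivializationAt (Rn m) V x).open_baseSet.mem_nhds
        (symm_center_mem (n := n) (m := m) (V := V) x))
  filter_upwards [this] with y hy
  have hy' : (⟨(extChartAt (𝓡 n) x).symm y, φ ((extChartAt (𝓡 n) x).symm y)⟩ :
      TotalSpace (Rn m) V) ∈ (trivializationAt (Rn m) V x).source :=
    (trivializationAt (Rn m) V x).mem_source.2 hy
  have key := (trivializationAt (Rn m) V x).symm_apply_mk_proj hy'
  simp only [Function.comp, BundleAction.coordMap, localSec]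
  erw [key]
  rfl

/-- The jet of `ψ_g ∘ φ` at `x` depends on the jet of `φ` at `x` only. -/
theorem BundleAction.onSec_congr (g : G) (x : M) {φ φ' : Sec n m V}
    (h : jetSetoid n m V x φ φ') : jetSetoid n m V x (ψ.onSec g φ) (ψ.onSec g φ') := by
  intro k
  have h0 : localSec n m x φ (extChartAt (𝓡 n) x x) =
      localSec n m x φ' (extChartAt (𝓡 n) x x) := by
    have := congrArg (fun T => T 0) (h 0)
    simpa using this
  have hT : ∀ i, iteratedFDeriv ℝ i (fun y => (y, localSec n m x φ y)) (extChartAt (𝓡 n) x x) =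
      iteratedFDeriv ℝ i (fun y => (y, localSec n m x φ' y)) (extChartAt (𝓡 n) x x) := by
    intro i
    have e := fun φ : Sec n m V => iteratedFDeriv_prodMk (n := ∞) (i := i)
      (contDiffAt_fun_id (𝕜 := ℝ) (x := extChartAt (𝓡 n) x x)) (localSec_contDiffAt φ x)
      (by exact_mod_cast le_top)
    rw [e, e, h i]
  have c := fun φ : Sec n m V => iteratedFDeriv_comp (n := ∞) (i := k)
    (f := fun y => (y, localSec n m x φ y)) (ψ.coordMap_contDiffAt g x _)
    (contDiffAt_fun_id.prodMk (localSec_contDiffAt φ x)) (by exact_mod_cast le_top)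
  have hT' : ftaylorSeries ℝ (fun y => (y, localSec n m x φ y)) (extChartAt (𝓡 n) x x) =
      ftaylorSeries ℝ (fun y => (y, localSec n m x φ' y)) (extChartAt (𝓡 n) x x) := funext hT
  rw [((ψ.localSec_onSec g φ x).iteratedFDeriv ℝ k).eq_of_nhds,
    ((ψ.localSec_onSec g φ' x).iteratedFDeriv ℝ k).eq_of_nhds, c, c, h0, hT']

/-- The induced action `jψ_g` on the jets at `x`, `jψ_g (j^∞φ(x)) = j^∞(ψ_g ∘ φ)(x)`. -/
def BundleAction.onJetAt (g : G) (x : M) (θ : Quotient (jetSetoid n m V x)) :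
    Quotient (jetSetoid n m V x) :=
  Quotient.map (ψ.onSec g) (fun _ _ h => ψ.onSec_congr g x h) θ

/-- The induced action `jψ_g` on `J^∞E`. -/
def BundleAction.onJet (g : G) (θ : Jet n m V) : Jet n m V := ⟨θ.1, ψ.onJetAt g θ.1 θ.2⟩

/-- The pullback `(jψ_g)^* α` of a horizontal form. -/
def BundleAction.pull {k : ℕ} (g : G) (α : HForm n m V k) : HForm n m V k :=
  fun θ => α (ψ.onJet g θ)

/-- `G`-invariant horizontal forms. -/
def BundleAction.IsInvariant {k : ℕ} (α : HForm n m V k) : Prop := ∀ g, ψ.pull g α = α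

/-- `G` acts by canonical automorphisms: the maps `Ψ_g(𝒫)(φ) = 𝒫(ψ_g ∘ φ)` preserve the Poisson
bracket, `{Ψ_g 𝒫, Ψ_g 𝒬} = Ψ_g {𝒫, 𝒬}`, for all local functionals `𝒫 = ∫ α` and `𝒬 = ∫ β` for which
`Ψ_g 𝒫 = ∫ (jψ_g)^* α` and `Ψ_g 𝒬 = ∫ (jψ_g)^* β` are again local functionals. -/
def BundleAction.IsCanonical [T2Space M] [SigmaCompactSpace M] (om : SkewPairing n m V)
    (ν : ∀ x : M, TangentSpace (𝓡 n) x [⋀^Fin n]→L[ℝ] ℝ) : Prop :=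
  ∀ (g : G) (α β : HForm n m V n), IsCompactTop n m α → IsCompactTop n m β →
    IsCompactTop n m (ψ.pull g α) → IsCompactTop n m (ψ.pull g β) →
    ∀ φ : Sec n m V, CompactSec n m φ →
      functional n m ν (l2 n m om ν (ψ.pull g α) (ψ.pull g β)) φ =
        functional n m ν (l2 n m om ν α β) (ψ.onSec g φ)

/-- The reduction hypothesis: every invariant `d_H`-exact form is the horizontal differential of an
invariant form. -/
def BundleAction.ReductionHypothesis : Prop :=
  ∀ (k : ℕ) (γ : HForm n m V k), IsCompactForm n m γ → ψ.IsInvariant (dH n m γ) →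
    ∃ γ' : HForm n m V k, IsCompactForm n m γ' ∧ ψ.IsInvariant γ' ∧ dH n m γ' = dH n m γ

/-- The orbit space `J^∞E/G`, as pairs of a point of `M` and an orbit of jets there. -/
def BundleAction.JetQuot : Type _ :=
  Σ x : M, Quot fun θ θ' : Quotient (jetSetoid n m V x) => ∃ g, ψ.onJetAt g x θ = θ'

/-- The projection `π : J^∞E → J^∞E/G`. -/
def BundleAction.proj (θ : Jet n m V) : ψ.JetQuot := ⟨θ.1, Quot.mk _ θ.2⟩

/-- Horizontal `k`-forms on `J^∞E/G`, not necessarily smooth. -/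
def BundleAction.RedForm (k : ℕ) : Type _ :=
  ∀ q : ψ.JetQuot, TangentSpace (𝓡 n) q.1 [⋀^Fin k]→L[ℝ] ℝ

instance (k : ℕ) : AddCommGroup (ψ.RedForm k) :=
  inferInstanceAs (AddCommGroup (∀ q : ψ.JetQuot, TangentSpace (𝓡 n) q.1 [⋀^Fin k]→L[ℝ] ℝ))

instance (k : ℕ) : Module ℝ (ψ.RedForm k) :=
  inferInstanceAs (Module ℝ (∀ q : ψ.JetQuot, TangentSpace (𝓡 n) q.1 [⋀^Fin k]→L[ℝ] ℝ))

/-- The pullback `π^*`. -/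
def BundleAction.pullProj {k : ℕ} (h : ψ.RedForm k) : HForm n m V k := fun θ => h (ψ.proj θ)

/-- The inverse `(π^*)⁻¹` of `π^*` on its image. -/
def BundleAction.pullProjInv {k : ℕ} (α : HForm n m V k) : ψ.RedForm k :=
  Function.invFun ψ.pullProj α

/-- The forms in `Ω^{k,0}_c(J^∞E/G)` for `k < n`; smoothness on the quotient is smoothness of the
pullback to `J^∞E`. -/
def BundleAction.IsRedCompact {k : ℕ} (h : ψ.RedForm k) : Prop :=
  IsCompactForm n m (ψ.pullProj h) ∧ ψ.IsInvariant (ψ.pullProj h)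

/-- The forms in `Ω^{n,0}_c(J^∞E/G)`. -/
def BundleAction.IsRedTop (h : ψ.RedForm n) : Prop :=
  IsCompactTop n m (ψ.pullProj h) ∧ ψ.IsInvariant (ψ.pullProj h)

/-- The reduced differential `d̂_H = (π^*)⁻¹ ∘ d_H ∘ π^*`. -/
def BundleAction.redD {k : ℕ} (h : ψ.RedForm k) : ψ.RedForm (k + 1) :=
  ψ.pullProjInv (dH n m (ψ.pullProj h))

/-- The reduced map `l̂₂ = (π^*)⁻¹ ∘ l̃₂ ∘ (π^* × π^*)`. -/
def BundleAction.redL2 (om : SkewPairing n m V)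
    (ν : ∀ x : M, TangentSpace (𝓡 n) x [⋀^Fin n]→L[ℝ] ℝ) (f h : ψ.RedForm n) : ψ.RedForm n :=
  ψ.pullProjInv (l2 n m om ν (ψ.pullProj f) (ψ.pullProj h))

/-- The subspace `Ω^{n,0}_c(J^∞E/G)`, spanned by the forms in it. -/
def BundleAction.redTop : Submodule ℝ (ψ.RedForm n) := Submodule.span ℝ {h | ψ.IsRedTop h}

/-- A form of degree `k` on `J^∞E/G` in the image of `d̂_H : Ω^{k-1,0}_c → Ω^{k,0}`, where
`Ω^{-1,0}_c = 0`. -/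
def BundleAction.IsRedExact : {k : ℕ} → ψ.RedForm k → Prop
  | 0, h => h = 0
  | k + 1, h => ∃ γ : ψ.RedForm k, ψ.IsRedCompact γ ∧ ψ.redD γ = h

/-- The subspace of `Ω^{n,0}_c(J^∞E/G)` of the `d̂_H`-exact forms. -/
def BundleAction.redExact : Submodule ℝ ψ.redTop :=
  Submodule.span ℝ {h | ψ.IsRedExact (h : ψ.RedForm n)}

/-- The top cohomology `H^n(Ω^{*,0}_c(J^∞E/G), d̂_H)`. -/
abbrev BundleAction.RedCohomology : Type _ := ψ.redTop ⧸ ψ.redExact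

end JetAction

end Bundle

end

end JetReduction

/-! The map `l2` sees its arguments only through their Euler-Lagrange forms. Hence three facts
suffice: `E` vanishes on `d_H`-exact forms, `l2` of invariant forms is invariant, and the cyclic sum
of the Jacobi identity (the `jacobiator`) is `d_H` of a form in `Ω_c`. By the first two, `l2`
descends to the reduced top cohomology. The reduction hypothesis then makes the primitive in the
third fact invariant, so the cyclic sum vanishes in the quotient.

The calculus rests on one device: a local function of finite order is determined by its values on
jets of smooth functions (`exists_jetAt_eq`), and along such a jet `D_i` is an ordinary partial
derivative (`pd_comp_jetAt`). Thus identities for total derivatives reduce to identities on `ℝⁿ`,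
and integration by parts gives the first variation formula `lineDeriv_eq_euler_add_bdry`. The first
variation of an `n`-form along a section changes between charts only by the Jacobian. Testing with
bump sections shows that `E` is independent of coordinates (`eulerIn_transMap`), without computing
with multi-indices. With Stokes' theorem the same tests give `euler_dH`.

Invariance (`BundleAction.IsInvariant.l2`): canonicity is an identity between integrals and has to
be localized. For Lagrangians of order zero, `E` is linear over functions on `M`, so inserting all
cut-offs gives a pointwise identity whenever one argument is such a test form
(`pairAt_pull_of_isCanonical`). At each jet the values of `E` on test forms exhaust all source
values, so test forms stand in for the given invariant Lagrangians.

Exactness of the jacobiator `J` (`exists_dH_eq_jacobiator`): the Poisson Jacobi identity says that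
the functional of `J` is zero, so `E(J) = 0` by the fundamental lemma of the calculus of variations.
Integrating the first variation along `t ↦ t φ`, split by a partition of unity, yields `d_H Γ = J -
J(0)`, where `J(0)` is the value along the zero section (`exists_dH_eq_sub_zero`). The primitive `Γ`
vanishes along `φ` wherever `φ` vanishes locally, hence lies in `Ω_c`. There remains `J(0)`, a form
on `M`. Cutting `α` by a partition of unity, and not `J` itself, splits `J(0)` into finitely many
pieces supported in coordinate cubes. Each of them has integral zero, by the Jacobi identity for the
cut form, and so is exact by the Poincaré lemma with compact supports
(`exists_dH_eq_of_integral_eq_zero`). For `n = 0` there are no exact forms except zero, and `J`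
itself vanishes (`jacobiator_eq_zero`). -/

namespace JetReduction

noncomputable section

/-! ### Iterated partial derivatives on `ℝⁿ` -/

section Partial

variable {n m : ℕ} {W W' : Type*} [NormedAddCommGroup W] [NormedSpace ℝ W]
  [NormedAddCommGroup W'] [NormedSpace ℝ W']

/-- The `i`-th coordinate vector. -/
abbrev stdVec (i : Fin n) : Rn n := EuclideanSpace.single i (1 : ℝ)

/-- The partial derivative in the direction `i`. -/
def pd (i : Fin n) (g : Rn n → W) (y : Rn n) : W := fderiv ℝ g y (stdVec i)

/-- The iterated partial derivative along a list of directions. -/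
def pdl (l : List (Fin n)) (g : Rn n → W) : Rn n → W := l.foldr pd g

@[simp] theorem pdl_nil (g : Rn n → W) : pdl [] g = g := rfl
@[simp] theorem pdl_cons (i : Fin n) (l : List (Fin n)) (g : Rn n → W) :
    pdl (i :: l) g = pd i (pdl l g) := rfl

theorem pd_contDiffOn {U : Set (Rn n)} (hU : IsOpen U) {g : Rn n → W} (hg : ContDiffOn ℝ ∞ g U)
    (i : Fin n) : ContDiffOn ℝ ∞ (pd i g) U :=
  (hg.fderiv_of_isOpen hU (by simp)).clm_apply contDiffOn_const

theorem pdl_contDiffOn {U : Set (Rn n)} (hU : IsOpen U) {g : Rn n → W} (hg : ContDiffOn ℝ ∞ g U)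
    (l : List (Fin n)) : ContDiffOn ℝ ∞ (pdl l g) U := by
  induction l with
  | nil => exact hg
  | cons i l ih => exact pd_contDiffOn hU ih i

theorem pd_congr {U : Set (Rn n)} (hU : IsOpen U) {g g' : Rn n → W} (h : EqOn g g' U)
    (i : Fin n) : EqOn (pd i g) (pd i g') U := fun y hy => by
  rw [pd, pd, (h.eventuallyEq_of_mem (hU.mem_nhds hy)).fderiv_eq]

theorem pdl_congr {U : Set (Rn n)} (hU : IsOpen U) {g g' : Rn n → W} (h : EqOn g g' U)
    (l : List (Fin n)) : EqOn (pdl l g) (pdl l g') U := by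
  induction l with
  | nil => exact h
  | cons i l ih => exact pd_congr hU ih i

theorem pd_comm {U : Set (Rn n)} (hU : IsOpen U) {g : Rn n → W} (hg : ContDiffOn ℝ ∞ g U)
    (i j : Fin n) : EqOn (pd i (pd j g)) (pd j (pd i g)) U := fun y hy => by
  have hgy : ContDiffAt ℝ ∞ g y := hg.contDiffAt (hU.mem_nhds hy)
  have hd : DifferentiableAt ℝ (fderiv ℝ g) y :=
    (hgy.fderiv_right (m := 1) (by norm_cast)).differentiableAt (by simp)
  have key : ∀ i j : Fin n, pd i (pd j g) y = fderiv ℝ (fderiv ℝ g) y (stdVec i) (stdVec j) := by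
    intro i j
    change fderiv ℝ (fun y => fderiv ℝ g y (stdVec j)) y (stdVec i) = _
    rw [fderiv_clm_apply hd (differentiableAt_const _)]
    simp
  rw [key, key]
  exact hgy.isSymmSndFDerivAt (by simp; norm_cast) _ _

/-- Adjacent swaps are the symmetry of second derivatives. This is what lets symmetric multi-indices
label derivatives: the order of directions chosen by `idxList` is immaterial. -/
theorem pdl_perm {U : Set (Rn n)} (hU : IsOpen U) {g : Rn n → W} (hg : ContDiffOn ℝ ∞ g U)
    {l l' : List (Fin n)} (h : l.Perm l') : EqOn (pdl l g) (pdl l' g) U := by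
  induction h with
  | nil => exact fun _ _ => rfl
  | cons i _ ih => exact pd_congr hU ih i
  | swap i j l => exact pd_comm hU (pdl_contDiffOn hU hg l) j i
  | trans _ _ h1 h2 => exact h1.trans h2

theorem pd_clm {U : Set (Rn n)} (hU : IsOpen U) {g : Rn n → W} (hg : ContDiffOn ℝ ∞ g U)
    (A : W →L[ℝ] W') (i : Fin n) : EqOn (pd i fun y => A (g y)) (fun y => A (pd i g y)) U :=
  fun y hy => by
    have : DifferentiableAt ℝ g y := (hg.contDiffAt (hU.mem_nhds hy)).differentiableAt (by simp)
    change fderiv ℝ (A ∘ g) y _ = _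
    rw [(A.hasFDerivAt.comp y this.hasFDerivAt).fderiv]
    rfl

theorem pdl_clm {U : Set (Rn n)} (hU : IsOpen U) {g : Rn n → W} (hg : ContDiffOn ℝ ∞ g U)
    (A : W →L[ℝ] W') (l : List (Fin n)) :
    EqOn (pdl l fun y => A (g y)) (fun y => A (pdl l g y)) U := by
  induction l with
  | nil => exact fun _ _ => rfl
  | cons i l ih => exact (pd_congr hU ih i).trans (pd_clm hU (pdl_contDiffOn hU hg l) A i)

/-- `partialDeriv` evaluates a single multilinear derivative on basis vectors. Successive partial
derivatives are the form in which inductions on the list of directions work. -/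
theorem iteratedFDeriv_eq_pdl {U : Set (Rn n)} (hU : IsOpen U) {g : Rn n → W}
    (hg : ContDiffOn ℝ ∞ g U) (l : List (Fin n)) {y : Rn n} (hy : y ∈ U) :
    iteratedFDeriv ℝ l.length g y (fun j => stdVec (l.get j)) = pdl l g y := by
  induction l generalizing y with
  | nil => simp
  | cons i l ih =>
    change iteratedFDeriv ℝ (l.length + 1) g y _ = _
    rw [iteratedFDeriv_succ_apply_left]
    have hd : DifferentiableAt ℝ (iteratedFDeriv ℝ l.length g) y :=
      (hg.contDiffAt (hU.mem_nhds hy)).differentiableAt_iteratedFDeriv (by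
        exact_mod_cast WithTop.coe_lt_coe.2 (ENat.natCast_lt_top _))
    have : (fun y => iteratedFDeriv ℝ l.length g y (fun j => stdVec (l.get j)))
        =ᶠ[𝓝 y] pdl l g := by
      filter_upwards [hU.mem_nhds hy] with y' hy' using ih hy'
    rw [pdl_cons, pd, ← this.fderiv_eq, fderiv_continuousMultilinear_apply_const_apply hd]
    rfl

theorem count_idxList (I : Fin n → ℕ) (i : Fin n) : (idxList I).count i = I i := by
  rw [idxList, List.count_flatMap]
  have : (List.map (List.count i ∘ fun j => List.replicate (I j) j) (List.finRange n)) =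
      List.map (fun j => if j = i then I j else 0) (List.finRange n) := by
    refine List.map_congr_left fun j _ => ?_
    simp [List.count_replicate]
  rw [this, ← List.ofFn_eq_map, List.sum_ofFn]
  simp

theorem idxList_add_single (I : Fin n → ℕ) (i : Fin n) :
    (idxList (I + Pi.single i 1)).Perm (i :: idxList I) := by
  rw [List.perm_iff_count]
  intro j
  rw [count_idxList, List.count_cons, count_idxList]
  by_cases h : i = j
  · subst h; simp
  · have h' : j ≠ i := fun e => h e.symm
    simp [h, h']

theorem length_idxList (I : Fin n → ℕ) : (idxList I).length = ∑ i, I i := by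
  have := List.length_flatMap (l := List.finRange n) (f := fun i => List.replicate (I i) i)
  rw [idxList, this, ← List.sum_ofFn, List.ofFn_eq_map]
  simp

theorem mem_multiIdx {r : ℕ} {I : Fin n → ℕ} : I ∈ multiIdx n r ↔ ∑ i, I i ≤ r := by
  simp only [multiIdx, Finset.mem_filter, Finset.mem_Iic, and_iff_right_iff_imp]
  exact fun h i => (Finset.single_le_sum (f := I) (fun _ _ => Nat.zero_le _)
    (Finset.mem_univ i)).trans h

theorem add_single_mem_multiIdx {r : ℕ} {I : Fin n → ℕ} (h : I ∈ multiIdx n r) (i : Fin n) :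
    I + Pi.single i 1 ∈ multiIdx n (r + 1) := by
  rw [mem_multiIdx] at h ⊢
  simp only [Pi.add_apply, Finset.sum_add_distrib, Finset.sum_pi_single', Finset.mem_univ, if_true]
  omega

theorem partialDeriv_eq_pdl {U : Set (Rn n)} (hU : IsOpen U) {f : Rn n → Rn m}
    (hf : ContDiffOn ℝ ∞ f U) (a : Fin m) (I : Fin n → ℕ) {y : Rn n} (hy : y ∈ U) :
    partialDeriv f y a I = pdl (idxList I) (fun y => f y a) y := by
  rw [partialDeriv, iteratedFDeriv_eq_pdl hU hf _ hy]
  exact (pdl_clm hU hf (EuclideanSpace.proj a : Rn m →L[ℝ] ℝ) (idxList I) hy).symm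

theorem partialDeriv_contDiffOn {U : Set (Rn n)} (hU : IsOpen U) {f : Rn n → Rn m}
    (hf : ContDiffOn ℝ ∞ f U) (a : Fin m) (I : Fin n → ℕ) :
    ContDiffOn ℝ ∞ (fun y => partialDeriv f y a I) U :=
  (pdl_contDiffOn hU ((EuclideanSpace.proj a : Rn m →L[ℝ] ℝ).contDiff.comp_contDiffOn hf)
    (idxList I)).congr fun _ hy => partialDeriv_eq_pdl hU hf a I hy

/-- The list of `I + e_i` has `i` at its sorted place and not at the head, so the two sides agree
only after a permutation of the directions. This is the source of the term `u_{I+i}` in `D_i`. -/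
theorem pd_partialDeriv {U : Set (Rn n)} (hU : IsOpen U) {f : Rn n → Rn m}
    (hf : ContDiffOn ℝ ∞ f U) (a : Fin m) (I : Fin n → ℕ) (i : Fin n) {y : Rn n} (hy : y ∈ U) :
    pd i (fun y => partialDeriv f y a I) y = partialDeriv f y a (I + Pi.single i 1) := by
  have hf' : ContDiffOn ℝ ∞ (fun y => f y a) U :=
    (EuclideanSpace.proj a : Rn m →L[ℝ] ℝ).contDiff.comp_contDiffOn hf
  rw [partialDeriv_eq_pdl hU hf a _ hy, pdl_perm hU hf' (idxList_add_single I i) hy, pdl_cons]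
  exact pd_congr hU (fun y hy => partialDeriv_eq_pdl hU hf a I hy) i hy

end Partial

/-! ### Local functions in coordinates -/

section LocalFunctions

variable {n m : ℕ} {W W' : Type*} [NormedAddCommGroup W] [NormedSpace ℝ W]
  [NormedAddCommGroup W'] [NormedSpace ℝ W']

/-- The jet of `f` at `y`, in coordinates. -/
def jetAt (f : Rn n → Rn m) (y : Rn n) : JetCoord n m :=
  (y, fun aI => partialDeriv f y aI.1 aI.2)

/-- The coordinates of order at most `r`. -/
def truncJet (r : ℕ) (u : Fin m × (Fin n → ℕ) → ℝ) : Fin m × multiIdx n r → ℝ :=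
  fun aI => u (aI.1, aI.2)

/-- A jet of order `r`, extended by zero. -/
def extJet (r : ℕ) (v : Fin m × multiIdx n r → ℝ) : Fin m × (Fin n → ℕ) → ℝ :=
  fun aI => if h : aI.2 ∈ multiIdx n r then v (aI.1, ⟨aI.2, h⟩) else 0

@[simp] theorem truncJet_extJet (r : ℕ) (v : Fin m × multiIdx n r → ℝ) :
    truncJet r (extJet r v) = v := by
  ext ⟨a, I, h⟩; simp [truncJet, extJet, h]

theorem truncJet_of_le {r s : ℕ} (h : r ≤ s) {u u' : Fin m × (Fin n → ℕ) → ℝ}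
    (hu : truncJet s u = truncJet s u') : truncJet r u = truncJet r u' := by
  ext ⟨a, I, hI⟩
  exact congrFun hu (a, ⟨I, mem_multiIdx.2 ((mem_multiIdx.1 hI).trans h)⟩)

/-- Extension of truncated jets by zero singles out a canonical witness `q`. Smoothness of order `r`
then becomes dependence on finitely many coordinates plus smoothness of one definite function, and
no choices are left to reconcile. -/
theorem smoothOfOrder_iff {r : ℕ} {U : Set (Rn n)} {p : JetCoord n m → W} :
    SmoothOfOrder r U p ↔ (∀ y ∈ U, ∀ u u', truncJet r u = truncJet r u' → p (y, u) = p (y, u')) ∧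
      ContDiffOn ℝ ∞ (fun z : Rn n × (Fin m × multiIdx n r → ℝ) => p (z.1, extJet r z.2))
        (U ×ˢ univ) := by
  constructor
  · rintro ⟨q, hq, h⟩
    refine ⟨fun y hy u u' e => ?_, hq.congr fun z hz => ?_⟩
    · rw [h y hy, h y hy]
      exact congrArg (fun v => q (y, v)) e
    · rw [h _ hz.1]
      exact congrArg (fun v => q (z.1, v)) (truncJet_extJet r z.2)
  · rintro ⟨h, hq⟩
    exact ⟨_, hq, fun y hy u => h y hy _ _ (truncJet_extJet r _).symm⟩

namespace SmoothOfOrder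

variable {r s : ℕ} {U U' : Set (Rn n)} {p p' : JetCoord n m → W}

theorem eq_of_trunc (hp : SmoothOfOrder r U p) {y : Rn n} (hy : y ∈ U)
    {u u' : Fin m × (Fin n → ℕ) → ℝ} (h : truncJet r u = truncJet r u') : p (y, u) = p (y, u') :=
  (smoothOfOrder_iff.1 hp).1 y hy u u' h

theorem mono_set (hp : SmoothOfOrder r U p) (h : U' ⊆ U) : SmoothOfOrder r U' p := by
  obtain ⟨q, hq, e⟩ := hp
  exact ⟨q, hq.mono (prod_mono h subset_rfl), fun y hy => e y (h hy)⟩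

theorem mono_order (hp : SmoothOfOrder r U p) (h : r ≤ s) : SmoothOfOrder s U p := by
  obtain ⟨q, hq, e⟩ := hp
  let L : Rn n × (Fin m × multiIdx n s → ℝ) → Rn n × (Fin m × multiIdx n r → ℝ) :=
    fun z => (z.1, fun aI => z.2 (aI.1, ⟨aI.2, mem_multiIdx.2 ((mem_multiIdx.1 aI.2.2).trans h)⟩))
  have hL : ContDiff ℝ ∞ L := contDiff_fst.prodMk (contDiff_pi.2 fun aI =>
    (contDiff_apply ℝ ℝ _).comp contDiff_snd)
  exact ⟨q ∘ L, hq.comp hL.contDiffOn fun z hz => ⟨hz.1, trivial⟩, fun y hy u => e y hy u⟩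

theorem congr (hp : SmoothOfOrder r U p) (h : ∀ y ∈ U, ∀ u, p' (y, u) = p (y, u)) :
    SmoothOfOrder r U p' := by
  obtain ⟨q, hq, e⟩ := hp
  exact ⟨q, hq, fun y hy u => (h y hy u).trans (e y hy u)⟩

/-- Witnesses `q` over different open sets need not be related, but the canonical one of
`smoothOfOrder_iff` is the same over all of them. The order has to be uniform. -/
theorem of_locally (h : ∀ y ∈ U, ∃ U', IsOpen U' ∧ y ∈ U' ∧ SmoothOfOrder r U' p) :
    SmoothOfOrder r U p := by
  rw [smoothOfOrder_iff]
  constructor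
  · intro y hy u u' e
    obtain ⟨U', _, hy', hp⟩ := h y hy
    exact hp.eq_of_trunc hy' e
  · rintro z ⟨hz, -⟩
    obtain ⟨U', hU', hy', hp⟩ := h z.1 hz
    exact (((smoothOfOrder_iff.1 hp).2 z ⟨hy', trivial⟩).contDiffAt
      ((hU'.prod isOpen_univ).mem_nhds ⟨hy', trivial⟩)).contDiffWithinAt

theorem prodMk {p' : JetCoord n m → W'} (hp : SmoothOfOrder r U p) (hp' : SmoothOfOrder r U p') :
    SmoothOfOrder r U fun z => (p z, p' z) := by
  obtain ⟨q, hq, e⟩ := hp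
  obtain ⟨q', hq', e'⟩ := hp'
  exact ⟨fun z => (q z, q' z), hq.prodMk hq', fun y hy u => Prod.ext (e y hy u) (e' y hy u)⟩

theorem comp (hp : SmoothOfOrder r U p) {Φ : W → W'} {S : Set W} (hΦ : ContDiffOn ℝ ∞ Φ S)
    (h : ∀ y ∈ U, ∀ u, p (y, u) ∈ S) : SmoothOfOrder r U fun z => Φ (p z) := by
  obtain ⟨h1, h2⟩ := smoothOfOrder_iff.1 hp
  exact smoothOfOrder_iff.2 ⟨fun y hy u u' e => congrArg Φ (h1 y hy u u' e),
    hΦ.comp h2 fun z hz => h _ hz.1 _⟩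

theorem compContDiff (hp : SmoothOfOrder r U p) {Φ : W → W'} (hΦ : ContDiff ℝ ∞ Φ) :
    SmoothOfOrder r U fun z => Φ (p z) :=
  hp.comp (S := univ) hΦ.contDiffOn fun _ _ _ => trivial

theorem add (hp : SmoothOfOrder r U p) (hp' : SmoothOfOrder r U p') :
    SmoothOfOrder r U fun z => p z + p' z :=
  (hp.prodMk hp').compContDiff (contDiff_fst.add contDiff_snd)

theorem smul {c : JetCoord n m → ℝ} (hc : SmoothOfOrder r U c) (hp : SmoothOfOrder r U p) :
    SmoothOfOrder r U fun z => c z • p z :=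
  (hc.prodMk hp).compContDiff (contDiff_fst.smul contDiff_snd)

theorem neg (hp : SmoothOfOrder r U p) : SmoothOfOrder r U fun z => - p z :=
  hp.compContDiff contDiff_neg

theorem sub (hp : SmoothOfOrder r U p) (hp' : SmoothOfOrder r U p') :
    SmoothOfOrder r U fun z => p z - p' z :=
  (hp.prodMk hp').compContDiff (contDiff_fst.sub contDiff_snd)

theorem const_smul (hp : SmoothOfOrder r U p) (c : ℝ) : SmoothOfOrder r U fun z => c • p z :=
  hp.compContDiff (contDiff_const_smul c)

theorem of_base {g : Rn n → W} (hg : ContDiffOn ℝ ∞ g U) :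
    SmoothOfOrder r U fun z : JetCoord n m => g z.1 :=
  ⟨fun z => g z.1, hg.comp contDiff_fst.contDiffOn fun _ hz => hz.1, fun _ _ _ => rfl⟩

theorem const (w : W) : SmoothOfOrder r U fun _ : JetCoord n m => w := of_base contDiffOn_const

theorem sum {ι : Type*} (t : Finset ι) {p : ι → JetCoord n m → W}
    (h : ∀ i ∈ t, SmoothOfOrder r U (p i)) : SmoothOfOrder r U fun z => ∑ i ∈ t, p i z := by
  classical
  induction t using Finset.induction_on with
  | empty => simpa using const 0
  | insert i t hi ih =>
    simp only [Finset.sum_insert hi]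
    exact (h i (by simp)).add (ih fun j hj => h j (by simp [hj]))

theorem coord (a : Fin m) {I : Fin n → ℕ} (hI : I ∈ multiIdx n r) :
    SmoothOfOrder r U fun z : JetCoord n m => z.2 (a, I) :=
  ⟨fun z => z.2 (a, ⟨I, hI⟩), ((contDiff_apply ℝ ℝ _).comp contDiff_snd).contDiffOn,
    fun _ _ _ => rfl⟩

theorem pi {ι : Type*} [Fintype ι] {p : JetCoord n m → ι → W}
    (h : ∀ i, SmoothOfOrder r U fun z => p z i) : SmoothOfOrder r U p := by
  have h' := fun i => smoothOfOrder_iff.1 (h i)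
  exact smoothOfOrder_iff.2 ⟨fun y hy u u' e => funext fun i => (h' i).1 y hy u u' e,
    contDiffOn_pi.2 fun i => (h' i).2⟩

/-- Substitution of local functions for the coordinates. -/
theorem subst {p : JetCoord n m → W} (hp : SmoothOfOrder r U p) {τ : Rn n → Rn n}
    (hτ : ContDiffOn ℝ ∞ τ U') (hU : MapsTo τ U' U) {v : Fin m × (Fin n → ℕ) → JetCoord n m → ℝ}
    (hv : ∀ a, ∀ I ∈ multiIdx n r, SmoothOfOrder s U' (v (a, I))) :
    SmoothOfOrder s U' fun z => p (τ z.1, fun aI => v aI z) := by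
  obtain ⟨q, hq, e⟩ := hp
  have h1 : SmoothOfOrder s U' fun z : JetCoord n m =>
      (τ z.1, fun aI : Fin m × multiIdx n r => v (aI.1, aI.2) z) :=
    (of_base hτ).prodMk (pi fun aI => hv aI.1 aI.2 aI.2.2)
  exact (h1.comp hq fun y hy u => ⟨hU hy, trivial⟩).congr fun y hy u => e _ (hU hy) _

end SmoothOfOrder

/-- The shift `u ↦ (uᵃ_{I+i})`. -/
def shiftJet (i : Fin n) (u : Fin m × (Fin n → ℕ) → ℝ) : Fin m × (Fin n → ℕ) → ℝ :=
  fun aI => u (aI.1, aI.2 + Pi.single i 1)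

variable {r : ℕ} {U : Set (Rn n)} {p p' : JetCoord n m → W}
  {q : Rn n × (Fin m × multiIdx n r → ℝ) → W}

/-- The space of jets has infinitely many coordinates and is used without a norm. Along a line,
however, `p` is the smooth function `q` composed with an affine path, at least for small times,
while the base point stays in `U`. Line derivatives are therefore all that is needed. -/
theorem hasLineDerivAt_of_rep (hU : IsOpen U) (hq : ContDiffOn ℝ ∞ q (U ×ˢ univ))
    (e : ∀ y ∈ U, ∀ u, p (y, u) = q (y, truncJet r u)) {z : JetCoord n m} (hz : z.1 ∈ U)
    (w : JetCoord n m) :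
    HasLineDerivAt ℝ p (fderiv ℝ q (z.1, truncJet r z.2) (w.1, truncJet r w.2)) z w := by
  have hd : DifferentiableAt ℝ q (z.1, truncJet r z.2) :=
    (hq.contDiffAt ((hU.prod isOpen_univ).mem_nhds ⟨hz, trivial⟩)).differentiableAt (by simp)
  have h1 := hd.hasFDerivAt.hasLineDerivAt (w.1, truncJet r w.2)
  rw [HasLineDerivAt] at h1 ⊢
  refine h1.congr_of_eventuallyEq ?_
  have : ∀ᶠ t : ℝ in 𝓝 0, z.1 + t • w.1 ∈ U := by
    have hc : Continuous fun t : ℝ => z.1 + t • w.1 := by fun_prop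
    exact hc.continuousAt.preimage_mem_nhds (hU.mem_nhds (by simpa using hz))
  filter_upwards [this] with t ht
  exact e _ ht _

theorem truncJet_single_of_notMem (a : Fin m) {I : Fin n → ℕ} (hI : I ∉ multiIdx n r) :
    truncJet r (Pi.single (a, I) (1 : ℝ)) = 0 := by
  ext ⟨b, K, hK⟩
  simp only [truncJet, Pi.zero_apply]
  rw [Pi.single_eq_of_ne]
  rintro ⟨⟩
  exact hI hK

theorem truncJet_eq_sum (w : Fin m × (Fin n → ℕ) → ℝ) :
    truncJet r w = ∑ a : Fin m, ∑ I ∈ multiIdx n r,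
      w (a, I) • truncJet r (Pi.single (a, I) (1 : ℝ)) := by
  ext ⟨b, K, hK⟩
  simp only [truncJet, Finset.sum_apply, Pi.smul_apply, smul_eq_mul]
  rw [Finset.sum_eq_single b, Finset.sum_eq_single K]
  · simp
  · intro I _ hI
    rw [Pi.single_eq_of_ne, mul_zero]
    rintro ⟨⟩; exact hI rfl
  · exact fun h => absurd hK h
  · intro a _ ha
    refine Finset.sum_eq_zero fun I _ => ?_
    rw [Pi.single_eq_of_ne, mul_zero]
    rintro ⟨⟩; exact ha rfl
  · simp

theorem lineDeriv_vert_of_rep (hU : IsOpen U) (hq : ContDiffOn ℝ ∞ q (U ×ˢ univ))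
    (e : ∀ y ∈ U, ∀ u, p (y, u) = q (y, truncJet r u)) {z : JetCoord n m} (hz : z.1 ∈ U)
    (w : Fin m × (Fin n → ℕ) → ℝ) :
    lineDeriv ℝ p z (0, w) = fderiv ℝ q (z.1, truncJet r z.2) (0, truncJet r w) :=
  (hasLineDerivAt_of_rep hU hq e hz (0, w)).lineDeriv

theorem lineDeriv_vert_eq_sum (hU : IsOpen U) (hp : SmoothOfOrder r U p) {z : JetCoord n m}
    (hz : z.1 ∈ U) (w : Fin m × (Fin n → ℕ) → ℝ) :
    lineDeriv ℝ p z (0, w) = ∑ a : Fin m, ∑ I ∈ multiIdx n r, w (a, I) • dU a I p z := by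
  obtain ⟨q, hq, e⟩ := hp
  simp only [dU]
  simp only [lineDeriv_vert_of_rep hU hq e hz]
  conv_lhs => rw [truncJet_eq_sum w]
  have : ((0 : Rn n), ∑ a : Fin m, ∑ I ∈ multiIdx n r,
      w (a, I) • truncJet r (Pi.single (a, I) (1 : ℝ))) =
      ∑ a : Fin m, ∑ I ∈ multiIdx n r,
        w (a, I) • ((0 : Rn n), truncJet r (Pi.single (a, I) (1 : ℝ))) := by
    simp only [Prod.smul_mk, smul_zero]
    refine Prod.ext ?_ ?_
    · simp [Prod.fst_sum]
    · simp [Prod.snd_sum]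
  rw [this]
  simp only [map_sum, map_smul]

theorem dU_of_notMem (hU : IsOpen U) (hp : SmoothOfOrder r U p) {z : JetCoord n m}
    (hz : z.1 ∈ U) (a : Fin m) {I : Fin n → ℕ} (hI : I ∉ multiIdx n r) : dU a I p z = 0 := by
  obtain ⟨q, hq, e⟩ := hp
  rw [dU, lineDeriv_vert_of_rep hU hq e hz, truncJet_single_of_notMem a hI]
  exact map_zero _

/-- The terms with `J` of order above `r` vanish, and the rest of the sum is one derivative of `q`,
in the direction of `∂_i` in the base and of the shifted jet in the fibre. The shift is what raises
the order by one. -/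
theorem totalD_of_rep (hU : IsOpen U) (hq : ContDiffOn ℝ ∞ q (U ×ˢ univ))
    (e : ∀ y ∈ U, ∀ u, p (y, u) = q (y, truncJet r u)) {z : JetCoord n m} (hz : z.1 ∈ U)
    (i : Fin n) :
    totalD i p z =
      fderiv ℝ q (z.1, truncJet r z.2) (stdVec i, truncJet r (shiftJet i z.2)) := by
  have hp : SmoothOfOrder r U p := ⟨q, hq, e⟩
  rw [totalD, dX, (hasLineDerivAt_of_rep hU hq e hz _).lineDeriv]
  rw [finsum_eq_sum_of_support_subset (s := Finset.univ ×ˢ multiIdx n r)]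
  · rw [Finset.sum_product]
    have := lineDeriv_vert_eq_sum hU hp hz (shiftJet i z.2)
    simp only [shiftJet] at this
    rw [← this]
    change _ + lineDeriv ℝ p z (0, shiftJet i z.2) = _
    rw [lineDeriv_vert_of_rep hU hq e hz, ← map_add]
    congr 1
    have h0 : truncJet r (0 : Fin m × (Fin n → ℕ) → ℝ) = 0 := rfl
    simp [h0]
  · intro aJ h
    simp only [Finset.coe_product, Finset.coe_univ, mem_prod, mem_univ, true_and, Finset.mem_coe]
    by_contra hn
    exact h (by simp [dU_of_notMem hU hp hz aJ.1 hn])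

theorem SmoothOfOrder.totalD (hU : IsOpen U) (hp : SmoothOfOrder r U p) (i : Fin n) :
    SmoothOfOrder (r + 1) U (totalD i p) := by
  obtain ⟨q, hq, e⟩ := hp
  have hq' := hq.fderiv_of_isOpen (hU.prod isOpen_univ) (m := ∞) (by simp)
  have h1 : SmoothOfOrder (r + 1) U fun z : JetCoord n m => (z.1, truncJet r z.2) :=
    (SmoothOfOrder.of_base contDiffOn_id).prodMk (SmoothOfOrder.pi fun aI =>
      SmoothOfOrder.coord aI.1 (mem_multiIdx.2 ((mem_multiIdx.1 aI.2.2).trans r.le_succ)))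
  have h2 : SmoothOfOrder (r + 1) U fun z : JetCoord n m =>
      (stdVec i, truncJet r (shiftJet i z.2)) :=
    (SmoothOfOrder.const _).prodMk (SmoothOfOrder.pi fun aI =>
      SmoothOfOrder.coord aI.1 (add_single_mem_multiIdx aI.2.2 i))
  have h3 := (h1.comp hq' fun y hy u => ⟨hy, trivial⟩).prodMk h2
  exact (h3.compContDiff (contDiff_fst.clm_apply contDiff_snd)).congr fun y hy u =>
    totalD_of_rep hU hq e hy i

theorem SmoothOfOrder.lineDeriv_vert (hU : IsOpen U) (hp : SmoothOfOrder r U p)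
    (w : Fin m × (Fin n → ℕ) → ℝ) : SmoothOfOrder r U fun z => lineDeriv ℝ p z (0, w) := by
  obtain ⟨q, hq, e⟩ := hp
  have hq' := hq.fderiv_of_isOpen (hU.prod isOpen_univ) (m := ∞) (by simp)
  exact ⟨fun z => fderiv ℝ q z (0, truncJet r w), hq'.clm_apply contDiffOn_const,
    fun y hy u => lineDeriv_vert_of_rep hU hq e hy w⟩

theorem SmoothOfOrder.dU (hU : IsOpen U) (hp : SmoothOfOrder r U p) (a : Fin m)
    (I : Fin n → ℕ) : SmoothOfOrder r U (dU a I p) := hp.lineDeriv_vert hU _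

theorem SmoothOfOrder.comp_jetAt (hU : IsOpen U) (hp : SmoothOfOrder r U p) {f : Rn n → Rn m}
    (hf : ContDiffOn ℝ ∞ f U) : ContDiffOn ℝ ∞ (fun y => p (jetAt f y)) U := by
  obtain ⟨q, hq, e⟩ := hp
  have h1 : ContDiffOn ℝ ∞ (fun y => (y, truncJet r (jetAt f y).2)) U :=
    contDiffOn_id.prodMk (contDiffOn_pi.2 fun aI => partialDeriv_contDiffOn hU hf aI.1 aI.2)
  exact (hq.comp h1 fun y hy => ⟨hy, trivial⟩).congr fun y hy => e y hy _

/-- `(D_i p)(jf) = ∂_i (p (jf))`. -/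
theorem pd_comp_jetAt (hU : IsOpen U) (hp : SmoothOfOrder r U p) {f : Rn n → Rn m}
    (hf : ContDiffOn ℝ ∞ f U) (i : Fin n) {y : Rn n} (hy : y ∈ U) :
    pd i (fun y => p (jetAt f y)) y = totalD i p (jetAt f y) := by
  obtain ⟨q, hq, e⟩ := hp
  have hd : DifferentiableAt ℝ q (y, truncJet r (jetAt f y).2) :=
    (hq.contDiffAt ((hU.prod isOpen_univ).mem_nhds ⟨hy, trivial⟩)).differentiableAt (by simp)
  have hc : ∀ aI : Fin m × multiIdx n r,
      HasFDerivAt (fun y => partialDeriv f y aI.1 aI.2)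
        (fderiv ℝ (fun y => partialDeriv f y aI.1 aI.2) y) y := fun aI =>
    (((partialDeriv_contDiffOn hU hf aI.1 aI.2).contDiffAt (hU.mem_nhds hy)).differentiableAt
      (by simp)).hasFDerivAt
  have h1 := (hasFDerivAt_id y).prodMk (hasFDerivAt_pi.2 hc)
  have h2 : (fun y => p (jetAt f y)) =ᶠ[𝓝 y] fun y => q (y, truncJet r (jetAt f y).2) := by
    filter_upwards [hU.mem_nhds hy] with y hy using e y hy _
  rw [pd, h2.fderiv_eq]
  have h3 : HasFDerivAt (fun y => q (y, truncJet r (jetAt f y).2)) _ y :=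
    hd.hasFDerivAt.comp y h1
  rw [h3.fderiv, totalD_of_rep (z := jetAt f y) hU hq e hy]
  simp only [ContinuousLinearMap.comp_apply]
  congr 1
  -- It remains that the derivative of the prolonged function in direction `i` is the shifted jet.
  refine Prod.ext rfl (funext fun aI => ?_)
  exact pd_partialDeriv hU hf aI.1 aI.2 i hy

end LocalFunctions

/-! ### Taylor polynomials: realizing finite jets by smooth functions -/

section Realization

variable {n m : ℕ} {W W' : Type*} [NormedAddCommGroup W] [NormedSpace ℝ W]
  [NormedAddCommGroup W'] [NormedSpace ℝ W']

/-- The normalized monomial `∏ₖ (zₖ - yₖ)^{Iₖ} / Iₖ!`. -/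
def monomialAt (y : Rn n) (I : Fin n → ℕ) (z : Rn n) : ℝ :=
  ∏ k, (z k - y k) ^ I k / (I k).factorial

theorem monomialAt_contDiff (y : Rn n) (I : Fin n → ℕ) : ContDiff ℝ ∞ (monomialAt y I) := by
  unfold monomialAt
  refine contDiff_prod fun k _ => ?_
  have h : ContDiff ℝ ∞ fun z : Rn n => z k :=
    (EuclideanSpace.proj k : Rn n →L[ℝ] ℝ).contDiff
  exact ((h.sub contDiff_const).pow _).div_const _

/-- Division by the factorials makes differentiation lower an exponent without producing a
coefficient, so the jets of these monomials at `y` are Kronecker deltas. -/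
theorem pd_monomialAt (y : Rn n) (I : Fin n → ℕ) (i : Fin n) :
    pd i (monomialAt y I) =
      if 1 ≤ I i then monomialAt y (I - Pi.single i 1) else 0 := by
  ext z
  have hd : DifferentiableAt ℝ (monomialAt y I) z :=
    (monomialAt_contDiff y I).contDiffAt.differentiableAt (by simp)
  rw [pd, ← hd.lineDeriv_eq_fderiv]
  have h1 : ∀ t : ℝ, monomialAt y I (z + t • stdVec i) =
      (z i + t - y i) ^ I i / (I i).factorial *
        ∏ k ∈ Finset.univ.erase i, (z k - y k) ^ I k / (I k).factorial := by
    intro t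
    rw [monomialAt, ← Finset.mul_prod_erase _ _ (Finset.mem_univ i)]
    congr 1
    · simp
    · refine Finset.prod_congr rfl fun k hk => ?_
      have : k ≠ i := (Finset.mem_erase.1 hk).1
      simp [this]
  rw [lineDeriv]
  simp only [h1]
  have h2 : HasDerivAt (fun t : ℝ => (z i + t - y i) ^ I i / (I i).factorial *
      ∏ k ∈ Finset.univ.erase i, (z k - y k) ^ I k / (I k).factorial)
      (((I i : ℝ) * (z i + 0 - y i) ^ (I i - 1) * 1) / (I i).factorial *
        ∏ k ∈ Finset.univ.erase i, (z k - y k) ^ I k / (I k).factorial) 0 :=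
    (((((hasDerivAt_id (0 : ℝ)).const_add (z i)).sub_const (y i)).pow (I i)).div_const _).mul_const _
  rw [h2.deriv]
  split_ifs with h
  · rw [monomialAt, ← Finset.mul_prod_erase _ _ (Finset.mem_univ i)]
    congr 1
    · obtain ⟨k, hk⟩ := Nat.exists_eq_add_of_le' h
      simp only [Pi.sub_apply, Pi.single_eq_same, hk, Nat.add_sub_cancel, Nat.factorial_succ,
        Nat.cast_mul, add_zero, mul_one]
      have : ((k + 1 : ℕ) : ℝ) ≠ 0 := by positivity
      field_simp
    · refine Finset.prod_congr rfl fun k hk => ?_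
      have : k ≠ i := (Finset.mem_erase.1 hk).1
      simp [this]
  · have : I i = 0 := by omega
    simp [this]

theorem pdl_monomialAt (y : Rn n) (I : Fin n → ℕ) (l : List (Fin n)) :
    pdl l (monomialAt y I) =
      if ∀ k, l.count k ≤ I k then monomialAt y (fun k => I k - l.count k) else 0 := by
  induction l with
  | nil => simp
  | cons i l ih =>
    rw [pdl_cons, ih]
    by_cases h : ∀ k, l.count k ≤ I k
    · rw [if_pos h, pd_monomialAt]
      by_cases h' : 1 ≤ I i - l.count i
      · rw [if_pos h', if_pos]
        · congr 1
          funext k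
          by_cases hk : k = i
          · subst hk; simp; omega
          · have hk' : ¬ i = k := fun e => hk e.symm
            simp [hk, hk']
        · intro k
          rw [List.count_cons]
          have := h k
          by_cases hk : i = k
          · subst hk; simp; omega
          · simp [hk, this]
      · rw [if_neg h', if_neg]
        intro hh
        have := hh i
        rw [List.count_cons_self] at this
        omega
    · rw [if_neg h, if_neg]
      · ext z
        change fderiv ℝ (fun _ => (0 : ℝ)) z _ = _
        simp
      · exact fun hh => h fun k => (List.count_le_count_cons).trans (hh k)

theorem monomialAt_self (y : Rn n) (I : Fin n → ℕ) :
    monomialAt y I y = if I = 0 then 1 else 0 := by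
  split_ifs with h
  · subst h; simp [monomialAt]
  · obtain ⟨k, hk⟩ := Function.ne_iff.1 h
    refine Finset.prod_eq_zero (Finset.mem_univ k) ?_
    simp only [Pi.zero_apply] at hk
    simp [hk]

theorem pdl_idxList_monomialAt (y : Rn n) (I J : Fin n → ℕ) :
    pdl (idxList J) (monomialAt y I) y = if I = J then 1 else 0 := by
  rw [pdl_monomialAt]
  simp only [count_idxList]
  by_cases hle : ∀ k, J k ≤ I k
  · rw [if_pos hle, monomialAt_self]
    refine if_congr ⟨fun e => funext fun k => ?_, fun e => ?_⟩ rfl rfl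
    · have := congrFun e k
      have := hle k
      simp at *
      omega
    · subst e; ext; simp
  · rw [if_neg hle, if_neg]
    · rfl
    · rintro rfl; exact hle fun _ => le_rfl

/-- Every jet of finite order is the jet of a smooth function. -/
theorem exists_jetAt_eq (r : ℕ) (y : Rn n) (u : Fin m × (Fin n → ℕ) → ℝ) :
    ∃ f : Rn n → Rn m, ContDiff ℝ ∞ f ∧ truncJet r (jetAt f y).2 = truncJet r u := by
  -- The function sought is the Taylor polynomial with coefficients `u`. Written as a linear map
  -- applied to the vector `g` of all monomials, it can be differentiated by `pdl_clm`.
  let g : Rn n → (multiIdx n r → ℝ) := fun z K => monomialAt y K z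
  have hg : ContDiff ℝ ∞ g := contDiff_pi.2 fun K => monomialAt_contDiff y K
  let A : Fin m → (multiIdx n r → ℝ) →L[ℝ] ℝ := fun a =>
    ∑ K : multiIdx n r, u (a, K) • ContinuousLinearMap.proj K
  let f : Rn n → Rn m := fun z => WithLp.toLp 2 fun a => A a (g z)
  have hf : ContDiff ℝ ∞ f := by
    rw [contDiff_euclidean]
    exact fun a => (A a).contDiff.comp hg
  refine ⟨f, hf, funext fun ⟨a, I, hI⟩ => ?_⟩
  change partialDeriv f y a I = u (a, I)
  rw [partialDeriv_eq_pdl isOpen_univ hf.contDiffOn a I (mem_univ y)]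
  have h1 := pdl_clm isOpen_univ hg.contDiffOn (A a) (idxList I) (mem_univ y)
  have h2 : ∀ K : multiIdx n r, pdl (idxList I) g y K = if (K : Fin n → ℕ) = I then 1 else 0 := by
    intro K
    rw [← pdl_idxList_monomialAt y K I]
    exact (pdl_clm isOpen_univ hg.contDiffOn
      (ContinuousLinearMap.proj K : (multiIdx n r → ℝ) →L[ℝ] ℝ) (idxList I) (mem_univ y)).symm
  change pdl (idxList I) (fun z => A a (g z)) y = _
  rw [h1]
  simp only [A, sum_apply, smul_apply,
    ContinuousLinearMap.proj_apply, h2, smul_eq_mul, mul_ite, mul_one, mul_zero]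
  rw [Finset.sum_eq_single ⟨I, hI⟩]
  · simp
  · intro K _ hK
    rw [if_neg fun e => hK (Subtype.ext e)]
  · simp

end Realization

/-! ### Total derivatives, the Euler operator and the first variation formula -/

section TotalDerivatives

variable {n m : ℕ} {W W' : Type*} [NormedAddCommGroup W] [NormedSpace ℝ W]
  [NormedAddCommGroup W'] [NormedSpace ℝ W'] {r s : ℕ} {U : Set (Rn n)} {p p' : JetCoord n m → W}

theorem lineDeriv_congr_of_isOpen (hU : IsOpen U) (h : ∀ z : JetCoord n m, z.1 ∈ U → p z = p' z)
    {z : JetCoord n m} (hz : z.1 ∈ U) (w : JetCoord n m) :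
    lineDeriv ℝ p z w = lineDeriv ℝ p' z w := by
  rw [lineDeriv, lineDeriv]
  refine Filter.EventuallyEq.deriv_eq ?_
  have hc : Continuous fun t : ℝ => z.1 + t • w.1 := by fun_prop
  filter_upwards [hc.continuousAt.preimage_mem_nhds (hU.mem_nhds (by simpa using hz))] with t ht
  exact h _ ht

theorem totalD_congr (hU : IsOpen U) (h : ∀ z : JetCoord n m, z.1 ∈ U → p z = p' z)
    (i : Fin n) {z : JetCoord n m} (hz : z.1 ∈ U) : totalD i p z = totalD i p' z := by
  simp only [totalD, dX, dU, lineDeriv_congr_of_isOpen hU h hz]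

/-- The iterated total derivative along a list of directions. -/
def totalDl (l : List (Fin n)) (p : JetCoord n m → W) : JetCoord n m → W := l.foldr totalD p

@[simp] theorem totalDl_nil (p : JetCoord n m → W) : totalDl [] p = p := rfl
@[simp] theorem totalDl_cons (i : Fin n) (l : List (Fin n)) (p : JetCoord n m → W) :
    totalDl (i :: l) p = totalD i (totalDl l p) := rfl

theorem totalDl_congr (hU : IsOpen U) (h : ∀ z : JetCoord n m, z.1 ∈ U → p z = p' z)
    (l : List (Fin n)) : ∀ z : JetCoord n m, z.1 ∈ U → totalDl l p z = totalDl l p' z := by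
  induction l with
  | nil => exact h
  | cons i l ih => exact fun z hz => totalD_congr hU ih i hz

theorem SmoothOfOrder.totalDl (hU : IsOpen U) (hp : SmoothOfOrder r U p) (l : List (Fin n)) :
    SmoothOfOrder (r + l.length) U (totalDl l p) := by
  induction l with
  | nil => exact hp
  | cons i l ih => exact ih.totalD hU i

theorem totalDl_comp_jetAt (hU : IsOpen U) (hp : SmoothOfOrder r U p) {f : Rn n → Rn m}
    (hf : ContDiffOn ℝ ∞ f U) (l : List (Fin n)) :
    EqOn (pdl l fun y => p (jetAt f y)) (fun y => totalDl l p (jetAt f y)) U := by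
  induction l with
  | nil => exact fun _ _ => rfl
  | cons i l ih =>
    exact fun y hy => (pd_congr hU ih i hy).trans (pd_comp_jetAt hU (hp.totalDl hU l) hf i hy)

/-- Local functions are determined by their values on jets of smooth functions. -/
theorem SmoothOfOrder.eq_of_jetAt (hp : SmoothOfOrder r U p) (hp' : SmoothOfOrder s U p')
    {y : Rn n} (hy : y ∈ U)
    (h : ∀ f : Rn n → Rn m, ContDiff ℝ ∞ f → p (jetAt f y) = p' (jetAt f y))
    (u : Fin m × (Fin n → ℕ) → ℝ) : p (y, u) = p' (y, u) := by
  -- One function has to realize the jet to both orders at once.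
  obtain ⟨f, hf, e⟩ := exists_jetAt_eq (max r s) y u
  rw [hp.eq_of_trunc hy (truncJet_of_le (le_max_left r s) e.symm),
    hp'.eq_of_trunc hy (truncJet_of_le (le_max_right r s) e.symm)]
  exact h f hf

/-- Both sides are local functions, so they may be compared on jets of smooth functions, where `D_i`
is a partial derivative. The same argument gives `totalD_clm`, `totalD_smul` and `totalDl_perm`. -/
theorem totalD_add (hU : IsOpen U) (hp : SmoothOfOrder r U p) (hp' : SmoothOfOrder s U p')
    (i : Fin n) {z : JetCoord n m} (hz : z.1 ∈ U) :
    totalD i (fun z => p z + p' z) z = totalD i p z + totalD i p' z := by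
  replace hp := hp.mono_order (le_max_left r s)
  replace hp' := hp'.mono_order (le_max_right r s)
  refine ((hp.add hp').totalD hU i).eq_of_jetAt ((hp.totalD hU i).add (hp'.totalD hU i)) hz
    (fun f hf => ?_) z.2
  rw [← pd_comp_jetAt hU (hp.add hp') hf.contDiffOn i hz, ← pd_comp_jetAt hU hp hf.contDiffOn i hz,
    ← pd_comp_jetAt hU hp' hf.contDiffOn i hz, pd, fderiv_fun_add]
  · rfl
  · exact ((hp.comp_jetAt hU hf.contDiffOn).contDiffAt (hU.mem_nhds hz)).differentiableAt (by simp)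
  · exact ((hp'.comp_jetAt hU hf.contDiffOn).contDiffAt (hU.mem_nhds hz)).differentiableAt (by simp)

theorem totalD_clm (hU : IsOpen U) (hp : SmoothOfOrder r U p) (A : W →L[ℝ] W')
    (i : Fin n) {z : JetCoord n m} (hz : z.1 ∈ U) :
    totalD i (fun z => A (p z)) z = A (totalD i p z) := by
  have hA := hp.compContDiff A.contDiff
  refine (hA.totalD hU i).eq_of_jetAt ((hp.totalD hU i).compContDiff A.contDiff) hz
    (fun f hf => ?_) z.2
  rw [← pd_comp_jetAt hU hA hf.contDiffOn i hz, ← pd_comp_jetAt hU hp hf.contDiffOn i hz]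
  exact pd_clm hU (hp.comp_jetAt hU hf.contDiffOn) A i hz

theorem totalD_smul (hU : IsOpen U) {c : JetCoord n m → ℝ} (hc : SmoothOfOrder r U c)
    (hp : SmoothOfOrder s U p) (i : Fin n) {z : JetCoord n m} (hz : z.1 ∈ U) :
    totalD i (fun z => c z • p z) z = c z • totalD i p z + totalD i c z • p z := by
  replace hc := hc.mono_order (le_max_left r s)
  replace hp := hp.mono_order (le_max_right r s)
  refine ((hc.smul hp).totalD hU i).eq_of_jetAt
    (((hc.mono_order (Nat.le_succ _)).smul (hp.totalD hU i)).add
      ((hc.totalD hU i).smul (hp.mono_order (Nat.le_succ _)))) hz (fun f hf => ?_) z.2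
  rw [← pd_comp_jetAt hU (hc.smul hp) hf.contDiffOn i hz, ← pd_comp_jetAt hU hp hf.contDiffOn i hz,
    ← pd_comp_jetAt hU hc hf.contDiffOn i hz, pd, fderiv_fun_smul]
  · rfl
  · exact ((hc.comp_jetAt hU hf.contDiffOn).contDiffAt (hU.mem_nhds hz)).differentiableAt (by simp)
  · exact ((hp.comp_jetAt hU hf.contDiffOn).contDiffAt (hU.mem_nhds hz)).differentiableAt (by simp)

theorem totalD_neg (hU : IsOpen U) (hp : SmoothOfOrder r U p) (i : Fin n) {z : JetCoord n m}
    (hz : z.1 ∈ U) : totalD i (fun z => - p z) z = - totalD i p z :=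
  totalD_clm hU hp (-ContinuousLinearMap.id ℝ W) i hz

theorem totalD_const (w : W) (i : Fin n) (z : JetCoord n m) :
    totalD i (fun _ => w) z = 0 := by
  simp [totalD, dX, dU, lineDeriv]

theorem totalD_sum (hU : IsOpen U) {ι : Type*} (t : Finset ι) {p : ι → JetCoord n m → W}
    (h : ∀ k ∈ t, SmoothOfOrder r U (p k)) (i : Fin n) {z : JetCoord n m} (hz : z.1 ∈ U) :
    totalD i (fun z => ∑ k ∈ t, p k z) z = ∑ k ∈ t, totalD i (p k) z := by
  classical
  induction t using Finset.induction_on with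
  | empty => simpa using totalD_const 0 i z
  | insert k t hk ih =>
    simp only [Finset.sum_insert hk]
    rw [totalD_add hU (h k (by simp)) (SmoothOfOrder.sum t fun j hj => h j (by simp [hj])) i hz,
      ih fun j hj => h j (by simp [hj])]

theorem totalDl_perm (hU : IsOpen U) (hp : SmoothOfOrder r U p) {l l' : List (Fin n)}
    (h : l.Perm l') {z : JetCoord n m} (hz : z.1 ∈ U) : totalDl l p z = totalDl l' p z := by
  refine (hp.totalDl hU l).eq_of_jetAt (hp.totalDl hU l') hz (fun f hf => ?_) z.2
  have h1 := totalDl_comp_jetAt hU hp hf.contDiffOn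
  exact (h1 l hz).symm.trans ((pdl_perm hU (hp.comp_jetAt hU hf.contDiffOn) h hz).trans (h1 l' hz))

theorem totalDl_eq_zero (hU : IsOpen U) (h : ∀ z : JetCoord n m, z.1 ∈ U → p z = 0)
    (l : List (Fin n)) {z : JetCoord n m} (hz : z.1 ∈ U) : totalDl l p z = 0 := by
  induction l generalizing z with
  | nil => exact h z hz
  | cons i l ih =>
    rw [totalDl_cons, totalD_congr (p' := fun _ => 0) hU (fun z hz => ih hz) i hz, totalD_const]

theorem eulerCoord_eq_sum (hU : IsOpen U) (hp : SmoothOfOrder r U p) (a : Fin m)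
    {z : JetCoord n m} (hz : z.1 ∈ U) :
    eulerCoord a p z =
      ∑ I ∈ multiIdx n r, (-1 : ℝ) ^ (∑ i, I i) • totalDl (idxList I) (dU a I p) z := by
  rw [eulerCoord, finsum_eq_sum_of_support_subset]
  · rfl
  · intro I hI
    by_contra hn
    refine hI ?_
    have : multiD I (dU a I p) z = 0 :=
      totalDl_eq_zero hU (fun z hz => dU_of_notMem hU hp hz a hn) _ hz
    simp only [this, smul_zero]

theorem dU_congr (hU : IsOpen U) (h : ∀ z : JetCoord n m, z.1 ∈ U → p z = p' z) (a : Fin m)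
    (I : Fin n → ℕ) {z : JetCoord n m} (hz : z.1 ∈ U) : dU a I p z = dU a I p' z :=
  lineDeriv_congr_of_isOpen hU h hz _

theorem eulerCoord_congr (hU : IsOpen U) (h : ∀ z : JetCoord n m, z.1 ∈ U → p z = p' z)
    (a : Fin m) {z : JetCoord n m} (hz : z.1 ∈ U) : eulerCoord a p z = eulerCoord a p' z := by
  rw [eulerCoord, eulerCoord]
  refine finsum_congr fun I => ?_
  congr 1
  exact totalDl_congr hU (fun z hz => dU_congr hU h a I hz) _ z hz

theorem SmoothOfOrder.eulerCoord (hU : IsOpen U) (hp : SmoothOfOrder r U p) (a : Fin m) :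
    SmoothOfOrder (r + r) U (eulerCoord a p) := by
  refine SmoothOfOrder.congr (p := fun z => ∑ I ∈ multiIdx n r,
    (-1 : ℝ) ^ (∑ i, I i) • JetReduction.totalDl (idxList I) (JetReduction.dU a I p) z)
    (SmoothOfOrder.sum (multiIdx n r) fun I hI => ?_)
    fun y hy u => eulerCoord_eq_sum (z := (y, u)) hU hp a hy
  refine (((hp.dU hU a I).totalDl hU _).mono_order ?_).const_smul _
  rw [length_idxList]
  have := mem_multiIdx.1 hI
  omega

/-- The boundary terms of the integration by parts of `D_l Q • P`. -/
def bdryTerm : List (Fin n) → (JetCoord n m → W) → (JetCoord n m → ℝ) → Fin n → JetCoord n m → W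
  | [], _, _, _ => fun _ => 0
  | i :: l, P, Q, j => fun z =>
      (if j = i then totalDl l Q z • P z else 0) - bdryTerm l (totalD i P) Q j z

theorem bdryTerm_smooth (hU : IsOpen U) (l : List (Fin n)) {P : JetCoord n m → W}
    (hP : SmoothOfOrder r U P) {Q : JetCoord n m → ℝ} (hQ : SmoothOfOrder s U Q) (j : Fin n) :
    SmoothOfOrder (r + s + l.length) U (bdryTerm l P Q j) := by
  induction l generalizing r P with
  | nil => exact SmoothOfOrder.const 0
  | cons i l ih =>
    refine SmoothOfOrder.sub ?_ ((ih (hP.totalD hU i)).mono_order (by simp; omega))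
    by_cases h : j = i
    · simp only [h, if_true]
      exact ((hQ.totalDl hU l).mono_order (by simp; omega)).smul
        (hP.mono_order (by simp; omega))
    · simp only [h, if_false]
      exact SmoothOfOrder.const 0

/-- The boundary terms are linear in the total derivatives of `Q`. This confines their support to
that of the direction of variation, and makes them vanish at the zero jet when `Q` is linear in `u`.
-/
theorem bdryTerm_eq_zero (l : List (Fin n)) (P : JetCoord n m → W) {Q : JetCoord n m → ℝ}
    {z : JetCoord n m} (h : ∀ l, totalDl l Q z = 0) (j : Fin n) : bdryTerm l P Q j z = 0 := by
  induction l generalizing P with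
  | nil => rfl
  | cons i l ih => simp [bdryTerm, ih, h l]

/-- Leibniz rule, one letter at a time: moving `D_i` from `Q` to `P` costs a sign and a divergence,
and the divergences are collected in `bdryTerm`. The outermost letter reaches `P` first, hence the
reversed list. -/
theorem totalDl_smul_eq (hU : IsOpen U) (l : List (Fin n)) {P : JetCoord n m → W}
    (hP : SmoothOfOrder r U P) {Q : JetCoord n m → ℝ} (hQ : SmoothOfOrder s U Q)
    {z : JetCoord n m} (hz : z.1 ∈ U) :
    totalDl l Q z • P z = (-1 : ℝ) ^ l.length • Q z • totalDl l.reverse P z +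
      ∑ j, totalD j (bdryTerm l P Q j) z := by
  induction l generalizing r P with
  | nil => simp [bdryTerm, totalD_const]
  | cons i l ih =>
    have ih' := ih (hP.totalD hU i)
    have hQl := hQ.totalDl hU l
    have h1 := totalD_smul hU hQl hP i hz
    have h2 : ∀ j, totalD j (bdryTerm (i :: l) P Q j) z =
        (if j = i then totalD i (fun z => totalDl l Q z • P z) z else 0) -
          totalD j (bdryTerm l (totalD i P) Q j) z := by
      intro j
      have hs := bdryTerm_smooth hU l (hP.totalD hU i) hQ j
      by_cases h : j = i
      · subst h
        have hm := (hQl.mono_order (le_max_left _ r)).smul (hP.mono_order (le_max_right (s + l.length) _))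
        have := totalD_add hU hm hs.neg j hz
        rw [totalD_neg hU hs j hz] at this
        simp only [if_true, sub_eq_add_neg]
        rw [← this]
        simp [bdryTerm, sub_eq_add_neg]
      · simp only [h, if_false, zero_sub]
        rw [← totalD_neg hU hs j hz]
        simp [bdryTerm, h]
    simp only [h2, Finset.sum_sub_distrib, Finset.sum_ite_eq', Finset.mem_univ, if_true]
    rw [h1, totalDl_cons, List.reverse_cons, List.length_cons]
    have h3 : totalDl (l.reverse ++ [i]) P = totalDl l.reverse (totalD i P) := by
      simp [totalDl, List.foldr_append]
    rw [h3, ih', pow_succ]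
    module

/-- The boundary terms in the first variation formula. -/
def varBdry (r : ℕ) (p : JetCoord n m → W) (Q : Fin m → JetCoord n m → ℝ) (j : Fin n)
    (z : JetCoord n m) : W :=
  ∑ a : Fin m, ∑ I ∈ multiIdx n r, bdryTerm (idxList I) (dU a I p) (Q a) j z

theorem varBdry_smooth (hU : IsOpen U) (hp : SmoothOfOrder r U p) {Q : Fin m → JetCoord n m → ℝ}
    (hQ : ∀ a, SmoothOfOrder s U (Q a)) (j : Fin n) :
    SmoothOfOrder (r + s + r) U (varBdry r p Q j) := by
  refine SmoothOfOrder.sum _ fun a _ => SmoothOfOrder.sum _ fun I hI => ?_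
  refine (bdryTerm_smooth hU (idxList I) (hp.dU hU a I) (hQ a) j).mono_order ?_
  rw [length_idxList]
  have := mem_multiIdx.1 hI
  omega

theorem varBdry_eq_zero (p : JetCoord n m → W) {Q : Fin m → JetCoord n m → ℝ}
    {z : JetCoord n m} (h : ∀ a l, totalDl l (Q a) z = 0) (j : Fin n) : varBdry r p Q j z = 0 :=
  Finset.sum_eq_zero fun a _ => Finset.sum_eq_zero fun _ _ => bdryTerm_eq_zero _ _ (h a) j

/-- The first variation formula. -/
theorem lineDeriv_eq_euler_add_bdry (hU : IsOpen U) (hp : SmoothOfOrder r U p)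
    {Q : Fin m → JetCoord n m → ℝ} (hQ : ∀ a, SmoothOfOrder s U (Q a)) {z : JetCoord n m}
    (hz : z.1 ∈ U) :
    lineDeriv ℝ p z (0, fun aI => totalDl (idxList aI.2) (Q aI.1) z) =
      ∑ a, Q a z • eulerCoord a p z + ∑ j, totalD j (varBdry r p Q j) z := by
  have hb : ∀ (a : Fin m), ∀ I ∈ multiIdx n r, ∀ j,
      SmoothOfOrder (r + s + r) U (bdryTerm (idxList I) (dU a I p) (Q a) j) := fun a I hI j => by
    refine (bdryTerm_smooth hU (idxList I) (hp.dU hU a I) (hQ a) j).mono_order ?_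
    rw [length_idxList]
    have := mem_multiIdx.1 hI
    omega
  have h1 : ∀ j, totalD j (varBdry r p Q j) z =
      ∑ a : Fin m, ∑ I ∈ multiIdx n r, totalD j (bdryTerm (idxList I) (dU a I p) (Q a) j) z := by
    intro j
    unfold varBdry
    rw [totalD_sum hU _ (fun a _ => SmoothOfOrder.sum _ fun I hI => hb a I hI j) j hz]
    exact Finset.sum_congr rfl fun a _ => totalD_sum hU _ (fun I hI => hb a I hI j) j hz
  simp only [h1]
  rw [Finset.sum_comm, ← Finset.sum_add_distrib, lineDeriv_vert_eq_sum hU hp hz]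
  refine Finset.sum_congr rfl fun a _ => ?_
  rw [Finset.sum_comm, eulerCoord_eq_sum hU hp a hz, Finset.smul_sum, ← Finset.sum_add_distrib]
  refine Finset.sum_congr rfl fun I _ => ?_
  -- The reversal of the list is undone because total derivatives commute.
  rw [totalDl_smul_eq hU (idxList I) (hp.dU hU a I) (hQ a) hz, length_idxList,
    totalDl_perm hU (hp.dU hU a I) (List.reverse_perm _) hz, smul_comm]

end TotalDerivatives

/-! ### Integrals depending on parameters -/

section Parametric

open MeasureTheory

/-- Dominated differentiation: closed balls are compact in a proper space, so `F'` is bounded on the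
product of such a ball with `K`, and this bound is the integrable majorant. -/
theorem hasFDerivAt_setIntegral {E α W : Type*} [NormedAddCommGroup E] [NormedSpace ℝ E]
    [ProperSpace E] [TopologicalSpace α] [MeasurableSpace α] [OpensMeasurableSpace α] [T2Space α]
    {μ : Measure α} [IsFiniteMeasureOnCompacts μ]
    [NormedAddCommGroup W] [NormedSpace ℝ W] {K : Set α} (hK : IsCompact K) {U : Set E}
    (hU : IsOpen U) {F : E → α → W} {F' : E → α → E →L[ℝ] W}
    (hd : ∀ x ∈ U, ∀ a ∈ K, HasFDerivAt (F · a) (F' x a) x)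
    (hF : ContinuousOn (fun z : E × α => F z.1 z.2) (U ×ˢ K))
    (hF' : ContinuousOn (fun z : E × α => F' z.1 z.2) (U ×ˢ K)) {x : E} (hx : x ∈ U) :
    HasFDerivAt (fun x => ∫ a in K, F x a ∂μ) (∫ a in K, F' x a ∂μ) x := by
  obtain ⟨ε, hε, hb⟩ := Metric.nhds_basis_closedBall.mem_iff.1 (hU.mem_nhds hx)
  have hslice : ∀ x ∈ U, ContinuousOn (F x) K := fun x hx =>
    hF.comp (f := fun a => (x, a)) (by fun_prop) fun a ha => ⟨hx, ha⟩
  have hslice' : ContinuousOn (F' x) K :=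
    hF'.comp (f := fun a => (x, a)) (by fun_prop) fun a ha => ⟨hx, ha⟩
  obtain ⟨C, hC⟩ := ((isCompact_closedBall x ε).prod hK).exists_bound_of_continuousOn
    (hF'.mono (prod_mono hb subset_rfl))
  refine hasFDerivAt_integral_of_dominated_of_fderiv_le (s := Metric.closedBall x ε)
    (bound := fun _ => C) (Metric.closedBall_mem_nhds x hε) ?_ ?_ ?_ ?_ ?_ ?_
  · filter_upwards [hU.mem_nhds hx] with y hy
    exact (hslice y hy).aestronglyMeasurable_of_isCompact hK hK.measurableSet
  · exact (hslice x hx).integrableOn_compact hK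
  · exact hslice'.aestronglyMeasurable_of_isCompact hK hK.measurableSet
  · filter_upwards [ae_restrict_mem hK.measurableSet] with a ha y hy
    exact hC (y, a) ⟨hy, ha⟩
  · exact continuousOn_const.integrableOn_compact hK
  · filter_upwards [ae_restrict_mem hK.measurableSet] with a ha y hy
    exact hd y (hb hy) a ha

variable {E : Type} [NormedAddCommGroup E] [NormedSpace ℝ E] [ProperSpace E]

theorem hasFDerivAt_partial {W : Type} [NormedAddCommGroup W] [NormedSpace ℝ W] {U : Set E}
    (hU : IsOpen U) {q : ℝ × E → W} (hq : ContDiffOn ℝ ∞ q (univ ×ˢ U)) (t : ℝ) {x : E}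
    (hx : x ∈ U) : HasFDerivAt (fun x => q (t, x))
      ((fderiv ℝ q (t, x)).comp (ContinuousLinearMap.inr ℝ ℝ E)) x := by
  have hd : DifferentiableAt ℝ q (t, x) :=
    (hq.contDiffAt ((isOpen_univ.prod hU).mem_nhds ⟨trivial, hx⟩)).differentiableAt (by simp)
  exact hd.hasFDerivAt.comp x (hasFDerivAt_prodMk_right t x)

theorem hasFDerivAt_intervalIntegral {W : Type} [NormedAddCommGroup W] [NormedSpace ℝ W]
    {U : Set E} (hU : IsOpen U) {q : ℝ × E → W} (hq : ContDiffOn ℝ ∞ q (univ ×ˢ U)) (a b : ℝ)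
    {x : E} (hx : x ∈ U) : HasFDerivAt (fun x => ∫ t in Icc a b, q (t, x))
      (∫ t in Icc a b, (fderiv ℝ q (t, x)).comp (ContinuousLinearMap.inr ℝ ℝ E)) x := by
  have hq' := hq.fderiv_of_isOpen (isOpen_univ.prod hU) (m := ∞) (by simp)
  have hsw : ∀ {X : Type} [TopologicalSpace X] {g : ℝ × E → X}, ContinuousOn g (univ ×ˢ U) →
      ContinuousOn (fun z : E × ℝ => g (z.2, z.1)) (U ×ˢ Icc a b) := fun hg =>
    hg.comp (by fun_prop) fun z hz => ⟨trivial, hz.1⟩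
  refine hasFDerivAt_setIntegral isCompact_Icc hU (F := fun x t => q (t, x))
    (fun x hx t _ => hasFDerivAt_partial hU hq t hx) (hsw hq.continuousOn) ?_ hx
  exact (hsw hq'.continuousOn).clm_comp continuousOn_const

theorem contDiffOn_intervalIntegral {W : Type} [NormedAddCommGroup W] [NormedSpace ℝ W]
    {U : Set E} (hU : IsOpen U) {q : ℝ × E → W} (hq : ContDiffOn ℝ ∞ q (univ ×ˢ U)) (a b : ℝ) :
    ContDiffOn ℝ ∞ (fun x => ∫ t in Icc a b, q (t, x)) U := by
  rw [contDiffOn_infty]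
  intro k
  -- The derivative of the integral is an integral of the same shape with values in `E →L[ℝ] W`, so
  -- the target must vary in the induction.
  induction k generalizing W with
  | zero =>
    exact contDiffOn_zero.2 fun x hx =>
      (hasFDerivAt_intervalIntegral hU hq a b hx).continuousAt.continuousWithinAt
  | succ k ih =>
    push_cast
    rw [contDiffOn_succ_iff_fderiv_of_isOpen hU]
    refine ⟨fun x hx => (hasFDerivAt_intervalIntegral hU hq a b
      hx).differentiableAt.differentiableWithinAt, fun h => by simp at h, ?_⟩
    have hq' : ContDiffOn ℝ ∞ (fun z => (fderiv ℝ q z).comp (ContinuousLinearMap.inr ℝ ℝ E))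
        (univ ×ˢ U) :=
      (hq.fderiv_of_isOpen (isOpen_univ.prod hU) (by simp)).clm_comp contDiffOn_const
    exact (ih hq').congr fun x hx => (hasFDerivAt_intervalIntegral hU hq a b hx).fderiv

end Parametric

/-! ### Compactly supported functions on `ℝⁿ` -/

section CompactSupport

open MeasureTheory

variable {n : ℕ}

/-- Integration by parts against the constant function `1`. -/
theorem integral_pd_eq_zero {v : Rn n → ℝ} (hv : ContDiff ℝ ∞ v) (hc : HasCompactSupport v)
    (i : Fin n) : ∫ y, pd i v y = 0 := by
  have h1 : Continuous (pd i v) :=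
    continuousOn_univ.1 (pd_contDiffOn isOpen_univ hv.contDiffOn i).continuousOn
  have h2 : HasCompactSupport (pd i v) := hc.fderiv_apply ℝ _
  have := integral_bilinear_hasFDerivAt_right_eq_neg_left_of_integrable (μ := volume)
    (f := fun _ : Rn n => (1 : ℝ)) (f' := fun _ => 0) (g := v) (g' := fderiv ℝ v) (v := stdVec i)
    (B := ContinuousLinearMap.mul ℝ ℝ) (by simp)
    (by simpa using! h1.integrable_of_hasCompactSupport h2)
    (by simpa using! hv.continuous.integrable_of_hasCompactSupport hc)
    (fun y _ => hasFDerivAt_const _ _)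
    (fun y _ => (hv.differentiable (by simp) y).hasFDerivAt)
  simpa [pd] using this

/-- Testing against bump functions gives vanishing almost everywhere, and continuity removes the
exceptional set. -/
theorem eq_zero_of_integral_smul_eq_zero {U : Set (Rn n)} (hU : IsOpen U) {h : Rn n → ℝ}
    (hc : ContinuousOn h U)
    (h0 : ∀ χ : Rn n → ℝ, ContDiff ℝ ∞ χ → HasCompactSupport χ → tsupport χ ⊆ U →
      ∫ y, χ y * h y = 0) : EqOn h 0 U := by
  have := hU.ae_eq_zero_of_integral_contDiff_smul_eq_zero (μ := volume)
    (hc.locallyIntegrableOn hU.measurableSet) h0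
  refine Measure.eqOn_open_of_ae_eq (μ := volume) ?_ hU hc continuousOn_const
  exact (ae_restrict_iff' hU.measurableSet).2 this

/-- Replace the `k`-th coordinate of `y` by `s`. -/
def setCoord (y : Rn n) (k : Fin n) (s : ℝ) : Rn n := y + (s - y k) • stdVec k

@[simp] theorem setCoord_same (y : Rn n) (k : Fin n) (s : ℝ) : setCoord y k s k = s := by
  simp [setCoord]

theorem setCoord_of_ne (y : Rn n) {k j : Fin n} (h : j ≠ k) (s : ℝ) : setCoord y k s j = y j := by
  simp [setCoord, h]

theorem setCoord_setCoord (y : Rn n) (k : Fin n) (s t : ℝ) :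
    setCoord (setCoord y k s) k t = setCoord y k t := by
  ext j
  by_cases h : j = k
  · subst h; simp
  · simp [setCoord_of_ne, h]

theorem setCoord_comm (y : Rn n) {k j : Fin n} (h : j ≠ k) (s t : ℝ) :
    setCoord (setCoord y k s) j t = setCoord (setCoord y j t) k s := by
  ext i
  by_cases hk : i = k
  · subst hk; simp [setCoord_of_ne _ h.symm]
  · by_cases hj : i = j
    · subst hj; simp [setCoord_of_ne _ h]
    · simp [setCoord_of_ne, hk, hj]

theorem setCoord_self (y : Rn n) (k : Fin n) : setCoord y k (y k) = y := by simp [setCoord]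

theorem contDiff_apply_euclidean (k : Fin n) : ContDiff ℝ ∞ fun z : Rn n => z k :=
  (EuclideanSpace.proj k : Rn n →L[ℝ] ℝ).contDiff

theorem contDiff_setCoord (k : Fin n) : ContDiff ℝ ∞ fun z : ℝ × Rn n => setCoord z.2 k z.1 :=
  contDiff_snd.add ((contDiff_fst.sub ((contDiff_apply_euclidean k).comp contDiff_snd)).smul
    contDiff_const)

theorem pd_eq_of_hasDerivAt {g : Rn n → ℝ} (hg : ContDiff ℝ ∞ g) {k : Fin n} {y : Rn n} {c : ℝ}
    (h : HasDerivAt (fun s => g (setCoord y k s)) c (y k)) : pd k g y = c := by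
  have hd : DifferentiableAt ℝ g y := hg.contDiffAt.differentiableAt (by simp)
  rw [pd, ← hd.lineDeriv_eq_fderiv, lineDeriv]
  have h' : HasDerivAt (fun s => g (setCoord y k s)) c (y k + 0) := by simpa using h
  have := h'.comp_const_add (y k) (0 : ℝ)
  rw [← this.deriv]
  congr 1
  funext t
  simp [setCoord]

/-- One step of the Poincaré lemma with compact supports: integration in the direction `k`. -/
theorem exists_primitive_direction (y₀ : Rn n) {R : ℝ} (hR : 0 < R) {θ : ℝ → ℝ}
    (hθ : ContDiff ℝ ∞ θ) (hθ0 : ∀ s, R ≤ |s| → θ s = 0) (hθ1 : ∫ s, θ s = 1) (k : Fin n)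
    {h : Rn n → ℝ} (hh : ContDiff ℝ ∞ h) (hk : ∀ y, R ≤ |y k - y₀ k| → h y = 0) :
    ∃ h' v : Rn n → ℝ, ContDiff ℝ ∞ h' ∧ ContDiff ℝ ∞ v ∧
      (∀ y s, h' (setCoord y k s) = h' y) ∧ (∀ y, R ≤ |y k - y₀ k| → v y = 0) ∧
      (∀ y, h y = pd k v y + θ (y k - y₀ k) * h' y) ∧
      (∀ j, j ≠ k → (∀ y s, h (setCoord y j s) = h y) → ∀ y s, h' (setCoord y j s) = h' y) ∧
      (∀ j, j ≠ k → ∀ y, (∀ s, h (setCoord y k s) = 0) → h' y = 0 ∧ v y = 0) := by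
  set a : ℝ := y₀ k - R with ha
  set b : ℝ := y₀ k + R with hb
  have hab : a ≤ b := by linarith
  let h' : Rn n → ℝ := fun y => ∫ s in Icc a b, h (setCoord y k s)
  have hq : ContDiff ℝ ∞ fun z : ℝ × Rn n => h (setCoord z.2 k z.1) :=
    hh.comp (contDiff_setCoord k)
  have hh' : ContDiff ℝ ∞ h' := contDiffOn_univ.1
    (contDiffOn_intervalIntegral isOpen_univ hq.contDiffOn a b)
  have hinv : ∀ y s, h' (setCoord y k s) = h' y := fun y s => by
    simp only [h', setCoord_setCoord]
  -- Here `h'` is the integral of `h` along the line in direction `k`. As `θ` has integral one, `g`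
  -- has integral zero along every such line, so its primitive has compact support in that
  -- direction.
  let g : Rn n → ℝ := fun y => h y - θ (y k - y₀ k) * h' y
  have hg : ContDiff ℝ ∞ g :=
    hh.sub ((hθ.comp ((contDiff_apply_euclidean k).sub contDiff_const)).mul hh')
  have hgk : ∀ y, R ≤ |y k - y₀ k| → g y = 0 := fun y hy => by
    simp [g, hk y hy, hθ0 _ hy]
  -- This is the primitive of `g` from `a` to `y k`, rescaled to the fixed interval `[0, 1]` so that
  -- smoothness follows from `contDiffOn_intervalIntegral`.
  let v : Rn n → ℝ := fun y => (y k - a) * ∫ t in Icc (0 : ℝ) 1, g (setCoord y k (a + t * (y k - a)))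
  have hv : ContDiff ℝ ∞ v := by
    refine ((contDiff_apply_euclidean k).sub contDiff_const).mul (contDiffOn_univ.1
      (contDiffOn_intervalIntegral (q := fun z : ℝ × Rn n =>
        g (setCoord z.2 k (a + z.1 * (z.2 k - a)))) isOpen_univ ?_ 0 1))
    have h1 : ContDiff ℝ ∞ fun z : ℝ × Rn n => (a + z.1 * (z.2 k - a), z.2) :=
      ContDiff.prodMk ?_ contDiff_snd
    · exact (hg.comp ((contDiff_setCoord k).comp h1)).contDiffOn
    exact contDiff_const.add (contDiff_fst.mul
      (((contDiff_apply_euclidean k).comp contDiff_snd).sub contDiff_const))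
  have hv' : ∀ y, v y = ∫ s in a..y k, g (setCoord y k s) := fun y => by
    simp only [v]
    rw [integral_Icc_eq_integral_Ioc, ← intervalIntegral.integral_of_le zero_le_one,
      ← smul_eq_mul, ]
    have := intervalIntegral.smul_integral_comp_add_mul (a := 0) (b := 1)
      (fun s => g (setCoord y k s)) (y k - a) a
    simp only [mul_comm (y k - a)] at this
    rw [this]
    simp
  have hgs : ∀ y, Continuous fun s => g (setCoord y k s) := fun y =>
    hg.continuous.comp
      ((contDiff_setCoord k).continuous.comp (by fun_prop : Continuous fun s : ℝ => (s, y)))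
  have hθi : ∫ s in a..b, θ (s - y₀ k) = 1 := by
    rw [intervalIntegral.integral_comp_sub_right, ← hθ1]
    have e1 : a - y₀ k = -R := by rw [ha]; ring
    have e2 : b - y₀ k = R := by rw [hb]; ring
    rw [e1, e2]
    refine intervalIntegral.integral_eq_integral_of_support_subset fun s hs => ?_
    have : |s| < R := not_le.1 fun h => hs (hθ0 s h)
    exact ⟨(abs_lt.1 this).1, (abs_lt.1 this).2.le⟩
  have hgi : ∀ y, ∫ s in a..b, g (setCoord y k s) = 0 := fun y => by
    simp only [g, setCoord_same, hinv]
    rw [intervalIntegral.integral_sub, intervalIntegral.integral_mul_const, hθi, one_mul]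
    · simp only [h']
      rw [integral_Icc_eq_integral_Ioc, ← intervalIntegral.integral_of_le hab, sub_self]
    · exact Continuous.intervalIntegrable (hh.continuous.comp
        ((contDiff_setCoord k).continuous.comp (by fun_prop : Continuous fun s : ℝ => (s, y)))) _ _
    · exact Continuous.intervalIntegrable ((hθ.continuous.comp (by fun_prop)).mul
        continuous_const) _ _
  refine ⟨h', v, hh', hv, hinv, fun y hy => ?_, fun y => ?_, fun j hj hi y s => ?_,
    fun j hj y h0 => ?_⟩
  · rw [hv']
    rcases le_abs.1 hy with hy | hy
    -- Beyond `b` the primitive is the full line integral of `g`, which is zero, plus an integral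
    -- over a region where `g` vanishes.
    · rw [← intervalIntegral.integral_add_adjacent_intervals (b := b)
        ((hgs y).intervalIntegrable _ _) ((hgs y).intervalIntegrable _ _), hgi, zero_add]
      refine intervalIntegral.integral_zero_ae (Filter.Eventually.of_forall fun s hs => ?_)
      rw [uIoc_of_le (by linarith)] at hs
      refine hgk _ ?_
      rw [setCoord_same]
      exact le_abs.2 (Or.inl (by linarith [hs.1]))
    · refine intervalIntegral.integral_zero_ae (Filter.Eventually.of_forall fun s hs => ?_)
      rw [uIoc_of_ge (by linarith)] at hs
      refine hgk _ ?_
      rw [setCoord_same]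
      exact le_abs.2 (Or.inr (by linarith [hs.2]))
  · have h1 : HasDerivAt (fun s => v (setCoord y k s)) (g y) (y k) := by
      simp only [hv', setCoord_same, setCoord_setCoord]
      have := intervalIntegral.integral_hasDerivAt_right (a := a) (b := y k)
        ((hgs y).intervalIntegrable _ _) ((hgs y).stronglyMeasurableAtFilter _ _)
        (hgs y).continuousAt
      rwa [setCoord_self] at this
    rw [pd_eq_of_hasDerivAt hv h1]
    simp [g]
  · simp only [h', setCoord_comm _ hj.symm, hi]
  · have h1 : h' y = 0 := by simp [h', h0]
    refine ⟨h1, ?_⟩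
    rw [hv']
    simp [g, h0, hinv, h1]

theorem hasDerivAt_setCoord {g : Rn n → ℝ} (hg : ContDiff ℝ ∞ g) (k : Fin n) (y : Rn n) :
    HasDerivAt (fun s => g (setCoord y k s)) (pd k g y) (y k) := by
  have h1 : HasDerivAt (fun s : ℝ => setCoord y k s) (stdVec k) (y k) := by
    have := (((hasDerivAt_id (y k)).sub_const (y k)).smul_const (stdVec k)).const_add y
    simpa [setCoord] using this
  have h2 : HasFDerivAt g (fderiv ℝ g y) (setCoord y k (y k)) := by
    rw [setCoord_self]
    exact (hg.differentiable (by simp) y).hasFDerivAt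
  exact h2.comp_hasDerivAt (y k) h1

/-- The closed cube of centre `y₀` and radius `R`. -/
def cube (y₀ : Rn n) (R : ℝ) : Set (Rn n) := {y | ∀ k, |y k - y₀ k| ≤ R}

theorem isCompact_cube (y₀ : Rn n) (R : ℝ) : IsCompact (cube y₀ R) := by
  have h := (EuclideanSpace.equiv (Fin n) ℝ).toHomeomorph.isCompact_preimage.2
    (isCompact_univ_pi fun k => isCompact_Icc (a := y₀ k - R) (b := y₀ k + R))
  convert h using 1
  ext y
  simp only [cube, mem_ofPred_eq, mem_preimage, mem_univ_pi, mem_Icc, abs_le]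
  refine forall_congr' fun k => ?_
  change _ ↔ y₀ k - R ≤ y k ∧ y k ≤ y₀ k + R
  constructor <;> rintro ⟨h1, h2⟩ <;> constructor <;> linarith

theorem hasCompactSupport_of_cube {y₀ : Rn n} {R : ℝ} {g : Rn n → ℝ}
    (h : ∀ y k, R ≤ |y k - y₀ k| → g y = 0) : HasCompactSupport g :=
  HasCompactSupport.intro (isCompact_cube y₀ R) fun y hy => by
    simp only [cube, mem_ofPred_eq, not_forall, not_le] at hy
    obtain ⟨k, hk⟩ := hy
    exact h y k hk.le

/-- The Poincaré lemma with compact supports, in top degree. -/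
theorem exists_divergence_eq (y₀ : Rn n) {R : ℝ} (hR : 0 < R) {b : Rn n → ℝ}
    (hb : ContDiff ℝ ∞ b) (hb0 : ∀ y k, R ≤ |y k - y₀ k| → b y = 0) (hint : ∫ y, b y = 0) :
    ∃ v : Fin n → Rn n → ℝ, (∀ j, ContDiff ℝ ∞ (v j)) ∧
      (∀ j y k, R ≤ |y k - y₀ k| → v j y = 0) ∧ ∀ y, b y = ∑ j, pd j (v j) y := by
  classical
  let β : ContDiffBump (0 : ℝ) := ⟨R / 2, R, by linarith, by linarith⟩
  set θ : ℝ → ℝ := β.normed volume with hθdef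
  have hθ : ContDiff ℝ ∞ θ := β.contDiff_normed
  have hθ0 : ∀ s, R ≤ |s| → θ s = 0 := fun s hs => by
    by_contra h
    have : s ∈ Function.support θ := h
    rw [hθdef, β.support_normed_eq] at this
    simp only [Metric.mem_ball, dist_zero_right, Real.norm_eq_abs] at this
    exact absurd this (not_lt.2 hs)
  have hθ1 : ∫ s, θ s = 1 := β.integral_normed
  let Θ : Finset (Fin n) → Rn n → ℝ := fun S y => ∏ k ∈ S, θ (y k - y₀ k)
  have hΘ : ∀ S, ContDiff ℝ ∞ (Θ S) := fun S => contDiff_prod fun k _ =>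
    hθ.comp ((contDiff_apply_euclidean k).sub contDiff_const)
  -- Induction on the set `S` of coordinates already integrated out: modulo divergences, `b` is the
  -- product of the bumps `θ` in the coordinates of `S` with a function that no longer depends on
  -- them and is still confined to the cube in the others.
  have key : ∀ S : Finset (Fin n), ∃ (v : Fin n → Rn n → ℝ) (h : Rn n → ℝ),
      (∀ j, ContDiff ℝ ∞ (v j)) ∧ ContDiff ℝ ∞ h ∧ (∀ j y k, R ≤ |y k - y₀ k| → v j y = 0) ∧
      (∀ k ∈ S, ∀ y s, h (setCoord y k s) = h y) ∧
      (∀ k ∉ S, ∀ y, R ≤ |y k - y₀ k| → h y = 0) ∧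
      ∀ y, b y = ∑ j, pd j (v j) y + Θ S y * h y := by
    intro S
    induction S using Finset.induction_on with
    | empty =>
      refine ⟨fun _ _ => 0, b, fun _ => contDiff_const, hb, fun _ _ _ _ => rfl, by simp,
        fun k _ y hy => hb0 y k hy, fun y => ?_⟩
      simp [Θ, pd]
    | insert k S hkS ih =>
      obtain ⟨v, h, hv, hh, hv0, hinv, hh0, e⟩ := ih
      obtain ⟨h', w, hh', hw, h1, h2, h3, h4, h5⟩ :=
        exists_primitive_direction y₀ hR hθ hθ0 hθ1 k hh (hh0 k hkS)
      have hΘk : ∀ y s, Θ S (setCoord y k s) = Θ S y := fun y s =>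
        Finset.prod_congr rfl fun j hj => by
          rw [setCoord_of_ne]
          rintro rfl; exact hkS hj
      have hw' : ContDiff ℝ ∞ fun y => Θ S y * w y := (hΘ S).mul hw
      -- As `k ∉ S`, the factor `Θ S` is constant in direction `k`.
      have hpd : ∀ y, pd k (fun y => Θ S y * w y) y = Θ S y * pd k w y := fun y => by
        refine pd_eq_of_hasDerivAt hw' ?_
        simp only [hΘk]
        exact (hasDerivAt_setCoord hw k y).const_mul _
      have h00 : ∀ j ∉ S, j ≠ k → ∀ y, R ≤ |y j - y₀ j| → h' y = 0 ∧ w y = 0 := fun j hj hjk y hy =>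
        h5 j hjk y fun s => hh0 j hj _ (by rwa [setCoord_of_ne _ hjk])
      refine ⟨fun j y => v j y + if j = k then Θ S y * w y else 0, h', fun j => ?_, hh',
        fun j y i hi => ?_, fun j hj y s => ?_, fun j hj y hy => ?_, fun y => ?_⟩
      · by_cases hj : j = k
        · simpa [hj] using (hv k).add hw'
        · simpa [hj] using hv j
      · change v j y + (if j = k then Θ S y * w y else 0) = 0
        rw [hv0 j y i hi, zero_add]
        split_ifs
        · by_cases hiS : i ∈ S
          · have : Θ S y = 0 := Finset.prod_eq_zero hiS (hθ0 _ hi)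
            rw [this, zero_mul]
          · by_cases hik : i = k
            · subst hik; rw [h2 y hi, mul_zero]
            · rw [(h00 i hiS hik y hi).2, mul_zero]
        · rfl
      · rcases Finset.mem_insert.1 hj with rfl | hj'
        · exact h1 y s
        · exact h4 j (by rintro rfl; exact hkS hj') (hinv j hj') y s
      · simp only [Finset.mem_insert, not_or] at hj
        exact (h00 j hj.2 hj.1 y hy).1
      · have hsum : ∑ j, pd j (fun y => v j y + if j = k then Θ S y * w y else 0) y =
            ∑ j, pd j (v j) y + Θ S y * pd k w y := by
          rw [← hpd, ← Finset.sum_erase_add _ _ (Finset.mem_univ k),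
            ← Finset.sum_erase_add _ (fun j => pd j (v j) y) (Finset.mem_univ k), add_assoc]
          congr 1
          · refine Finset.sum_congr rfl fun j hj => ?_
            simp [(Finset.mem_erase.1 hj).1]
          · simp only [if_true, pd]
            rw [fderiv_fun_add ((hv k).differentiable (by simp) y)
              (hw'.differentiable (by simp) y)]
            rfl
        rw [hsum, e y, h3 y]
        simp only [Θ, Finset.prod_insert hkS]
        ring
  obtain ⟨v, h, hv, hh, hv0, hinv, -, e⟩ := key Finset.univ
  have hconst : ∀ y, h y = h y₀ := by
    refine fun y => is_const_of_fderiv_eq_zero (𝕜 := ℝ) (hh.differentiable (by simp))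
      (fun y => ?_) y y₀
    refine ContinuousLinearMap.coe_injective
      ((EuclideanSpace.basisFun (Fin n) ℝ).toBasis.ext fun k => ?_)
    have : pd k h y = 0 := pd_eq_of_hasDerivAt hh (by
      simp only [hinv k (Finset.mem_univ k)]; exact hasDerivAt_const _ _)
    simpa [pd] using this
  have hΘ0 : ∀ y k, R ≤ |y k - y₀ k| → Θ Finset.univ y = 0 := fun y k hy =>
    Finset.prod_eq_zero (Finset.mem_univ k) (hθ0 _ hy)
  have hvi : ∀ j, ∫ y, pd j (v j) y = 0 := fun j =>
    integral_pd_eq_zero (hv j) (hasCompactSupport_of_cube (hv0 j)) j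
  have hvint : ∀ j, Integrable (pd j (v j)) := fun j =>
    Continuous.integrable_of_hasCompactSupport
      (continuousOn_univ.1 (pd_contDiffOn isOpen_univ (hv j).contDiffOn j).continuousOn)
      ((hasCompactSupport_of_cube (hv0 j)).fderiv_apply ℝ _)
  have hΘint : Integrable (Θ Finset.univ) :=
    (hΘ _).continuous.integrable_of_hasCompactSupport (hasCompactSupport_of_cube hΘ0)
  have hpos : 0 < ∫ y, Θ Finset.univ y := by
    refine Continuous.integral_pos_of_hasCompactSupport_nonneg_nonzero (x := y₀)
      (hΘ _).continuous (hasCompactSupport_of_cube hΘ0)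
      (fun y => Finset.prod_nonneg fun k _ => β.nonneg_normed _) ?_
    refine Finset.prod_ne_zero_iff.2 fun k _ => ?_
    have : (0 : ℝ) ∈ Function.support θ := by
      rw [hθdef, β.support_normed_eq]; simpa using hR
    simpa using this
  -- With all coordinates integrated out, `h` is constant. Divergences integrate to zero, so the
  -- integral of `b` is this constant times the positive integral of `Θ`.
  have hc : h y₀ = 0 := by
    have h1 : ∫ y, b y = (∫ y, Θ Finset.univ y) * h y₀ := by
      simp only [e, hconst]
      rw [integral_add (integrable_finsetSum _ fun j _ => hvint j) (hΘint.mul_const _),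
        integral_finsetSum _ fun j _ => hvint j, integral_mul_const]
      simp [hvi]
    rw [hint] at h1
    exact (mul_eq_zero.1 h1.symm).resolve_left hpos.ne'
  exact ⟨v, hv, hv0, fun y => by rw [e y, hconst, hc, mul_zero, add_zero]⟩

end CompactSupport

/-! ### Alternating forms in coordinates -/

section Alternating

variable {n k : ℕ}

theorem alternating_apply_eq_sum (β : Rn n [⋀^Fin k]→L[ℝ] ℝ) (v : Fin k → Rn n) :
    β v = ∑ σ : Fin k → Fin n, (∏ i, v i (σ i)) * β fun i => stdVec (σ i) := by
  have hv : v = fun i => ∑ j, v i j • stdVec j := by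
    funext i
    have := (EuclideanSpace.basisFun (Fin n) ℝ).sum_repr (v i)
    simpa using this.symm
  conv_lhs => rw [hv]
  have h1 := β.toMultilinearMap.map_sum (fun i j => v i j • (stdVec j : Rn n))
  refine h1.trans (Finset.sum_congr rfl fun σ _ => ?_)
  exact β.toMultilinearMap.map_smul_univ (fun i => v i (σ i)) fun i => stdVec (σ i)

/-- Evaluation on tuples of basis vectors is an injective linear map into a finite-dimensional
space. A linear left inverse of it is continuous and recovers the form from its finitely many
coefficients. -/
theorem contDiffOn_alternating {E : Type*} [NormedAddCommGroup E] [NormedSpace ℝ E] {U : Set E}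
    {f : E → Rn n [⋀^Fin k]→L[ℝ] ℝ}
    (h : ∀ v : Fin k → Rn n, ContDiffOn ℝ ∞ (fun x => f x v) U) : ContDiffOn ℝ ∞ f U := by
  let ev : (Rn n [⋀^Fin k]→L[ℝ] ℝ) →ₗ[ℝ] ((Fin k → Fin n) → ℝ) :=
    { toFun := fun β σ => β fun i => stdVec (σ i)
      map_add' := fun _ _ => rfl
      map_smul' := fun _ _ => rfl }
  have hev : LinearMap.ker ev = ⊥ := by
    refine LinearMap.ker_eq_bot'.2 fun β hβ => ?_
    ext v
    rw [alternating_apply_eq_sum]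
    refine Finset.sum_eq_zero fun σ _ => ?_
    have : β (fun i => stdVec (σ i)) = 0 := congrFun hβ σ
    rw [this, mul_zero]
  obtain ⟨g, hg⟩ := LinearMap.exists_leftInverse_of_injective ev hev
  have h1 : ContDiffOn ℝ ∞ (fun x => LinearMap.toContinuousLinearMap g (ev (f x))) U :=
    (LinearMap.toContinuousLinearMap g).contDiff.comp_contDiffOn
      (contDiffOn_pi.2 fun σ => h fun i => stdVec (σ i))
  exact h1.congr fun x _ => (LinearMap.congr_fun hg (f x)).symm

theorem contDiff_alternating_apply (v : Fin k → Rn n) :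
    ContDiff ℝ ∞ fun β : Rn n [⋀^Fin k]→L[ℝ] ℝ => β v :=
  (ContinuousAlternatingMap.apply ℝ (Rn n) ℝ v).contDiff

theorem contDiff_compContinuousLinearMap :
    ContDiff ℝ ∞ fun z : (Rn n [⋀^Fin k]→L[ℝ] ℝ) × (Rn n →L[ℝ] Rn n) =>
      z.1.compContinuousLinearMap z.2 := by
  refine contDiffOn_univ.1 (contDiffOn_alternating fun v => contDiffOn_univ.2 ?_)
  have : (fun z : (Rn n [⋀^Fin k]→L[ℝ] ℝ) × (Rn n →L[ℝ] Rn n) =>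
      z.1.compContinuousLinearMap z.2 v) = fun z => ∑ σ : Fin k → Fin n,
        (∏ i, z.2 (v i) (σ i)) * z.1 fun i => stdVec (σ i) := by
    funext z
    exact alternating_apply_eq_sum z.1 fun i => z.2 (v i)
  rw [this]
  refine ContDiff.sum fun σ _ => ContDiff.mul (contDiff_prod fun i _ => ?_)
    ((contDiff_alternating_apply _).comp contDiff_fst)
  exact (contDiff_apply_euclidean (σ i)).comp (contDiff_snd.clm_apply contDiff_const)

/-- The standard frame of `ℝⁿ`. -/
abbrev stdFrame : Fin n → Rn n := fun i => stdVec i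

theorem topForm_eq_zero {β : Rn n [⋀^Fin n]→L[ℝ] ℝ} (h : β stdFrame = 0) : β = 0 := by
  have h2 := AlternatingMap.map_basis_eq_zero_iff (e := (EuclideanSpace.basisFun (Fin n) ℝ).toBasis)
    (f := β.toAlternatingMap)
  have h3 : ((EuclideanSpace.basisFun (Fin n) ℝ).toBasis : Fin n → Rn n) = stdFrame := by
    funext i; simp
  rw [h3] at h2
  ext v
  exact DFunLike.congr_fun (h2.1 h) v

theorem topForm_ext {β β' : Rn n [⋀^Fin n]→L[ℝ] ℝ} (h : β stdFrame = β' stdFrame) : β = β' :=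
  sub_eq_zero.1 (topForm_eq_zero (by simp [h]))

theorem topForm_comp_apply (β : Rn n [⋀^Fin n]→L[ℝ] ℝ) (A : Rn n →L[ℝ] Rn n) :
    β.compContinuousLinearMap A stdFrame = A.det * β stdFrame := by
  let e := (EuclideanSpace.basisFun (Fin n) ℝ).toBasis
  have h3 : (e : Fin n → Rn n) = stdFrame := by
    funext i; simp [e]
  have h1 := β.toAlternatingMap.eq_smul_basis_det e
  have h2 : β.compContinuousLinearMap A stdFrame = β.toAlternatingMap (A ∘ e) := by rw [h3]; rfl
  rw [h2, h1, AlternatingMap.smul_apply, h3, smul_eq_mul, mul_comm]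
  congr 1
  have := e.det_comp_basis e (A : Rn n →ₗ[ℝ] Rn n)
  rw [h3] at this
  exact this

end Alternating

/-! ### Charts and trivializations -/

section Charts

variable {n m : ℕ} {M : Type*} [TopologicalSpace M] [ChartedSpace (Rn n) M]
  [IsManifold (𝓡 n) ∞ M]
  {V : M → Type*} [∀ x, AddCommGroup (V x)] [∀ x, Module ℝ (V x)] [∀ x, TopologicalSpace (V x)]
  [TopologicalSpace (TotalSpace (Rn m) V)] [FiberBundle (Rn m) V] [VectorBundle ℝ (Rn m) V]
  [ContMDiffVectorBundle ∞ (Rn m) V (𝓡 n)]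

variable (m V) in
theorem isOpen_coordTarget (x₀ : M) : IsOpen (coordTarget n m V x₀) :=
  (continuousOn_extChartAt_symm x₀).isOpen_inter_preimage (isOpen_extChartAt_target x₀)
    (trivializationAt (Rn m) V x₀).open_baseSet

variable (m V) in
theorem isOpen_coordSource (x₀ : M) : IsOpen (coordSource n m V x₀) :=
  (chartAt (Rn n) x₀).open_source.inter (trivializationAt (Rn m) V x₀).open_baseSet

theorem mem_coordSource_self (x : M) : x ∈ coordSource n m V x :=
  ⟨mem_chart_source _ x, mem_baseSet_trivializationAt _ _ x⟩

theorem mem_extChartAt_source {x₀ x : M} (hx : x ∈ coordSource n m V x₀) :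
    x ∈ (extChartAt (𝓡 n) x₀).source := by
  rw [extChartAt_source]; exact hx.1

theorem symm_ext {x₀ x : M} (hx : x ∈ coordSource n m V x₀) :
    (extChartAt (𝓡 n) x₀).symm (extChartAt (𝓡 n) x₀ x) = x :=
  (extChartAt (𝓡 n) x₀).left_inv (mem_extChartAt_source hx)

theorem ext_symm {x₀ : M} {y : Rn n} (hy : y ∈ coordTarget n m V x₀) :
    extChartAt (𝓡 n) x₀ ((extChartAt (𝓡 n) x₀).symm y) = y :=
  (extChartAt (𝓡 n) x₀).right_inv hy.1

theorem ext_mem {x₀ x : M} (hx : x ∈ coordSource n m V x₀) :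
    extChartAt (𝓡 n) x₀ x ∈ coordTarget n m V x₀ :=
  ⟨(extChartAt (𝓡 n) x₀).map_source (mem_extChartAt_source hx), by
    rw [mem_preimage, symm_ext hx]; exact hx.2⟩

theorem symm_mem {x₀ : M} {y : Rn n} (hy : y ∈ coordTarget n m V x₀) :
    (extChartAt (𝓡 n) x₀).symm y ∈ coordSource n m V x₀ :=
  ⟨by have := (extChartAt (𝓡 n) x₀).map_target hy.1; rwa [extChartAt_source] at this, hy.2⟩

theorem contMDiffAt_ext {x₀ x : M} (hx : x ∈ coordSource n m V x₀) :
    ContMDiffAt (𝓡 n) 𝓘(ℝ, Rn n) ∞ (extChartAt (𝓡 n) x₀) x :=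
  contMDiffAt_extChartAt' hx.1

theorem contMDiffAt_symm {x₀ : M} {y : Rn n} (hy : y ∈ coordTarget n m V x₀) :
    ContMDiffAt 𝓘(ℝ, Rn n) (𝓡 n) ∞ (extChartAt (𝓡 n) x₀).symm y :=
  (contMDiffOn_extChartAt_symm x₀).contMDiffAt
    ((isOpen_extChartAt_target x₀).mem_nhds hy.1)

theorem continuousAt_symm {x₀ : M} {y : Rn n} (hy : y ∈ coordTarget n m V x₀) :
    ContinuousAt (extChartAt (𝓡 n) x₀).symm y := (contMDiffAt_symm hy).continuousAt

theorem localSec_contDiffOn (φ : Sec n m V) (x₀ : M) :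
    ContDiffOn ℝ ∞ (localSec n m x₀ φ) (coordTarget n m V x₀) := by
  intro y hy
  refine ContDiffAt.contDiffWithinAt ?_
  rw [← contMDiffAt_iff_contDiffAt]
  have h1 : ContMDiffAt 𝓘(ℝ, Rn n) ((𝓡 n).prod 𝓘(ℝ, Rn m)) ∞
      (fun y => (⟨(extChartAt (𝓡 n) x₀).symm y, φ ((extChartAt (𝓡 n) x₀).symm y)⟩ :
        TotalSpace (Rn m) V)) y :=
    (φ.contMDiff_toFun _).comp _ (contMDiffAt_symm hy)
  have h2 := ((trivializationAt (Rn m) V x₀).contMDiffOn (IB := 𝓡 n) (n := ∞)).contMDiffAt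
    ((trivializationAt (Rn m) V x₀).open_source.mem_nhds
      ((trivializationAt (Rn m) V x₀).mem_source.2 hy.2 :
        (⟨_, φ ((extChartAt (𝓡 n) x₀).symm y)⟩ : TotalSpace (Rn m) V) ∈ _))
  exact (ContMDiffAt.comp_of_eq h2 h1 rfl).snd

/-- The trivialization at `x₀` on the fibre over `x`. -/
theorem triv_eq_linearMapAt {x₀ x : M} (hx : x ∈ coordSource n m V x₀) (v : V x) :
    (trivializationAt (Rn m) V x₀ ⟨x, v⟩).2 =
      (trivializationAt (Rn m) V x₀).linearMapAt ℝ x v := by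
  rw [Trivialization.coe_linearMapAt_of_mem _ hx.2]

theorem localSec_add_smul (φ η : Sec n m V) (t : ℝ) {x₀ : M} {y : Rn n}
    (hy : y ∈ coordTarget n m V x₀) :
    localSec n m x₀ (φ + t • η) y = localSec n m x₀ φ y + t • localSec n m x₀ η y := by
  simp only [localSec]
  rw [triv_eq_linearMapAt (symm_mem hy), triv_eq_linearMapAt (symm_mem hy),
    triv_eq_linearMapAt (symm_mem hy)]
  exact (map_add _ _ _).trans (congrArg _ (map_smul _ _ _))

theorem localSec_smul (t : ℝ) (φ : Sec n m V) {x₀ : M} {y : Rn n}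
    (hy : y ∈ coordTarget n m V x₀) :
    localSec n m x₀ (t • φ) y = t • localSec n m x₀ φ y := by
  simp only [localSec]
  rw [triv_eq_linearMapAt (symm_mem hy), triv_eq_linearMapAt (symm_mem hy)]
  exact map_smul _ _ _

theorem partialDeriv_congr {U : Set (Rn n)} (hU : IsOpen U) {f g : Rn n → Rn m}
    (h : EqOn f g U) {y : Rn n} (hy : y ∈ U) (a : Fin m) (I : Fin n → ℕ) :
    partialDeriv f y a I = partialDeriv g y a I := by
  rw [partialDeriv, partialDeriv,
    ((h.eventuallyEq_of_mem (hU.mem_nhds hy)).iteratedFDeriv ℝ _).eq_of_nhds]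

theorem jetAt_congr {U : Set (Rn n)} (hU : IsOpen U) {f g : Rn n → Rn m}
    (h : EqOn f g U) {y : Rn n} (hy : y ∈ U) : jetAt f y = jetAt g y :=
  Prod.ext rfl (funext fun aI => partialDeriv_congr hU h hy aI.1 aI.2)

theorem pdl_add_smul {U : Set (Rn n)} (hU : IsOpen U) {W : Type*} [NormedAddCommGroup W]
    [NormedSpace ℝ W] {f g : Rn n → W} (hf : ContDiffOn ℝ ∞ f U) (hg : ContDiffOn ℝ ∞ g U)
    (t : ℝ) (l : List (Fin n)) :
    EqOn (pdl l fun y => f y + t • g y) (fun y => pdl l f y + t • pdl l g y) U := fun y hy => by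
  have h := hf.prodMk hg
  have h1 := pdl_clm hU h (ContinuousLinearMap.fst ℝ W W + t • ContinuousLinearMap.snd ℝ W W) l hy
  have h2 := pdl_clm hU h (ContinuousLinearMap.fst ℝ W W) l hy
  have h3 := pdl_clm hU h (ContinuousLinearMap.snd ℝ W W) l hy
  exact h1.trans (congrArg₂ (fun a b => a + t • b) h2.symm h3.symm)

theorem jetAt_add_smul {U : Set (Rn n)} (hU : IsOpen U) {f g : Rn n → Rn m}
    (hf : ContDiffOn ℝ ∞ f U) (hg : ContDiffOn ℝ ∞ g U) (t : ℝ) {y : Rn n} (hy : y ∈ U) :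
    jetAt (fun y => f y + t • g y) y = jetAt f y + t • (0, (jetAt g y).2) := by
  refine Prod.ext (by simp [jetAt]) (funext fun aI => ?_)
  change partialDeriv _ y aI.1 aI.2 =
    partialDeriv f y aI.1 aI.2 + t • partialDeriv g y aI.1 aI.2
  have pr : ∀ {h : Rn n → Rn m}, ContDiffOn ℝ ∞ h U → ContDiffOn ℝ ∞ (fun y => h y aI.1) U :=
    fun h => (contDiff_apply_euclidean aI.1).comp_contDiffOn h
  rw [partialDeriv_eq_pdl hU (hf.add (hg.const_smul t)) _ _ hy, partialDeriv_eq_pdl hU hf _ _ hy,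
    partialDeriv_eq_pdl hU hg _ _ hy]
  exact pdl_add_smul hU (pr hf) (pr hg) t _ hy

theorem jetCoordAt_eq (x₀ : M) (φ : Sec n m V) (x : M) :
    jetCoordAt n m x₀ φ x = jetAt (localSec n m x₀ φ) (extChartAt (𝓡 n) x₀ x) := rfl

/-- Trivializations are linear on fibres, so the jets of `φ + t η` run along a straight line in
coordinates. This is why first variations are line derivatives. -/
theorem jetAt_localSec_add_smul (φ η : Sec n m V) (t : ℝ) {x₀ : M} {y : Rn n}
    (hy : y ∈ coordTarget n m V x₀) :
    jetAt (localSec n m x₀ (φ + t • η)) y =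
      jetAt (localSec n m x₀ φ) y + t • (0, (jetAt (localSec n m x₀ η) y).2) := by
  rw [← jetAt_add_smul (isOpen_coordTarget m V x₀) (localSec_contDiffOn φ x₀)
    (localSec_contDiffOn η x₀) t hy]
  exact jetAt_congr (isOpen_coordTarget m V x₀) (fun y hy => localSec_add_smul φ η t hy) hy

/-! ### Changes of coordinates -/

/-- The change of charts from `x₁` to `x₀`. -/
def transMap (x₁ x₀ : M) (y : Rn n) : Rn n :=
  extChartAt (𝓡 n) x₀ ((extChartAt (𝓡 n) x₁).symm y)

variable (n m V) in
/-- The part of the coordinate domain at `x₁` where the coordinates at `x₀` are defined too. -/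
def overlap (x₁ x₀ : M) : Set (Rn n) :=
  coordTarget n m V x₁ ∩ (extChartAt (𝓡 n) x₁).symm ⁻¹' coordSource n m V x₀

variable (n m V) in
theorem isOpen_overlap (x₁ x₀ : M) : IsOpen (overlap n m V x₁ x₀) :=
  ContinuousOn.isOpen_inter_preimage
    (fun _ hy => (continuousAt_symm (m := m) (V := V) hy).continuousWithinAt)
    (isOpen_coordTarget m V x₁) (isOpen_coordSource m V x₀)

theorem ext_mem_overlap {x₁ x₀ x : M} (h₁ : x ∈ coordSource n m V x₁)
    (h₀ : x ∈ coordSource n m V x₀) : extChartAt (𝓡 n) x₁ x ∈ overlap n m V x₁ x₀ :=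
  ⟨ext_mem h₁, by rw [mem_preimage, symm_ext h₁]; exact h₀⟩

theorem symm_transMap {x₁ x₀ : M} {y : Rn n} (hy : y ∈ overlap n m V x₁ x₀) :
    (extChartAt (𝓡 n) x₀).symm (transMap x₁ x₀ y) = (extChartAt (𝓡 n) x₁).symm y :=
  symm_ext hy.2

theorem transMap_mem {x₁ x₀ : M} {y : Rn n} (hy : y ∈ overlap n m V x₁ x₀) :
    transMap x₁ x₀ y ∈ overlap n m V x₀ x₁ :=
  ⟨ext_mem hy.2, by rw [mem_preimage, symm_transMap hy]; exact symm_mem hy.1⟩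

theorem transMap_transMap {x₁ x₀ : M} {y : Rn n} (hy : y ∈ overlap n m V x₁ x₀) :
    transMap x₀ x₁ (transMap x₁ x₀ y) = y := by
  rw [transMap, symm_transMap hy, ext_symm hy.1]

theorem transMap_ext {x₁ x₀ x : M} (h₁ : x ∈ coordSource n m V x₁) :
    transMap x₁ x₀ (extChartAt (𝓡 n) x₁ x) = extChartAt (𝓡 n) x₀ x := by
  rw [transMap, symm_ext h₁]

theorem transMap_contDiffOn (x₁ x₀ : M) :
    ContDiffOn ℝ ∞ (transMap (n := n) x₁ x₀) (overlap n m V x₁ x₀) := fun y hy => by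
  refine ContDiffAt.contDiffWithinAt ?_
  rw [← contMDiffAt_iff_contDiffAt]
  exact (contMDiffAt_ext hy.2).comp y (contMDiffAt_symm hy.1)

theorem transMap_differentiableAt {x₁ x₀ : M} {y : Rn n} (hy : y ∈ overlap n m V x₁ x₀) :
    DifferentiableAt ℝ (transMap x₁ x₀) y :=
  ((transMap_contDiffOn x₁ x₀).contDiffAt ((isOpen_overlap n m V x₁ x₀).mem_nhds hy)).differentiableAt
    (by simp)

/-- The change of trivializations from `x₁` to `x₀`, in the chart at `x₁`. -/
def fibreTrans (x₁ x₀ : M) (y : Rn n) : Rn m →L[ℝ] Rn m :=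
  (trivializationAt (Rn m) V x₁).coordChangeL ℝ (trivializationAt (Rn m) V x₀)
    ((extChartAt (𝓡 n) x₁).symm y)

theorem fibreTrans_contDiffOn (x₁ x₀ : M) :
    ContDiffOn ℝ ∞ (fibreTrans (m := m) (V := V) x₁ x₀) (overlap n m V x₁ x₀) := fun y hy => by
  refine ContDiffAt.contDiffWithinAt ?_
  rw [← contMDiffAt_iff_contDiffAt]
  exact (contMDiffAt_coordChangeL (n := ∞) (IB := 𝓡 n) (𝕜 := ℝ) hy.1.2 hy.2.2).comp y
    (contMDiffAt_symm hy.1)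

theorem fibreTrans_apply {x₁ x₀ : M} {y : Rn n} (hy : y ∈ overlap n m V x₁ x₀)
    (v : V ((extChartAt (𝓡 n) x₁).symm y)) :
    fibreTrans (V := V) x₁ x₀ y ((trivializationAt (Rn m) V x₁ ⟨_, v⟩).2) =
      (trivializationAt (Rn m) V x₀ ⟨_, v⟩).2 := by
  rw [fibreTrans, ContinuousLinearEquiv.coe_coe, Trivialization.coordChangeL_apply _ _ ⟨hy.1.2, hy.2.2⟩]
  rw [Trivialization.symm_apply_apply_mk _ hy.1.2]

theorem localSec_transMap (φ : Sec n m V) {x₁ x₀ : M} {y : Rn n} (hy : y ∈ overlap n m V x₁ x₀) :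
    localSec n m x₀ φ (transMap x₁ x₀ y) =
      fibreTrans (V := V) x₁ x₀ y (localSec n m x₁ φ y) := by
  rw [localSec, symm_transMap hy, localSec, fibreTrans_apply hy]

end Charts

section Transition

variable {n m : ℕ} {M : Type*} [TopologicalSpace M] [ChartedSpace (Rn n) M]
  [IsManifold (𝓡 n) ∞ M]
  {V : M → Type*} [∀ x, AddCommGroup (V x)] [∀ x, Module ℝ (V x)] [∀ x, TopologicalSpace (V x)]
  [TopologicalSpace (TotalSpace (Rn m) V)] [FiberBundle (Rn m) V] [VectorBundle ℝ (Rn m) V]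
  [ContMDiffVectorBundle ∞ (Rn m) V (𝓡 n)]

/-! ### Sections with prescribed germs -/

/-- Extension by zero. Smoothness away from the coordinate domain holds because the image of `K` is
compact, hence closed in the Hausdorff space `M`, so the section is zero near every other point. -/
theorem exists_sec_of_local [T2Space M] (x₀ : M) {g : Rn n → Rn m}
    (hg : ContDiffOn ℝ ∞ g (coordTarget n m V x₀)) {K : Set (Rn n)} (hK : IsCompact K)
    (hKs : K ⊆ coordTarget n m V x₀) (h0 : ∀ y ∈ coordTarget n m V x₀, y ∉ K → g y = 0) :
    ∃ φ : Sec n m V, (∀ y ∈ coordTarget n m V x₀, localSec n m x₀ φ y = g y) ∧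
      ∀ x ∉ (extChartAt (𝓡 n) x₀).symm '' K, φ x = 0 := by
  classical
  set e := trivializationAt (Rn m) V x₀ with he
  let s : ∀ x, V x := fun x =>
    if x ∈ coordSource n m V x₀ then e.symm x (g (extChartAt (𝓡 n) x₀ x)) else 0
  have hs0 : ∀ x ∉ (extChartAt (𝓡 n) x₀).symm '' K, s x = 0 := by
    intro x hx
    simp only [s]
    split_ifs with h
    · rw [h0 _ (ext_mem h) fun hk => hx ⟨_, hk, symm_ext h⟩]
      rw [← e.coe_symmₗ (R := ℝ) h.2, map_zero]
    · rfl
  have hcl : IsClosed ((extChartAt (𝓡 n) x₀).symm '' K) :=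
    (hK.image_of_continuousOn fun y hy =>
      (continuousAt_symm (hKs hy)).continuousWithinAt).isClosed
  have hs : ContMDiff (𝓡 n) ((𝓡 n).prod 𝓘(ℝ, Rn m)) ∞
      fun x => (TotalSpace.mk' (Rn m) x (s x) : TotalSpace (Rn m) V) := by
    intro x
    by_cases hx : x ∈ coordSource n m V x₀
    · have h1 : ContMDiffAt (𝓡 n) 𝓘(ℝ, Rn m) ∞ (fun x => g (extChartAt (𝓡 n) x₀ x)) x :=
        ((hg.contDiffAt ((isOpen_coordTarget m V x₀).mem_nhds (ext_mem hx))).contMDiffAt).comp x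
          (contMDiffAt_ext hx)
      have h2 : ContMDiffAt (𝓡 n) ((𝓡 n).prod 𝓘(ℝ, Rn m)) ∞
          (fun x => (x, g (extChartAt (𝓡 n) x₀ x))) x := contMDiffAt_id.prodMk h1
      have ht : (x, g (extChartAt (𝓡 n) x₀ x)) ∈ e.target := e.mem_target.2 hx.2
      have h3 := (e.contMDiffOn_symm (IB := 𝓡 n) (n := ∞)).contMDiffAt (e.open_target.mem_nhds ht)
      refine (h3.comp x h2).congr_of_eventuallyEq ?_
      filter_upwards [(isOpen_coordSource m V x₀).mem_nhds hx] with x' hx'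
      simp only [s, if_pos hx', Function.comp]
      exact e.mk_symm hx'.2 _
    · have hx' : x ∉ (extChartAt (𝓡 n) x₀).symm '' K := by
        rintro ⟨y, hy, rfl⟩
        exact hx (symm_mem (hKs hy))
      refine ((contMDiff_zeroSection ℝ V).of_le le_top x).congr_of_eventuallyEq ?_
      filter_upwards [hcl.isOpen_compl.mem_nhds hx'] with x'' hx''
      simp only [hs0 x'' hx'']
      rfl
  refine ⟨⟨s, hs⟩, fun y hy => ?_, hs0⟩
  change (e ⟨_, s _⟩).2 = _
  simp only [s, if_pos (symm_mem hy), ext_symm hy]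
  rw [e.apply_mk_symm hy.2]

theorem CompactSec.of_image [T2Space M] {x₀ : M} {K : Set (Rn n)} (hK : IsCompact K)
    (hKs : K ⊆ coordTarget n m V x₀) {φ : Sec n m V}
    (h : ∀ x ∉ (extChartAt (𝓡 n) x₀).symm '' K, φ x = 0) : CompactSec n m φ :=
  ⟨_, hK.image_of_continuousOn fun _ hy => (continuousAt_symm (hKs hy)).continuousWithinAt, h⟩

/-- Every germ of a local section extends to a compactly supported global section. -/
theorem exists_compactSec_germ [T2Space M] (x₀ : M) {f : Rn n → Rn m}
    (hf : ContDiffOn ℝ ∞ f (coordTarget n m V x₀)) {y : Rn n} (hy : y ∈ coordTarget n m V x₀) :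
    ∃ φ : Sec n m V, CompactSec n m φ ∧ localSec n m x₀ φ =ᶠ[𝓝 y] f := by
  obtain ⟨R, hR, hb⟩ := Metric.nhds_basis_closedBall.mem_iff.1
    ((isOpen_coordTarget m V x₀).mem_nhds hy)
  let χ : ContDiffBump y := ⟨R / 2, R, by linarith, by linarith⟩
  obtain ⟨φ, h1, h2⟩ := exists_sec_of_local x₀ (g := fun z => χ z • f z)
    (χ.contDiff.contDiffOn.smul hf) (isCompact_closedBall y R) hb fun z _ hz => by
      rw [χ.zero_of_le_dist (not_le.1 hz).le, zero_smul]
  refine ⟨φ, CompactSec.of_image (isCompact_closedBall y R) hb h2, ?_⟩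
  filter_upwards [(isOpen_coordTarget m V x₀).mem_nhds hy,
    Metric.closedBall_mem_nhds y (half_pos hR)] with z hz hz'
  rw [h1 z hz, χ.one_of_mem_closedBall hz', one_smul]

theorem jetAt_congr_of_eventuallyEq {f g : Rn n → Rn m} {y : Rn n} (h : f =ᶠ[𝓝 y] g) :
    jetAt f y = jetAt g y :=
  Prod.ext rfl (funext fun aI => by
    change partialDeriv f y aI.1 aI.2 = partialDeriv g y aI.1 aI.2
    rw [partialDeriv, partialDeriv, (h.iteratedFDeriv ℝ _).eq_of_nhds])

theorem jet_eq_iff {φ φ' : Sec n m V} {x : M} :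
    jet n m φ x = jet n m φ' x ↔ jetSetoid n m V x φ φ' := by
  constructor
  · intro h
    have := (Sigma.mk.inj_iff.1 h).2
    exact Quotient.exact (eq_of_heq this)
  · exact fun h => congrArg (Sigma.mk x) (Quotient.sound h)

theorem localSec_eventuallyEq {φ φ' : Sec n m V} {x₀ : M} {y : Rn n}
    (hy : y ∈ coordTarget n m V x₀)
    (h : ∀ᶠ x in 𝓝 ((extChartAt (𝓡 n) x₀).symm y), φ x = φ' x) :
    localSec n m x₀ φ =ᶠ[𝓝 y] localSec n m x₀ φ' := by
  filter_upwards [(continuousAt_symm hy).eventually h] with z hz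
  simp only [localSec, hz]

theorem jet_eq_of_eventuallyEq {φ φ' : Sec n m V} {x : M} (h : ∀ᶠ x in 𝓝 x, φ x = φ' x) :
    jet n m φ x = jet n m φ' x := by
  refine jet_eq_iff.2 fun k => ?_
  have hx := mem_coordSource_self (n := n) (m := m) (V := V) x
  exact ((localSec_eventuallyEq (ext_mem hx) (by rwa [symm_ext hx])).iteratedFDeriv ℝ k).eq_of_nhds

theorem eventuallyEq_of_localSec {φ φ' : Sec n m V} {x₀ x : M} (hx : x ∈ coordSource n m V x₀)
    (h : localSec n m x₀ φ =ᶠ[𝓝 (extChartAt (𝓡 n) x₀ x)] localSec n m x₀ φ') :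
    ∀ᶠ x in 𝓝 x, φ x = φ' x := by
  filter_upwards [(contMDiffAt_ext hx).continuousAt.eventually h,
    (isOpen_coordSource m V x₀).mem_nhds hx] with z hz hzs
  have h1 : ∀ φ : Sec n m V, localSec n m x₀ φ (extChartAt (𝓡 n) x₀ z) =
      (trivializationAt (Rn m) V x₀ ⟨z, φ z⟩).2 := fun φ => by
    rw [localSec, symm_ext hzs]
  rw [h1, h1] at hz
  rw [← (trivializationAt (Rn m) V x₀).symm_apply_apply_mk hzs.2 (φ z), hz,
    (trivializationAt (Rn m) V x₀).symm_apply_apply_mk hzs.2 (φ' z)]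

/-- Hypotheses are stated for compactly supported sections only. Since every germ is the germ of one
of these, pointwise conclusions reach all jets. -/
theorem exists_compactSec_jet [T2Space M] (φ : Sec n m V) (x : M) :
    ∃ φ' : Sec n m V, CompactSec n m φ' ∧ ∀ᶠ x in 𝓝 x, φ' x = φ x := by
  have hx := mem_coordSource_self (n := n) (m := m) (V := V) x
  obtain ⟨φ', h, e⟩ := exists_compactSec_germ x (localSec_contDiffOn φ x) (ext_mem hx)
  exact ⟨φ', h, eventuallyEq_of_localSec hx e⟩

/-- The product of a section with a smooth function. -/
def mulSec (ρ : M → ℝ) (hρ : ContMDiff (𝓡 n) 𝓘(ℝ) ∞ ρ) (φ : Sec n m V) : Sec n m V :=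
  ⟨fun x => ρ x • φ x, hρ.smul_section φ.contMDiff⟩

/-! ### Local expressions and changes of coordinates -/

/-- `p` expresses `f` in the coordinates at `x₀` over the set `U`. -/
def RepOn {W : Type*} (x₀ : M) (U : Set (Rn n)) (f : M → Sec n m V → W)
    (p : JetCoord n m → W) : Prop :=
  ∀ y ∈ U, ∀ φ : Sec n m V,
    f ((extChartAt (𝓡 n) x₀).symm y) φ = p (jetAt (localSec n m x₀ φ) y)

theorem represents_iff {W : Type*} {x₀ : M} {f : M → Sec n m V → W} {p : JetCoord n m → W} :
    Represents n m x₀ f p ↔ RepOn x₀ (coordTarget n m V x₀) f p := by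
  constructor
  · intro h y hy φ
    rw [h _ (symm_mem hy) φ, jetCoordAt_eq, ext_symm hy]
  · intro h x hx φ
    have := h _ (ext_mem hx) φ
    rwa [symm_ext hx] at this

section Rep

variable {W : Type*} [NormedAddCommGroup W] [NormedSpace ℝ W] {r s : ℕ} {x₀ x₁ : M}
  {U U' : Set (Rn n)} {f : M → Sec n m V → W} {p p' : JetCoord n m → W}

theorem RepOn.mono (h : RepOn x₀ U f p) (hU : U' ⊆ U) : RepOn x₀ U' f p :=
  fun y hy => h y (hU hy)

/-- Every smooth function on the coordinate patch has, at each point, the germ of a global section.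
Two representatives thus agree on all jets of functions, which determines them. -/
theorem RepOn.unique [T2Space M] (h : RepOn x₀ U f p) (h' : RepOn x₀ U f p')
    (hp : SmoothOfOrder r U p) (hp' : SmoothOfOrder s U p') (hU : U ⊆ coordTarget n m V x₀)
    {y : Rn n} (hy : y ∈ U) (u : Fin m × (Fin n → ℕ) → ℝ) : p (y, u) = p' (y, u) := by
  refine hp.eq_of_jetAt hp' hy (fun g hg => ?_) u
  obtain ⟨φ, -, e⟩ := exists_compactSec_germ (V := V) x₀ hg.contDiffOn (hU hy)
  rw [← jetAt_congr_of_eventuallyEq e, ← h y hy, ← h' y hy]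

/-- Gluing along the diagonal: over the base point `y` the representative chosen for `y` is used.
Uniqueness shows that near `y` this is the single smooth expression of `y`. The common order `r` is
part of the hypothesis. -/
theorem exists_rep_of_locally [T2Space M]
    (h : ∀ y ∈ coordTarget n m V x₀, ∃ U, IsOpen U ∧ y ∈ U ∧ U ⊆ coordTarget n m V x₀ ∧
      ∃ p, SmoothOfOrder r U p ∧ RepOn x₀ U f p) :
    ∃ p, SmoothOfOrder r (coordTarget n m V x₀) p ∧ Represents n m x₀ f p := by
  classical
  choose! U hUo hyU hUs p hp hrep using h
  have key : ∀ y ∈ coordTarget n m V x₀, ∀ y' ∈ U y, ∀ u, p y' (y', u) = p y (y', u) := by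
    intro y hy y' hy' u
    have hy'' := hUs y hy hy'
    exact ((hrep y' hy'').mono (inter_subset_left (t := U y))).unique
      ((hrep y hy).mono inter_subset_right) ((hp y' hy'').mono_set inter_subset_left)
      ((hp y hy).mono_set inter_subset_right)
      (inter_subset_left.trans (hUs y' hy'')) ⟨hyU y' hy'', hy'⟩ u
  refine ⟨fun z => p z.1 z, SmoothOfOrder.of_locally fun y hy =>
    ⟨U y, hUo y hy, hyU y hy, (hp y hy).congr fun y' hy' u => key y hy y' hy' u⟩, ?_⟩
  rw [represents_iff]
  exact fun y hy φ => hrep y hy y (hyU y hy) φ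

/-- The transformation law of jet coordinates, by the chain rule: one more derivative in the chart
at `x₀` is a combination of total derivatives in the chart at `x₁`, with coefficients from the
Jacobian of the change of charts. Only the existence and the order of the expression matter later,
not its formula. -/
theorem exists_transition (x₁ x₀ : M) (a : Fin m) (l : List (Fin n)) :
    ∃ v : JetCoord n m → ℝ, SmoothOfOrder l.length (overlap n m V x₁ x₀) v ∧
      ∀ φ : Sec n m V, ∀ y ∈ overlap n m V x₁ x₀,
        pdl l (fun y => localSec n m x₀ φ y a) (transMap x₁ x₀ y) =
          v (jetAt (localSec n m x₁ φ) y) := by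
  have hO := isOpen_overlap n m V x₁ x₀
  have hO' := isOpen_overlap n m V x₀ x₁
  induction l with
  | nil =>
    have h0 : (0 : Fin n → ℕ) ∈ multiIdx n 0 := mem_multiIdx.2 (by simp)
    refine ⟨fun z => fibreTrans (V := V) x₁ x₀ z.1 (WithLp.toLp 2 fun b => z.2 (b, 0)) a, ?_, ?_⟩
    · have h1 : SmoothOfOrder 0 (overlap n m V x₁ x₀) fun z : JetCoord n m =>
          fun b : Fin m => z.2 (b, 0) := SmoothOfOrder.pi fun b => SmoothOfOrder.coord b h0
      have h2 := h1.compContDiff (PiLp.contDiff_toLp (𝕜 := ℝ) (p := 2) (E := fun _ : Fin m => ℝ))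
      have h3 := (SmoothOfOrder.of_base (m := m) (r := 0)
        (fibreTrans_contDiffOn (V := V) x₁ x₀)).prodMk h2
      exact h3.compContDiff ((contDiff_apply_euclidean a).comp
        (contDiff_fst.clm_apply contDiff_snd))
    · intro φ y hy
      rw [pdl_nil, localSec_transMap φ hy]
      refine congrArg (fun w : Rn m => fibreTrans (V := V) x₁ x₀ y w a) ?_
      ext b
      change _ = partialDeriv (localSec n m x₁ φ) y b 0
      rw [partialDeriv_eq_pdl (isOpen_coordTarget m V x₁) (localSec_contDiffOn φ x₁) _ _ hy.1]
      have : idxList (0 : Fin n → ℕ) = [] := by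
        rw [← List.length_eq_zero_iff, length_idxList]; simp
      rw [this]; rfl
  | cons i l ih =>
    obtain ⟨v, hv, e⟩ := ih
    -- The derivative of the `j`-th coordinate at `x₁` with respect to the `i`-th coordinate at
    -- `x₀`, as a function on the chart at `x₁`.
    let c : Fin n → Rn n → ℝ := fun j y => fderiv ℝ (transMap x₀ x₁) (transMap x₁ x₀ y) (stdVec i) j
    have hc : ∀ j, ContDiffOn ℝ ∞ (c j) (overlap n m V x₁ x₀) := fun j => by
      have h1 := (transMap_contDiffOn (n := n) (m := m) (V := V) x₀ x₁).fderiv_of_isOpen hO'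
        (m := ∞) (by simp)
      have h2 := h1.comp (transMap_contDiffOn x₁ x₀) fun y hy => transMap_mem hy
      exact (contDiff_apply_euclidean j).comp_contDiffOn (h2.clm_apply contDiffOn_const)
    refine ⟨fun z => ∑ j, c j z.1 • totalD j v z, SmoothOfOrder.sum _ fun j _ =>
      (SmoothOfOrder.of_base (hc j)).smul (hv.totalD hO j), fun φ y hy => ?_⟩
    have hf₁ : ContDiffOn ℝ ∞ (localSec n m x₁ φ) (overlap n m V x₁ x₀) :=
      (localSec_contDiffOn φ x₁).mono inter_subset_left
    have h1 : pdl l (fun y => localSec n m x₀ φ y a) =ᶠ[𝓝 (transMap x₁ x₀ y)]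
        (fun y => v (jetAt (localSec n m x₁ φ) y)) ∘ transMap x₀ x₁ := by
      filter_upwards [hO'.mem_nhds (transMap_mem hy)] with y' hy'
      have := e φ _ (transMap_mem hy')
      rw [transMap_transMap hy'] at this
      exact this
    have h2 : DifferentiableAt ℝ (fun y => v (jetAt (localSec n m x₁ φ) y))
        (transMap x₀ x₁ (transMap x₁ x₀ y)) := by
      rw [transMap_transMap hy]
      exact ((hv.comp_jetAt hO hf₁).contDiffAt (hO.mem_nhds hy)).differentiableAt (by simp)
    rw [pdl_cons, pd, h1.fderiv_eq,
      fderiv_comp _ h2 (transMap_differentiableAt (transMap_mem hy)), transMap_transMap hy,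
      ContinuousLinearMap.comp_apply]
    set w := fderiv ℝ (transMap x₀ x₁) (transMap x₁ x₀ y) (stdVec i) with hw
    have h3 : w = ∑ j, w j • stdVec j := by
      have := (EuclideanSpace.basisFun (Fin n) ℝ).sum_repr w
      simpa using this.symm
    rw [h3, map_sum]
    refine Finset.sum_congr rfl fun j _ => ?_
    rw [map_smul, ← pd_comp_jetAt hO hv hf₁ j hy]
    rfl

theorem exists_transition_partialDeriv (x₁ x₀ : M) (a : Fin m) (I : Fin n → ℕ) :
    ∃ v : JetCoord n m → ℝ, SmoothOfOrder (∑ i, I i) (overlap n m V x₁ x₀) v ∧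
      ∀ φ : Sec n m V, ∀ y ∈ overlap n m V x₁ x₀,
        partialDeriv (localSec n m x₀ φ) (transMap x₁ x₀ y) a I =
          v (jetAt (localSec n m x₁ φ) y) := by
  obtain ⟨v, hv, e⟩ := exists_transition (V := V) x₁ x₀ a (idxList I)
  rw [length_idxList] at hv
  refine ⟨v, hv, fun φ y hy => ?_⟩
  rw [partialDeriv_eq_pdl (isOpen_coordTarget m V x₀) (localSec_contDiffOn φ x₀) _ _
    (transMap_mem hy).1, e φ y hy]

theorem RepOn.transition (h : RepOn x₀ U f p) (hp : SmoothOfOrder r U p) (x₁ : M) :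
    ∃ p', SmoothOfOrder r (overlap n m V x₁ x₀ ∩ transMap x₁ x₀ ⁻¹' U) p' ∧
      RepOn x₁ (overlap n m V x₁ x₀ ∩ transMap x₁ x₀ ⁻¹' U) f p' := by
  choose v hv e using fun aI : Fin m × (Fin n → ℕ) =>
    exists_transition_partialDeriv (V := V) x₁ x₀ aI.1 aI.2
  refine ⟨fun z => p (transMap x₁ x₀ z.1, fun aI => v aI z), ?_, fun y hy φ => ?_⟩
  · refine hp.subst ((transMap_contDiffOn x₁ x₀).mono inter_subset_left) (fun y hy => hy.2)
      fun a I hI => ((hv (a, I)).mono_set inter_subset_left).mono_order (mem_multiIdx.1 hI)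
  · have := h _ hy.2 φ
    rw [symm_transMap hy.1] at this
    rw [this]
    congr 1
    exact Prod.ext rfl (funext fun aI => e aI φ y hy.1)

/-- Equality of jets is defined in the preferred chart at the point. Jet coordinates in another
chart are functions of those, by `exists_transition_partialDeriv`. -/
theorem jetAt_eq_of_jet_eq {φ φ' : Sec n m V} {x : M} (h : jet n m φ x = jet n m φ' x)
    (hx : x ∈ coordSource n m V x₀) :
    jetAt (localSec n m x₀ φ) (extChartAt (𝓡 n) x₀ x) =
      jetAt (localSec n m x₀ φ') (extChartAt (𝓡 n) x₀ x) := by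
  have hj := jet_eq_iff.1 h
  have hxx := mem_coordSource_self (n := n) (m := m) (V := V) x
  have h0 : jetAt (localSec n m x φ) (extChartAt (𝓡 n) x x) =
      jetAt (localSec n m x φ') (extChartAt (𝓡 n) x x) :=
    Prod.ext rfl (funext fun aI => by
      change partialDeriv _ _ _ _ = partialDeriv _ _ _ _
      rw [partialDeriv, partialDeriv, hj])
  refine Prod.ext rfl (funext fun aI => ?_)
  obtain ⟨v, -, e⟩ := exists_transition_partialDeriv (V := V) x x₀ aI.1 aI.2
  have h1 := fun φ => e φ _ (ext_mem_overlap hxx hx)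
  simp only [transMap_ext hxx] at h1
  change partialDeriv _ _ _ _ = partialDeriv _ _ _ _
  rw [h1, h1, h0]

end Rep

end Transition

section Forms

variable {n m : ℕ} {M : Type*} [TopologicalSpace M] [ChartedSpace (Rn n) M]
  [IsManifold (𝓡 n) ∞ M]
  {V : M → Type*} [∀ x, AddCommGroup (V x)] [∀ x, Module ℝ (V x)] [∀ x, TopologicalSpace (V x)]
  [TopologicalSpace (TotalSpace (Rn m) V)] [FiberBundle (Rn m) V] [VectorBundle ℝ (Rn m) V]
  [ContMDiffVectorBundle ∞ (Rn m) V (𝓡 n)]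

/-! ### Covectors in charts -/

section Covectors

variable {k : ℕ} {x₀ x₁ x : M}

theorem mfderiv_ext_comp_symm (hx : x ∈ (extChartAt (𝓡 n) x₀).source) :
    (mfderiv (𝓡 n) 𝓘(ℝ, Rn n) (extChartAt (𝓡 n) x₀) x : Rn n →L[ℝ] Rn n).comp
      (mfderiv 𝓘(ℝ, Rn n) (𝓡 n) (extChartAt (𝓡 n) x₀).symm (extChartAt (𝓡 n) x₀ x) :
        Rn n →L[ℝ] Rn n) = ContinuousLinearMap.id ℝ (Rn n) := by
  have := mfderiv_extChartAt_comp_mfderivWithin_extChartAt_symm' (I := 𝓡 n) hx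
  rwa [ModelWithCorners.range_eq_univ, mfderivWithin_univ] at this

theorem mfderiv_symm_comp_ext (hx : x ∈ (extChartAt (𝓡 n) x₀).source) :
    (mfderiv 𝓘(ℝ, Rn n) (𝓡 n) (extChartAt (𝓡 n) x₀).symm (extChartAt (𝓡 n) x₀ x) :
        Rn n →L[ℝ] Rn n).comp
      (mfderiv (𝓡 n) 𝓘(ℝ, Rn n) (extChartAt (𝓡 n) x₀) x : Rn n →L[ℝ] Rn n) =
        ContinuousLinearMap.id ℝ (Rn n) := by
  have := mfderivWithin_extChartAt_symm_comp_mfderiv_extChartAt' (I := 𝓡 n) hx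
  rwa [ModelWithCorners.range_eq_univ, mfderivWithin_univ] at this

/-- A form on `ℝⁿ`, in the chart at `x₀`, as a covector at `x`. -/
def fromChart (x₀ x : M) (β : Rn n [⋀^Fin k]→L[ℝ] ℝ) :
    TangentSpace (𝓡 n) x [⋀^Fin k]→L[ℝ] ℝ :=
  β.compContinuousLinearMap
    (mfderiv (𝓡 n) 𝓘(ℝ, Rn n) (extChartAt (𝓡 n) x₀) x : TangentSpace (𝓡 n) x →L[ℝ] Rn n)

theorem toChart_fromChart (hx : x ∈ (extChartAt (𝓡 n) x₀).source) (β : Rn n [⋀^Fin k]→L[ℝ] ℝ) :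
    toChart n x₀ x (fromChart x₀ x β) = β := by
  ext v
  have h := fun w => congrArg (fun A : Rn n →L[ℝ] Rn n => A w) (mfderiv_ext_comp_symm hx)
  exact congrArg β (funext fun i => h (v i))

theorem fromChart_toChart (hx : x ∈ (extChartAt (𝓡 n) x₀).source)
    (β : TangentSpace (𝓡 n) x [⋀^Fin k]→L[ℝ] ℝ) :
    fromChart x₀ x (toChart n x₀ x β) = β := by
  ext v
  have h := fun w => congrArg (fun A : Rn n →L[ℝ] Rn n => A w) (mfderiv_symm_comp_ext hx)
  exact congrArg β (funext fun i => h (v i))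

theorem toChart_injective (hx : x ∈ (extChartAt (𝓡 n) x₀).source)
    {β β' : TangentSpace (𝓡 n) x [⋀^Fin k]→L[ℝ] ℝ} (h : toChart n x₀ x β = toChart n x₀ x β') :
    β = β' := by
  rw [← fromChart_toChart hx β, h, fromChart_toChart hx]

@[simp] theorem toChart_zero (x₀ x : M) :
    toChart n x₀ x (0 : TangentSpace (𝓡 n) x [⋀^Fin k]→L[ℝ] ℝ) = 0 := rfl

theorem toChart_trans (h₁ : x ∈ coordSource n m V x₁) (h₀ : x ∈ coordSource n m V x₀)
    (β : TangentSpace (𝓡 n) x [⋀^Fin k]→L[ℝ] ℝ) :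
    toChart n x₁ x β = (toChart n x₀ x β).compContinuousLinearMap
      (fderiv ℝ (transMap x₁ x₀) (extChartAt (𝓡 n) x₁ x)) := by
  have hy := ext_mem_overlap h₁ h₀
  have e : (extChartAt (𝓡 n) x₁).symm =ᶠ[𝓝 (extChartAt (𝓡 n) x₁ x)]
      (extChartAt (𝓡 n) x₀).symm ∘ transMap x₁ x₀ := by
    filter_upwards [(isOpen_overlap n m V x₁ x₀).mem_nhds hy] with y hy
    exact (symm_transMap hy).symm
  have hT : MDifferentiableAt 𝓘(ℝ, Rn n) 𝓘(ℝ, Rn n) (transMap x₁ x₀)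
      (extChartAt (𝓡 n) x₁ x) := (transMap_differentiableAt hy).mdifferentiableAt
  have hS : MDifferentiableAt 𝓘(ℝ, Rn n) (𝓡 n) (extChartAt (𝓡 n) x₀).symm
      (transMap x₁ x₀ (extChartAt (𝓡 n) x₁ x)) := by
    rw [transMap_ext h₁]
    exact (contMDiffAt_symm (ext_mem h₀)).mdifferentiableAt (by simp)
  have key : (mfderiv 𝓘(ℝ, Rn n) (𝓡 n) (extChartAt (𝓡 n) x₁).symm (extChartAt (𝓡 n) x₁ x) :
      Rn n →L[ℝ] Rn n) =
      (mfderiv 𝓘(ℝ, Rn n) (𝓡 n) (extChartAt (𝓡 n) x₀).symm (extChartAt (𝓡 n) x₀ x) :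
        Rn n →L[ℝ] Rn n).comp (fderiv ℝ (transMap x₁ x₀) (extChartAt (𝓡 n) x₁ x)) := by
    have h := e.mfderiv_eq (I := 𝓘(ℝ, Rn n)) (I' := 𝓡 n)
    have h' := mfderiv_comp (extChartAt (𝓡 n) x₁ x) hS hT
    rw [mfderiv_eq_fderiv, transMap_ext h₁] at h'
    exact h.trans h'
  ext v
  have h := fun w => congrArg (fun A : Rn n →L[ℝ] Rn n => A w) key
  exact congrArg β (funext fun i => h (v i))

end Covectors

/-! ### Smooth horizontal forms -/

section SmoothForms

variable {k r : ℕ} {x₀ x₁ x : M} {α β : HForm n m V k} {U : Set (Rn n)}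
  {p p' : JetCoord n m → Rn n [⋀^Fin k]→L[ℝ] ℝ}

/-- A horizontal form along a section, in the chart at `x₀`. -/
def formIn (x₀ : M) (α : HForm n m V k) (x : M) (φ : Sec n m V) : Rn n [⋀^Fin k]→L[ℝ] ℝ :=
  toChart n x₀ x (pullSec n m φ α x)

theorem isSmoothForm_iff : IsSmoothForm n m α ↔ ∃ r, ∀ x₀, ∃ p,
    SmoothOfOrder r (coordTarget n m V x₀) p ∧ RepOn x₀ (coordTarget n m V x₀) (formIn x₀ α) p := by
  simp only [IsSmoothForm, IsLocal, represents_iff]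
  rfl

theorem RepOn.formIn_transition (h : RepOn x₀ U (formIn x₀ α) p) (hp : SmoothOfOrder r U p)
    (x₁ : M) : ∃ p', SmoothOfOrder r (overlap n m V x₁ x₀ ∩ transMap x₁ x₀ ⁻¹' U) p' ∧
      RepOn x₁ (overlap n m V x₁ x₀ ∩ transMap x₁ x₀ ⁻¹' U) (formIn x₁ α) p' := by
  obtain ⟨q, hq, hrep⟩ := h.transition hp x₁
  have hT : ContDiffOn ℝ ∞ (fderiv ℝ (transMap x₁ x₀))
      (overlap n m V x₁ x₀ ∩ transMap x₁ x₀ ⁻¹' U) :=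
    ((transMap_contDiffOn x₁ x₀).fderiv_of_isOpen (isOpen_overlap n m V x₁ x₀) (by simp)).mono
      inter_subset_left
  refine ⟨fun z => (q z).compContinuousLinearMap (fderiv ℝ (transMap x₁ x₀) z.1),
    (hq.prodMk (SmoothOfOrder.of_base hT)).compContDiff contDiff_compContinuousLinearMap,
    fun y hy φ => ?_⟩
  rw [formIn, toChart_trans (symm_mem hy.1.1) hy.1.2, ext_symm hy.1.1]
  exact congrArg (fun β : Rn n [⋀^Fin k]→L[ℝ] ℝ =>
    β.compContinuousLinearMap (fderiv ℝ (transMap x₁ x₀) y)) (hrep y hy φ)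

theorem isOpen_overlap_preimage (hU : IsOpen U) (x₁ x₀ : M) :
    IsOpen (overlap n m V x₁ x₀ ∩ transMap x₁ x₀ ⁻¹' U) :=
  (transMap_contDiffOn x₁ x₀).continuousOn.isOpen_inter_preimage (isOpen_overlap n m V x₁ x₀) hU

/-- Smooth horizontal forms on `J^rE`. -/
def IsSmoothFormOfOrder (r : ℕ) (α : HForm n m V k) : Prop :=
  ∀ x₀ : M, ∃ p, SmoothOfOrder r (coordTarget n m V x₀) p ∧
    RepOn x₀ (coordTarget n m V x₀) (formIn x₀ α) p

theorem IsSmoothFormOfOrder.isSmoothForm {r : ℕ} (h : IsSmoothFormOfOrder r α) :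
    IsSmoothForm n m α := isSmoothForm_iff.2 ⟨r, h⟩

/-- Smoothness of a horizontal form is a local property, for forms of a fixed order. -/
theorem isSmoothFormOfOrder_of_locally [T2Space M] (r : ℕ)
    (h : ∀ x : M, ∃ x₀, x ∈ coordSource n m V x₀ ∧ ∃ U, IsOpen U ∧ extChartAt (𝓡 n) x₀ x ∈ U ∧
      ∃ p, SmoothOfOrder r U p ∧ RepOn x₀ U (formIn x₀ α) p) : IsSmoothFormOfOrder r α := by
  intro x₁
  simp only [← represents_iff]
  refine exists_rep_of_locally fun y hy => ?_
  obtain ⟨x₀, hx, U, hU, hyU, p, hp, hrep⟩ := h ((extChartAt (𝓡 n) x₁).symm y)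
  obtain ⟨p', hp', hrep'⟩ := hrep.formIn_transition hp x₁
  exact ⟨_, isOpen_overlap_preimage hU x₁ x₀, ⟨⟨hy, hx⟩, hyU⟩, fun y hy => hy.1.1,
    p', hp', hrep'⟩

theorem IsSmoothForm.coordRep (h : IsSmoothForm n m α) (x₀ : M) :
    (∃ r, SmoothOfOrder r (coordTarget n m V x₀) (coordRep n m x₀ α)) ∧
      RepOn x₀ (coordTarget n m V x₀) (formIn x₀ α) (coordRep n m x₀ α) := by
  obtain ⟨r, hr⟩ := h
  obtain ⟨p, hp, hrep⟩ := hr x₀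
  have hex : ∃ p : JetCoord n m → Rn n [⋀^Fin k]→L[ℝ] ℝ,
      (∃ r, SmoothOfOrder r (coordTarget n m V x₀) p) ∧
        Represents n m x₀ (fun x φ => toChart n x₀ x (pullSec n m φ α x)) p := ⟨p, ⟨r, hp⟩, hrep⟩
  rw [JetReduction.coordRep, dif_pos hex]
  exact ⟨hex.choose_spec.1, represents_iff.1 hex.choose_spec.2⟩

/-- `coordRep` is an arbitrary choice of a representative. By uniqueness, any explicit expression
may be computed with in its place. -/
theorem RepOn.coordRep_eq [T2Space M] (hα : IsSmoothForm n m α) (hp : SmoothOfOrder r U p)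
    (h : RepOn x₀ U (formIn x₀ α) p) (hU : U ⊆ coordTarget n m V x₀)
    (z : JetCoord n m) (hz : z.1 ∈ U) : coordRep n m x₀ α z = p z := by
  obtain ⟨⟨s, hs⟩, hrep⟩ := hα.coordRep x₀
  exact (hrep.mono hU).unique h (hs.mono_set hU) hp hU hz z.2

theorem IsSmoothForm.zero : IsSmoothForm n m (0 : HForm n m V k) :=
  ⟨0, fun _ => ⟨fun _ => 0, SmoothOfOrder.const 0, fun _ _ _ => rfl⟩⟩

theorem IsSmoothForm.add (hα : IsSmoothForm n m α) (hβ : IsSmoothForm n m β) :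
    IsSmoothForm n m (α + β) := by
  obtain ⟨r, hr⟩ := isSmoothForm_iff.1 hα
  obtain ⟨s, hs⟩ := isSmoothForm_iff.1 hβ
  refine isSmoothForm_iff.2 ⟨max r s, fun x₀ => ?_⟩
  obtain ⟨p, hp, h⟩ := hr x₀
  obtain ⟨q, hq, h'⟩ := hs x₀
  refine ⟨fun z => p z + q z, (hp.mono_order (le_max_left r s)).add
    (hq.mono_order (le_max_right r s)), fun y hy φ => ?_⟩
  exact congrArg₂ (· + ·) (h y hy φ) (h' y hy φ)

theorem IsSmoothForm.smul (hα : IsSmoothForm n m α) (c : ℝ) : IsSmoothForm n m (c • α) := by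
  obtain ⟨r, hr⟩ := isSmoothForm_iff.1 hα
  refine isSmoothForm_iff.2 ⟨r, fun x₀ => ?_⟩
  obtain ⟨p, hp, h⟩ := hr x₀
  refine ⟨fun z => c • p z, hp.const_smul c, fun y hy φ => ?_⟩
  exact congrArg (c • ·) (h y hy φ)

theorem coordRep_add [T2Space M] (hα : IsSmoothForm n m α) (hβ : IsSmoothForm n m β) (x₀ : M)
    (z : JetCoord n m) (hz : z.1 ∈ coordTarget n m V x₀) :
    coordRep n m x₀ (α + β) z = coordRep n m x₀ α z + coordRep n m x₀ β z := by
  obtain ⟨⟨r, hr⟩, h⟩ := hα.coordRep x₀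
  obtain ⟨⟨s, hs⟩, h'⟩ := hβ.coordRep x₀
  refine RepOn.coordRep_eq (hα.add hβ) (p := fun z => coordRep n m x₀ α z + coordRep n m x₀ β z)
    ((hr.mono_order (le_max_left r s)).add (hs.mono_order (le_max_right r s)))
    (fun y hy φ => ?_) subset_rfl z hz
  exact congrArg₂ (· + ·) (h y hy φ) (h' y hy φ)

theorem coordRep_smul [T2Space M] (hα : IsSmoothForm n m α) (c : ℝ) (x₀ : M)
    (z : JetCoord n m) (hz : z.1 ∈ coordTarget n m V x₀) :
    coordRep n m x₀ (c • α) z = c • coordRep n m x₀ α z := by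
  obtain ⟨⟨r, hr⟩, h⟩ := hα.coordRep x₀
  refine RepOn.coordRep_eq (hα.smul c) (p := fun z => c • coordRep n m x₀ α z)
    (hr.const_smul c) (fun y hy φ => ?_) subset_rfl z hz
  exact congrArg (c • ·) (h y hy φ)

theorem exists_jet_eq (θ : Jet n m V) : ∃ φ : Sec n m V, jet n m φ θ.1 = θ := by
  obtain ⟨x, q⟩ := θ
  obtain ⟨φ, rfl⟩ := Quotient.exists_rep q
  exact ⟨φ, rfl⟩

theorem hform_ext {α β : HForm n m V k}
    (h : ∀ (φ : Sec n m V) (x : M), α (jet n m φ x) = β (jet n m φ x)) : α = β := by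
  funext θ
  obtain ⟨φ, e⟩ := exists_jet_eq θ
  have := h φ θ.1
  rwa [e] at this

end SmoothForms

end Forms

/-! ### The horizontal differential as exterior derivative along sections -/

section HorizontalDifferential

variable {n m : ℕ} {M : Type*} [TopologicalSpace M] [ChartedSpace (Rn n) M]
  [IsManifold (𝓡 n) ∞ M]
  {V : M → Type*} [∀ x, AddCommGroup (V x)] [∀ x, Module ℝ (V x)] [∀ x, TopologicalSpace (V x)]
  [TopologicalSpace (TotalSpace (Rn m) V)] [FiberBundle (Rn m) V] [VectorBundle ℝ (Rn m) V]
  [ContMDiffVectorBundle ∞ (Rn m) V (𝓡 n)]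

section Coordinates

variable {k r : ℕ} {U : Set (Rn n)} {p p' : JetCoord n m → Rn n [⋀^Fin k]→L[ℝ] ℝ}

theorem clm_eq_sum_proj {W : Type*} [NormedAddCommGroup W] [NormedSpace ℝ W]
    (A : Rn n →L[ℝ] W) :
    A = ∑ i, (EuclideanSpace.proj i : Rn n →L[ℝ] ℝ).smulRight (A (stdVec i)) := by
  ext v
  have hv : v = ∑ j, v j • stdVec j := by
    have := (EuclideanSpace.basisFun (Fin n) ℝ).sum_repr v
    simpa using this.symm
  conv_lhs => rw [hv]
  simp

theorem dHCoord_jetAt (hU : IsOpen U) (hp : SmoothOfOrder r U p) {f : Rn n → Rn m}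
    (hf : ContDiffOn ℝ ∞ f U) {y : Rn n} (hy : y ∈ U) :
    dHCoord p (jetAt f y) = extDeriv (fun y => p (jetAt f y)) y := by
  rw [dHCoord, extDeriv, clm_eq_sum_proj (fderiv ℝ (fun y => p (jetAt f y)) y)]
  simp only [← pd_comp_jetAt hU hp hf _ hy]
  rfl

theorem SmoothOfOrder.dHCoord (hU : IsOpen U) (hp : SmoothOfOrder r U p) :
    SmoothOfOrder (r + 1) U (dHCoord p) := by
  have hA : ContDiff ℝ ∞ fun T : Fin n → Rn n [⋀^Fin k]→L[ℝ] ℝ =>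
      ContinuousAlternatingMap.alternatizeUncurryFin
        (∑ i, (EuclideanSpace.proj i : Rn n →L[ℝ] ℝ).smulRight (T i)) := by
    refine contDiffOn_univ.1 (contDiffOn_alternating fun v => contDiffOn_univ.2 ?_)
    simp only [ContinuousAlternatingMap.alternatizeUncurryFin_apply]
    refine ContDiff.sum fun i _ => ContDiff.const_smul _ ?_
    have : (fun T : Fin n → Rn n [⋀^Fin k]→L[ℝ] ℝ =>
        (∑ j, (EuclideanSpace.proj j : Rn n →L[ℝ] ℝ).smulRight (T j)) (v i) (i.removeNth v)) =
        fun T => ∑ j, v i j * T j (i.removeNth v) := by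
      funext T
      simp
    rw [this]
    exact ContDiff.sum fun j _ => contDiff_const.mul
      ((contDiff_alternating_apply _).comp (contDiff_apply ℝ _ j))
  have h := SmoothOfOrder.pi (p := fun z i => JetReduction.totalD i p z) fun i => hp.totalD hU i
  exact h.compContDiff hA

end Coordinates

variable {k r : ℕ} {x₀ x₁ x : M} {α β : HForm n m V k} {U : Set (Rn n)}
  {p : JetCoord n m → Rn n [⋀^Fin k]→L[ℝ] ℝ}

theorem formIn_symm_contDiffOn (hα : IsSmoothForm n m α) (x₀ : M) (φ : Sec n m V) :
    ContDiffOn ℝ ∞ (fun y => formIn x₀ α ((extChartAt (𝓡 n) x₀).symm y) φ)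
      (coordTarget n m V x₀) := by
  obtain ⟨⟨r, hp⟩, h⟩ := hα.coordRep x₀
  exact (hp.comp_jetAt (isOpen_coordTarget m V x₀) (localSec_contDiffOn φ x₀)).congr
    fun y hy => h y hy φ

/-- The horizontal differential along a section is the exterior derivative of the pullback. -/
theorem formIn_dH (hα : IsSmoothForm n m α) (hx : x ∈ coordSource n m V x₀) (φ : Sec n m V) :
    formIn x₀ (dH n m α) x φ =
      extDeriv (fun y => formIn x₀ α ((extChartAt (𝓡 n) x₀).symm y) φ)
        (extChartAt (𝓡 n) x₀ x) := by
  have hxx := mem_coordSource_self (n := n) (m := m) (V := V) x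
  obtain ⟨⟨r, hp⟩, h⟩ := hα.coordRep x
  have hU := isOpen_coordTarget (n := n) m V x
  have h1 : formIn x (dH n m α) x φ =
      extDeriv (fun y => formIn x α ((extChartAt (𝓡 n) x).symm y) φ) (extChartAt (𝓡 n) x x) := by
    refine (toChart_fromChart (mem_extChartAt_source hxx) _).trans ?_
    refine (dHCoord_jetAt hU hp (localSec_contDiffOn φ x) (ext_mem hxx)).trans ?_
    refine Filter.EventuallyEq.extDeriv_eq ?_
    filter_upwards [hU.mem_nhds (ext_mem hxx)] with y hy
    exact (h y hy φ).symm
  -- `dH` is defined with the chart at `x` itself. Naturality of the exterior derivative under the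
  -- change of charts carries the formula to the chart at `x₀`.
  have hy := ext_mem_overlap hx hxx
  have h2 : (fun y => formIn x₀ α ((extChartAt (𝓡 n) x₀).symm y) φ)
      =ᶠ[𝓝 (extChartAt (𝓡 n) x₀ x)] fun y =>
        (formIn x α ((extChartAt (𝓡 n) x).symm (transMap x₀ x y)) φ).compContinuousLinearMap
          (fderiv ℝ (transMap x₀ x) y) := by
    filter_upwards [(isOpen_overlap n m V x₀ x).mem_nhds hy] with y hy
    rw [symm_transMap hy, formIn, toChart_trans (symm_mem hy.1) hy.2, ext_symm hy.1]
    rfl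
  rw [h2.extDeriv_eq]
  have h3 : DifferentiableAt ℝ (fun y => formIn x α ((extChartAt (𝓡 n) x).symm y) φ)
      (transMap x₀ x (extChartAt (𝓡 n) x₀ x)) := by
    rw [transMap_ext hx]
    exact ((formIn_symm_contDiffOn hα x φ).contDiffAt (hU.mem_nhds (ext_mem hxx))).differentiableAt
      (by simp)
  refine Eq.trans ?_ (extDeriv_pullback h3
    ((transMap_contDiffOn x₀ x).contDiffAt ((isOpen_overlap n m V x₀ x).mem_nhds hy))
    (by simp only [minSmoothness_of_isRCLikeNormedField]; exact ENat.LEInfty.out)).symm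
  rw [transMap_ext hx, ← h1]
  exact toChart_trans hx hxx _

theorem dH_ext (hα : IsSmoothForm n m α) {η : HForm n m V (k + 1)}
    (h : ∀ (x : M) (φ : Sec n m V), formIn x η x φ =
      extDeriv (fun y => formIn x α ((extChartAt (𝓡 n) x).symm y) φ) (extChartAt (𝓡 n) x x)) :
    dH n m α = η := hform_ext fun φ x => by
  have hxx := mem_coordSource_self (n := n) (m := m) (V := V) x
  exact toChart_injective (mem_extChartAt_source hxx) ((formIn_dH hα hxx φ).trans (h x φ).symm)

/-- The coefficients of `d_H α`, from those of `α`. -/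
theorem RepOn.dH (hα : IsSmoothForm n m α) (hU : IsOpen U) (hUs : U ⊆ coordTarget n m V x₀)
    (hp : SmoothOfOrder r U p) (h : RepOn x₀ U (formIn x₀ α) p) :
    RepOn x₀ U (formIn x₀ (dH n m α)) (dHCoord p) := fun y hy φ => by
  rw [formIn_dH hα (symm_mem (hUs hy)), ext_symm (hUs hy),
    dHCoord_jetAt hU hp ((localSec_contDiffOn φ x₀).mono hUs) hy]
  refine Filter.EventuallyEq.extDeriv_eq ?_
  filter_upwards [hU.mem_nhds hy] with y hy
  exact h y hy φ

theorem IsSmoothForm.dH (hα : IsSmoothForm n m α) : IsSmoothForm n m (dH n m α) := by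
  obtain ⟨r, hr⟩ := isSmoothForm_iff.1 hα
  refine isSmoothForm_iff.2 ⟨r + 1, fun x₀ => ?_⟩
  obtain ⟨p, hp, h⟩ := hr x₀
  have hU := isOpen_coordTarget (n := n) m V x₀
  exact ⟨_, hp.dHCoord hU, h.dH hα hU subset_rfl hp⟩

theorem dH_add (hα : IsSmoothForm n m α) (hβ : IsSmoothForm n m β) :
    dH n m (α + β) = dH n m α + dH n m β := by
  refine dH_ext (hα.add hβ) fun x φ => ?_
  have hxx := mem_coordSource_self (n := n) (m := m) (V := V) x
  have hd : ∀ {α : HForm n m V k}, IsSmoothForm n m α → DifferentiableAt ℝ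
      (fun y => formIn x α ((extChartAt (𝓡 n) x).symm y) φ) (extChartAt (𝓡 n) x x) := fun hα =>
    ((formIn_symm_contDiffOn hα x φ).contDiffAt
      ((isOpen_coordTarget m V x).mem_nhds (ext_mem hxx))).differentiableAt (by simp)
  refine Eq.trans ?_ (extDeriv_fun_add (hd hα) (hd hβ)).symm
  rw [← formIn_dH hα hxx, ← formIn_dH hβ hxx]; rfl

theorem dH_smul (hα : IsSmoothForm n m α) (c : ℝ) : dH n m (c • α) = c • dH n m α := by
  refine dH_ext (hα.smul c) fun x φ => Eq.symm ?_
  have hxx := mem_coordSource_self (n := n) (m := m) (V := V) x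
  refine (extDeriv_fun_smul c fun y => formIn x α ((extChartAt (𝓡 n) x).symm y) φ).trans ?_
  rw [← formIn_dH hα hxx]; rfl

theorem dH_zero : dH n m (0 : HForm n m V k) = 0 := by
  have := dH_smul (IsSmoothForm.zero (n := n) (m := m) (V := V) (k := k)) 0
  simpa using this

/-- `d_H α` vanishes along `φ` at `x` if `α` vanishes along `φ` near `x`. -/
theorem dH_eq_zero (hα : IsSmoothForm n m α) {φ : Sec n m V} {x : M}
    (h : ∀ᶠ x in 𝓝 x, α (jet n m φ x) = 0) : dH n m α (jet n m φ x) = 0 := by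
  have hxx := mem_coordSource_self (n := n) (m := m) (V := V) x
  refine toChart_injective (x₀ := x) (mem_extChartAt_source hxx) ((formIn_dH hα hxx φ).trans ?_)
  have h0 : (fun y => formIn x α ((extChartAt (𝓡 n) x).symm y) φ)
      =ᶠ[𝓝 (extChartAt (𝓡 n) x x)] fun _ => 0 := by
    have hc := continuousAt_symm (ext_mem hxx)
    rw [ContinuousAt, symm_ext hxx] at hc
    filter_upwards [hc.eventually h] with y hy
    exact congrArg (toChart n x _) hy
  rw [h0.extDeriv_eq]
  refine Eq.trans ?_ (toChart_zero x x).symm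
  rw [extDeriv, fderiv_const_apply]
  exact map_zero (ContinuousAlternatingMap.alternatizeUncurryFinCLM ℝ (Rn n) ℝ)

section Action

variable {G : Type*} [Group G] (ψ : BundleAction n m V G)

/-- Along a section, `d_H` depends only on the pullback of the form, and an invariant form has the
same pullback along `φ` and along `ψ_g ∘ φ`. No formula for the prolonged action is needed. -/
theorem BundleAction.IsInvariant.dH {α : HForm n m V k} (hα : IsSmoothForm n m α)
    (h : ψ.IsInvariant α) : ψ.IsInvariant (dH n m α) := fun g => hform_ext fun φ x => by
  have hxx := mem_coordSource_self (n := n) (m := m) (V := V) x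
  refine toChart_injective (x₀ := x) (mem_extChartAt_source hxx) ?_
  refine (formIn_dH hα hxx (ψ.onSec g φ)).trans (Eq.trans ?_ (formIn_dH hα hxx φ).symm)
  congr 1
  funext y
  exact congrArg (toChart n x _) (congrFun (h g) (jet n m φ _))

end Action

end HorizontalDifferential

section Integration
open MeasureTheory
variable {n : ℕ} {M : Type*} [TopologicalSpace M] [ChartedSpace (Rn n) M]
  [IsManifold (𝓡 n) ∞ M]

/-! ### Integration of `n`-forms on `M` -/

/-- The results on overlaps are stated for a vector bundle. The trivial bundle of rank zero
specializes them to the charts of `M` alone. -/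
theorem coordSource_trivial (x : M) :
    coordSource n 0 (Bundle.Trivial M (Rn 0)) x = (extChartAt (𝓡 n) x).source := by
  simp [coordSource]

theorem coordTarget_trivial (x : M) :
    coordTarget n 0 (Bundle.Trivial M (Rn 0)) x = (extChartAt (𝓡 n) x).target := by
  simp [coordTarget]

/-- The coefficient of an `n`-form in the chart at `x₀`. -/
def coef (x₀ : M) (β : ∀ x : M, TangentSpace (𝓡 n) x [⋀^Fin n]→L[ℝ] ℝ) (y : Rn n) : ℝ :=
  toChart n x₀ ((extChartAt (𝓡 n) x₀).symm y) (β ((extChartAt (𝓡 n) x₀).symm y)) stdFrame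

/-- Continuity of an `n`-form. -/
def IsContForm (β : ∀ x : M, TangentSpace (𝓡 n) x [⋀^Fin n]→L[ℝ] ℝ) : Prop :=
  ∀ x₀ : M, ContinuousOn (coef x₀ β) (extChartAt (𝓡 n) x₀).target

variable {x₀ x₁ : M} {β β' ν : ∀ x : M, TangentSpace (𝓡 n) x [⋀^Fin n]→L[ℝ] ℝ}

theorem coef_transMap {m : ℕ} {V : M → Type*} [∀ x, AddCommGroup (V x)] [∀ x, Module ℝ (V x)]
    [∀ x, TopologicalSpace (V x)] [TopologicalSpace (TotalSpace (Rn m) V)] [FiberBundle (Rn m) V]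
    [VectorBundle ℝ (Rn m) V] [ContMDiffVectorBundle ∞ (Rn m) V (𝓡 n)] {y : Rn n}
    (hy : y ∈ overlap n m V x₁ x₀)
    (β : ∀ x : M, TangentSpace (𝓡 n) x [⋀^Fin n]→L[ℝ] ℝ) :
    coef x₁ β y = (fderiv ℝ (transMap x₁ x₀) y).det * coef x₀ β (transMap x₁ x₀ y) := by
  rw [coef, toChart_trans (symm_mem hy.1) hy.2, topForm_comp_apply, ext_symm hy.1, coef,
    symm_transMap hy]

/-- Each point is the centre of its own preferred chart, and passing to another chart multiplies the
coefficient by a continuous Jacobian determinant. -/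
theorem isContForm_of_continuousAt (h : ∀ x : M, ContinuousAt (coef x β) (extChartAt (𝓡 n) x x)) :
    IsContForm β := by
  intro x₁ y hy
  refine ContinuousAt.continuousWithinAt ?_
  rw [← coordTarget_trivial] at hy
  set x := (extChartAt (𝓡 n) x₁).symm y with hx
  have hxx := mem_coordSource_self (n := n) (m := 0) (V := Bundle.Trivial M (Rn 0)) x
  have hy' : y ∈ overlap n 0 (Bundle.Trivial M (Rn 0)) x₁ x := ⟨hy, hxx⟩
  have hO := (isOpen_overlap n 0 (Bundle.Trivial M (Rn 0)) x₁ x).mem_nhds hy'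
  have hT := ((transMap_contDiffOn x₁ x).contDiffAt hO)
  have e : coef x₁ β =ᶠ[𝓝 y] fun y =>
      (fderiv ℝ (transMap x₁ x) y).det * coef x β (transMap x₁ x y) := by
    filter_upwards [hO] with y hy using coef_transMap hy β
  refine ContinuousAt.congr ?_ e.symm
  have h1 : ContinuousAt (fun y => (fderiv ℝ (transMap x₁ x) y).det) y :=
    ContinuousLinearMap.continuous_det.continuousAt.comp
      (hT.fderiv_right (m := 0) (by simp)).continuousAt
  have h2 : ContinuousAt (coef x β) (transMap x₁ x y) := h x
  exact h1.mul (h2.comp hT.continuousAt)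

theorem coef_add (x₀ : M) (y : Rn n) : coef x₀ (β + β') y = coef x₀ β y + coef x₀ β' y := rfl

theorem coef_eq_zero {y : Rn n} (h : β ((extChartAt (𝓡 n) x₀).symm y) = 0) : coef x₀ β y = 0 := by
  rw [coef, h]; rfl

theorem IsContForm.add (h : IsContForm β) (h' : IsContForm β') : IsContForm (β + β') :=
  fun x₀ => (h x₀).add (h' x₀)

theorem IsContForm.smul (h : IsContForm β) (c : ℝ) : IsContForm (c • β) :=
  fun x₀ => (h x₀).const_smul c

/-- The sign of the coefficient of `ν` in the chart at `x₀`. -/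
def orient (ν : ∀ x : M, TangentSpace (𝓡 n) x [⋀^Fin n]→L[ℝ] ℝ) (x₀ : M) (y : Rn n) : SignType :=
  SignType.sign (coef x₀ ν y)

theorem coef_ne_zero (hν : IsVolumeForm n ν) {y : Rn n} (hy : y ∈ (extChartAt (𝓡 n) x₀).target) :
    coef x₀ ν y ≠ 0 := fun h => by
  have h1 := topForm_eq_zero h
  have h2 := fromChart_toChart (x₀ := x₀) ((extChartAt (𝓡 n) x₀).map_target hy)
    (ν ((extChartAt (𝓡 n) x₀).symm y))
  rw [h1] at h2
  exact hν.1 _ h2.symm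

theorem coef_contDiffOn (hν : IsVolumeForm n ν) (x₀ : M) :
    ContDiffOn ℝ ∞ (coef x₀ ν) (extChartAt (𝓡 n) x₀).target :=
  (contDiff_alternating_apply stdFrame).comp_contDiffOn (hν.2 x₀)

theorem orient_continuousOn (hν : IsVolumeForm n ν) (x₀ : M) :
    ContinuousOn (orient ν x₀) (extChartAt (𝓡 n) x₀).target := fun y hy =>
  ContinuousAt.comp_continuousWithinAt (continuousAt_sign_of_ne_zero (coef_ne_zero hν hy))
    ((coef_contDiffOn hν x₀).continuousOn y hy)

theorem orient_cast_continuousOn (hν : IsVolumeForm n ν) (x₀ : M) :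
    ContinuousOn (fun y => (orient ν x₀ y : ℝ)) (extChartAt (𝓡 n) x₀).target :=
  (continuous_of_discreteTopology (f := fun s : SignType => (s : ℝ))).comp_continuousOn
    (orient_continuousOn hν x₀)

variable [T2Space M] [SigmaCompactSpace M]

/-- The integrand of `formIntegral` in the chart at `x₁`. -/
def chartIntegrand (ν β : ∀ x : M, TangentSpace (𝓡 n) x [⋀^Fin n]→L[ℝ] ℝ) (x₁ : M)
    (y : Rn n) : ℝ :=
  chartPartition n M x₁ ((extChartAt (𝓡 n) x₁).symm y) * (coef x₁ β y * (orient ν x₁ y : ℝ))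

theorem formIntegral_eq_finsum (ν β : ∀ x : M, TangentSpace (𝓡 n) x [⋀^Fin n]→L[ℝ] ℝ) :
    formIntegral n ν β = ∑ᶠ x₁ : M, ∫ y in (extChartAt (𝓡 n) x₁).target,
      chartIntegrand ν β x₁ y := rfl

theorem chartPartition_subordinate (x₁ : M) :
    tsupport (chartPartition n M x₁) ⊆ (extChartAt (𝓡 n) x₁).source := by
  rw [extChartAt_source]
  exact (exists_partition n M).choose_spec x₁

theorem measurableSet_target (x₁ : M) : MeasurableSet (extChartAt (𝓡 n) x₁).target :=
  (isOpen_extChartAt_target x₁).measurableSet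

theorem integrableOn_of_compact {f : Rn n → ℝ} {U K : Set (Rn n)} (hU : MeasurableSet U)
    (hK : IsCompact K) (hf : ContinuousOn f U) (hKU : K ⊆ U) (h0 : ∀ y ∈ U, y ∉ K → f y = 0) :
    IntegrableOn f U :=
  ((hf.mono hKU).integrableOn_compact hK).of_forall_sdiff_eq_zero hU
    fun y hy => h0 y hy.1 hy.2

theorem chartIntegrand_integrable (hν : IsVolumeForm n ν) (hβ : IsContForm β) {K : Set M}
    (hK : IsCompact K) (h0 : ∀ x ∉ K, β x = 0) (x₁ : M) :
    IntegrableOn (chartIntegrand ν β x₁) (extChartAt (𝓡 n) x₁).target := by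
  have hK' : IsCompact (K ∩ tsupport (chartPartition n M x₁)) := hK.inter_right (isClosed_tsupport _)
  have hs : K ∩ tsupport (chartPartition n M x₁) ⊆ (extChartAt (𝓡 n) x₁).source :=
    inter_subset_right.trans (chartPartition_subordinate x₁)
  refine integrableOn_of_compact (measurableSet_target x₁)
    (hK'.image_of_continuousOn ((continuousOn_extChartAt x₁).mono hs)) ?_
    (image_subset_iff.2 fun x hx => (extChartAt (𝓡 n) x₁).map_source (hs hx)) ?_
  · exact ((chartPartition n M x₁).contMDiff.continuous.comp_continuousOn (continuousOn_extChartAt_symm x₁)).mul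
      ((hβ x₁).mul (orient_cast_continuousOn hν x₁))
  · intro y hy hy'
    rw [chartIntegrand]
    by_cases hx : (extChartAt (𝓡 n) x₁).symm y ∈ tsupport (chartPartition n M x₁)
    · have hx' : (extChartAt (𝓡 n) x₁).symm y ∉ K := fun h =>
        hy' ⟨_, ⟨h, hx⟩, (extChartAt (𝓡 n) x₁).right_inv hy⟩
      rw [coef_eq_zero (h0 _ hx')]
      simp
    · rw [image_eq_zero_of_notMem_tsupport hx, zero_mul]

theorem finite_partition_meets {K : Set M} (hK : IsCompact K) :
    {x₁ : M | ∃ x ∈ K, chartPartition n M x₁ x ≠ 0}.Finite := by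
  refine ((chartPartition n M).locallyFinite.finite_nonempty_inter_compact hK).subset ?_
  rintro x₁ ⟨x, hx, h⟩
  exact ⟨x, h, hx⟩

theorem chartIntegrand_eq_zero {K : Set M} (h0 : ∀ x ∉ K, β x = 0) {x₁ : M}
    (h : ¬ ∃ x ∈ K, chartPartition n M x₁ x ≠ 0) (y : Rn n) : chartIntegrand ν β x₁ y = 0 := by
  rw [chartIntegrand]
  by_cases hx : (extChartAt (𝓡 n) x₁).symm y ∈ K
  · have : chartPartition n M x₁ ((extChartAt (𝓡 n) x₁).symm y) = 0 := by
      by_contra h'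
      exact h ⟨_, hx, h'⟩
    rw [this, zero_mul]
  · rw [coef_eq_zero (h0 _ hx)]
    simp

theorem hasFiniteSupport_integral {K : Set M} (hK : IsCompact K) (h0 : ∀ x ∉ K, β x = 0) :
    (Function.support fun x₁ : M => ∫ y in (extChartAt (𝓡 n) x₁).target,
      chartIntegrand ν β x₁ y).Finite := by
  refine (finite_partition_meets (n := n) hK).subset fun x₁ hx => ?_
  by_contra h
  refine hx ?_
  simp [chartIntegrand_eq_zero h0 h]

theorem formIntegral_add (hν : IsVolumeForm n ν) (hβ : IsContForm β) (hβ' : IsContForm β')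
    {K K' : Set M} (hK : IsCompact K) (h0 : ∀ x ∉ K, β x = 0) (hK' : IsCompact K')
    (h0' : ∀ x ∉ K', β' x = 0) :
    formIntegral n ν (β + β') = formIntegral n ν β + formIntegral n ν β' := by
  simp only [formIntegral_eq_finsum]
  rw [← finsum_add_distrib (hasFiniteSupport_integral hK h0) (hasFiniteSupport_integral hK' h0')]
  refine finsum_congr fun x₁ => ?_
  rw [← integral_add (chartIntegrand_integrable hν hβ hK h0 x₁)
    (chartIntegrand_integrable hν hβ' hK' h0' x₁)]
  congr 1
  funext y
  simp only [chartIntegrand, coef_add]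
  ring

theorem formIntegral_smul (c : ℝ) (ν β : ∀ x : M, TangentSpace (𝓡 n) x [⋀^Fin n]→L[ℝ] ℝ) :
    formIntegral n ν (c • β) = c * formIntegral n ν β := by
  simp only [formIntegral_eq_finsum]
  rw [← smul_eq_mul, smul_finsum]
  refine finsum_congr fun x₁ => ?_
  rw [← integral_smul]
  congr 1
  funext y
  have : coef x₁ (c • β) y = c * coef x₁ β y := rfl
  simp only [chartIntegrand, this, smul_eq_mul]
  ring

/-- Change of variables on the overlap. The coefficient of `β` picks up the Jacobian determinant and
the orientation sign of `ν` picks up its sign; their product is the absolute value that the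
substitution rule requires. Outside the overlap either `β` or the member of the partition vanishes.
-/
theorem setIntegral_chartIntegrand {K : Set M}
    (hKs : K ⊆ (extChartAt (𝓡 n) x₀).source) (h0 : ∀ x ∉ K, β x = 0) (x₁ : M) :
    ∫ y in (extChartAt (𝓡 n) x₁).target, chartIntegrand ν β x₁ y =
      ∫ y in (extChartAt (𝓡 n) x₀).target,
        chartPartition n M x₁ ((extChartAt (𝓡 n) x₀).symm y) *
          (coef x₀ β y * (orient ν x₀ y : ℝ)) := by
  set O := overlap n 0 (Bundle.Trivial M (Rn 0)) x₁ x₀ with hO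
  set O' := overlap n 0 (Bundle.Trivial M (Rn 0)) x₀ x₁ with hO'
  have hOo : IsOpen O := isOpen_overlap n 0 (Bundle.Trivial M (Rn 0)) x₁ x₀
  have e1 : ∫ y in (extChartAt (𝓡 n) x₁).target, chartIntegrand ν β x₁ y =
      ∫ y in O, chartIntegrand ν β x₁ y := by
    refine setIntegral_eq_of_subset_of_forall_sdiff_eq_zero (measurableSet_target x₁)
      (fun y hy => hy.1.1) fun y hy => ?_
    have hx : (extChartAt (𝓡 n) x₁).symm y ∉ K := fun h =>
      hy.2 ⟨by rw [coordTarget_trivial]; exact hy.1, by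
        rw [mem_preimage, coordSource_trivial]; exact hKs h⟩
    rw [chartIntegrand, coef_eq_zero (h0 _ hx)]
    simp
  have himg : transMap x₁ x₀ '' O = O' := by
    refine Subset.antisymm (image_subset_iff.2 fun y hy => transMap_mem hy) fun y hy =>
      ⟨transMap x₀ x₁ y, transMap_mem hy, transMap_transMap hy⟩
  have e2 := integral_image_eq_integral_abs_det_fderiv_smul (s := O) (f := transMap x₁ x₀)
    (f' := fderiv ℝ (transMap x₁ x₀)) volume hOo.measurableSet
    (fun y hy => (transMap_differentiableAt hy).hasFDerivAt.hasFDerivWithinAt)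
    (fun y hy y' hy' h => by rw [← transMap_transMap hy, h, transMap_transMap hy'])
    (fun y => chartPartition n M x₁ ((extChartAt (𝓡 n) x₀).symm y) *
          (coef x₀ β y * (orient ν x₀ y : ℝ)))
  rw [himg] at e2
  rw [e1]
  refine Eq.trans ?_ (e2.symm.trans ?_)
  · refine setIntegral_congr_fun hOo.measurableSet fun y hy => ?_
    simp only [chartIntegrand, orient, coef_transMap hy, sign_mul, SignType.coe_mul,
      symm_transMap hy, smul_eq_mul]
    rw [← self_mul_sign (fderiv ℝ (transMap x₁ x₀) y).det]
    ring
  · refine (setIntegral_eq_of_subset_of_forall_sdiff_eq_zero (measurableSet_target x₀)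
      (fun y hy => hy.1.1) fun y hy => ?_).symm
    have hx : (extChartAt (𝓡 n) x₀).symm y ∉ tsupport (chartPartition n M x₁) := fun h =>
      hy.2 ⟨by rw [coordTarget_trivial]; exact hy.1, by
        rw [mem_preimage, coordSource_trivial]; exact chartPartition_subordinate x₁ h⟩
    rw [image_eq_zero_of_notMem_tsupport hx, zero_mul]

/-- The integral of an `n`-form that is supported in the domain of a chart. -/
theorem formIntegral_eq_setIntegral (hν : IsVolumeForm n ν) (hβ : IsContForm β) {K : Set M}
    (hK : IsCompact K) (hKs : K ⊆ (extChartAt (𝓡 n) x₀).source) (h0 : ∀ x ∉ K, β x = 0) :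
    formIntegral n ν β = ∫ y in (extChartAt (𝓡 n) x₀).target, coef x₀ β y * (orient ν x₀ y : ℝ) := by
  rw [formIntegral_eq_finsum]
  set F := (finite_partition_meets (n := n) hK).toFinset with hF
  have hsub : (Function.support fun x₁ : M => ∫ y in (extChartAt (𝓡 n) x₁).target,
      chartIntegrand ν β x₁ y) ⊆ F := fun x₁ hx => by
    rw [hF, Finite.coe_toFinset]
    by_contra h
    refine hx ?_
    simp [chartIntegrand_eq_zero h0 h]
  rw [finsum_eq_sum_of_support_subset _ hsub]
  simp only [setIntegral_chartIntegrand hKs h0]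
  have hcont : ContinuousOn (fun y => coef x₀ β y * (orient ν x₀ y : ℝ))
      (extChartAt (𝓡 n) x₀).target := (hβ x₀).mul (orient_cast_continuousOn hν x₀)
  rw [← integral_finsetSum]
  · refine setIntegral_congr_fun (measurableSet_target x₀) fun y hy => ?_
    rw [← Finset.sum_mul]
    by_cases hx : (extChartAt (𝓡 n) x₀).symm y ∈ K
    · have h1 : ∑ᶠ x₁, chartPartition n M x₁ ((extChartAt (𝓡 n) x₀).symm y) = 1 :=
        (chartPartition n M).sum_eq_one (mem_univ _)
      rw [finsum_eq_sum_of_support_subset (s := F) _ fun x₁ h => by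
        rw [hF, Finite.coe_toFinset]; exact ⟨_, hx, h⟩] at h1
      rw [h1, one_mul]
    · rw [coef_eq_zero (h0 _ hx)]
      simp
  · intro x₁ _
    refine integrableOn_of_compact (measurableSet_target x₀)
      (hK.image_of_continuousOn ((continuousOn_extChartAt x₀).mono hKs))
      (((chartPartition n M x₁).contMDiff.continuous.comp_continuousOn (continuousOn_extChartAt_symm x₀)).mul
        hcont)
      (image_subset_iff.2 fun x hx => (extChartAt (𝓡 n) x₀).map_source (hKs hx)) ?_
    intro y hy hy'
    have hx : (extChartAt (𝓡 n) x₀).symm y ∉ K := fun h =>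
      hy' ⟨_, h, (extChartAt (𝓡 n) x₀).right_inv hy⟩
    rw [coef_eq_zero (h0 _ hx)]
    simp

/-- The integral of an `n`-form that is supported in a connected part of a chart. -/
theorem exists_formIntegral_eq (hν : IsVolumeForm n ν) {B : Set (Rn n)} (hB : IsPreconnected B)
    (hBm : MeasurableSet B) (hBs : B ⊆ (extChartAt (𝓡 n) x₀).target) :
    ∃ s : ℝ, s ≠ 0 ∧ ∀ β : ∀ x : M, TangentSpace (𝓡 n) x [⋀^Fin n]→L[ℝ] ℝ, IsContForm β →
      ∀ K ⊆ B, IsCompact K → (∀ x ∉ (extChartAt (𝓡 n) x₀).symm '' K, β x = 0) →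
        formIntegral n ν β = s * ∫ y in B, coef x₀ β y := by
  rcases B.eq_empty_or_nonempty with rfl | ⟨b, hb⟩
  · refine ⟨1, one_ne_zero, fun β hβ K hK hKc h0 => ?_⟩
    obtain rfl := subset_empty_iff.1 hK
    rw [formIntegral_eq_setIntegral (x₀ := x₀) hν hβ isCompact_empty (empty_subset _)
      (by simpa using h0)]
    have h : ∀ y, coef x₀ β y = 0 := fun y => coef_eq_zero (h0 _ (by simp))
    simp [h]
  -- `ν` has no zeros, so its orientation sign is locally constant, hence constant on the
  -- preconnected set `B`.
  refine ⟨(orient ν x₀ b : ℝ), ?_, fun β hβ K hK hKc h0 => ?_⟩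
  · have := coef_ne_zero hν (hBs hb)
    simp only [orient]
    rcases lt_or_gt_of_ne this with h | h
    · rw [sign_neg h]; simp
    · rw [sign_pos h]; simp
  · have hKt := hK.trans hBs
    rw [formIntegral_eq_setIntegral hν hβ
      (hKc.image_of_continuousOn ((continuousOn_extChartAt_symm x₀).mono hKt))
      (image_subset_iff.2 fun y hy => (extChartAt (𝓡 n) x₀).map_target (hKt hy)) h0,
      ← integral_const_mul]
    refine (setIntegral_eq_of_subset_of_forall_sdiff_eq_zero (measurableSet_target x₀) hBs
      fun y hy => ?_).trans ?_
    · have hx : (extChartAt (𝓡 n) x₀).symm y ∉ (extChartAt (𝓡 n) x₀).symm '' K := by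
        rintro ⟨y', hy', e⟩
        have := (extChartAt (𝓡 n) x₀).symm.injOn (hKt hy') hy.1 e
        exact hy.2 (this ▸ hK hy')
      rw [coef_eq_zero (h0 _ hx)]
      simp
    · refine setIntegral_congr_fun hBm fun y hy => ?_
      rw [hB.constant ((orient_continuousOn hν x₀).mono hBs) hy hb, mul_comm]

end Integration

section Variation
open MeasureTheory

/-! ### The first variation in coordinates -/

variable {n m r s : ℕ} {U K : Set (Rn n)}

theorem contDiff_indicator {W : Type*} [NormedAddCommGroup W] [NormedSpace ℝ W] {h : Rn n → W}
    (hU : IsOpen U) (hK : IsClosed K) (hKU : K ⊆ U) (hh : ContDiffOn ℝ ∞ h U)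
    (h0 : ∀ y ∈ U, y ∉ K → h y = 0) : ContDiff ℝ ∞ (U.indicator h) := by
  refine contDiff_iff_contDiffAt.2 fun y => ?_
  by_cases hy : y ∈ U
  · refine (hh.contDiffAt (hU.mem_nhds hy)).congr_of_eventuallyEq ?_
    filter_upwards [hU.mem_nhds hy] with z hz using indicator_of_mem hz h
  · refine (contDiffAt_const (c := (0 : W))).congr_of_eventuallyEq ?_
    filter_upwards [hK.isOpen_compl.mem_nhds fun hk => hy (hKU hk)] with z hz
    by_cases hzU : z ∈ U
    · rw [indicator_of_mem hzU, h0 z hzU hz]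
    · exact indicator_of_notMem hzU h

theorem setIntegral_pd_eq_zero {h : Rn n → ℝ} (hU : IsOpen U) (hK : IsCompact K) (hKU : K ⊆ U)
    (hh : ContDiffOn ℝ ∞ h U) (h0 : ∀ y ∈ U, y ∉ K → h y = 0) (i : Fin n) :
    ∫ y in U, pd i h y = 0 := by
  have hi := contDiff_indicator (W := ℝ) hU hK.isClosed hKU hh h0
  have hz : ∀ y ∉ K, U.indicator h y = 0 := fun y hy => by
    by_cases hyU : y ∈ U
    · rw [indicator_of_mem hyU, h0 y hyU hy]
    · exact indicator_of_notMem hyU h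
  refine (setIntegral_congr_fun hU.measurableSet fun y hy =>
    (pd_congr hU (fun z hz => indicator_of_mem hz h) i hy).symm).trans
    ((setIntegral_eq_integral_of_forall_compl_eq_zero fun y hy => ?_).trans
      (integral_pd_eq_zero hi (HasCompactSupport.intro hK hz) i))
  have : U.indicator h =ᶠ[𝓝 y] fun _ => 0 := by
    filter_upwards [hK.isClosed.isOpen_compl.mem_nhds fun hk => hy (hKU hk)] with z hz' using
      hz z hz'
  rw [pd, this.fderiv_eq]
  simp

section Clm

variable {W W' : Type*} [NormedAddCommGroup W] [NormedSpace ℝ W] [NormedAddCommGroup W']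
  [NormedSpace ℝ W'] {p : JetCoord n m → W}

theorem lineDeriv_clm (hU : IsOpen U) (hp : SmoothOfOrder r U p) (A : W →L[ℝ] W')
    {z : JetCoord n m} (hz : z.1 ∈ U) (w : JetCoord n m) :
    lineDeriv ℝ (fun z => A (p z)) z w = A (lineDeriv ℝ p z w) := by
  obtain ⟨q, hq, e⟩ := hp
  have h := hasLineDerivAt_of_rep hU hq e hz w
  have h1 : HasLineDerivAt ℝ (fun z => A (p z)) _ z w := A.hasFDerivAt.comp_hasDerivAt _ h
  rw [h.lineDeriv, h1.lineDeriv]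

theorem dU_clm (hU : IsOpen U) (hp : SmoothOfOrder r U p) (A : W →L[ℝ] W') (a : Fin m)
    (I : Fin n → ℕ) {z : JetCoord n m} (hz : z.1 ∈ U) :
    dU a I (fun z => A (p z)) z = A (dU a I p z) := lineDeriv_clm hU hp A hz _

theorem totalDl_clm (hU : IsOpen U) (hp : SmoothOfOrder r U p) (A : W →L[ℝ] W')
    (l : List (Fin n)) {z : JetCoord n m} (hz : z.1 ∈ U) :
    totalDl l (fun z => A (p z)) z = A (totalDl l p z) := by
  induction l generalizing z with
  | nil => rfl
  | cons i l ih =>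
    rw [totalDl_cons, totalD_congr hU (fun z hz => ih hz) i hz, totalD_clm hU (hp.totalDl hU l) A i hz]
    rfl

theorem eulerCoord_clm (hU : IsOpen U) (hp : SmoothOfOrder r U p) (A : W →L[ℝ] W') (a : Fin m)
    {z : JetCoord n m} (hz : z.1 ∈ U) :
    eulerCoord a (fun z => A (p z)) z = A (eulerCoord a p z) := by
  rw [eulerCoord_eq_sum hU (hp.compContDiff A.contDiff) a hz, eulerCoord_eq_sum hU hp a hz, map_sum]
  refine Finset.sum_congr rfl fun I _ => ?_
  rw [map_smul, ← totalDl_clm hU (hp.dU hU a I) A _ hz]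
  congr 1
  exact totalDl_congr hU (fun z hz => dU_clm hU hp A a I hz) _ z hz

theorem eulerCoord_add {p' : JetCoord n m → W} (hU : IsOpen U) (hp : SmoothOfOrder r U p)
    (hp' : SmoothOfOrder s U p') (a : Fin m) {z : JetCoord n m} (hz : z.1 ∈ U) :
    eulerCoord a (fun z => p z + p' z) z = eulerCoord a p z + eulerCoord a p' z := by
  have h := (hp.mono_order (le_max_left r s)).prodMk (hp'.mono_order (le_max_right r s))
  have h1 := eulerCoord_clm hU h (ContinuousLinearMap.fst ℝ W W + ContinuousLinearMap.snd ℝ W W)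
    a hz
  have h2 := eulerCoord_clm hU h (ContinuousLinearMap.fst ℝ W W) a hz
  have h3 := eulerCoord_clm hU h (ContinuousLinearMap.snd ℝ W W) a hz
  simp only [add_apply, ContinuousLinearMap.coe_fst',
    ContinuousLinearMap.coe_snd'] at h1 h2 h3
  rw [h1, ← h2, ← h3]

end Clm

variable {p : JetCoord n m → ℝ} {f g : Rn n → Rn m}

theorem jetAt_eq_zero (hK : IsClosed K) (h0 : ∀ y ∉ K, g y = 0) {y : Rn n} (hy : y ∉ K) :
    (jetAt g y).2 = 0 := by
  have h : g =ᶠ[𝓝 y] fun _ => 0 := by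
    filter_upwards [hK.isOpen_compl.mem_nhds hy] with z hz using h0 z hz
  rw [jetAt_congr_of_eventuallyEq h]
  funext aI
  change partialDeriv (fun _ => (0 : Rn m)) y aI.1 aI.2 = 0
  simp [partialDeriv]

/-- The sections that are used as directions of variation, as generalized functions of the jet. -/
theorem totalDl_base (hU : IsOpen U) (hg : ContDiffOn ℝ ∞ g U) (hf : ContDiffOn ℝ ∞ f U)
    (a : Fin m) (l : List (Fin n)) {y : Rn n} (hy : y ∈ U) :
    totalDl l (fun z : JetCoord n m => g z.1 a) (jetAt f y) = pdl l (fun y => g y a) y := by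
  have h : ContDiffOn ℝ ∞ (fun y => g y a) U := (contDiff_apply_euclidean a).comp_contDiffOn hg
  exact (totalDl_comp_jetAt hU (SmoothOfOrder.of_base (m := m) (r := 0) h) hf l hy).symm

theorem lineDeriv_jetAt_eq (hU : IsOpen U) (hp : SmoothOfOrder r U p) (hf : ContDiffOn ℝ ∞ f U)
    (hg : ContDiffOn ℝ ∞ g U) {y : Rn n} (hy : y ∈ U) :
    lineDeriv ℝ p (jetAt f y) (0, (jetAt g y).2) =
      ∑ a, g y a * eulerCoord a p (jetAt f y) +
        ∑ j, pd j (fun y => varBdry r p (fun a z => g z.1 a) j (jetAt f y)) y := by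
  have hQ : ∀ a, SmoothOfOrder (m := m) 0 U (fun z : JetCoord n m => g z.1 a) := fun a =>
    SmoothOfOrder.of_base ((contDiff_apply_euclidean a).comp_contDiffOn hg)
  have h1 := lineDeriv_eq_euler_add_bdry hU hp hQ (z := jetAt f y) hy
  have h2 : (fun aI : Fin m × (Fin n → ℕ) =>
      totalDl (idxList aI.2) (fun z : JetCoord n m => g z.1 aI.1) (jetAt f y)) = (jetAt g y).2 := by
    funext aI
    rw [totalDl_base hU hg hf _ _ hy]
    exact (partialDeriv_eq_pdl hU hg aI.1 aI.2 hy).symm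
  rw [h2] at h1
  rw [h1]
  congr 1
  exact Finset.sum_congr rfl fun j _ => (pd_comp_jetAt hU (varBdry_smooth hU hp hQ j) hf j hy).symm

theorem varBdry_jetAt_eq_zero (hU : IsOpen U) (hK : IsClosed K) (hf : ContDiffOn ℝ ∞ f U)
    (hg : ContDiffOn ℝ ∞ g U) (h0 : ∀ y ∈ U, y ∉ K → g y = 0) (j : Fin n) {y : Rn n}
    (hy : y ∈ U) (hyK : y ∉ K) : varBdry r p (fun a z => g z.1 a) j (jetAt f y) = 0 := by
  refine varBdry_eq_zero p (fun a l => ?_) j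
  rw [totalDl_base hU hg hf a l hy]
  have hO : IsOpen (U \ K) := hU.sdiff hK
  rw [pdl_congr hO (g' := fun _ => 0) (fun z hz => by rw [h0 z hz.1 hz.2]; rfl) l ⟨hy, hyK⟩]
  exact pdl_clm isOpen_univ (g := fun _ => (0 : ℝ)) contDiffOn_const (0 : ℝ →L[ℝ] ℝ) l (mem_univ y)

/-- The one-parameter family of expressions along `f + t g`. -/
theorem contDiffOn_family (hU : IsOpen U) (hp : SmoothOfOrder r U p)
    (hf : ContDiffOn ℝ ∞ f U) (hg : ContDiffOn ℝ ∞ g U) :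
    ContDiffOn ℝ ∞ (fun z : ℝ × Rn n => p (jetAt f z.2 + z.1 • (0, (jetAt g z.2).2)))
      (univ ×ˢ U) := by
  obtain ⟨q, hq, e⟩ := hp
  have hjet : ∀ {f : Rn n → Rn m}, ContDiffOn ℝ ∞ f U →
      ContDiffOn ℝ ∞ (fun y => truncJet r (jetAt f y).2) U := fun hf =>
    contDiffOn_pi.2 fun aI => partialDeriv_contDiffOn hU hf aI.1 aI.2
  have hsnd : MapsTo (fun z : ℝ × Rn n => z.2) (univ ×ˢ U) U := fun z hz => hz.2
  have hi : ContDiffOn ℝ ∞ (fun z : ℝ × Rn n =>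
      (z.2, truncJet r (jetAt f z.2).2 + z.1 • truncJet r (jetAt g z.2).2)) (univ ×ˢ U) :=
    contDiffOn_snd.prodMk (((hjet hf).comp contDiffOn_snd hsnd).add
      (contDiffOn_fst.smul ((hjet hg).comp contDiffOn_snd hsnd)))
  refine (hq.comp hi fun z hz => ⟨hz.2, trivial⟩).congr fun z hz => ?_
  have : jetAt f z.2 + z.1 • ((0 : Rn n), (jetAt g z.2).2) =
      (z.2, (jetAt f z.2).2 + z.1 • (jetAt g z.2).2) := Prod.ext (by simp [jetAt]) rfl
  rw [this, e z.2 hz.2]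
  rfl

/-- The integrated first variation. -/
theorem setIntegral_lineDeriv_eq (hU : IsOpen U) (hp : SmoothOfOrder r U p)
    (hf : ContDiffOn ℝ ∞ f U) (hg : ContDiffOn ℝ ∞ g U) (hK : IsCompact K) (hKU : K ⊆ U)
    (h0 : ∀ y ∈ U, y ∉ K → g y = 0) :
    ∫ y in U, lineDeriv ℝ p (jetAt f y) (0, (jetAt g y).2) =
      ∫ y in U, ∑ a, g y a * eulerCoord a p (jetAt f y) := by
  have hQ : ∀ a, SmoothOfOrder (m := m) 0 U (fun z : JetCoord n m => g z.1 a) := fun a =>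
    SmoothOfOrder.of_base ((contDiff_apply_euclidean a).comp_contDiffOn hg)
  have hB : ∀ j, ContDiffOn ℝ ∞
      (fun y => varBdry r p (fun a z => g z.1 a) j (jetAt f y)) U := fun j =>
    (varBdry_smooth hU hp hQ j).comp_jetAt hU hf
  have hB0 := fun j y (hy : y ∈ U) (hyK : y ∉ K) =>
    varBdry_jetAt_eq_zero (r := r) (p := p) hU hK.isClosed hf hg h0 j hy hyK
  have hint : ∀ j, IntegrableOn
      (pd j fun y => varBdry r p (fun a z => g z.1 a) j (jetAt f y)) U := fun j => by
    refine integrableOn_of_compact hU.measurableSet hK (pd_contDiffOn hU (hB j) j).continuousOn hKU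
      fun y hy hyK => ?_
    have hO : IsOpen (U \ K) := hU.sdiff hK.isClosed
    rw [pd_congr hO (g' := fun _ => 0) (fun z hz => hB0 j z hz.1 hz.2) j ⟨hy, hyK⟩]
    simp [pd]
  have hint' : IntegrableOn (fun y => ∑ a, g y a * eulerCoord a p (jetAt f y)) U := by
    refine integrableOn_of_compact hU.measurableSet hK ?_ hKU fun y hy hyK => ?_
    · exact continuousOn_finsetSum _ fun a _ =>
        ((contDiff_apply_euclidean a).comp_contDiffOn hg).continuousOn.mul
          ((hp.eulerCoord hU a).comp_jetAt hU hf).continuousOn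
    · simp [h0 y hy hyK]
  rw [setIntegral_congr_fun hU.measurableSet fun y hy => lineDeriv_jetAt_eq hU hp hf hg hy,
    integral_add hint' (integrable_finsetSum _ fun j _ => hint j),
    integral_finsetSum _ fun j _ => hint j,
    Finset.sum_eq_zero fun j _ => setIntegral_pd_eq_zero hU hK hKU (hB j) (hB0 j) j, add_zero]

/-- If the integral of `p` along `f` is stationary under compactly supported variations, then `f`
solves the Euler-Lagrange equations. -/
theorem setIntegral_lineDeriv_eq_zero (hU : IsOpen U) (hp : SmoothOfOrder r U p)
    (hf : ContDiffOn ℝ ∞ f U) (hg : ContDiffOn ℝ ∞ g U) (hK : IsCompact K) (hKU : K ⊆ U)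
    (h0 : ∀ y ∈ U, y ∉ K → g y = 0)
    (h : ∀ t : ℝ, ∫ y in U, (p (jetAt f y + t • (0, (jetAt g y).2)) - p (jetAt f y)) = 0) :
    ∫ y in U, lineDeriv ℝ p (jetAt f y) (0, (jetAt g y).2) = 0 := by
  have hO : IsOpen (U \ K) := hU.sdiff hK.isClosed
  have hj0 : ∀ y ∈ U, y ∉ K → (jetAt g y).2 = 0 := fun y hy hyK => by
    rw [jetAt_congr hO (g := fun _ => 0) (fun z hz => h0 z hz.1 hz.2) ⟨hy, hyK⟩]
    exact jetAt_eq_zero (K := ∅) isClosed_empty (fun _ _ => rfl) (notMem_empty y)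
  set Φ : ℝ × Rn n → ℝ := fun z => p (jetAt f z.2 + z.1 • (0, (jetAt g z.2).2)) with hΦdef
  have hΦ : ContDiffOn ℝ ∞ Φ (univ ×ˢ U) := contDiffOn_family hU hp hf hg
  have hW : IsOpen ((univ : Set ℝ) ×ˢ U) := isOpen_univ.prod hU
  have hΦ' := hΦ.fderiv_of_isOpen hW (m := ∞) (by simp)
  have hd : ∀ t, ∀ y ∈ U, HasFDerivAt (fun t => Φ (t, y))
      ((fderiv ℝ Φ (t, y)).comp (ContinuousLinearMap.inl ℝ ℝ (Rn n))) t := fun t y hy => by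
    have hda : DifferentiableAt ℝ Φ (t, y) :=
      (hΦ.contDiffAt (hW.mem_nhds ⟨trivial, hy⟩)).differentiableAt (by simp)
    have hl : HasFDerivAt (fun t : ℝ => (t, y)) (ContinuousLinearMap.inl ℝ ℝ (Rn n)) t :=
      hasFDerivAt_prodMk_left t y
    exact hda.hasFDerivAt.comp t hl
  -- The integral of the difference vanishes for every `t`, and so does its derivative at `0`,
  -- computed under the integral sign. Subtracting the value at `t = 0` confines the integrand to
  -- `K`, so that `p` along `f` need not be integrable over `U`.
  have key := hasFDerivAt_setIntegral (μ := (volume : Measure (Rn n))) hK isOpen_univ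
    (F := fun t y => Φ (t, y) - Φ (0, y))
    (F' := fun t y => (fderiv ℝ Φ (t, y)).comp (ContinuousLinearMap.inl ℝ ℝ (Rn n)))
    (fun t _ y hy => (hd t y (hKU hy)).sub_const _)
    ((hΦ.continuousOn.mono (prod_mono subset_rfl hKU)).sub
      (hΦ.continuousOn.comp (f := fun z : ℝ × Rn n => ((0 : ℝ), z.2)) (by fun_prop)
        fun z hz => ⟨trivial, hKU hz.2⟩))
    ((hΦ'.continuousOn.mono (prod_mono subset_rfl hKU)).clm_comp continuousOn_const)
    (mem_univ (0 : ℝ))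
  have hzero : (fun t => ∫ y in K, (Φ (t, y) - Φ (0, y))) = fun _ => 0 := by
    funext t
    have h' := h t
    rw [setIntegral_eq_of_subset_of_forall_sdiff_eq_zero hU.measurableSet hKU fun y hy => ?_] at h'
    · have e0 : ∀ y, Φ (0, y) = p (jetAt f y) := fun y => by
        change p (jetAt f y + (0 : ℝ) • _) = _
        rw [zero_smul, add_zero]
      simp only [e0]
      exact h'
    · rw [hj0 y hy.1 hy.2]
      have : t • ((0 : Rn n), (0 : Fin m × (Fin n → ℕ) → ℝ)) = 0 := smul_zero t
      rw [this, add_zero, sub_self]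
  rw [hzero] at key
  have h3 := key.unique (hasFDerivAt_const (0 : ℝ) (0 : ℝ))
  have h4 := congrArg (fun A : ℝ →L[ℝ] ℝ => A 1) h3
  simp only [zero_apply] at h4
  rw [ContinuousLinearMap.integral_apply] at h4
  · rw [← h4]
    refine (setIntegral_eq_of_subset_of_forall_sdiff_eq_zero hU.measurableSet hKU
      fun y hy => ?_).trans (setIntegral_congr_fun hK.measurableSet fun y hy => ?_)
    · rw [hj0 y hy.1 hy.2]
      exact lineDeriv_zero
    · exact (hd 0 y (hKU hy)).hasDerivAt.deriv
  · exact (((hΦ'.continuousOn.comp (f := fun y : Rn n => ((0 : ℝ), y)) (by fun_prop)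
        fun z hz => ⟨trivial, hKU hz⟩).clm_comp continuousOn_const).integrableOn_compact hK)

end Variation

section EulerLagrange
open MeasureTheory
variable {n m : ℕ} {M : Type*} [TopologicalSpace M] [ChartedSpace (Rn n) M]
  [IsManifold (𝓡 n) ∞ M]
  {V : M → Type*} [∀ x, AddCommGroup (V x)] [∀ x, Module ℝ (V x)] [∀ x, TopologicalSpace (V x)]
  [TopologicalSpace (TotalSpace (Rn m) V)] [FiberBundle (Rn m) V] [VectorBundle ℝ (Rn m) V]
  [ContMDiffVectorBundle ∞ (Rn m) V (𝓡 n)]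

variable {x₀ x₁ : M} {lam mu : HForm n m V n} {r : ℕ}

/-! ### The Euler-Lagrange operator is independent of coordinates -/

/-- The coefficient function of a horizontal `n`-form in the coordinates at `x₀`. -/
def scoef (x₀ : M) (lam : HForm n m V n) (z : JetCoord n m) : ℝ := coordRep n m x₀ lam z stdFrame

theorem scoef_smooth (h : IsSmoothForm n m lam) (x₀ : M) :
    ∃ r, SmoothOfOrder r (coordTarget n m V x₀) (scoef x₀ lam) := by
  obtain ⟨⟨r, hr⟩, -⟩ := h.coordRep x₀
  exact ⟨r, hr.compContDiff (contDiff_alternating_apply stdFrame)⟩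

theorem coef_pullSec (h : IsSmoothForm n m lam) (φ : Sec n m V) {y : Rn n}
    (hy : y ∈ coordTarget n m V x₀) :
    coef x₀ (pullSec n m φ lam) y = scoef x₀ lam (jetAt (localSec n m x₀ φ) y) :=
  congrArg (fun β : Rn n [⋀^Fin n]→L[ℝ] ℝ => β stdFrame) ((h.coordRep x₀).2 y hy φ)

/-- The first variation of `lam` at `φ` in the direction `η`, in the chart at `x₀`. -/
def variation (x₀ : M) (lam : HForm n m V n) (φ η : Sec n m V) (y : Rn n) : ℝ :=
  lineDeriv ℝ (scoef x₀ lam) (jetAt (localSec n m x₀ φ) y)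
    (0, (jetAt (localSec n m x₀ η) y).2)

theorem variation_eq_deriv (h : IsSmoothForm n m lam) (φ η : Sec n m V) {y : Rn n}
    (hy : y ∈ coordTarget n m V x₀) :
    variation x₀ lam φ η y = deriv (fun t : ℝ => coef x₀ (pullSec n m (φ + t • η) lam) y) 0 := by
  rw [variation, lineDeriv]
  congr 1
  funext t
  rw [coef_pullSec h _ hy, jetAt_localSec_add_smul φ η t hy]

/-- The variation is the derivative at `t = 0` of the coefficient of an `n`-form along `φ + t η`,
and the Jacobian factor of that coefficient does not depend on `t`. All comparisons of charts for
`E` and for the homotopy rest on this. -/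
theorem variation_transMap (h : IsSmoothForm n m lam) (φ η : Sec n m V) {y : Rn n}
    (hy : y ∈ overlap n m V x₀ x₁) :
    variation x₀ lam φ η y =
      (fderiv ℝ (transMap x₀ x₁) y).det * variation x₁ lam φ η (transMap x₀ x₁ y) := by
  rw [variation_eq_deriv h φ η hy.1, variation_eq_deriv h φ η (transMap_mem hy).1]
  simp only [coef_transMap hy]
  exact deriv_const_mul_field _

/-- The contraction of `E(lam)` with the vector `c`, in the coordinates at `x₀`. -/
def eulerIn (x₀ : M) (lam : HForm n m V n) (φ : Sec n m V) (c : Rn m) (y : Rn n) : ℝ :=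
  ∑ a, c a * eulerCoord a (scoef x₀ lam) (jetAt (localSec n m x₀ φ) y)

theorem eulerCoord_scoef_contDiffOn (h : IsSmoothForm n m lam) (x₀ : M) (φ : Sec n m V)
    (a : Fin m) : ContDiffOn ℝ ∞
      (fun y => eulerCoord a (scoef x₀ lam) (jetAt (localSec n m x₀ φ) y))
      (coordTarget n m V x₀) := by
  obtain ⟨r, hr⟩ := scoef_smooth h x₀
  exact (hr.eulerCoord (isOpen_coordTarget m V x₀) a).comp_jetAt (isOpen_coordTarget m V x₀)
    (localSec_contDiffOn φ x₀)

theorem eulerIn_contDiffOn (h : IsSmoothForm n m lam) (x₀ : M) (φ : Sec n m V) {c : Rn n → Rn m}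
    {U : Set (Rn n)} (hc : ContDiffOn ℝ ∞ c U) (hU : U ⊆ coordTarget n m V x₀) :
    ContDiffOn ℝ ∞ (fun y => eulerIn x₀ lam φ (c y) y) U :=
  ContDiffOn.sum fun a _ => ((contDiff_apply_euclidean a).comp_contDiffOn hc).mul
    ((eulerCoord_scoef_contDiffOn h x₀ φ a).mono hU)

theorem eulerIn_smul (φ : Sec n m V) (t : ℝ) (c : Rn m) (y : Rn n) :
    eulerIn x₀ lam φ (t • c) y = t * eulerIn x₀ lam φ c y := by
  simp only [eulerIn, Finset.mul_sum, PiLp.smul_apply, smul_eq_mul, mul_assoc]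

theorem localSec_eq_zero {η : Sec n m V} {K : Set (Rn n)}
    (h0 : ∀ x ∉ (extChartAt (𝓡 n) x₀).symm '' K, η x = 0) (hKs : K ⊆ coordTarget n m V x₀)
    {y : Rn n} (hy : y ∈ coordTarget n m V x₀) (hyK : y ∉ K) : localSec n m x₀ η y = 0 := by
  have hx : (extChartAt (𝓡 n) x₀).symm y ∉ (extChartAt (𝓡 n) x₀).symm '' K := by
    rintro ⟨y', hy', e⟩
    exact hyK ((extChartAt (𝓡 n) x₀).symm.injOn (hKs hy').1 hy.1 e ▸ hy')
  rw [localSec, triv_eq_linearMapAt (symm_mem hy), h0 _ hx]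
  exact map_zero _

theorem setIntegral_variation (h : IsSmoothForm n m lam) (φ η : Sec n m V) {B K : Set (Rn n)}
    (hB : IsOpen B) (hBs : B ⊆ coordTarget n m V x₀) (hK : IsCompact K) (hKB : K ⊆ B)
    (h0 : ∀ y ∈ B, y ∉ K → localSec n m x₀ η y = 0) :
    ∫ y in B, variation x₀ lam φ η y = ∫ y in B, eulerIn x₀ lam φ (localSec n m x₀ η y) y := by
  obtain ⟨r, hr⟩ := scoef_smooth h x₀
  exact setIntegral_lineDeriv_eq hB (hr.mono_set hBs) ((localSec_contDiffOn φ x₀).mono hBs)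
    ((localSec_contDiffOn η x₀).mono hBs) hK hKB h0

theorem exists_sec_bump [T2Space M] (x₀ : M) {χ : Rn n → ℝ} (hχ : ContDiff ℝ ∞ χ)
    (hc : HasCompactSupport χ) (hs : tsupport χ ⊆ coordTarget n m V x₀) (c : Rn m) :
    ∃ η : Sec n m V, (∀ y ∈ coordTarget n m V x₀, localSec n m x₀ η y = χ y • c) ∧
      ∀ x ∉ (extChartAt (𝓡 n) x₀).symm '' tsupport χ, η x = 0 :=
  exists_sec_of_local x₀ (hχ.smul contDiff_const).contDiffOn hc hs fun y _ hy => by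
    change χ y • c = 0
    rw [image_eq_zero_of_notMem_tsupport hy, zero_smul]

/-- The fundamental lemma of the calculus of variations. -/
theorem eulerIn_eq_zero [T2Space M] (h : IsSmoothForm n m lam) (φ : Sec n m V) {B : Set (Rn n)}
    (hB : IsOpen B) (hBs : B ⊆ coordTarget n m V x₀)
    (hvar : ∀ (η : Sec n m V) (K : Set (Rn n)), IsCompact K → K ⊆ B →
      (∀ x ∉ (extChartAt (𝓡 n) x₀).symm '' K, η x = 0) → ∫ y in B, variation x₀ lam φ η y = 0)
    (c : Rn m) {y : Rn n} (hy : y ∈ B) : eulerIn x₀ lam φ c y = 0 := by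
  refine eq_zero_of_integral_smul_eq_zero (h := eulerIn x₀ lam φ c) hB
    (eulerIn_contDiffOn h x₀ φ contDiffOn_const hBs).continuousOn (fun χ hχ hcs hsub => ?_) hy
  obtain ⟨η, h1, h2⟩ := exists_sec_bump (V := V) x₀ hχ hcs (hsub.trans hBs) c
  have h3 := hvar η _ hcs hsub h2
  rw [setIntegral_variation h φ η hB hBs hcs hsub
    fun y hy hyK => localSec_eq_zero h2 (hsub.trans hBs) (hBs hy) hyK] at h3
  rw [← h3, ← setIntegral_eq_integral_of_forall_compl_eq_zero (s := B)]
  · refine setIntegral_congr_fun hB.measurableSet fun y hy => ?_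
    rw [h1 y (hBs hy), eulerIn_smul]
  · intro y hy
    rw [image_eq_zero_of_notMem_tsupport fun h => hy (hsub h), zero_mul]

theorem det_fderiv_transMap_ne_zero {y : Rn n} (hy : y ∈ overlap n m V x₀ x₁) :
    (fderiv ℝ (transMap x₀ x₁) y).det ≠ 0 := by
  have h1 := transMap_differentiableAt hy
  have h2 := transMap_differentiableAt (transMap_mem hy)
  have h3 : transMap x₁ x₀ ∘ transMap x₀ x₁ =ᶠ[𝓝 y] id := by
    filter_upwards [(isOpen_overlap n m V x₀ x₁).mem_nhds hy] with z hz using transMap_transMap hz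
  have h4 := fderiv_comp y h2 h1
  rw [h3.fderiv_eq, fderiv_id] at h4
  intro h0
  have h5 := congrArg ContinuousLinearMap.det h4
  have h6 : ((fderiv ℝ (transMap x₁ x₀) (transMap x₀ x₁ y)).comp
      (fderiv ℝ (transMap x₀ x₁) y)).det = (fderiv ℝ (transMap x₁ x₀) (transMap x₀ x₁ y)).det *
        (fderiv ℝ (transMap x₀ x₁) y).det := LinearMap.det_comp _ _
  rw [h6, h0, mul_zero] at h5
  have h7 : (ContinuousLinearMap.id ℝ (Rn n)).det = 1 := LinearMap.det_id
  rw [h7] at h5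
  exact one_ne_zero h5

/-- The change of variables between two charts, up to the sign of the Jacobian. -/
theorem exists_setIntegral_transMap {B : Set (Rn n)} (hB : IsOpen B) (hBc : IsPreconnected B)
    (hBs : B ⊆ overlap n m V x₀ x₁) : ∃ s : ℝ, s ≠ 0 ∧ ∀ g : Rn n → ℝ,
      ∫ y in B, (fderiv ℝ (transMap x₀ x₁) y).det * g (transMap x₀ x₁ y) =
        s * ∫ y in transMap x₀ x₁ '' B, g y := by
  rcases B.eq_empty_or_nonempty with rfl | ⟨b, hb⟩
  · exact ⟨1, one_ne_zero, fun g => by simp⟩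
  have hdet : ContinuousOn (fun y => (fderiv ℝ (transMap x₀ x₁) y).det) B := fun y hy => by
    have hO := (isOpen_overlap n m V x₀ x₁).mem_nhds (hBs hy)
    exact (ContinuousLinearMap.continuous_det.continuousAt.comp
      (((transMap_contDiffOn x₀ x₁).contDiffAt hO).fderiv_right (m := 0)
        (by simp)).continuousAt).continuousWithinAt
  have hsgn : ContinuousOn (fun y => SignType.sign (fderiv ℝ (transMap x₀ x₁) y).det) B :=
    fun y hy => ContinuousAt.comp_continuousWithinAt
      (continuousAt_sign_of_ne_zero (det_fderiv_transMap_ne_zero (hBs hy))) (hdet y hy)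
  have hs : ((SignType.sign (fderiv ℝ (transMap x₀ x₁) b).det : SignType) : ℝ) ≠ 0 := by
    rcases lt_or_gt_of_ne (det_fderiv_transMap_ne_zero (hBs hb)) with h | h
    · rw [sign_neg h]; simp
    · rw [sign_pos h]; simp
  refine ⟨(SignType.sign (fderiv ℝ (transMap x₀ x₁) b).det : SignType), hs, fun g => ?_⟩
  rw [integral_image_eq_integral_abs_det_fderiv_smul (s := B) (f := transMap x₀ x₁)
    (f' := fderiv ℝ (transMap x₀ x₁)) volume hB.measurableSet
    (fun y hy => (transMap_differentiableAt (hBs hy)).hasFDerivAt.hasFDerivWithinAt)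
    (fun y hy y' hy' h => by rw [← transMap_transMap (hBs hy), h, transMap_transMap (hBs hy')]),
    ← integral_const_mul]
  refine setIntegral_congr_fun hB.measurableSet fun y hy => ?_
  rw [hBc.constant hsgn hb hy, smul_eq_mul, ← mul_assoc, sign_mul_abs]

/-- Against a bump section with value `χ c`, each side integrates to the first variation of `lam`,
which is the same in both charts up to the Jacobian. The fundamental lemma makes the two sides equal
pointwise, with no direct computation of iterated total derivatives. -/
theorem eulerIn_transMap [T2Space M] (h : IsSmoothForm n m lam) (φ : Sec n m V) (c : Rn m)
    {y : Rn n} (hy : y ∈ overlap n m V x₀ x₁) :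
    eulerIn x₀ lam φ c y = (fderiv ℝ (transMap x₀ x₁) y).det *
      eulerIn x₁ lam φ (fibreTrans (V := V) x₀ x₁ y c) (transMap x₀ x₁ y) := by
  have hO := isOpen_overlap n m V x₀ x₁
  obtain ⟨R, hR, hball⟩ := Metric.isOpen_iff.1 hO y hy
  set B := Metric.ball y R with hBdef
  have hB : IsOpen B := Metric.isOpen_ball
  have hBs : B ⊆ coordTarget n m V x₀ := hball.trans inter_subset_left
  set T := transMap (n := n) x₀ x₁ with hT
  have hTc : ContDiffOn ℝ ∞ T B := (transMap_contDiffOn x₀ x₁).mono hball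
  have hTB : T '' B = overlap n m V x₁ x₀ ∩ transMap x₁ x₀ ⁻¹' B := by
    refine Subset.antisymm (image_subset_iff.2 fun z hz => ⟨transMap_mem (hball hz), ?_⟩)
      fun z hz => ⟨_, hz.2, transMap_transMap hz.1⟩
    rw [mem_preimage, transMap_transMap (hball hz)]
    exact hz
  have hTBo : IsOpen (T '' B) := by
    rw [hTB]
    exact isOpen_overlap_preimage hB x₁ x₀
  have hTBs : T '' B ⊆ coordTarget n m V x₁ := by
    rw [hTB]
    exact inter_subset_left.trans inter_subset_left
  obtain ⟨s, -, hs⟩ := exists_setIntegral_transMap (V := V) hB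
    (convex_ball y R).isPreconnected hball
  have h0 : ContinuousOn (eulerIn x₀ lam φ c) B :=
    (eulerIn_contDiffOn h x₀ φ contDiffOn_const hBs).continuousOn
  have h1 : ContinuousOn (fun y => (fderiv ℝ T y).det *
      eulerIn x₁ lam φ (fibreTrans (V := V) x₀ x₁ y c) (T y)) B := by
    refine (ContinuousLinearMap.continuous_det.comp_continuousOn
      (hTc.fderiv_of_isOpen hB (m := 0) (by simp)).continuousOn).mul ?_
    refine continuousOn_finsetSum _ fun a _ => ContinuousOn.mul ?_ ?_
    · exact ((contDiff_apply_euclidean a).comp_contDiffOn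
        (((fibreTrans_contDiffOn (V := V) x₀ x₁).mono hball).clm_apply
          contDiffOn_const)).continuousOn
    · exact (eulerCoord_scoef_contDiffOn h x₁ φ a).continuousOn.comp hTc.continuousOn
        fun z hz => hTBs ⟨z, hz, rfl⟩
  have key : EqOn (fun z => eulerIn x₀ lam φ c z - (fderiv ℝ T z).det *
      eulerIn x₁ lam φ (fibreTrans (V := V) x₀ x₁ z c) (T z)) 0 B := by
    refine eq_zero_of_integral_smul_eq_zero hB
      (h0.sub h1)
      fun χ hχ hcs hsub => ?_
    obtain ⟨η, e1, e2⟩ := exists_sec_bump (V := V) x₀ hχ hcs (hsub.trans hBs) c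
    have i1 := setIntegral_variation h φ η hB hBs hcs hsub
      fun y hy hyK => localSec_eq_zero e2 (hsub.trans hBs) (hBs hy) hyK
    have hη : ∀ z ∈ B, localSec n m x₁ η (T z) = χ z • fibreTrans (V := V) x₀ x₁ z c := fun z hz => by
      rw [hT, localSec_transMap η (hball hz), e1 z (hBs hz), map_smul]
    have i2 := setIntegral_variation (x₀ := x₁) h φ η hTBo hTBs
      (hcs.isCompact.image_of_continuousOn (hTc.continuousOn.mono hsub)) (image_mono hsub)
      fun z hz hzK => by
        obtain ⟨z, hz, rfl⟩ := hz
        rw [hη z hz, image_eq_zero_of_notMem_tsupport fun h => hzK ⟨z, h, rfl⟩, zero_smul]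
    have i3 : ∫ z in B, variation x₀ lam φ η z = ∫ z in B, (fderiv ℝ T z).det *
        variation x₁ lam φ η (T z) :=
      setIntegral_congr_fun hB.measurableSet fun z hz => variation_transMap h φ η (hball hz)
    -- The factor `s` is introduced and removed again, so the sign of the Jacobian plays no role.
    rw [hs, i2, ← hs, i1] at i3
    have i4 : ∫ z in B, χ z * (eulerIn x₀ lam φ c z - (fderiv ℝ T z).det *
      eulerIn x₁ lam φ (fibreTrans (V := V) x₀ x₁ z c) (T z)) = 0 := by
      have hint : ∀ {g : Rn n → ℝ}, ContinuousOn g B → IntegrableOn (fun z => χ z * g z) B :=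
        fun hg => integrableOn_of_compact hB.measurableSet hcs
          (hχ.continuous.continuousOn.mul hg) hsub fun z _ hzK => by
            rw [image_eq_zero_of_notMem_tsupport hzK, zero_mul]
      simp only [mul_sub]
      rw [integral_sub (hint h0) (hint h1), sub_eq_zero]
      refine Eq.trans ?_ (i3.trans ?_)
      · refine setIntegral_congr_fun hB.measurableSet fun z hz => ?_
        rw [e1 z (hBs hz), eulerIn_smul]
      · refine setIntegral_congr_fun hB.measurableSet fun z hz => ?_
        rw [hη z hz, eulerIn_smul]
        ring
    rw [← i4, ← setIntegral_eq_integral_of_forall_compl_eq_zero (s := B)]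
    intro z hz
    rw [image_eq_zero_of_notMem_tsupport fun h => hz (hsub h), zero_mul]
  exact sub_eq_zero.1 (key (Metric.mem_ball_self hR))

end EulerLagrange

section EulerForm
open MeasureTheory
variable {n m : ℕ} {M : Type*} [TopologicalSpace M] [ChartedSpace (Rn n) M]
  [IsManifold (𝓡 n) ∞ M]
  {V : M → Type*} [∀ x, AddCommGroup (V x)] [∀ x, Module ℝ (V x)] [∀ x, TopologicalSpace (V x)]
  [TopologicalSpace (TotalSpace (Rn m) V)] [FiberBundle (Rn m) V] [VectorBundle ℝ (Rn m) V]
  [ContMDiffVectorBundle ∞ (Rn m) V (𝓡 n)]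

variable {x₀ x₁ : M} {lam mu : HForm n m V n} {r : ℕ}

/-! ### The Euler-Lagrange form -/

theorem eulerCoord_scoef (h : IsSmoothForm n m lam) (a : Fin m) {z : JetCoord n m}
    (hz : z.1 ∈ coordTarget n m V x₀) :
    eulerCoord a (scoef x₀ lam) z = eulerCoord a (coordRep n m x₀ lam) z stdFrame := by
  obtain ⟨⟨r, hr⟩, -⟩ := h.coordRep x₀
  exact eulerCoord_clm (isOpen_coordTarget m V x₀) hr
    (ContinuousAlternatingMap.apply ℝ (Rn n) ℝ stdFrame) a hz

theorem toChart_euler_self (h : IsSmoothForm n m lam) (φ : Sec n m V) (x : M) (v : V x) :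
    toChart n x x (euler n m lam (jet n m φ x) v) stdFrame =
      eulerIn x lam φ ((trivializationAt (Rn m) V x).linearMapAt ℝ x v)
        (extChartAt (𝓡 n) x x) := by
  have hxx := mem_coordSource_self (n := n) (m := m) (V := V) x
  have h1 : euler n m lam (jet n m φ x) v = fromChart x x (∑ a : Fin m,
      (trivializationAt (Rn m) V x).linearMapAt ℝ x v a •
        eulerCoord a (coordRep n m x lam) (jetAt (localSec n m x φ) (extChartAt (𝓡 n) x x))) := by
    have : ∀ (s : Finset (Fin m)) (c : Fin m → ℝ) (β : Fin m → Rn n [⋀^Fin n]→L[ℝ] ℝ),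
        fromChart x x (∑ a ∈ s, c a • β a) = ∑ a ∈ s, c a • fromChart x x (β a) := by
      intro s c β
      classical
      induction s using Finset.induction_on with
      | empty => rfl
      | insert a s ha ih => rw [Finset.sum_insert ha, Finset.sum_insert ha, ← ih]; rfl
    rw [this]
    exact LinearMap.sum_apply _ _ _
  rw [h1, toChart_fromChart (mem_extChartAt_source hxx), eulerIn]
  have h2 : ∀ (β : Fin m → Rn n [⋀^Fin n]→L[ℝ] ℝ), (∑ a, β a) stdFrame = ∑ a, β a stdFrame :=
    fun β => map_sum (ContinuousAlternatingMap.apply ℝ (Rn n) ℝ stdFrame) β Finset.univ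
  rw [h2]
  exact Finset.sum_congr rfl fun a _ => by rw [eulerCoord_scoef h a (ext_mem hxx)]; rfl

variable [T2Space M]

/-- `euler` uses a different chart at every base point. Its invariance under coordinate changes
turns it into one formula on the whole patch at `x₀`, from which smoothness and linearity can be
read off. Points are written as images under the inverse chart to avoid rewriting in dependent
types. -/
theorem toChart_euler_symm (h : IsSmoothForm n m lam) (φ : Sec n m V) {y : Rn n}
    (hy : y ∈ coordTarget n m V x₀) (v : V ((extChartAt (𝓡 n) x₀).symm y)) :
    toChart n x₀ ((extChartAt (𝓡 n) x₀).symm y)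
      (euler n m lam (jet n m φ ((extChartAt (𝓡 n) x₀).symm y)) v) stdFrame =
      eulerIn x₀ lam φ ((trivializationAt (Rn m) V x₀).linearMapAt ℝ _ v) y := by
  have hxx := mem_coordSource_self (n := n) (m := m) (V := V) ((extChartAt (𝓡 n) x₀).symm y)
  have hyo : y ∈ overlap n m V x₀ ((extChartAt (𝓡 n) x₀).symm y) := ⟨hy, hxx⟩
  have h1 := toChart_trans (symm_mem hy) hxx
    (euler n m lam (jet n m φ ((extChartAt (𝓡 n) x₀).symm y)) v)
  refine (congrArg (fun β : Rn n [⋀^Fin n]→L[ℝ] ℝ => β stdFrame) h1).trans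
    ((topForm_comp_apply _ _).trans ?_)
  rw [eulerIn_transMap h φ _ hyo, ext_symm hy]
  congr 1
  refine (toChart_euler_self h φ _ v).trans ?_
  rw [← triv_eq_linearMapAt (symm_mem hy), fibreTrans_apply hyo, triv_eq_linearMapAt hxx]
  rfl

theorem toChart_euler (h : IsSmoothForm n m lam) (φ : Sec n m V) {x : M}
    (hx : x ∈ coordSource n m V x₀) (v : V x) :
    toChart n x₀ x (euler n m lam (jet n m φ x) v) stdFrame =
      eulerIn x₀ lam φ ((trivializationAt (Rn m) V x₀).linearMapAt ℝ x v)
        (extChartAt (𝓡 n) x₀ x) := by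
  obtain ⟨y, hy, rfl⟩ : ∃ y ∈ coordTarget n m V x₀, (extChartAt (𝓡 n) x₀).symm y = x :=
    ⟨_, ext_mem hx, symm_ext hx⟩
  rw [toChart_euler_symm h φ hy, ext_symm hy]

theorem topForm_eq_of_toChart {x : M} (hx : x ∈ coordSource n m V x₀)
    {β β' : TangentSpace (𝓡 n) x [⋀^Fin n]→L[ℝ] ℝ}
    (h : toChart n x₀ x β stdFrame = toChart n x₀ x β' stdFrame) : β = β' :=
  toChart_injective (mem_extChartAt_source hx) (topForm_ext h)

theorem euler_eq_zero_iff (h : IsSmoothForm n m lam) (φ : Sec n m V) {x : M}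
    (hx : x ∈ coordSource n m V x₀) : euler n m lam (jet n m φ x) = 0 ↔
      ∀ c, eulerIn x₀ lam φ c (extChartAt (𝓡 n) x₀ x) = 0 := by
  constructor
  · intro h0 c
    have h1 := toChart_euler h φ hx ((trivializationAt (Rn m) V x₀).symmₗ ℝ x c)
    rw [Trivialization.linearMapAt_symmₗ _ hx.2] at h1
    rw [← h1, h0]
    rfl
  · intro h0
    ext1 v
    refine topForm_eq_of_toChart hx ?_
    exact (toChart_euler h φ hx v).trans (h0 _)

theorem isSmoothSource_euler (h : IsSmoothForm n m lam) :
    IsSmoothSource n m (euler n m lam) := by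
  intro a
  obtain ⟨r, hr⟩ := isSmoothForm_iff.1 h
  refine ⟨r + r, fun x₀ => ?_⟩
  obtain ⟨p, hp, hrep⟩ := hr x₀
  have hU := isOpen_coordTarget (n := n) m V x₀
  refine ⟨eulerCoord a p, hp.eulerCoord hU a, fun x hx φ => topForm_ext ?_⟩
  rw [toChart_euler h φ hx, Trivialization.linearMapAt_symmₗ _ hx.2, eulerIn,
    Finset.sum_eq_single a (fun b _ hb => by simp [hb]) (fun h => absurd (Finset.mem_univ a) h),
    eulerCoord_scoef h a (ext_mem hx)]
  rw [eulerCoord_congr hU (hrep.coordRep_eq h hp subset_rfl) a (ext_mem hx)]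
  simp [jetCoordAt_eq]

theorem eulerIn_add (h : IsSmoothForm n m lam) (h' : IsSmoothForm n m mu) (φ : Sec n m V)
    (c : Rn m) {y : Rn n} (hy : y ∈ coordTarget n m V x₀) :
    eulerIn x₀ (lam + mu) φ c y = eulerIn x₀ lam φ c y + eulerIn x₀ mu φ c y := by
  have hU := isOpen_coordTarget (n := n) m V x₀
  obtain ⟨r, hr⟩ := scoef_smooth h x₀
  obtain ⟨s, hs⟩ := scoef_smooth h' x₀
  simp only [eulerIn, ← Finset.sum_add_distrib, ← mul_add]
  refine Finset.sum_congr rfl fun a _ => ?_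
  rw [← eulerCoord_add hU hr hs a (z := jetAt (localSec n m x₀ φ) y) hy]
  congr 1
  refine eulerCoord_congr hU (fun z hz => ?_) a hy
  rw [scoef, coordRep_add h h' x₀ z hz]
  rfl

theorem eulerIn_smul_form (h : IsSmoothForm n m lam) (t : ℝ) (φ : Sec n m V)
    (c : Rn m) {y : Rn n} (hy : y ∈ coordTarget n m V x₀) :
    eulerIn x₀ (t • lam) φ c y = t * eulerIn x₀ lam φ c y := by
  have hU := isOpen_coordTarget (n := n) m V x₀
  obtain ⟨r, hr⟩ := scoef_smooth h x₀
  rw [eulerIn, eulerIn, Finset.mul_sum]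
  refine Finset.sum_congr rfl fun a _ => ?_
  rw [mul_left_comm]
  have h1 := eulerCoord_clm hU hr (t • ContinuousLinearMap.id ℝ ℝ) a
    (z := jetAt (localSec n m x₀ φ) y) hy
  congr 1
  refine Eq.trans ?_ h1
  refine eulerCoord_congr hU (fun z hz => ?_) a hy
  rw [scoef, coordRep_smul h t x₀ z hz]
  rfl

theorem pullSec_congr {k : ℕ} (α : HForm n m V k) {φ φ' : Sec n m V} {x : M}
    (h : jet n m φ x = jet n m φ' x) : pullSec n m φ α x = pullSec n m φ' α x := by
  have h' : Quotient.mk (jetSetoid n m V x) φ = Quotient.mk (jetSetoid n m V x) φ' :=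
    Quotient.sound (jet_eq_iff.1 h)
  have key : ∀ q q' : Quotient (jetSetoid n m V x), q = q' →
      (α ⟨x, q⟩ : TangentSpace (𝓡 n) x [⋀^Fin k]→L[ℝ] ℝ) = α ⟨x, q'⟩ := by
    rintro q _ rfl
    rfl
  exact key _ _ h'

theorem source_ext {η η' : SourceForm n m V}
    (h : ∀ (φ : Sec n m V) (x : M), η (jet n m φ x) = η' (jet n m φ x)) : η = η' := by
  funext θ
  obtain ⟨φ, e⟩ := exists_jet_eq θ
  have := h φ θ.1
  rwa [e] at this

theorem euler_add (h : IsSmoothForm n m lam) (h' : IsSmoothForm n m mu) :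
    euler n m (lam + mu) = euler n m lam + euler n m mu := by
  refine source_ext fun φ x => ?_
  have hxx := mem_coordSource_self (n := n) (m := m) (V := V) x
  ext1 v
  refine topForm_eq_of_toChart hxx ?_
  change _ = toChart n x x (euler n m lam (jet n m φ x) v) stdFrame +
    toChart n x x (euler n m mu (jet n m φ x) v) stdFrame
  refine (toChart_euler (h.add h') φ hxx v).trans ((eulerIn_add h h' φ _ (ext_mem hxx)).trans ?_)
  exact (congrArg₂ (· + ·) (toChart_euler h φ hxx v) (toChart_euler h' φ hxx v)).symm

theorem euler_smul (h : IsSmoothForm n m lam) (t : ℝ) :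
    euler n m (t • lam) = t • euler n m lam := by
  refine source_ext fun φ x => ?_
  have hxx := mem_coordSource_self (n := n) (m := m) (V := V) x
  ext1 v
  refine topForm_eq_of_toChart hxx ?_
  change _ = t * toChart n x x (euler n m lam (jet n m φ x) v) stdFrame
  refine (toChart_euler (h.smul t) φ hxx v).trans
    ((eulerIn_smul_form h t φ _ (ext_mem hxx)).trans ?_)
  exact (congrArg (t * ·) (toChart_euler h φ hxx v)).symm

theorem eulerIn_eq_zero_of_stationary (h : IsSmoothForm n m lam) (φ : Sec n m V) {B : Set (Rn n)}
    (hB : IsOpen B) (hBs : B ⊆ coordTarget n m V x₀)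
    (hst : ∀ (η : Sec n m V) (K : Set (Rn n)), IsCompact K → K ⊆ B →
      (∀ x ∉ (extChartAt (𝓡 n) x₀).symm '' K, η x = 0) → ∀ t : ℝ,
        ∫ y in B, (coef x₀ (pullSec n m (φ + t • η) lam) y - coef x₀ (pullSec n m φ lam) y) = 0)
    (c : Rn m) {y : Rn n} (hy : y ∈ B) : eulerIn x₀ lam φ c y = 0 := by
  refine eulerIn_eq_zero h φ hB hBs (fun η K hK hKB h0 => ?_) c hy
  obtain ⟨r, hr⟩ := scoef_smooth h x₀
  refine setIntegral_lineDeriv_eq_zero hB (hr.mono_set hBs) ((localSec_contDiffOn φ x₀).mono hBs)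
    ((localSec_contDiffOn η x₀).mono hBs) hK hKB
    (fun y hy hyK => localSec_eq_zero h0 (hKB.trans hBs) (hBs hy) hyK) fun t => ?_
  rw [← hst η K hK hKB h0 t]
  refine setIntegral_congr_fun hB.measurableSet fun y hy => ?_
  rw [coef_pullSec h _ (hBs hy), coef_pullSec h _ (hBs hy),
    jetAt_localSec_add_smul φ η t (hBs hy)]

/-- If the first variation of `lam` at `φ` vanishes identically near `x`, then `E(lam)` vanishes
there. -/
theorem euler_eq_zero_of_deriv (h : IsSmoothForm n m lam) (φ : Sec n m V) {x : M}
    (hd : ∀ᶠ x' in 𝓝 x, ∀ η : Sec n m V, HasDerivAt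
      (fun t : ℝ => toChart n x x' (pullSec n m (φ + t • η) lam x') stdFrame) 0 0) :
    euler n m lam (jet n m φ x) = 0 := by
  have hxx := mem_coordSource_self (n := n) (m := m) (V := V) x
  rw [euler_eq_zero_iff h φ hxx]
  have hc := continuousAt_symm (ext_mem hxx)
  rw [ContinuousAt, symm_ext hxx] at hc
  obtain ⟨B, hBs, hB, hyB⟩ := mem_nhds_iff.1 ((hc.eventually hd).and
    ((isOpen_coordTarget m V x).mem_nhds (ext_mem hxx)))
  refine fun c => eulerIn_eq_zero h φ hB (fun y hy => (hBs hy).2) (fun η K _ _ _ => ?_) c hyB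
  refine setIntegral_eq_zero_of_forall_eq_zero fun y hy => ?_
  rw [variation_eq_deriv h φ η (hBs hy).2]
  exact ((hBs hy).1 η).deriv

theorem isContForm_pullSec (h : IsSmoothForm n m lam) (φ : Sec n m V) :
    IsContForm (pullSec n m φ lam) := by
  refine isContForm_of_continuousAt fun x => ?_
  have hxx := mem_coordSource_self (n := n) (m := m) (V := V) x
  exact ((contDiff_alternating_apply stdFrame).comp_contDiffOn
    (formIn_symm_contDiffOn h x φ)).continuousOn.continuousAt
      ((isOpen_coordTarget m V x).mem_nhds (ext_mem hxx))

theorem CompactSec.add_smul {φ η : Sec n m V} (hφ : CompactSec n m φ) (hη : CompactSec n m η)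
    (t : ℝ) : CompactSec n m (φ + t • η) := by
  obtain ⟨K, hK, h⟩ := hφ
  obtain ⟨K', hK', h'⟩ := hη
  refine ⟨K ∪ K', hK.union hK', fun x hx => ?_⟩
  rw [mem_union, not_or] at hx
  change φ x + t • η x = 0
  rw [h x hx.1, h' x hx.2, smul_zero, add_zero]

/-- A local functional that is constant determines an Euler-Lagrange form that vanishes. -/
theorem euler_eq_zero_of_functional [SigmaCompactSpace M]
    {ν : ∀ x : M, TangentSpace (𝓡 n) x [⋀^Fin n]→L[ℝ] ℝ} (hν : IsVolumeForm n ν)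
    (h : IsCompactForm n m lam)
    (h0 : ∀ φ : Sec n m V, CompactSec n m φ → functional n m ν lam φ = 0) :
    euler n m lam = 0 := by
  refine source_ext fun φ' x => ?_
  obtain ⟨φ, hφ, e⟩ := exists_compactSec_jet φ' x
  rw [← jet_eq_of_eventuallyEq e]
  have hxx := mem_coordSource_self (n := n) (m := m) (V := V) x
  refine (euler_eq_zero_iff h.1 φ hxx).2 fun c => ?_
  obtain ⟨R, hR, hball⟩ := Metric.isOpen_iff.1 (isOpen_coordTarget (n := n) m V x) _ (ext_mem hxx)
  obtain ⟨s, hs, hI⟩ := exists_formIntegral_eq hν (x₀ := x) (convex_ball _ R).isPreconnected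
    Metric.isOpen_ball.measurableSet fun y hy => (hball hy).1
  refine eulerIn_eq_zero_of_stationary h.1 φ Metric.isOpen_ball hball
    (fun η K hK hKB hη t => ?_) c (Metric.mem_ball_self hR)
  have hη' : CompactSec n m η := CompactSec.of_image hK (hKB.trans hball) hη
  have hφt := hφ.add_smul hη' t
  have c1 := isContForm_pullSec h.1 (φ + t • η)
  have c2 := (isContForm_pullSec h.1 φ).smul (-1)
  obtain ⟨K₁, hK₁, z₁⟩ := h.2 _ hφt
  obtain ⟨K₂, hK₂, z₂⟩ := h.2 _ hφ
  -- Neither pullback is supported in the chart, but their difference is, because `φ` and `φ + t •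
  -- η` have the same jets off the support of `η`. Its integral is therefore an integral over the
  -- coordinate ball.
  have hsum := formIntegral_add hν c1 c2 hK₁ z₁ hK₂ fun x hx => by
    change (-1 : ℝ) • pullSec n m φ lam x = 0
    rw [z₂ x hx, smul_zero]
  have f1 : formIntegral n ν (pullSec n m (φ + t • η) lam) = 0 := h0 _ hφt
  have f2 : formIntegral n ν (pullSec n m φ lam) = 0 := h0 _ hφ
  rw [formIntegral_smul, f1, f2, mul_zero, add_zero, hI _ (c1.add c2) K hKB hK] at hsum
  · have := (mul_eq_zero.1 hsum).resolve_left hs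
    rw [← this]
    refine setIntegral_congr_fun Metric.isOpen_ball.measurableSet fun y _ => ?_
    rw [coef_add, sub_eq_add_neg]
    congr 1
    change _ = (-1 : ℝ) * coef x (pullSec n m φ lam) y
    ring
  · intro x' hx'
    have hcl : IsClosed ((extChartAt (𝓡 n) x).symm '' K) :=
      (hK.image_of_continuousOn fun y hy =>
        (continuousAt_symm (hball (hKB hy))).continuousWithinAt).isClosed
    have hj : jet n m (φ + t • η) x' = jet n m φ x' := by
      refine jet_eq_of_eventuallyEq ?_
      filter_upwards [hcl.isOpen_compl.mem_nhds hx'] with z hz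
      change φ z + t • η z = φ z
      rw [hη z hz, smul_zero, add_zero]
    change pullSec n m (φ + t • η) lam x' + (-1 : ℝ) • pullSec n m φ lam x' = 0
    rw [pullSec_congr lam hj]
    ext v
    change _ + (-1 : ℝ) * _ = (0 : ℝ)
    ring

end EulerForm

/-! ### Stokes' theorem and the Euler-Lagrange operator on exact forms -/

section EulerDH
open MeasureTheory
variable {n m : ℕ} {M : Type*} [TopologicalSpace M] [ChartedSpace (Rn n) M]
  [IsManifold (𝓡 n) ∞ M]
  {V : M → Type*} [∀ x, AddCommGroup (V x)] [∀ x, Module ℝ (V x)] [∀ x, TopologicalSpace (V x)]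
  [TopologicalSpace (TotalSpace (Rn m) V)] [FiberBundle (Rn m) V] [VectorBundle ℝ (Rn m) V]
  [ContMDiffVectorBundle ∞ (Rn m) V (𝓡 n)]

variable {k : ℕ}

/-- Stokes' theorem for forms on `ℝⁿ` with compact support in an open set. -/
theorem setIntegral_extDeriv_eq_zero {U K : Set (Rn (k + 1))} (hU : IsOpen U) (hK : IsCompact K)
    (hKU : K ⊆ U) {F : Rn (k + 1) → Rn (k + 1) [⋀^Fin k]→L[ℝ] ℝ} (hF : ContDiffOn ℝ ∞ F U)
    (h0 : ∀ y ∈ U, y ∉ K → F y = 0) : ∫ y in U, extDeriv F y stdFrame = 0 := by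
  have hs : ∀ i : Fin (k + 1), ContDiffOn ℝ ∞ (fun y => F y (i.removeNth stdFrame)) U := fun i =>
    (contDiff_alternating_apply _).comp_contDiffOn hF
  have h1 : ∀ y ∈ U, extDeriv F y stdFrame =
      ∑ i : Fin (k + 1), (-1 : ℝ) ^ (i : ℕ) * pd i (fun y => F y (i.removeNth stdFrame)) y := by
    intro y hy
    rw [extDeriv_apply ((hF.contDiffAt (hU.mem_nhds hy)).differentiableAt (by simp))]
    refine Finset.sum_congr rfl fun i _ => ?_
    rw [pd]
    simp
  rw [setIntegral_congr_fun hU.measurableSet h1, integral_finsetSum]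
  · refine Finset.sum_eq_zero fun i _ => ?_
    rw [integral_const_mul, setIntegral_pd_eq_zero hU hK hKU (hs i)
      (fun y hy hyK => by rw [h0 y hy hyK]; rfl) i, mul_zero]
  · intro i _
    refine Integrable.const_mul ?_ _
    refine integrableOn_of_compact hU.measurableSet hK (pd_contDiffOn hU (hs i) i).continuousOn hKU ?_
    intro y hy hyK
    have : (fun y => F y (i.removeNth stdFrame)) =ᶠ[𝓝 y] fun _ => 0 := by
      filter_upwards [hU.mem_nhds hy, hK.isClosed.isOpen_compl.mem_nhds hyK] with z hz hzK
      rw [h0 z hz hzK]; rfl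
    rw [pd, this.fderiv_eq]
    simp

theorem jet_add_smul_eq_of_image [T2Space M] (φ : Sec n m V) {η : Sec n m V} {x₀ : M}
    {K : Set (Rn n)} (hK : IsCompact K) (hKs : K ⊆ coordTarget n m V x₀)
    (hη : ∀ x ∉ (extChartAt (𝓡 n) x₀).symm '' K, η x = 0) (t : ℝ) {x : M}
    (hx : x ∉ (extChartAt (𝓡 n) x₀).symm '' K) :
    jet n m (φ + t • η) x = jet n m φ x := by
  have hcl : IsClosed ((extChartAt (𝓡 n) x₀).symm '' K) :=
    (hK.image_of_continuousOn fun y hy =>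
      (continuousAt_symm (hKs hy)).continuousWithinAt).isClosed
  refine jet_eq_of_eventuallyEq ?_
  filter_upwards [hcl.isOpen_compl.mem_nhds hx] with z hz
  change φ z + t • η z = φ z
  rw [hη z hz, smul_zero, add_zero]

end EulerDH

section EulerDH
open MeasureTheory
variable {k m : ℕ} {M : Type*} [TopologicalSpace M] [ChartedSpace (Rn (k + 1)) M]
  [IsManifold (𝓡 (k + 1)) ∞ M]
  {V : M → Type*} [∀ x, AddCommGroup (V x)] [∀ x, Module ℝ (V x)] [∀ x, TopologicalSpace (V x)]
  [TopologicalSpace (TotalSpace (Rn m) V)] [FiberBundle (Rn m) V] [VectorBundle ℝ (Rn m) V]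
  [ContMDiffVectorBundle ∞ (Rn m) V (𝓡 (k + 1))]

/-- The Euler-Lagrange operator vanishes on exact horizontal forms. -/
theorem euler_dH [T2Space M] {γ : HForm (k + 1) m V k} (h : IsSmoothForm (k + 1) m γ) :
    euler (k + 1) m (dH (k + 1) m γ) = 0 := by
  refine source_ext fun φ x => ?_
  have hxx := mem_coordSource_self (n := k + 1) (m := m) (V := V) x
  have hU := isOpen_coordTarget (n := k + 1) m V x
  refine (euler_eq_zero_iff h.dH φ hxx).2 fun c => ?_
  refine eulerIn_eq_zero_of_stationary h.dH φ hU subset_rfl (fun η K hK hKU hη t => ?_) c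
    (ext_mem hxx)
  set F : Sec (k + 1) m V → Rn (k + 1) → Rn (k + 1) [⋀^Fin k]→L[ℝ] ℝ :=
    fun φ y => formIn x γ ((extChartAt (𝓡 (k + 1)) x).symm y) φ
  have hF : ∀ φ, ContDiffOn ℝ ∞ (F φ) (coordTarget (k + 1) m V x) := formIn_symm_contDiffOn h x
  have hc : ∀ φ, ∀ y ∈ coordTarget (k + 1) m V x,
      coef x (pullSec (k + 1) m φ (dH (k + 1) m γ)) y = extDeriv (F φ) y stdFrame := by
    intro φ y hy
    have := formIn_dH h (symm_mem hy) φ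
    rw [ext_symm hy] at this
    exact congrArg (fun β : Rn (k + 1) [⋀^Fin (k + 1)]→L[ℝ] ℝ => β stdFrame) this
  -- A variation supported in `K` changes the pullback of `γ` only over `K`, so the change of `d_H
  -- γ` integrates to zero by Stokes and every section is stationary.
  rw [← setIntegral_extDeriv_eq_zero hU hK hKU ((hF (φ + t • η)).sub (hF φ))]
  · refine setIntegral_congr_fun hU.measurableSet fun y hy => ?_
    have hd := fun φ => ((hF φ).contDiffAt (hU.mem_nhds hy)).differentiableAt
      (by simp : (∞ : WithTop ℕ∞) ≠ 0)
    rw [hc _ y hy, hc _ y hy, extDeriv, extDeriv, extDeriv, fderiv_fun_sub (hd _) (hd _)]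
    have := map_sub (ContinuousAlternatingMap.alternatizeUncurryFinCLM ℝ (Rn (k + 1)) ℝ (n := k))
      (fderiv ℝ (F (φ + t • η)) y) (fderiv ℝ (F φ) y)
    simp only [ContinuousAlternatingMap.alternatizeUncurryFinCLM_apply] at this
    rw [this]
    rfl
  · intro y hy hyK
    have hx : (extChartAt (𝓡 (k + 1)) x).symm y ∉ (extChartAt (𝓡 (k + 1)) x).symm '' K := by
      rintro ⟨y', hy', e⟩
      have := congrArg (extChartAt (𝓡 (k + 1)) x) e
      rw [ext_symm (hKU hy'), ext_symm hy] at this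
      exact hyK (this ▸ hy')
    have hj := jet_add_smul_eq_of_image φ hK hKU hη t hx
    change F _ y - F _ y = 0
    rw [sub_eq_zero]
    exact congrArg (toChart (k + 1) x _) (pullSec_congr γ hj)

end EulerDH

section ChartForms
open MeasureTheory
variable {n m : ℕ} {M : Type*} [TopologicalSpace M] [ChartedSpace (Rn n) M]
  [IsManifold (𝓡 n) ∞ M]
  {V : M → Type*} [∀ x, AddCommGroup (V x)] [∀ x, Module ℝ (V x)] [∀ x, TopologicalSpace (V x)]
  [TopologicalSpace (TotalSpace (Rn m) V)] [FiberBundle (Rn m) V] [VectorBundle ℝ (Rn m) V]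
  [ContMDiffVectorBundle ∞ (Rn m) V (𝓡 n)]

variable {k r s : ℕ} {x₀ : M}

/-! ### Forms of fixed order, forms supported in a chart -/

/-- The standard volume form on `ℝⁿ`. -/
def stdTop (n : ℕ) : Rn n [⋀^Fin n]→L[ℝ] ℝ :=
  haveI : Fact (Module.finrank ℝ (Rn n) = n) := ⟨by simp⟩
  -- The bound is Hadamard's inequality, with constant `1`.
  ((EuclideanSpace.basisFun (Fin n) ℝ).toBasis.det).mkContinuous 1 fun v => by
    rw [← Orientation.volumeForm_robust _ (EuclideanSpace.basisFun (Fin n) ℝ) rfl, one_mul]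
    exact Orientation.abs_volumeForm_apply_le _ v

theorem stdTop_stdFrame : stdTop n stdFrame = 1 := by
  have h : (stdFrame : Fin n → Rn n) = (EuclideanSpace.basisFun (Fin n) ℝ).toBasis := by
    funext i
    simp
  change (EuclideanSpace.basisFun (Fin n) ℝ).toBasis.det stdFrame = 1
  rw [h, Module.Basis.det_self]

theorem exists_isOpen_coord {P : M → Prop} {x : M} (h : ∀ᶠ x' in 𝓝 x, P x')
    (hx : x ∈ coordSource n m V x₀) :
    ∃ U, IsOpen U ∧ extChartAt (𝓡 n) x₀ x ∈ U ∧ U ⊆ coordTarget n m V x₀ ∧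
      ∀ y ∈ U, P ((extChartAt (𝓡 n) x₀).symm y) := by
  have hc := continuousAt_symm (ext_mem hx)
  rw [ContinuousAt, symm_ext hx] at hc
  obtain ⟨B, hBs, hB, hyB⟩ := mem_nhds_iff.1 ((hc.eventually h).and
    ((isOpen_coordTarget m V x₀).mem_nhds (ext_mem hx)))
  exact ⟨B, hB, hyB, fun y hy => (hBs hy).2, fun y hy => (hBs hy).1⟩

variable {α β : HForm n m V k}

theorem IsSmoothFormOfOrder.zero : IsSmoothFormOfOrder r (0 : HForm n m V k) :=
  fun _ => ⟨fun _ => 0, SmoothOfOrder.const 0, fun _ _ _ => rfl⟩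

theorem IsSmoothFormOfOrder.add (hα : IsSmoothFormOfOrder r α) (hβ : IsSmoothFormOfOrder r β) :
    IsSmoothFormOfOrder r (α + β) := by
  intro x₀
  obtain ⟨p, hp, h⟩ := hα x₀
  obtain ⟨q, hq, h'⟩ := hβ x₀
  exact ⟨fun z => p z + q z, hp.add hq, fun y hy φ => congrArg₂ (· + ·) (h y hy φ) (h' y hy φ)⟩

theorem IsSmoothFormOfOrder.sum {ι : Type*} (t : Finset ι) {α : ι → HForm n m V k}
    (h : ∀ i ∈ t, IsSmoothFormOfOrder r (α i)) : IsSmoothFormOfOrder r (∑ i ∈ t, α i) := by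
  classical
  induction t using Finset.induction_on with
  | empty => exact .zero
  | insert i t hi ih =>
    rw [Finset.sum_insert hi]
    exact (h i (Finset.mem_insert_self i t)).add
      (ih fun j hj => h j (Finset.mem_insert_of_mem hj))

/-- A form that agrees near each point with a form of order `r` is of order `r`. -/
theorem IsSmoothFormOfOrder.of_eventuallyEq [T2Space M]
    (h : ∀ x : M, ∃ β : HForm n m V k, IsSmoothFormOfOrder r β ∧
      ∀ᶠ x' in 𝓝 x, ∀ φ : Sec n m V, pullSec n m φ α x' = pullSec n m φ β x') :
    IsSmoothFormOfOrder r α := by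
  refine isSmoothFormOfOrder_of_locally r fun x => ?_
  have hxx := mem_coordSource_self (n := n) (m := m) (V := V) x
  obtain ⟨β, hβ, e⟩ := h x
  obtain ⟨p, hp, hrep⟩ := hβ x
  obtain ⟨U, hU, hxU, hUs, hUe⟩ := exists_isOpen_coord e hxx
  refine ⟨x, hxx, U, hU, hxU, p, hp.mono_set hUs, fun y hy φ => ?_⟩
  exact (congrArg (toChart n x _) (hUe y hy φ)).trans (hrep y (hUs hy) φ)

theorem IsSmoothFormOfOrder.coordRep [T2Space M] (h : IsSmoothFormOfOrder r α) (x₀ : M) :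
    SmoothOfOrder r (coordTarget n m V x₀) (coordRep n m x₀ α) := by
  obtain ⟨p, hp, hrep⟩ := h x₀
  exact hp.congr fun y hy u => hrep.coordRep_eq h.isSmoothForm hp subset_rfl (y, u) hy

theorem IsSmoothFormOfOrder.scoef [T2Space M] {lam : HForm n m V n} (h : IsSmoothFormOfOrder r lam)
    (x₀ : M) : SmoothOfOrder r (coordTarget n m V x₀) (scoef x₀ lam) :=
  (h.coordRep x₀).compContDiff (contDiff_alternating_apply stdFrame)

/-- The product of a horizontal form with a function on the base. -/
def baseSmul (χ : M → ℝ) (α : HForm n m V k) : HForm n m V k := fun θ => χ θ.1 • α θ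

theorem contDiffOn_comp_symm {χ : M → ℝ} (hχ : ContMDiff (𝓡 n) 𝓘(ℝ) ∞ χ) (x₀ : M) :
    ContDiffOn ℝ ∞ (fun y => χ ((extChartAt (𝓡 n) x₀).symm y)) (coordTarget n m V x₀) := by
  intro y hy
  have h1 : ContMDiffAt 𝓘(ℝ, Rn n) 𝓘(ℝ) ∞ (fun y => χ ((extChartAt (𝓡 n) x₀).symm y)) y :=
    (hχ _).comp y (contMDiffAt_symm hy)
  exact (contMDiffAt_iff_contDiffAt.1 h1).contDiffWithinAt

theorem IsSmoothFormOfOrder.baseSmul {χ : M → ℝ} (hχ : ContMDiff (𝓡 n) 𝓘(ℝ) ∞ χ)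
    (h : IsSmoothFormOfOrder r α) : IsSmoothFormOfOrder r (baseSmul χ α) := by
  intro x₀
  obtain ⟨p, hp, hrep⟩ := h x₀
  refine ⟨fun z => χ ((extChartAt (𝓡 n) x₀).symm z.1) • p z,
    (SmoothOfOrder.of_base (contDiffOn_comp_symm hχ x₀)).smul hp, fun y hy φ => ?_⟩
  exact congrArg (χ ((extChartAt (𝓡 n) x₀).symm y) • ·) (hrep y hy φ)

theorem IsSmoothForm.baseSmul {χ : M → ℝ} (hχ : ContMDiff (𝓡 n) 𝓘(ℝ) ∞ χ)
    (h : IsSmoothForm n m α) : IsSmoothForm n m (baseSmul χ α) := by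
  obtain ⟨r, hr⟩ := isSmoothForm_iff.1 h
  exact IsSmoothFormOfOrder.isSmoothForm (IsSmoothFormOfOrder.baseSmul hχ hr)

/-- The form with coefficients `p` in the coordinates at `x₀`, extended by zero. -/
def chartForm (x₀ : M) (p : JetCoord n m → Rn n [⋀^Fin k]→L[ℝ] ℝ) : HForm n m V k := fun θ =>
  open Classical in
  if θ.1 ∈ coordSource n m V x₀ then
    fromChart x₀ θ.1 (p (jetCoordAt n m x₀ (Quotient.out θ.2) θ.1))
  else 0

variable {p : JetCoord n m → Rn n [⋀^Fin k]→L[ℝ] ℝ}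

/-- The section chosen by `Quotient.out` is irrelevant: equal jets have equal coordinates in every
chart. -/
theorem pullSec_chartForm (φ : Sec n m V) {x : M} (hx : x ∈ coordSource n m V x₀) :
    pullSec n m φ (chartForm x₀ p) x =
      fromChart x₀ x (p (jetAt (localSec n m x₀ φ) (extChartAt (𝓡 n) x₀ x))) := by
  refine (if_pos hx).trans ?_
  have hj : jet n m (Quotient.out (Quotient.mk (jetSetoid n m V x) φ)) x = jet n m φ x :=
    jet_eq_iff.2 (Quotient.exact (Quotient.out_eq _))
  have := jetAt_eq_of_jet_eq hj hx
  rw [jetCoordAt_eq]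
  exact congrArg (fun z => fromChart x₀ x (p z)) this

theorem repOn_chartForm : RepOn x₀ (coordTarget n m V x₀)
    (formIn x₀ (chartForm x₀ p : HForm n m V k)) p := by
  intro y hy φ
  rw [formIn, pullSec_chartForm φ (symm_mem hy), toChart_fromChart
    (mem_extChartAt_source (symm_mem hy)), ext_symm hy]

theorem pullSec_chartForm_eq_zero {K : Set (Rn n)}
    (h0 : ∀ z : JetCoord n m, z.1 ∈ coordTarget n m V x₀ → z.1 ∉ K → p z = 0) (φ : Sec n m V)
    {x : M} (hx : x ∉ (extChartAt (𝓡 n) x₀).symm '' K) :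
    pullSec n m φ (chartForm x₀ p) x = 0 := by
  by_cases hxs : x ∈ coordSource n m V x₀
  · rw [pullSec_chartForm φ hxs, h0 _ (ext_mem hxs) fun h => hx ⟨_, h, symm_ext hxs⟩]
    rfl
  · exact if_neg hxs

theorem isCompact_image_symm [T2Space M] {K : Set (Rn n)} (hK : IsCompact K)
    (hKs : K ⊆ coordTarget n m V x₀) : IsCompact ((extChartAt (𝓡 n) x₀).symm '' K) :=
  hK.image_of_continuousOn fun _ hy => (continuousAt_symm (hKs hy)).continuousWithinAt

theorem isSmoothFormOfOrder_chartForm [T2Space M] {K : Set (Rn n)} (hK : IsCompact K)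
    (hKs : K ⊆ coordTarget n m V x₀) (hp : SmoothOfOrder r (coordTarget n m V x₀) p)
    (h0 : ∀ z : JetCoord n m, z.1 ∈ coordTarget n m V x₀ → z.1 ∉ K → p z = 0) :
    IsSmoothFormOfOrder r (chartForm x₀ p : HForm n m V k) := by
  refine isSmoothFormOfOrder_of_locally r fun x => ?_
  by_cases hxs : x ∈ coordSource n m V x₀
  · exact ⟨x₀, hxs, _, isOpen_coordTarget m V x₀, ext_mem hxs, p, hp, repOn_chartForm⟩
  · have hxx := mem_coordSource_self (n := n) (m := m) (V := V) x
    have hx : x ∉ (extChartAt (𝓡 n) x₀).symm '' K := by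
      rintro ⟨y, hy, rfl⟩
      exact hxs (symm_mem (hKs hy))
    obtain ⟨U, hU, hxU, hUs, hUe⟩ := exists_isOpen_coord
      ((isCompact_image_symm hK hKs).isClosed.isOpen_compl.eventually_mem hx) hxx
    refine ⟨x, hxx, U, hU, hxU, fun _ => 0, SmoothOfOrder.const 0, fun y hy φ => ?_⟩
    exact (congrArg (toChart n x _) (pullSec_chartForm_eq_zero h0 φ (hUe y hy))).trans
      (toChart_zero _ _)

/-! ### Forms with compact support in the base -/

theorem isCompactForm_of_support (hα : IsSmoothForm n m α) {K : Set M} (hK : IsCompact K)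
    (h0 : ∀ φ : Sec n m V, ∀ x ∉ K, pullSec n m φ α x = 0) : IsCompactForm n m α :=
  ⟨hα, fun φ _ => ⟨K, hK, h0 φ⟩⟩

variable {lam mu : HForm n m V n}

theorem euler_eq_zero_of_eventually [T2Space M] (h : IsSmoothForm n m lam) (φ : Sec n m V) {x : M}
    (h0 : ∀ᶠ x' in 𝓝 x, ∀ φ : Sec n m V, pullSec n m φ lam x' = 0) :
    euler n m lam (jet n m φ x) = 0 := by
  refine euler_eq_zero_of_deriv h φ ?_
  filter_upwards [h0] with x' hx' η
  have : (fun t : ℝ => toChart n x x' (pullSec n m (φ + t • η) lam x') stdFrame) =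
      fun _ => 0 := by
    funext t
    rw [hx']
    rfl
  rw [this]
  exact hasDerivAt_const 0 0

theorem isCompactTop_of_support [T2Space M] (hα : IsSmoothForm n m lam) {K : Set M}
    (hK : IsCompact K) (h0 : ∀ φ : Sec n m V, ∀ x ∉ K, pullSec n m φ lam x = 0) :
    IsCompactTop n m lam :=
  ⟨isCompactForm_of_support hα hK h0, fun φ _ => ⟨K, hK, fun x hx =>
    euler_eq_zero_of_eventually hα φ (by
      filter_upwards [hK.isClosed.isOpen_compl.mem_nhds hx] with x' hx' φ using h0 φ x' hx')⟩⟩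

theorem IsCompactForm.add (hα : IsCompactForm n m α) (hβ : IsCompactForm n m β) :
    IsCompactForm n m (α + β) := by
  refine ⟨hα.1.add hβ.1, fun φ hφ => ?_⟩
  obtain ⟨K, hK, h⟩ := hα.2 φ hφ
  obtain ⟨K', hK', h'⟩ := hβ.2 φ hφ
  refine ⟨K ∪ K', hK.union hK', fun x hx => ?_⟩
  rw [mem_union, not_or] at hx
  refine (congrArg₂ (· + ·) (h x hx.1) (h' x hx.2)).trans (add_zero _)

theorem IsCompactForm.smul (hα : IsCompactForm n m α) (c : ℝ) : IsCompactForm n m (c • α) := by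
  refine ⟨hα.1.smul c, fun φ hφ => ?_⟩
  obtain ⟨K, hK, h⟩ := hα.2 φ hφ
  exact ⟨K, hK, fun x hx => (congrArg (c • ·) (h x hx)).trans (smul_zero c)⟩

theorem IsCompactTop.add [T2Space M] (hα : IsCompactTop n m lam) (hβ : IsCompactTop n m mu) :
    IsCompactTop n m (lam + mu) := by
  refine ⟨hα.1.add hβ.1, fun φ hφ => ?_⟩
  obtain ⟨K, hK, h⟩ := hα.2 φ hφ
  obtain ⟨K', hK', h'⟩ := hβ.2 φ hφ
  refine ⟨K ∪ K', hK.union hK', fun x hx => ?_⟩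
  rw [mem_union, not_or] at hx
  rw [euler_add hα.1.1 hβ.1.1]
  exact (congrArg₂ (· + ·) (h x hx.1) (h' x hx.2)).trans (add_zero _)

theorem IsCompactTop.smul [T2Space M] (hα : IsCompactTop n m lam) (c : ℝ) :
    IsCompactTop n m (c • lam) := by
  refine ⟨hα.1.smul c, fun φ hφ => ?_⟩
  obtain ⟨K, hK, h⟩ := hα.2 φ hφ
  refine ⟨K, hK, fun x hx => ?_⟩
  rw [euler_smul hα.1.1]
  exact (congrArg (c • ·) (h x hx)).trans (smul_zero c)

/-! ### Forms of order zero -/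

theorem eulerCoord_of_order_zero {W : Type*} [NormedAddCommGroup W] [NormedSpace ℝ W]
    {U : Set (Rn n)} {q : JetCoord n m → W} (hU : IsOpen U) (hq : SmoothOfOrder 0 U q) (a : Fin m)
    {z : JetCoord n m} (hz : z.1 ∈ U) : eulerCoord a q z = dU a 0 q z := by
  have h0 : multiIdx n 0 = {0} := by
    ext I
    rw [mem_multiIdx, Finset.mem_singleton]
    simp [funext_iff]
  have h1 : idxList (0 : Fin n → ℕ) = [] := by
    rw [← List.length_eq_zero_iff, length_idxList]
    simp
  rw [eulerCoord_eq_sum hU hq a hz, h0, Finset.sum_singleton, h1]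
  simp [totalDl]

theorem dU_base_mul (χ : Rn n → ℝ) (q : JetCoord n m → ℝ) (a : Fin m) (I : Fin n → ℕ)
    (z : JetCoord n m) : dU a I (fun z => χ z.1 * q z) z = χ z.1 * dU a I q z := by
  simp only [dU, lineDeriv]
  rw [← deriv_const_mul_field]
  simp

/-- In order zero the Euler operator is `∂/∂uᵃ` without total derivatives, so a function on the base
passes through it. In higher order, derivatives of `χ` would enter. This linearity is what permits
integral identities to be localized. -/
theorem euler_baseSmul [T2Space M] {χ : M → ℝ} (hχ : ContMDiff (𝓡 n) 𝓘(ℝ) ∞ χ)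
    (h : IsSmoothFormOfOrder 0 lam) (φ : Sec n m V) (x : M) :
    euler n m (baseSmul χ lam) (jet n m φ x) = χ x • euler n m lam (jet n m φ x) := by
  have hxx := mem_coordSource_self (n := n) (m := m) (V := V) x
  have hU := isOpen_coordTarget (n := n) m V x
  have h' := h.baseSmul hχ
  ext1 v
  refine topForm_eq_of_toChart hxx ?_
  change _ = χ x * toChart n x x (euler n m lam (jet n m φ x) v) stdFrame
  refine (toChart_euler h'.isSmoothForm φ hxx v).trans
    (Eq.trans ?_ (congrArg (χ x * ·) (toChart_euler h.isSmoothForm φ hxx v)).symm)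
  simp only [eulerIn, Finset.mul_sum]
  refine Finset.sum_congr rfl fun a _ => ?_
  rw [mul_left_comm]
  congr 1
  have hz : (jetAt (localSec n m x φ) (extChartAt (𝓡 n) x x)).1 ∈ coordTarget n m V x := ext_mem hxx
  have e : ∀ z : JetCoord n m, z.1 ∈ coordTarget n m V x → scoef x (baseSmul χ lam) z =
      χ ((extChartAt (𝓡 n) x).symm z.1) * scoef x lam z := by
    intro z hz
    obtain ⟨p, hp, hrep⟩ := h x
    rw [scoef, scoef, hrep.coordRep_eq h.isSmoothForm hp subset_rfl z hz]
    have hrep' : RepOn x (coordTarget n m V x) (formIn x (baseSmul χ lam))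
        fun z => χ ((extChartAt (𝓡 n) x).symm z.1) • p z := fun y hy φ =>
      congrArg (χ ((extChartAt (𝓡 n) x).symm y) • ·) (hrep y hy φ)
    rw [hrep'.coordRep_eq h'.isSmoothForm
      ((SmoothOfOrder.of_base (contDiffOn_comp_symm hχ x)).smul hp) subset_rfl z hz]
    rfl
  rw [eulerCoord_congr hU e a hz, eulerCoord_of_order_zero
    (q := fun z => χ ((extChartAt (𝓡 n) x).symm z.1) * scoef x lam z) hU
    ((SmoothOfOrder.of_base (contDiffOn_comp_symm hχ x)).smul (h.scoef x)) a hz,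
    eulerCoord_of_order_zero hU (h.scoef x) a hz]
  refine (dU_base_mul (fun y => χ ((extChartAt (𝓡 n) x).symm y)) _ a 0 _).trans ?_
  change χ ((extChartAt (𝓡 n) x).symm (extChartAt (𝓡 n) x x)) * _ = _
  rw [symm_ext hxx]

end ChartForms

section Bracket
open MeasureTheory
variable {n m : ℕ} {M : Type*} [TopologicalSpace M] [ChartedSpace (Rn n) M]
  [IsManifold (𝓡 n) ∞ M]
  {V : M → Type*} [∀ x, AddCommGroup (V x)] [∀ x, Module ℝ (V x)] [∀ x, TopologicalSpace (V x)]
  [TopologicalSpace (TotalSpace (Rn m) V)] [FiberBundle (Rn m) V] [VectorBundle ℝ (Rn m) V]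
  [ContMDiffVectorBundle ∞ (Rn m) V (𝓡 n)]

variable {r s : ℕ} {x₀ : M}

/-! ### A local basis of source forms -/

theorem exists_cutoff {U : Set (Rn n)} (hU : IsOpen U) {y : Rn n} (hy : y ∈ U) :
    ∃ χ : Rn n → ℝ, ContDiff ℝ ∞ χ ∧ (∃ K ⊆ U, IsCompact K ∧ ∀ z ∉ K, χ z = 0) ∧
      ∀ᶠ z in 𝓝 y, χ z = 1 := by
  obtain ⟨R, hR, hb⟩ := Metric.nhds_basis_closedBall.mem_iff.1 (hU.mem_nhds hy)
  let χ : ContDiffBump y := ⟨R / 2, R, by linarith, by linarith⟩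
  refine ⟨χ, χ.contDiff, ⟨_, hb, isCompact_closedBall y R, fun z hz => ?_⟩, ?_⟩
  · exact χ.zero_of_le_dist (not_le.1 hz).le
  · filter_upwards [Metric.closedBall_mem_nhds y (half_pos hR)] with z hz
    exact χ.one_of_mem_closedBall hz

/-- The form `χ uᵃ dⁿx` in the coordinates at `x₀`. -/
def basisForm (x₀ : M) (χ : Rn n → ℝ) (a : Fin m) : HForm n m V n :=
  chartForm x₀ fun z => (χ z.1 * z.2 (a, 0)) • stdTop n

theorem basisForm_coef_smooth {χ : Rn n → ℝ} (hχ : ContDiff ℝ ∞ χ) (a : Fin m) {U : Set (Rn n)} :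
    SmoothOfOrder 0 U fun z : JetCoord n m => χ z.1 * z.2 (a, 0) :=
  (SmoothOfOrder.of_base hχ.contDiffOn).smul
    (SmoothOfOrder.coord a (mem_multiIdx.2 (by simp)))

variable [T2Space M] {χ : Rn n → ℝ} {K : Set (Rn n)}

theorem isSmoothFormOfOrder_basisForm (hχ : ContDiff ℝ ∞ χ) (hK : IsCompact K)
    (hKs : K ⊆ coordTarget n m V x₀) (h0 : ∀ z ∉ K, χ z = 0) (a : Fin m) :
    IsSmoothFormOfOrder 0 (basisForm x₀ χ a : HForm n m V n) :=
  isSmoothFormOfOrder_chartForm hK hKs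
    ((basisForm_coef_smooth hχ a).smul (SmoothOfOrder.const (stdTop n)))
    fun z _ hz => by rw [h0 _ hz, zero_mul, zero_smul]

theorem toChart_euler_basisForm (hχ : ContDiff ℝ ∞ χ) (hK : IsCompact K)
    (hKs : K ⊆ coordTarget n m V x₀) (h0 : ∀ z ∉ K, χ z = 0) (a : Fin m) (φ : Sec n m V) {x : M}
    (hx : x ∈ coordSource n m V x₀) (v : V x) :
    toChart n x₀ x (euler n m (basisForm x₀ χ a) (jet n m φ x) v) stdFrame =
      χ (extChartAt (𝓡 n) x₀ x) * (trivializationAt (Rn m) V x₀).linearMapAt ℝ x v a := by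
  have hU := isOpen_coordTarget (n := n) m V x₀
  have hs := isSmoothFormOfOrder_basisForm (V := V) hχ hK hKs h0 a
  refine (toChart_euler hs.isSmoothForm φ hx v).trans ?_
  have hz : (jetAt (localSec n m x₀ φ) (extChartAt (𝓡 n) x₀ x)).1 ∈ coordTarget n m V x₀ :=
    ext_mem hx
  have e : ∀ z : JetCoord n m, z.1 ∈ coordTarget n m V x₀ → scoef x₀ (basisForm x₀ χ a :
      HForm n m V n) z = χ z.1 * z.2 (a, 0) := by
    intro z hz
    rw [scoef, RepOn.coordRep_eq hs.isSmoothForm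
      ((basisForm_coef_smooth hχ a).smul (SmoothOfOrder.const (stdTop n))) repOn_chartForm
      subset_rfl z hz]
    change _ * stdTop n stdFrame = _
    rw [stdTop_stdFrame, mul_one]
  have e' : ∀ b : Fin m, eulerCoord b (scoef x₀ (basisForm x₀ χ a : HForm n m V n))
      (jetAt (localSec n m x₀ φ) (extChartAt (𝓡 n) x₀ x)) =
      χ (extChartAt (𝓡 n) x₀ x) * if b = a then 1 else 0 := by
    intro b
    rw [eulerCoord_congr hU e b hz, eulerCoord_of_order_zero hU (basisForm_coef_smooth hχ a) b hz,
      dU_base_mul χ (fun z => z.2 (a, 0))]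
    congr 1
    have h1 : ∀ t : ℝ, ((jetAt (localSec n m x₀ φ) (extChartAt (𝓡 n) x₀ x)) +
        t • ((0 : Rn n), Pi.single (b, (0 : Fin n → ℕ)) (1 : ℝ))).2 (a, 0) =
        (jetAt (localSec n m x₀ φ) (extChartAt (𝓡 n) x₀ x)).2 (a, 0) +
          t * if b = a then 1 else 0 := by
      intro t
      simp [Pi.single_apply, eq_comm]
    simp only [dU, lineDeriv, h1]
    split_ifs <;> simp
  simp only [eulerIn, e']
  simp [mul_comm]

/-- The value of the Euler-Lagrange form along a section. -/
def eulerAt (lam : HForm n m V n) (φ : Sec n m V) (x : M) :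
    V x →ₗ[ℝ] (TangentSpace (𝓡 n) x [⋀^Fin n]→L[ℝ] ℝ) := euler n m lam (jet n m φ x)

/-- The Euler-Lagrange forms of the forms `uᵃ dⁿx` are a basis of the source forms. -/
theorem source_eq_sum (hχ : ContDiff ℝ ∞ χ) (hK : IsCompact K)
    (hKs : K ⊆ coordTarget n m V x₀) (h0 : ∀ z ∉ K, χ z = 0) (φ : Sec n m V) {x : M}
    (hx : x ∈ coordSource n m V x₀) (h1 : χ (extChartAt (𝓡 n) x₀ x) = 1)
    (ξ : V x →ₗ[ℝ] (TangentSpace (𝓡 n) x [⋀^Fin n]→L[ℝ] ℝ)) :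
    ξ = ∑ a, toChart n x₀ x (ξ ((trivializationAt (Rn m) V x₀).symmₗ ℝ x
      (EuclideanSpace.single a (1 : ℝ)))) stdFrame •
        eulerAt (basisForm x₀ χ a) φ x := by
  ext1 v
  let T : (V x →ₗ[ℝ] (TangentSpace (𝓡 n) x [⋀^Fin n]→L[ℝ] ℝ)) →ₗ[ℝ] ℝ :=
    { toFun := fun ξ => toChart n x₀ x (ξ v) stdFrame
      map_add' := fun _ _ => rfl
      map_smul' := fun _ _ => rfl }
  refine topForm_eq_of_toChart hx ?_
  change T ξ = T (∑ a, _ • _)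
  rw [map_sum]
  simp only [map_smul, smul_eq_mul]
  have e : ∀ a, T (eulerAt (basisForm x₀ χ a) φ x) =
      (trivializationAt (Rn m) V x₀).linearMapAt ℝ x v a := fun a =>
    (toChart_euler_basisForm hχ hK hKs h0 a φ hx v).trans (by rw [h1, one_mul])
  simp only [e]
  let S : V x →ₗ[ℝ] ℝ :=
    { toFun := fun v => toChart n x₀ x (ξ v) stdFrame
      map_add' := fun v w => by rw [map_add]; rfl
      map_smul' := fun c v => by rw [map_smul]; rfl }
  have hv : v = ∑ a, (trivializationAt (Rn m) V x₀).linearMapAt ℝ x v a •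
      (trivializationAt (Rn m) V x₀).symmₗ ℝ x (EuclideanSpace.single a (1 : ℝ)) := by
    conv_lhs => rw [← Trivialization.symmₗ_linearMapAt (R := ℝ) _ hx.2 v]
    simp only [← map_smul, ← map_sum]
    congr 1
    ext b
    simp [Pi.single_apply]
  change S v = _
  conv_lhs => rw [hv]
  rw [map_sum]
  refine Finset.sum_congr rfl fun a _ => ?_
  rw [map_smul, smul_eq_mul, mul_comm]
  rfl

end Bracket

section Bracket
open MeasureTheory
variable {n m : ℕ} {M : Type*} [TopologicalSpace M] [ChartedSpace (Rn n) M]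
  [IsManifold (𝓡 n) ∞ M]
  {V : M → Type*} [∀ x, AddCommGroup (V x)] [∀ x, Module ℝ (V x)] [∀ x, TopologicalSpace (V x)]
  [TopologicalSpace (TotalSpace (Rn m) V)] [FiberBundle (Rn m) V] [VectorBundle ℝ (Rn m) V]
  [ContMDiffVectorBundle ∞ (Rn m) V (𝓡 n)]

variable {r s : ℕ} {x₀ : M} {om : SkewPairing n m V}
  {ν : ∀ x : M, TangentSpace (𝓡 n) x [⋀^Fin n]→L[ℝ] ℝ} {lam mu : HForm n m V n}

/-! ### The Poisson bracket of Lagrangian forms -/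

/-- The value of the pairing at the jet of a section. -/
def pairAt (om : SkewPairing n m V) (φ : Sec n m V) (x : M) :
    (V x →ₗ[ℝ] (TangentSpace (𝓡 n) x [⋀^Fin n]→L[ℝ] ℝ)) →ₗ[ℝ]
      (V x →ₗ[ℝ] (TangentSpace (𝓡 n) x [⋀^Fin n]→L[ℝ] ℝ)) →ₗ[ℝ] ℝ := om.form (jet n m φ x)

theorem pairAt_skew (φ : Sec n m V) (x : M)
    (ξ ξ' : V x →ₗ[ℝ] (TangentSpace (𝓡 n) x [⋀^Fin n]→L[ℝ] ℝ)) :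
    pairAt om φ x ξ ξ' = - pairAt om φ x ξ' ξ := om.skew (jet n m φ x) ξ ξ'

theorem pullSec_l2 (lam mu : HForm n m V n) (φ : Sec n m V) (x : M) :
    pullSec n m φ (l2 n m om ν lam mu) x =
      pairAt om φ x (eulerAt lam φ x) (eulerAt mu φ x) • ν x := rfl

theorem l2_skew (lam mu : HForm n m V n) : l2 n m om ν lam mu = - l2 n m om ν mu lam := by
  funext θ
  change om.form θ _ _ • ν θ.1 = - (om.form θ _ _ • ν θ.1)
  rw [om.skew]
  exact neg_smul _ (ν θ.1)

theorem IsLocal.hasDerivAt {W : Type*} [NormedAddCommGroup W] [NormedSpace ℝ W]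
    {f : M → M → Sec n m V → W} (h : IsLocal n m f) {x : M} (hx : x ∈ coordSource n m V x₀)
    (φ η : Sec n m V) : ∃ d, HasDerivAt (fun t : ℝ => f x₀ x (φ + t • η)) d 0 := by
  obtain ⟨r, hr⟩ := h
  obtain ⟨p, hp, hrep⟩ := hr x₀
  obtain ⟨q, hq, e⟩ := hp
  have h1 := hasLineDerivAt_of_rep (isOpen_coordTarget m V x₀) hq e
    (z := jetAt (localSec n m x₀ φ) (extChartAt (𝓡 n) x₀ x)) (ext_mem hx)
    (0, (jetAt (localSec n m x₀ η) (extChartAt (𝓡 n) x₀ x)).2)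
  rw [HasLineDerivAt] at h1
  refine ⟨_, h1.congr_of_eventuallyEq (Filter.Eventually.of_forall fun t => ?_)⟩
  change f x₀ x (φ + t • η) = _
  rw [hrep x hx, jetCoordAt_eq, jetAt_localSec_add_smul φ η t (ext_mem hx)]

theorem isSmoothForm_smul_base (hν : IsVolumeForm n ν) {P : Jet n m V → ℝ} (hP : IsLoc n m P) :
    IsSmoothForm n m (fun θ => P θ • ν θ.1 : HForm n m V n) := by
  obtain ⟨r, hr⟩ := hP
  refine isSmoothForm_iff.2 ⟨r, fun x₀ => ?_⟩
  obtain ⟨p, hp, hrep⟩ := hr x₀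
  rw [represents_iff] at hrep
  refine ⟨_, hp.smul (SmoothOfOrder.of_base ((hν.2 x₀).mono inter_subset_left)), fun y hy φ => ?_⟩
  exact congrArg (· • toChart n x₀ ((extChartAt (𝓡 n) x₀).symm y)
    (ν ((extChartAt (𝓡 n) x₀).symm y))) (hrep y hy φ)

variable [T2Space M] {lam' mu' : HForm n m V n}

theorem isLoc_pair (h : IsSmoothForm n m lam) (h' : IsSmoothForm n m mu) :
    IsLoc n m fun θ => om.form θ (euler n m lam θ) (euler n m mu θ) :=
  om.smooth _ _ (isSmoothSource_euler h) (isSmoothSource_euler h')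

theorem IsSmoothForm.l2 (hν : IsVolumeForm n ν) (h : IsSmoothForm n m lam)
    (h' : IsSmoothForm n m mu) : IsSmoothForm n m (l2 n m om ν lam mu) :=
  isSmoothForm_smul_base hν (isLoc_pair h h')

theorem l2_add_left (h : IsSmoothForm n m lam) (h' : IsSmoothForm n m lam') :
    l2 n m om ν (lam + lam') mu = l2 n m om ν lam mu + l2 n m om ν lam' mu := by
  funext θ
  change om.form θ (euler n m (lam + lam') θ) _ • ν θ.1 =
    om.form θ (euler n m lam θ) _ • ν θ.1 + om.form θ (euler n m lam' θ) _ • ν θ.1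
  rw [euler_add h h', ← add_smul]
  refine congrArg (· • ν θ.1) ?_
  exact LinearMap.map_add₂ (om.form θ) _ _ _

theorem l2_smul_left (h : IsSmoothForm n m lam) (c : ℝ) :
    l2 n m om ν (c • lam) mu = c • l2 n m om ν lam mu := by
  funext θ
  change om.form θ (euler n m (c • lam) θ) _ • ν θ.1 = c • om.form θ (euler n m lam θ) _ • ν θ.1
  rw [euler_smul h, ← smul_assoc]
  refine congrArg (· • ν θ.1) ?_
  exact LinearMap.map_smul₂ (om.form θ) _ _ _

theorem l2_add_right (h : IsSmoothForm n m mu) (h' : IsSmoothForm n m mu') :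
    l2 n m om ν lam (mu + mu') = l2 n m om ν lam mu + l2 n m om ν lam mu' := by
  rw [l2_skew, l2_add_left h h', neg_add, ← l2_skew, ← l2_skew]

theorem l2_smul_right (h : IsSmoothForm n m mu) (c : ℝ) :
    l2 n m om ν lam (c • mu) = c • l2 n m om ν lam mu := by
  rw [l2_skew, l2_smul_left h, l2_skew lam mu]
  exact (smul_neg c (l2 n m om ν mu lam)).symm

/-- The Euler-Lagrange form of `l₂(λ, μ)` vanishes where those of `λ` and `μ` do. -/
theorem euler_l2_eq_zero (hν : IsVolumeForm n ν) (h : IsSmoothForm n m lam)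
    (h' : IsSmoothForm n m mu) (φ : Sec n m V) {x : M}
    (h0 : ∀ᶠ x' in 𝓝 x, eulerAt lam φ x' = 0) (h0' : ∀ᶠ x' in 𝓝 x, eulerAt mu φ x' = 0) :
    eulerAt (l2 n m om ν lam mu) φ x = 0 := by
  have hxx := mem_coordSource_self (n := n) (m := m) (V := V) x
  obtain ⟨χ, hχ, ⟨K, hKs, hK, hχ0⟩, hχ1⟩ :=
    exists_cutoff (isOpen_coordTarget (n := n) m V x) (ext_mem hxx)
  refine euler_eq_zero_of_deriv (h.l2 hν h') φ ?_
  filter_upwards [h0, h0', (contMDiffAt_ext hxx).continuousAt.eventually hχ1,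
    (isOpen_coordSource m V x).mem_nhds hxx] with x' h1 h2 h3 hx' η
  have hb := fun a => (isSmoothFormOfOrder_basisForm (V := V) hχ hK hKs hχ0 a).isSmoothForm
  set A : HForm n m V n → Fin m → ℝ → ℝ := fun lam a t =>
    toChart n x x' (eulerAt lam (φ + t • η) x' ((trivializationAt (Rn m) V x).symmₗ ℝ x'
      (EuclideanSpace.single a (1 : ℝ)))) stdFrame with hA
  set w : Fin m → Fin m → ℝ → ℝ := fun a b t => pairAt om (φ + t • η) x'
    (eulerAt (basisForm x χ a) (φ + t • η) x') (eulerAt (basisForm x χ b) (φ + t • η) x') with hw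
  have hz : φ + (0 : ℝ) • η = φ := by
    ext y
    change φ y + (0 : ℝ) • η y = φ y
    rw [zero_smul, add_zero]
  have hA0 : ∀ lam, eulerAt lam φ x' = 0 → ∀ a, A lam a 0 = 0 := by
    intro lam h a
    simp only [hA, hz, h]
    rfl
  have hAd : ∀ lam, IsSmoothForm n m lam → ∀ a, ∃ d, HasDerivAt (A lam a) d 0 := by
    intro lam h a
    obtain ⟨d, hd⟩ := (isSmoothSource_euler h a).hasDerivAt hx' φ η
    exact ⟨_, (ContinuousAlternatingMap.apply ℝ (Rn n) ℝ stdFrame).hasFDerivAt.comp_hasDerivAt 0 hd⟩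
  have hwd : ∀ a b, ∃ d, HasDerivAt (w a b) d 0 := fun a b =>
    (isLoc_pair (om := om) (hb a) (hb b)).hasDerivAt hx' φ η
  -- Both arguments are expanded in the local basis of source forms, since the regularity of `om` is
  -- only known on pairs of smooth source forms. Each summand has one factor from `lam` and one from
  -- `mu`, both zero at `t = 0`, so the first variation vanishes to second order.
  have key : ∀ t : ℝ, toChart n x x' (pullSec n m (φ + t • η) (l2 n m om ν lam mu) x') stdFrame =
      (∑ a, ∑ b, A lam a t * (A mu b t * w a b t)) * toChart n x x' (ν x') stdFrame := by
    intro t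
    have e := fun lam => source_eq_sum hχ hK hKs hχ0 (φ + t • η) hx' h3
      (eulerAt lam (φ + t • η) x')
    rw [pullSec_l2]
    conv_lhs => rw [e lam, e mu]
    simp only [map_sum, LinearMap.sum_apply, map_smul, LinearMap.smul_apply, smul_eq_mul,
      Finset.mul_sum]
    refine congrArg (· * toChart n x x' (ν x') stdFrame) ?_
    rw [Finset.sum_comm]
    refine Finset.sum_congr rfl fun a _ => Finset.sum_congr rfl fun b _ => ?_
    simp only [hA, hw]
    ring
  simp only [key]
  choose d hd using hAd lam h
  choose d' hd' using hAd mu h'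
  choose e he using hwd
  have hsum : HasDerivAt (fun t => ∑ a, ∑ b, A lam a t * (A mu b t * w a b t)) 0 0 := by
    have := HasDerivAt.fun_sum (u := Finset.univ) fun a _ =>
      HasDerivAt.fun_sum (u := Finset.univ) fun b _ => (hd a).mul ((hd' b).mul (he a b))
    refine this.congr_deriv (Finset.sum_eq_zero fun a _ => Finset.sum_eq_zero fun b _ => ?_)
    rw [Pi.mul_apply, hA0 lam h1, hA0 mu h2]
    ring
  simpa using hsum.mul_const (toChart n x x' (ν x') stdFrame)

/-- The form itself vanishes wherever `E(λ)` does, but its Euler-Lagrange form is only controlled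
where both `E(λ)` and `E(μ)` vanish nearby; hence the union of the two supports. Iterated brackets
make sense because of this closure property. -/
theorem IsCompactTop.l2 (hν : IsVolumeForm n ν) (h : IsCompactTop n m lam)
    (h' : IsCompactTop n m mu) : IsCompactTop n m (l2 n m om ν lam mu) := by
  refine ⟨⟨h.1.1.l2 hν h'.1.1, fun φ hφ => ?_⟩, fun φ hφ => ?_⟩
  · obtain ⟨K, hK, h0⟩ := h.2 φ hφ
    refine ⟨K, hK, fun x hx => ?_⟩
    have e : eulerAt lam φ x = 0 := h0 x hx
    rw [pullSec_l2, e, map_zero, LinearMap.zero_apply]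
    exact zero_smul ℝ (ν x)
  · obtain ⟨K, hK, h0⟩ := h.2 φ hφ
    obtain ⟨K', hK', h0'⟩ := h'.2 φ hφ
    refine ⟨K ∪ K', hK.union hK', fun x hx => ?_⟩
    rw [mem_union, not_or] at hx
    refine euler_l2_eq_zero hν h.1.1 h'.1.1 φ ?_ ?_
    · filter_upwards [hK.isClosed.isOpen_compl.mem_nhds hx.1] with x' hx' using h0 x' hx'
    · filter_upwards [hK'.isClosed.isOpen_compl.mem_nhds hx.2] with x' hx' using h0' x' hx'

theorem l2_eq_zero_left (h : euler n m lam = 0) : l2 n m om ν lam mu = 0 := by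
  funext θ
  change om.form θ (euler n m lam θ) _ • ν θ.1 = 0
  rw [h]
  change om.form θ 0 _ • ν θ.1 = 0
  rw [map_zero, LinearMap.zero_apply]
  exact zero_smul ℝ (ν θ.1)

end Bracket

section Canonical
open MeasureTheory
variable {n m : ℕ} {M : Type*} [TopologicalSpace M] [ChartedSpace (Rn n) M]
  [IsManifold (𝓡 n) ∞ M]
  {V : M → Type*} [∀ x, AddCommGroup (V x)] [∀ x, Module ℝ (V x)] [∀ x, TopologicalSpace (V x)]
  [TopologicalSpace (TotalSpace (Rn m) V)] [FiberBundle (Rn m) V] [VectorBundle ℝ (Rn m) V]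
  [ContMDiffVectorBundle ∞ (Rn m) V (𝓡 n)]

variable {r s k : ℕ} {x₀ : M}

/-! ### The fundamental lemma of the calculus of variations on a manifold -/

theorem exists_function_of_local [T2Space M] (x₀ : M) {g : Rn n → ℝ}
    (hg : ContDiffOn ℝ ∞ g (coordTarget n m V x₀)) {K : Set (Rn n)} (hK : IsCompact K)
    (hKs : K ⊆ coordTarget n m V x₀) (h0 : ∀ y ∈ coordTarget n m V x₀, y ∉ K → g y = 0) :
    ∃ χ : M → ℝ, ContMDiff (𝓡 n) 𝓘(ℝ) ∞ χ ∧
      (∀ y ∈ coordTarget n m V x₀, χ ((extChartAt (𝓡 n) x₀).symm y) = g y) ∧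
      ∀ x ∉ (extChartAt (𝓡 n) x₀).symm '' K, χ x = 0 := by
  classical
  let χ : M → ℝ := fun x => if x ∈ coordSource n m V x₀ then g (extChartAt (𝓡 n) x₀ x) else 0
  have hχ0 : ∀ x ∉ (extChartAt (𝓡 n) x₀).symm '' K, χ x = 0 := by
    intro x hx
    simp only [χ]
    split_ifs with h
    · exact h0 _ (ext_mem h) fun hk => hx ⟨_, hk, symm_ext h⟩
    · rfl
  refine ⟨χ, fun x => ?_, fun y hy => ?_, hχ0⟩
  · by_cases hx : x ∈ coordSource n m V x₀
    · refine ContMDiffAt.congr_of_eventuallyEq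
        (((hg.contDiffAt ((isOpen_coordTarget m V x₀).mem_nhds (ext_mem hx))).contMDiffAt).comp x
          (contMDiffAt_ext hx)) ?_
      filter_upwards [(isOpen_coordSource m V x₀).mem_nhds hx] with x' hx'
      exact if_pos hx'
    · have hx' : x ∉ (extChartAt (𝓡 n) x₀).symm '' K := by
        rintro ⟨y, hy, rfl⟩
        exact hx (symm_mem (hKs hy))
      refine (contMDiffAt_const (c := (0 : ℝ))).congr_of_eventuallyEq ?_
      filter_upwards [(isCompact_image_symm hK hKs).isClosed.isOpen_compl.mem_nhds hx'] with z hz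
        using hχ0 z hz
  · simp only [χ, if_pos (symm_mem hy), ext_symm hy]

theorem form_eq_zero_of_integral [T2Space M] [SigmaCompactSpace M]
    {ν β : ∀ x : M, TangentSpace (𝓡 n) x [⋀^Fin n]→L[ℝ] ℝ} (hν : IsVolumeForm n ν)
    (hβ : IsContForm β) (h : ∀ χ : M → ℝ, ContMDiff (𝓡 n) 𝓘(ℝ) ∞ χ →
      (∃ K, IsCompact K ∧ ∀ x ∉ K, χ x = 0) → formIntegral n ν (fun x => χ x • β x) = 0)
    (x : M) : β x = 0 := by
  have hxx := mem_coordSource_self (n := n) (m := 0) (V := Bundle.Trivial M (Rn 0)) x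
  obtain ⟨R, hR, hball⟩ := Metric.isOpen_iff.1
    (isOpen_coordTarget (n := n) 0 (Bundle.Trivial M (Rn 0)) x) _ (ext_mem hxx)
  obtain ⟨s, hs, hI⟩ := exists_formIntegral_eq hν (x₀ := x) (convex_ball _ R).isPreconnected
    Metric.isOpen_ball.measurableSet fun y hy => (hball hy).1
  have hc : ContinuousOn (coef x β) (Metric.ball (extChartAt (𝓡 n) x x) R) :=
    (hβ x).mono fun y hy => (hball hy).1
  have key : EqOn (coef x β) 0 (Metric.ball (extChartAt (𝓡 n) x x) R) := by
    refine eq_zero_of_integral_smul_eq_zero Metric.isOpen_ball hc fun g hg hgc hgs => ?_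
    have hg0 : ∀ y ∉ tsupport g, g y = 0 := fun y hy => image_eq_zero_of_notMem_tsupport hy
    obtain ⟨χ, hχ, hχg, hχ0⟩ := exists_function_of_local (m := 0) (V := Bundle.Trivial M (Rn 0)) x hg.contDiffOn hgc
      (hgs.trans hball) fun y _ hy => hg0 y hy
    have hcs := isCompact_image_symm hgc (hgs.trans hball)
    have h1 := h χ hχ ⟨_, hcs, hχ0⟩
    have hcont : IsContForm fun x => χ x • β x := by
      intro x₁
      refine ContinuousOn.mul (f := fun y => χ ((extChartAt (𝓡 n) x₁).symm y)) ?_ (hβ x₁)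
      exact hχ.continuous.comp_continuousOn (continuousOn_extChartAt_symm x₁)
    rw [hI _ hcont _ hgs hgc fun x' hx' => by rw [hχ0 x' hx']; exact zero_smul ℝ (β x')] at h1
    have h2 := (mul_eq_zero.1 h1).resolve_left hs
    rw [← h2, ← setIntegral_eq_integral_of_forall_compl_eq_zero
      (s := Metric.ball (extChartAt (𝓡 n) x x) R)
      fun y hy => by rw [hg0 y fun h => hy (hgs h), zero_mul]]
    refine setIntegral_congr_fun Metric.isOpen_ball.measurableSet fun y hy => ?_
    exact (congrArg (· * coef x β y) (hχg y (hball hy))).symm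
  have h1 := key (Metric.mem_ball_self hR)
  have h2 : coef x β (extChartAt (𝓡 n) x x) = toChart n x x (β x) stdFrame := by
    unfold coef
    rw [symm_ext hxx]
  refine topForm_eq_of_toChart hxx ?_
  rw [← h2, h1]
  rfl

/-! ### Bundle automorphisms and forms of order zero -/

theorem partialDeriv_zero (f : Rn n → Rn m) (y : Rn n) (a : Fin m) :
    partialDeriv f y a 0 = f y a := by
  have : (idxList (0 : Fin n → ℕ)).length = 0 := by
    rw [length_idxList]
    simp
  have key : ∀ (l : List (Fin n)), l.length = 0 → iteratedFDeriv ℝ l.length f y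
      (fun j => EuclideanSpace.single (l.get j) (1 : ℝ)) a = f y a := by
    intro l hl
    obtain rfl := List.length_eq_zero_iff.1 hl
    rfl
  exact key _ this

section Automorphism

variable {G : Type*} [Group G] (ψ : BundleAction n m V G)

theorem coordMap_contDiffAt_of_mem (g : G) {x : M} {y : Rn n}
    (hy : y ∈ coordTarget n m V x) (v : Rn m) : ContDiffAt ℝ ∞ (ψ.coordMap g x) (y, v) := by
  rw [← contMDiffAt_iff_contDiffAt]
  have h1 : ContMDiffAt 𝓘(ℝ, Rn n × Rn m) ((𝓡 n).prod 𝓘(ℝ, Rn m)) ∞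
      (fun z : Rn n × Rn m => ((extChartAt (𝓡 n) x).symm z.1, z.2)) (y, v) :=
    (ContMDiffAt.comp_of_eq (contMDiffAt_symm hy) contDiffAt_fst.contMDiffAt rfl).prodMk
      contDiffAt_snd.contMDiffAt
  have ht : ((extChartAt (𝓡 n) x).symm y, v) ∈ (trivializationAt (Rn m) V x).target :=
    (trivializationAt (Rn m) V x).mem_target.2 hy.2
  have h2 := ((trivializationAt (Rn m) V x).contMDiffOn_symm (IB := 𝓡 n) (n := ∞)).contMDiffAt
    ((trivializationAt (Rn m) V x).open_target.mem_nhds ht)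
  have hs : (⟨_, ψ.act g _ ((trivializationAt (Rn m) V x).toOpenPartialHomeomorph.symm
      ((extChartAt (𝓡 n) x).symm y, v)).2⟩ : TotalSpace (Rn m) V) ∈
      (trivializationAt (Rn m) V x).source := by
    rw [Trivialization.mem_source]
    change ((trivializationAt (Rn m) V x).toOpenPartialHomeomorph.symm _).proj ∈ _
    rw [(trivializationAt (Rn m) V x).proj_symm_apply ht]
    exact hy.2
  have h3 := ((trivializationAt (Rn m) V x).contMDiffOn (IB := 𝓡 n) (n := ∞)).contMDiffAt
    ((trivializationAt (Rn m) V x).open_source.mem_nhds hs)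
  have h4 := ContMDiffAt.comp_of_eq h2 h1 rfl
  have h5 := ContMDiffAt.comp_of_eq (ψ.smooth g _) h4 rfl
  exact (ContMDiffAt.comp_of_eq h3 h5 rfl).snd

theorem localSec_onSec_of_mem (g : G) (φ : Sec n m V) {x : M} {y : Rn n}
    (hy : y ∈ coordTarget n m V x) :
    localSec n m x (ψ.onSec g φ) y = ψ.coordMap g x (y, localSec n m x φ y) := by
  have hy' : (⟨(extChartAt (𝓡 n) x).symm y, φ ((extChartAt (𝓡 n) x).symm y)⟩ :
      TotalSpace (Rn m) V) ∈ (trivializationAt (Rn m) V x).source :=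
    (trivializationAt (Rn m) V x).mem_source.2 hy.2
  have key := (trivializationAt (Rn m) V x).symm_apply_mk_proj hy'
  simp only [BundleAction.coordMap, localSec]
  erw [key]
  rfl

/-- A form of order zero reads only the value of the section, where `jψ_g` acts by the smooth
coordinate map of `ψ_g`. Working with test forms of order zero avoids the prolongation of the action
to higher derivatives. -/
theorem IsSmoothFormOfOrder.pull {α : HForm n m V k} (h : IsSmoothFormOfOrder 0 α) (g : G) :
    IsSmoothFormOfOrder 0 (ψ.pull g α) := by
  intro x₀
  obtain ⟨p, hp, hrep⟩ := h x₀
  have hI : (0 : Fin n → ℕ) ∈ multiIdx n 0 := mem_multiIdx.2 (by simp)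
  let F : JetCoord n m → Rn m := fun z => WithLp.toLp 2 fun b => z.2 (b, 0)
  have hF : SmoothOfOrder 0 (coordTarget n m V x₀) F :=
    (SmoothOfOrder.pi fun b => SmoothOfOrder.coord b hI).compContDiff
      (PiLp.contDiff_toLp (𝕜 := ℝ) (p := 2) (E := fun _ : Fin m => ℝ))
  have hA : SmoothOfOrder 0 (coordTarget n m V x₀) fun z => ψ.coordMap g x₀ (z.1, F z) :=
    ((SmoothOfOrder.of_base contDiffOn_id).prodMk hF).comp (S := coordTarget n m V x₀ ×ˢ univ)
      (fun z hz => (coordMap_contDiffAt_of_mem ψ g hz.1 z.2).contDiffWithinAt)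
      fun y hy u => ⟨hy, trivial⟩
  -- The entries with nonzero multi-index are fillers: `p` has order zero and does not read them.
  refine ⟨fun z => p (z.1, fun aI => ψ.coordMap g x₀ (z.1, F z) aI.1), ?_, fun y hy φ => ?_⟩
  · exact hp.subst (τ := fun y => y) contDiffOn_id (fun y hy => hy)
      fun a I _ => hA.compContDiff (contDiff_apply_euclidean a)
  · refine (hrep y hy (ψ.onSec g φ)).trans ?_
    refine hp.eq_of_trunc hy (funext fun aI => ?_)
    obtain ⟨a, I, hI'⟩ := aI
    obtain rfl : I = 0 := by
      rw [mem_multiIdx] at hI'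
      funext i
      exact Finset.sum_eq_zero_iff.1 (Nat.le_zero.1 hI') i (Finset.mem_univ i)
    change partialDeriv _ _ _ _ = _
    rw [partialDeriv_zero, localSec_onSec_of_mem ψ g φ hy]
    have e : localSec n m x₀ φ y = F (jetAt (localSec n m x₀ φ) y) := by
      ext b
      exact (partialDeriv_zero _ _ _).symm
    rw [e]
    rfl

end Automorphism

end Canonical

section Canonical
open MeasureTheory
variable {n m : ℕ} {M : Type*} [TopologicalSpace M] [ChartedSpace (Rn n) M]
  [IsManifold (𝓡 n) ∞ M]
  {V : M → Type*} [∀ x, AddCommGroup (V x)] [∀ x, Module ℝ (V x)] [∀ x, TopologicalSpace (V x)]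
  [TopologicalSpace (TotalSpace (Rn m) V)] [FiberBundle (Rn m) V] [VectorBundle ℝ (Rn m) V]
  [ContMDiffVectorBundle ∞ (Rn m) V (𝓡 n)]

variable {k : ℕ} {x₀ : M} {lam mu : HForm n m V n} {om : SkewPairing n m V}
  {ν : ∀ x : M, TangentSpace (𝓡 n) x [⋀^Fin n]→L[ℝ] ℝ}

/-! ### Canonical actions preserve the bracket of invariant forms -/

theorem onSec_eq_of_jet {G : Type*} [Group G] (ψ : BundleAction n m V G) (g : G)
    {φ φ' : Sec n m V} {x : M} (h : jet n m φ x = jet n m φ' x) :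
    jet n m (ψ.onSec g φ) x = jet n m (ψ.onSec g φ') x := congrArg (ψ.onJet g) h

/-- Forms of order zero that are supported over a compact set. -/
def IsTestForm (t : HForm n m V n) : Prop :=
  IsSmoothFormOfOrder 0 t ∧ ∃ K : Set M, IsCompact K ∧
    ∀ φ : Sec n m V, ∀ x ∉ K, pullSec n m φ t x = 0

variable [T2Space M]

theorem pairAt_congr {φ φ' : Sec n m V} {x : M} (h : jet n m φ x = jet n m φ' x)
    (lam mu : HForm n m V n) : pairAt om φ x (eulerAt lam φ x) (eulerAt mu φ x) =
      pairAt om φ' x (eulerAt lam φ' x) (eulerAt mu φ' x) :=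
  congrArg (fun θ : Jet n m V => om.form θ (euler n m lam θ) (euler n m mu θ)) h

namespace IsTestForm

variable {t t' : HForm n m V n}

theorem isCompactTop (h : IsTestForm t) : IsCompactTop n m t := by
  obtain ⟨h1, K, hK, h2⟩ := h
  exact isCompactTop_of_support h1.isSmoothForm hK h2

theorem baseSmul {χ : M → ℝ} (hχ : ContMDiff (𝓡 n) 𝓘(ℝ) ∞ χ) (h : IsTestForm t) :
    IsTestForm (baseSmul χ t) := by
  obtain ⟨h1, K, hK, h2⟩ := h
  exact ⟨h1.baseSmul hχ, K, hK, fun φ x hx => (congrArg (χ x • ·) (h2 φ x hx)).trans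
    (smul_zero (χ x))⟩

theorem pull {G : Type*} [Group G] (ψ : BundleAction n m V G) (g : G) (h : IsTestForm t) :
    IsTestForm (ψ.pull g t) := by
  obtain ⟨h1, K, hK, h2⟩ := h
  exact ⟨h1.pull ψ g, K, hK, fun φ x hx => h2 (ψ.onSec g φ) x hx⟩

theorem add (h : IsTestForm t) (h' : IsTestForm t') : IsTestForm (t + t') := by
  obtain ⟨h1, K, hK, h2⟩ := h
  obtain ⟨h1', K', hK', h2'⟩ := h'
  refine ⟨h1.add h1', K ∪ K', hK.union hK', fun φ x hx => ?_⟩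
  rw [mem_union, not_or] at hx
  exact (congrArg₂ (· + ·) (h2 φ x hx.1) (h2' φ x hx.2)).trans (add_zero _)

theorem zero : IsTestForm (0 : HForm n m V n) :=
  ⟨.zero, ∅, isCompact_empty, fun _ _ _ => rfl⟩

theorem smul (c : ℝ) (h : IsTestForm t) : IsTestForm (c • t) :=
  h.baseSmul (χ := fun _ => c) contMDiff_const

end IsTestForm

theorem eulerAt_add (h : IsSmoothForm n m lam) (h' : IsSmoothForm n m mu) (φ : Sec n m V) (x : M) :
    eulerAt (lam + mu) φ x = eulerAt lam φ x + eulerAt mu φ x :=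
  congrFun (euler_add h h') (jet n m φ x)

theorem eulerAt_smul (h : IsSmoothForm n m lam) (c : ℝ) (φ : Sec n m V) (x : M) :
    eulerAt (c • lam) φ x = c • eulerAt lam φ x :=
  congrFun (euler_smul h c) (jet n m φ x)

/-- Every value of a source form is a value of the Euler-Lagrange form of a test form. -/
theorem exists_isTestForm_eulerAt (φ : Sec n m V) (x : M)
    (ξ : V x →ₗ[ℝ] (TangentSpace (𝓡 n) x [⋀^Fin n]→L[ℝ] ℝ)) :
    ∃ t : HForm n m V n, IsTestForm t ∧ eulerAt t φ x = ξ := by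
  have hxx := mem_coordSource_self (n := n) (m := m) (V := V) x
  obtain ⟨χ, hχ, ⟨K, hKs, hK, hχ0⟩, hχ1⟩ :=
    exists_cutoff (isOpen_coordTarget (n := n) m V x) (ext_mem hxx)
  rw [source_eq_sum hχ hK hKs hχ0 φ hxx hχ1.self_of_nhds ξ]
  have key : ∀ (s : Finset (Fin m)) (c : Fin m → ℝ), ∃ t : HForm n m V n, IsTestForm t ∧
      eulerAt t φ x = ∑ a ∈ s, c a • eulerAt (basisForm x χ a) φ x := by
    classical
    intro s c
    induction s using Finset.induction_on with
    | empty =>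
      refine ⟨0, .zero, ?_⟩
      have := eulerAt_smul (IsSmoothForm.zero (V := V) (n := n) (m := m) (k := n)) 0 φ x
      rw [zero_smul, zero_smul] at this
      rw [this, Finset.sum_empty]
    | insert a s ha ih =>
      obtain ⟨t, ht, e⟩ := ih
      have hb : IsTestForm (basisForm x χ a : HForm n m V n) :=
        ⟨isSmoothFormOfOrder_basisForm hχ hK hKs hχ0 a, _, isCompact_image_symm hK hKs,
          pullSec_chartForm_eq_zero fun z _ hz => by rw [hχ0 _ hz, zero_mul, zero_smul]⟩
      refine ⟨c a • basisForm x χ a + t, (hb.smul (c a)).add ht, ?_⟩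
      rw [eulerAt_add (hb.smul (c a)).1.isSmoothForm ht.1.isSmoothForm,
        eulerAt_smul hb.1.isSmoothForm, e, Finset.sum_insert ha]
  exact key _ _

section Action

variable [SigmaCompactSpace M] {G : Type*} [Group G] {ψ : BundleAction n m V G} {t : HForm n m V n}

theorem pullSec_l2_baseSmul {χ : M → ℝ} (hχ : ContMDiff (𝓡 n) 𝓘(ℝ) ∞ χ)
    (ht : IsSmoothFormOfOrder 0 t) (φ : Sec n m V) (x : M) :
    pullSec n m φ (l2 n m om ν lam (baseSmul χ t)) x =
      χ x • pullSec n m φ (l2 n m om ν lam t) x := by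
  have h : eulerAt (baseSmul χ t) φ x = χ x • eulerAt t φ x := euler_baseSmul hχ ht φ x
  rw [pullSec_l2, pullSec_l2, h, map_smul, smul_assoc]

/-- A canonical action preserves the pairing of the Euler-Lagrange forms pointwise, when one of the
Lagrangians is a test form. -/
theorem pairAt_pull_of_isCanonical (hν : IsVolumeForm n ν) (hcan : ψ.IsCanonical om ν) (g : G)
    (h : IsCompactTop n m lam) (h' : IsCompactTop n m (ψ.pull g lam)) (ht : IsTestForm t)
    (φ : Sec n m V) (x : M) :
    pairAt om φ x (eulerAt (ψ.pull g lam) φ x) (eulerAt (ψ.pull g t) φ x) =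
      pairAt om (ψ.onSec g φ) x (eulerAt lam (ψ.onSec g φ) x) (eulerAt t (ψ.onSec g φ) x) := by
  obtain ⟨φ', hφ', e⟩ := exists_compactSec_jet φ x
  have hj := jet_eq_of_eventuallyEq e
  rw [pairAt_congr hj.symm, pairAt_congr (onSec_eq_of_jet ψ g hj.symm)]
  clear e hj φ
  have s1 := h'.1.1.l2 (om := om) hν (ht.pull ψ g).1.isSmoothForm
  have s2 := h.1.1.l2 (om := om) hν ht.1.isSmoothForm
  have c1 := isContForm_pullSec s1 φ'
  have c2 := isContForm_pullSec s2 (ψ.onSec g φ')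
  have key := form_eq_zero_of_integral hν (c1.add (c2.smul (-1))) (fun χ hχ hχK => ?_) x
  · have h1 : (pairAt om φ' x (eulerAt (ψ.pull g lam) φ' x) (eulerAt (ψ.pull g t) φ' x) -
        pairAt om (ψ.onSec g φ') x (eulerAt lam (ψ.onSec g φ') x)
          (eulerAt t (ψ.onSec g φ') x)) • ν x = 0 := by
      have gen : ∀ (a b : ℝ) (w : TangentSpace (𝓡 n) x [⋀^Fin n]→L[ℝ] ℝ),
          (a - b) • w = a • w + (-1 : ℝ) • b • w := by
        intro a b w
        ext v
        change (a - b) * w v = a * w v + (-1 : ℝ) * (b * w v)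
        ring
      exact (gen _ _ _).trans key
    exact sub_eq_zero.1 ((smul_eq_zero.1 h1).resolve_right (hν.1 x))
  · obtain ⟨K, hK, hχ0⟩ := hχK
    -- Canonicity, an identity of integrals, is applied to `χ t` for every cut-off `χ`. The function
    -- `χ` commutes with `E` on test forms, and with the pullback because `ψ_g` covers the identity,
    -- so it appears as a weight on both sides.
    have hc := hcan g lam (baseSmul χ t) h (ht.baseSmul hχ).isCompactTop h'
      ((ht.baseSmul hχ).pull ψ g).isCompactTop φ' hφ'
    have i1 : functional n m ν (l2 n m om ν (ψ.pull g lam) (ψ.pull g (baseSmul χ t))) φ' =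
        formIntegral n ν (fun x => χ x • pullSec n m φ' (l2 n m om ν (ψ.pull g lam) (ψ.pull g t)) x) :=
      congrArg (formIntegral n ν) (funext fun x => pullSec_l2_baseSmul hχ (ht.pull ψ g).1 φ' x)
    have i2 : functional n m ν (l2 n m om ν lam (baseSmul χ t)) (ψ.onSec g φ') =
        formIntegral n ν (fun x => χ x • pullSec n m (ψ.onSec g φ') (l2 n m om ν lam t) x) :=
      congrArg (formIntegral n ν) (funext fun x => pullSec_l2_baseSmul hχ ht.1 _ x)
    rw [i1, i2] at hc
    have hcont : ∀ β : ∀ x : M, TangentSpace (𝓡 n) x [⋀^Fin n]→L[ℝ] ℝ, IsContForm β →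
        IsContForm fun x => χ x • β x := by
      intro β hβ x₁
      refine ContinuousOn.mul (f := fun y => χ ((extChartAt (𝓡 n) x₁).symm y)) ?_ (hβ x₁)
      exact hχ.continuous.comp_continuousOn (continuousOn_extChartAt_symm x₁)
    have hz : ∀ β : ∀ x : M, TangentSpace (𝓡 n) x [⋀^Fin n]→L[ℝ] ℝ, ∀ x ∉ K, χ x • β x = 0 :=
      fun β x hx => by rw [hχ0 x hx]; exact zero_smul ℝ (β x)
    have hsum := formIntegral_add hν (hcont _ c1) ((hcont _ c2).smul (-1)) hK (hz _) hK
      fun x hx => (congrArg ((-1 : ℝ) • ·) (hz _ x hx)).trans (smul_zero _)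
    rw [formIntegral_smul, hc, neg_one_mul, add_neg_cancel] at hsum
    rw [← hsum]
    refine congrArg (formIntegral n ν) (funext fun x => ?_)
    refine (smul_add (χ x) (pullSec n m φ' (l2 n m om ν (ψ.pull g lam) (ψ.pull g t)) x)
      ((-1 : ℝ) • pullSec n m (ψ.onSec g φ') (l2 n m om ν lam t) x)).trans ?_
    rw [smul_comm]
    rfl

theorem pull_pull_inv (g : G) (α : HForm n m V k) : ψ.pull g (ψ.pull g⁻¹ α) = α := by
  refine hform_ext fun φ x => ?_
  have : ψ.onSec g⁻¹ (ψ.onSec g φ) = φ := by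
    ext x
    change ψ.act g⁻¹ x (ψ.act g x (φ x)) = φ x
    rw [← ψ.mul, inv_mul_cancel, ψ.one]
  change pullSec n m (ψ.onSec g⁻¹ (ψ.onSec g φ)) α x = pullSec n m φ α x
  rw [this]

/-- Canonicity cannot be localized directly for two forms of arbitrary order. Instead a test form
`t` is chosen whose pullback has the same Euler-Lagrange value at `φ` as `lam`. Equivariance against
all test forms `w` shows that `E(lam)` and `E(t)` at `ψ_g ∘ φ` have the same pairing with every
source value, so `t` replaces `lam` there. Nondegeneracy of the pairing is not needed. -/
theorem BundleAction.IsInvariant.l2 (hν : IsVolumeForm n ν) (hcan : ψ.IsCanonical om ν)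
    (h : IsCompactTop n m lam) (h' : IsCompactTop n m mu) (hi : ψ.IsInvariant lam)
    (hi' : ψ.IsInvariant mu) : ψ.IsInvariant (l2 n m om ν lam mu) := by
  refine fun g => hform_ext fun φ x => ?_
  have h1 : ∀ lam : HForm n m V n, IsCompactTop n m lam → ψ.IsInvariant lam → ∀ w, IsTestForm w →
      pairAt om φ x (eulerAt lam φ x) (eulerAt (ψ.pull g w) φ x) =
        pairAt om (ψ.onSec g φ) x (eulerAt lam (ψ.onSec g φ) x) (eulerAt w (ψ.onSec g φ) x) := by
    intro lam h hi w hw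
    have := pairAt_pull_of_isCanonical hν hcan g h (by rwa [hi g]) hw φ x
    rwa [hi g] at this
  have h2 : ∀ t w, IsTestForm t → IsTestForm w →
      pairAt om φ x (eulerAt (ψ.pull g t) φ x) (eulerAt (ψ.pull g w) φ x) =
        pairAt om (ψ.onSec g φ) x (eulerAt t (ψ.onSec g φ) x) (eulerAt w (ψ.onSec g φ) x) :=
    fun t w ht hw =>
      pairAt_pull_of_isCanonical hν hcan g ht.isCompactTop (ht.pull ψ g).isCompactTop hw φ x
  have h3 : ∀ lam : HForm n m V n, ∃ t, IsTestForm t ∧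
      eulerAt (ψ.pull g t) φ x = eulerAt lam φ x := by
    intro lam
    obtain ⟨t, ht, e⟩ := exists_isTestForm_eulerAt φ x (eulerAt lam φ x)
    exact ⟨ψ.pull g⁻¹ t, ht.pull ψ g⁻¹, by rw [pull_pull_inv, e]⟩
  obtain ⟨t, ht, et⟩ := h3 lam
  obtain ⟨s, hs, es⟩ := h3 mu
  have h4 : ∀ ξ, pairAt om (ψ.onSec g φ) x (eulerAt lam (ψ.onSec g φ) x) ξ =
      pairAt om (ψ.onSec g φ) x (eulerAt t (ψ.onSec g φ) x) ξ := by
    intro ξ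
    obtain ⟨w, hw, rfl⟩ := exists_isTestForm_eulerAt (ψ.onSec g φ) x ξ
    rw [← h1 lam h hi w hw, ← et, h2 t w ht hw]
  change pullSec n m (ψ.onSec g φ) (JetReduction.l2 n m om ν lam mu) x =
    pullSec n m φ (JetReduction.l2 n m om ν lam mu) x
  rw [pullSec_l2, pullSec_l2]
  refine congrArg (· • ν x) ?_
  -- With `lam` replaced by the test form `t`, skew-symmetry puts `t` into the second place, where
  -- the equivariance for the invariant form `mu` applies.
  rw [h4, pairAt_skew, ← h1 mu h' hi' t ht, et, ← pairAt_skew]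

end Action

end Canonical

section Homotopy
open MeasureTheory

variable {n m r s : ℕ} {U : Set (Rn n)} {p : JetCoord n m → ℝ}

/-! ### The fibre homotopy in coordinates -/

/-- Scaling of the fibre coordinates. -/
def vertScale (t : ℝ) (z : JetCoord n m) : JetCoord n m := (z.1, t • z.2)

/-- The mean of `p` over the segment from the zero jet. -/
def fiberMean (p : JetCoord n m → ℝ) (z : JetCoord n m) : ℝ :=
  ∫ t in Icc (0 : ℝ) 1, p (vertScale t z)

theorem SmoothOfOrder.fiberMean (hU : IsOpen U) (hp : SmoothOfOrder r U p) :
    SmoothOfOrder r U (fiberMean p) := by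
  obtain ⟨q, hq, e⟩ := hp
  refine ⟨fun w => ∫ t in Icc (0 : ℝ) 1, q (w.1, t • w.2), ?_, fun y hy u => ?_⟩
  · refine contDiffOn_intervalIntegral (hU.prod isOpen_univ)
      (q := fun z : ℝ × (Rn n × (Fin m × multiIdx n r → ℝ)) => q (z.2.1, z.1 • z.2.2)) ?_ 0 1
    refine hq.comp (ContDiff.contDiffOn ?_) fun z hz => ⟨hz.2.1, trivial⟩
    exact contDiff_snd.fst.prodMk (contDiff_fst.smul contDiff_snd.snd)
  · exact setIntegral_congr_fun measurableSet_Icc fun t _ => e y hy (t • u)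

/-- Jets of a fixed section, scaled in the fibres, depend smoothly on the scale and the point. -/
theorem SmoothOfOrder.comp_vertScale_jetAt (hU : IsOpen U) (hp : SmoothOfOrder r U p)
    {f : Rn n → Rn m} (hf : ContDiffOn ℝ ∞ f U) :
    ContDiffOn ℝ ∞ (fun z : ℝ × Rn n => p (vertScale z.1 (jetAt f z.2))) (univ ×ˢ U) := by
  obtain ⟨q, hq, e⟩ := hp
  have hjet : ContDiffOn ℝ ∞ (fun y => truncJet r (jetAt f y).2) U :=
    contDiffOn_pi.2 fun aI => partialDeriv_contDiffOn hU hf aI.1 aI.2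
  have hi : ContDiffOn ℝ ∞ (fun z : ℝ × Rn n => (z.2, z.1 • truncJet r (jetAt f z.2).2))
      (univ ×ˢ U) := contDiffOn_snd.prodMk
    (contDiffOn_fst.smul (hjet.comp contDiffOn_snd fun z hz => hz.2))
  exact (hq.comp hi fun z hz => ⟨hz.2, trivial⟩).congr fun z hz => e z.2 hz.2 _

theorem hasDerivAt_vertScale (hU : IsOpen U) (hp : SmoothOfOrder r U p) {z : JetCoord n m}
    (hz : z.1 ∈ U) (t : ℝ) : HasDerivAt (fun t => p (vertScale t z))
      (lineDeriv ℝ p (vertScale t z) (0, z.2)) t := by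
  obtain ⟨q, hq, e⟩ := hp
  have h1 := hasLineDerivAt_of_rep hU hq e (z := vertScale t z) hz (0, z.2)
  rw [← h1.lineDeriv, HasLineDerivAt] at h1
  have h2 : HasDerivAt (fun t' : ℝ => t' - t) 1 t := (hasDerivAt_id t).sub_const t
  have h3 := HasDerivAt.scomp t (by rwa [sub_self]) h2 (h := fun t' => t' - t)
    (g₁ := fun s => p (vertScale t z + s • ((0 : Rn n), z.2)))
  rw [one_smul] at h3
  refine h3.congr_of_eventuallyEq (Filter.Eventually.of_forall fun t' => ?_)
  refine congrArg p (Prod.ext ?_ ?_)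
  · simp [vertScale]
  · simp only [vertScale, Prod.smul_mk, Prod.mk_add_mk]
    module

theorem continuous_vertScale (hp : SmoothOfOrder r U p) {z : JetCoord n m} (hz : z.1 ∈ U) :
    Continuous fun t : ℝ => p (vertScale t z) := by
  obtain ⟨q, hq, e⟩ := hp
  have h : (fun t : ℝ => p (vertScale t z)) = fun t => q (z.1, t • truncJet r z.2) :=
    funext fun t => e z.1 hz (t • z.2)
  rw [h]
  have hc : Continuous fun t : ℝ => (z.1, t • truncJet r z.2) := by fun_prop
  exact continuousOn_univ.1 (hq.continuousOn.comp hc.continuousOn fun t _ => ⟨hz, trivial⟩)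

theorem vertScale_one (z : JetCoord n m) : vertScale 1 z = z := Prod.ext rfl (one_smul ℝ z.2)

/-- The fundamental theorem of calculus along the segment from the zero jet. -/
theorem sub_eq_integral_lineDeriv (hU : IsOpen U) (hp : SmoothOfOrder r U p) {z : JetCoord n m}
    (hz : z.1 ∈ U) : p z - p (vertScale 0 z) =
      ∫ t in Icc (0 : ℝ) 1, lineDeriv ℝ p (vertScale t z) (0, z.2) := by
  rw [integral_Icc_eq_integral_Ioc, ← intervalIntegral.integral_of_le zero_le_one]
  rw [intervalIntegral.integral_eq_sub_of_hasDerivAt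
    (fun t _ => hasDerivAt_vertScale hU hp hz t), vertScale_one]
  exact (continuous_vertScale (hp.lineDeriv_vert hU z.2) hz).intervalIntegrable 0 1

/-- The coefficient of the scaled function, divided by the scale. -/
def slope (r : ℕ) (p : JetCoord n m → ℝ) (z : JetCoord n m) : ℝ :=
  ∑ a : Fin m, ∑ I ∈ multiIdx n r, z.2 (a, I) * fiberMean (dU a I p) z

/-- The primitive for the fibre homotopy. -/
def fiberHomotopy (r : ℕ) (p : JetCoord n m → ℝ) (z : JetCoord n m) : ℝ :=
  ∑ a : Fin m, ∑ I ∈ multiIdx n r, z.2 (a, I) * fiberMean (fiberMean (dU a I p)) z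

/-- Hadamard's lemma along the fibres. Taken at a jet scaled by `t`, it shows that the quotient of
`p(t u) - p(0)` by `t` extends smoothly through `t = 0`; the mean of this quotient over `[0, 1]` is
`fiberHomotopy`. -/
theorem slope_eq (hU : IsOpen U) (hp : SmoothOfOrder r U p) {z : JetCoord n m} (hz : z.1 ∈ U) :
    slope r p z = p z - p (vertScale 0 z) := by
  rw [sub_eq_integral_lineDeriv hU hp hz]
  have hc : ∀ a I, Continuous fun t : ℝ => dU a I p (vertScale t z) := fun a I =>
    continuous_vertScale (hp.dU hU a I) hz
  have h1 : ∀ t : ℝ, lineDeriv ℝ p (vertScale t z) (0, z.2) =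
      ∑ a : Fin m, ∑ I ∈ multiIdx n r, z.2 (a, I) * dU a I p (vertScale t z) := fun t =>
    lineDeriv_vert_eq_sum hU hp (z := vertScale t z) hz z.2
  simp only [h1]
  rw [integral_finsetSum _ fun a _ => ?_]
  · refine Finset.sum_congr rfl fun a _ => ?_
    rw [integral_finsetSum _ fun I _ => ?_]
    · exact Finset.sum_congr rfl fun I _ => (integral_const_mul _ _).symm
    · exact ((hc a I).const_mul _).continuousOn.integrableOn_compact isCompact_Icc
  · exact (continuous_finsetSum _ fun I _ => (hc a I).const_mul _).continuousOn.integrableOn_compact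
      isCompact_Icc

theorem SmoothOfOrder.fiberHomotopy (hU : IsOpen U) (hp : SmoothOfOrder r U p) :
    SmoothOfOrder r U (fiberHomotopy r p) :=
  SmoothOfOrder.sum _ fun a _ => SmoothOfOrder.sum _ fun I hI =>
    (SmoothOfOrder.coord a hI).smul (((hp.dU hU a I).fiberMean hU).fiberMean hU)

/-- For the coefficients `B j` of a divergence, the divergence of their fibre homotopies. -/
theorem sum_pd_fiberHomotopy (hU : IsOpen U) {B : Fin n → JetCoord n m → ℝ}
    (hB : ∀ j, SmoothOfOrder r U (B j)) (hB0 : ∀ j, ∀ y ∈ U, B j (y, 0) = 0)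
    {f : Rn n → Rn m} (hf : ContDiffOn ℝ ∞ f U) {y : Rn n} (hy : y ∈ U) {w : ℝ → ℝ}
    (hw : ∀ t, t ≠ 0 →
      ∑ j, pd j (fun y => B j (vertScale t (jetAt f y))) y = t * w t) :
    ∑ j, pd j (fun y => fiberHomotopy r (B j) (jetAt f y)) y = ∫ t in Icc (0 : ℝ) 1, w t := by
  have hpd : ∀ a I, ContDiffOn ℝ ∞ (fun y => (jetAt f y).2 (a, I)) U := fun a I =>
    partialDeriv_contDiffOn hU hf a I
  -- `c j (t, y)` is the quotient of `B j`, at the jet of `f` scaled by `t`, by `t`, in a form that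
  -- is smooth at `t = 0` too.
  let c : Fin n → ℝ × Rn n → ℝ := fun j z => ∑ a : Fin m, ∑ I ∈ multiIdx n r,
    (jetAt f z.2).2 (a, I) * fiberMean (dU a I (B j)) (vertScale z.1 (jetAt f z.2))
  have hcs : ∀ j a I, ContDiffOn ℝ ∞ (fun z : ℝ × Rn n =>
      fiberMean (dU a I (B j)) (vertScale z.1 (jetAt f z.2))) (univ ×ˢ U) := fun j a I =>
    (((hB j).dU hU a I).fiberMean hU).comp_vertScale_jetAt hU hf
  have hc : ∀ j, ContDiffOn ℝ ∞ (c j) (univ ×ˢ U) := fun j =>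
    ContDiffOn.sum fun a _ => ContDiffOn.sum fun I _ =>
      ((hpd a I).comp contDiffOn_snd fun z hz => hz.2).mul (hcs j a I)
  have hcB : ∀ j, ∀ t : ℝ, ∀ y ∈ U, t * c j (t, y) = B j (vertScale t (jetAt f y)) := by
    intro j t y hy
    have h1 := slope_eq hU (hB j) (z := vertScale t (jetAt f y)) hy
    have h2 : vertScale 0 (vertScale t (jetAt f y)) = (y, 0) :=
      Prod.ext rfl (zero_smul ℝ _)
    rw [h2, hB0 j y hy, sub_zero] at h1
    rw [← h1, slope]
    simp only [c, Finset.mul_sum]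
    refine Finset.sum_congr rfl fun a _ => Finset.sum_congr rfl fun I _ => ?_
    change _ = (t * (jetAt f y).2 (a, I)) * _
    ring
  have hint : ∀ j, ∀ y ∈ U, fiberHomotopy r (B j) (jetAt f y) =
      ∫ t in Icc (0 : ℝ) 1, c j (t, y) := by
    intro j y hy
    have hcont : ∀ a I, Continuous fun t : ℝ =>
        fiberMean (dU a I (B j)) (vertScale t (jetAt f y)) := fun a I =>
      continuous_vertScale (((hB j).dU hU a I).fiberMean hU) hy
    simp only [c]
    rw [integral_finsetSum _ fun a _ => ?_]
    · refine Finset.sum_congr rfl fun a _ => ?_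
      rw [integral_finsetSum _ fun I _ => ?_]
      · exact Finset.sum_congr rfl fun I _ => (integral_const_mul _ _).symm
      · exact ((hcont a I).const_mul _).continuousOn.integrableOn_compact isCompact_Icc
    · exact (continuous_finsetSum _ fun I _ =>
        (hcont a I).const_mul _).continuousOn.integrableOn_compact isCompact_Icc
  have hW : IsOpen ((univ : Set ℝ) ×ˢ U) := isOpen_univ.prod hU
  have hpdc : ∀ j, Continuous fun t : ℝ => fderiv ℝ (c j) (t, y) (0, stdVec j) := fun j => by
    have h1 := ((hc j).fderiv_of_isOpen hW (m := ∞) (by simp)).continuousOn.clm_apply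
      (continuousOn_const (c := ((0 : ℝ), stdVec j)))
    have hcy : Continuous fun t : ℝ => (t, y) := by fun_prop
    exact continuousOn_univ.1 (h1.comp hcy.continuousOn fun t _ => ⟨trivial, hy⟩)
  have hcd : ∀ j t, HasFDerivAt (fun y => c j (t, y))
      ((fderiv ℝ (c j) (t, y)).comp (ContinuousLinearMap.inr ℝ ℝ (Rn n))) y := fun j t =>
    hasFDerivAt_partial hU (hc j) t hy
  have h1 : ∀ j, pd j (fun y => fiberHomotopy r (B j) (jetAt f y)) y =
      ∫ t in Icc (0 : ℝ) 1, fderiv ℝ (c j) (t, y) (0, stdVec j) := by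
    intro j
    have hd := hasFDerivAt_intervalIntegral hU (hc j) 0 1 hy
    rw [pd_congr hU (hint j) j hy, pd, hd.fderiv, ContinuousLinearMap.integral_apply]
    · rfl
    · have h2 := ((hc j).fderiv_of_isOpen hW (m := ∞) (by simp)).continuousOn.clm_comp
        (continuousOn_const (c := ContinuousLinearMap.inr ℝ ℝ (Rn n)))
      have hcy : Continuous fun t : ℝ => (t, y) := by fun_prop
      exact (h2.comp hcy.continuousOn fun t _ => ⟨trivial, hy⟩).integrableOn_compact isCompact_Icc
  simp only [h1]
  rw [← integral_finsetSum _ fun j _ => (hpdc j).continuousOn.integrableOn_compact isCompact_Icc]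
  refine setIntegral_congr_ae measurableSet_Icc ?_
  -- The hypothesis on `w` is divided by `t`; the excluded value is a null set.
  have hne : ∀ᵐ t : ℝ, t ≠ 0 := by simp [ae_iff]
  filter_upwards [hne] with t ht _
  have h3 := hw t ht
  have h4 : ∀ j, pd j (fun y => B j (vertScale t (jetAt f y))) y =
      t * fderiv ℝ (c j) (t, y) (0, stdVec j) := by
    intro j
    rw [pd_congr hU (fun y hy => (hcB j t y hy).symm) j hy, pd,
      ((hcd j t).const_mul t).fderiv]
    simp
  simp only [h4, ← Finset.mul_sum] at h3
  exact mul_left_cancel₀ ht h3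

end Homotopy

/-! ### Divergences as exterior derivatives -/

section Contraction

variable {k : ℕ}

/-- The contraction of the standard volume form with the vector `v`. -/
def contractTop (v : Fin (k + 1) → ℝ) : Rn (k + 1) [⋀^Fin k]→L[ℝ] ℝ :=
  ∑ j, v j • (stdTop (k + 1)).curryLeft (stdVec j)

/-- Only the component along the missing vector survives, since a repeated vector kills the form.
Moving this vector from the front to place `i` costs the sign, which cancels against the sign in the
exterior derivative. -/
theorem contractTop_apply (v : Fin (k + 1) → ℝ) (i : Fin (k + 1)) :
    contractTop v (i.removeNth stdFrame) = (-1 : ℝ) ^ (i : ℕ) * v i := by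
  have h : ∀ j : Fin (k + 1), stdTop (k + 1)
      (Matrix.vecCons (stdVec j) (i.removeNth stdFrame)) = if j = i then (-1 : ℝ) ^ (i : ℕ) else 0 := by
    intro j
    split_ifs with hj
    · subst hj
      have := (stdTop (k + 1)).toAlternatingMap.neg_one_pow_smul_map_insertNth j (stdVec j)
        (j.removeNth stdFrame)
      refine this.symm.trans ?_
      have h2 : j.insertNth (stdVec j) (j.removeNth stdFrame) = (stdFrame : Fin (k + 1) → _) :=
        Fin.insertNth_self_removeNth j stdFrame
      rw [h2]
      change (-1 : ℤ) ^ (j : ℕ) • stdTop (k + 1) stdFrame = _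
      rw [stdTop_stdFrame]
      simp
    · obtain ⟨l, rfl⟩ := Fin.exists_succAbove_eq hj
      exact (stdTop (k + 1)).map_eq_zero_of_eq _ (i := 0) (j := l.succ) rfl (Fin.succ_ne_zero l).symm
  have h2 : contractTop v (i.removeNth stdFrame) =
      ∑ j, v j * stdTop (k + 1) (Matrix.vecCons (stdVec j) (i.removeNth stdFrame)) := by
    rw [contractTop]
    exact map_sum (ContinuousAlternatingMap.apply ℝ (Rn (k + 1)) ℝ (i.removeNth stdFrame)) _ _
  rw [h2]
  simp [h, mul_comm]

theorem contractTop_contDiffOn {v : Fin (k + 1) → Rn (k + 1) → ℝ} {U : Set (Rn (k + 1))}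
    (hv : ∀ j, ContDiffOn ℝ ∞ (v j) U) :
    ContDiffOn ℝ ∞ (fun y => contractTop fun j => v j y) U :=
  ContDiffOn.sum fun j _ => (hv j).smul contDiffOn_const

/-- The exterior derivative of the contraction of the volume form with a vector field is its
divergence. -/
theorem extDeriv_contractTop {v : Fin (k + 1) → Rn (k + 1) → ℝ} {U : Set (Rn (k + 1))}
    (hU : IsOpen U) (hv : ∀ j, ContDiffOn ℝ ∞ (v j) U) {y : Rn (k + 1)} (hy : y ∈ U) :
    extDeriv (fun y => contractTop fun j => v j y) y stdFrame = ∑ j, pd j (v j) y := by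
  rw [extDeriv_apply (((contractTop_contDiffOn hv).contDiffAt (hU.mem_nhds hy)).differentiableAt
    (by simp))]
  refine Finset.sum_congr rfl fun i _ => ?_
  simp only [contractTop_apply]
  have hd : DifferentiableAt ℝ (v i) y :=
    ((hv i).contDiffAt (hU.mem_nhds hy)).differentiableAt (by simp)
  rw [(hd.hasFDerivAt.const_mul _).fderiv, pd]
  change (-1 : ℤ) ^ (i : ℕ) • ((-1 : ℝ) ^ (i : ℕ) * fderiv ℝ (v i) y (stdVec i)) = _
  rw [zsmul_eq_mul, ← mul_assoc]
  push_cast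
  rw [← mul_pow]
  norm_num

end Contraction

section LocalHomotopy
open MeasureTheory
variable {n m : ℕ} {M : Type*} [TopologicalSpace M] [ChartedSpace (Rn n) M]
  [IsManifold (𝓡 n) ∞ M]
  {V : M → Type*} [∀ x, AddCommGroup (V x)] [∀ x, Module ℝ (V x)] [∀ x, TopologicalSpace (V x)]
  [TopologicalSpace (TotalSpace (Rn m) V)] [FiberBundle (Rn m) V] [VectorBundle ℝ (Rn m) V]
  [ContMDiffVectorBundle ∞ (Rn m) V (𝓡 n)]

variable {r : ℕ} {x₀ : M} {χ : M → ℝ} {lam : HForm n m V n}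

/-! ### The homotopy operator in a chart -/

/-- The direction of variation `χ uᵃ` in the coordinates at `x₀`. -/
def cutDir (x₀ : M) (χ : M → ℝ) (a : Fin m) (z : JetCoord n m) : ℝ :=
  χ ((extChartAt (𝓡 n) x₀).symm z.1) * z.2 (a, 0)

/-- The boundary terms of the variation of `lam` in the direction `χ u`. -/
def bdryCoef (x₀ : M) (χ : M → ℝ) (r : ℕ) (lam : HForm n m V n) (j : Fin n) :
    JetCoord n m → ℝ := varBdry r (scoef x₀ lam) (cutDir x₀ χ) j

theorem cutDir_smooth (hχ : ContMDiff (𝓡 n) 𝓘(ℝ) ∞ χ) (a : Fin m) :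
    SmoothOfOrder 0 (coordTarget n m V x₀) (cutDir x₀ χ a) :=
  (SmoothOfOrder.of_base (contDiffOn_comp_symm hχ x₀)).smul
    (SmoothOfOrder.coord a (mem_multiIdx.2 (by simp)))

theorem bdryCoef_eq_zero_of_cutDir {z : JetCoord n m}
    (h : ∀ a l, totalDl l (cutDir x₀ χ a) z = 0) (j : Fin n) : bdryCoef x₀ χ r lam j z = 0 :=
  varBdry_eq_zero _ h j

/-- The direction `χ u` vanishes at the zero jet together with its total derivatives. The quotient
by `t` in the fibre homotopy requires this. -/
theorem bdryCoef_zero_jet (hχ : ContMDiff (𝓡 n) 𝓘(ℝ) ∞ χ) (j : Fin n) {y : Rn n}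
    (hy : y ∈ coordTarget n m V x₀) : bdryCoef x₀ χ r lam j (y, 0) = 0 := by
  have hU := isOpen_coordTarget (n := n) m V x₀
  have h0 : (y, 0) = jetAt (fun _ => (0 : Rn m)) y :=
    Prod.ext rfl (jetAt_eq_zero isClosed_empty (fun _ _ => rfl) (notMem_empty y)).symm
  refine bdryCoef_eq_zero_of_cutDir (fun a l => ?_) j
  rw [h0]
  refine (totalDl_comp_jetAt hU (cutDir_smooth (V := V) hχ a) contDiffOn_const l hy).symm.trans ?_
  have h1 : EqOn (fun y => cutDir x₀ χ a (jetAt (fun _ => (0 : Rn m)) y)) (fun _ => 0)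
      (coordTarget n m V x₀) := fun y _ => by
    change _ * partialDeriv (fun _ => (0 : Rn m)) y a 0 = 0
    rw [partialDeriv_zero]
    simp
  rw [pdl_congr hU h1 l hy]
  have h2 : ∀ l : List (Fin n), pdl l (fun _ : Rn n => (0 : ℝ)) = fun _ => 0 := by
    intro l
    induction l with
    | nil => rfl
    | cons i l ih =>
      change pd i (pdl l _) = _
      rw [ih]
      funext y
      simp [pd]
  rw [h2]

theorem bdryCoef_eq_zero {K : Set (Rn n)} (hK : IsClosed K)
    (h0 : ∀ y ∈ coordTarget n m V x₀, y ∉ K → χ ((extChartAt (𝓡 n) x₀).symm y) = 0) (j : Fin n)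
    {z : JetCoord n m} (hz : z.1 ∈ coordTarget n m V x₀ \ K) :
    bdryCoef x₀ χ r lam j z = 0 := by
  have hU : IsOpen (coordTarget n m V x₀ \ K) := (isOpen_coordTarget m V x₀).sdiff hK
  refine bdryCoef_eq_zero_of_cutDir (fun a l => ?_) j
  refine totalDl_eq_zero hU (fun z hz => ?_) l hz
  rw [cutDir, h0 _ hz.1 hz.2, zero_mul]

theorem fiberHomotopy_eq_zero {s : ℕ} {U : Set (Rn n)} (hU : IsOpen U) {p : JetCoord n m → ℝ}
    (h : ∀ z : JetCoord n m, z.1 ∈ U → p z = 0) {z : JetCoord n m} (hz : z.1 ∈ U) :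
    fiberHomotopy s p z = 0 := by
  have h1 : ∀ a I, ∀ z : JetCoord n m, z.1 ∈ U → dU a I p z = 0 := fun a I z hz => by
    rw [dU_congr (p' := fun _ => (0 : ℝ)) hU h a I hz]
    simp [dU, lineDeriv]
  refine Finset.sum_eq_zero fun a _ => Finset.sum_eq_zero fun I _ => ?_
  have h2 : fiberMean (fiberMean (dU a I p)) z = 0 := by
    refine setIntegral_eq_zero_of_forall_eq_zero fun t _ => ?_
    exact setIntegral_eq_zero_of_forall_eq_zero fun s _ => h1 a I _ hz
  rw [h2, mul_zero]

variable [T2Space M]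

/-- In `r + 0 + r` the first `r` is the order of the Lagrangian, `0` that of the direction `χ u`,
and the last `r` bounds the number of total derivatives taken. -/
theorem bdryCoef_smooth (hχ : ContMDiff (𝓡 n) 𝓘(ℝ) ∞ χ) (h : IsSmoothFormOfOrder r lam)
    (j : Fin n) : SmoothOfOrder (r + 0 + r) (coordTarget n m V x₀) (bdryCoef x₀ χ r lam j) :=
  varBdry_smooth (isOpen_coordTarget m V x₀) (h.scoef x₀) (fun a => cutDir_smooth hχ a) j

theorem localSec_mulSec (hχ : ContMDiff (𝓡 n) 𝓘(ℝ) ∞ χ) (φ : Sec n m V) {y : Rn n}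
    (hy : y ∈ coordTarget n m V x₀) : localSec n m x₀ (mulSec χ hχ φ) y =
      χ ((extChartAt (𝓡 n) x₀).symm y) • localSec n m x₀ φ y := by
  rw [localSec, localSec, triv_eq_linearMapAt (symm_mem hy), triv_eq_linearMapAt (symm_mem hy)]
  exact map_smul _ _ _

theorem vertScale_jetAt (φ : Sec n m V) (t : ℝ) {y : Rn n} (hy : y ∈ coordTarget n m V x₀) :
    vertScale t (jetAt (localSec n m x₀ φ) y) = jetAt (localSec n m x₀ (t • φ)) y := by
  have h := jetAt_localSec_add_smul (0 : Sec n m V) φ t hy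
  rw [zero_add] at h
  rw [h]
  have h0 : jetAt (localSec n m x₀ (0 : Sec n m V)) y = (y, 0) := by
    rw [jetAt_congr (g := fun _ => 0) (isOpen_coordTarget (n := n) m V x₀) (fun y hy => ?_) hy]
    · exact Prod.ext rfl (jetAt_eq_zero isClosed_empty (fun _ _ => rfl) (notMem_empty y))
    · rw [localSec, triv_eq_linearMapAt (symm_mem hy)]
      exact map_zero _
  rw [h0]
  refine Prod.ext ?_ ?_
  · simp [vertScale, jetAt]
  · simp [vertScale]

/-- The first variation in the direction `χ φ` of a Lagrangian with vanishing Euler-Lagrange form is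
a divergence. -/
theorem sum_pd_bdryCoef (hχ : ContMDiff (𝓡 n) 𝓘(ℝ) ∞ χ) (h : IsSmoothFormOfOrder r lam)
    (hE : euler n m lam = 0) (φ : Sec n m V) {y : Rn n} (hy : y ∈ coordTarget n m V x₀) (t : ℝ) :
    ∑ j, pd j (fun y => bdryCoef x₀ χ r lam j (vertScale t (jetAt (localSec n m x₀ φ) y))) y =
      t * variation x₀ lam (t • φ) (mulSec χ hχ φ) y := by
  have hU := isOpen_coordTarget (n := n) m V x₀
  set f := localSec n m x₀ (t • φ) with hf
  have hfs : ContDiffOn ℝ ∞ f (coordTarget n m V x₀) := localSec_contDiffOn _ x₀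
  have h1 : ∀ j, pd j (fun y => bdryCoef x₀ χ r lam j
      (vertScale t (jetAt (localSec n m x₀ φ) y))) y =
      totalD j (bdryCoef x₀ χ r lam j) (jetAt f y) := fun j => by
    rw [← pd_comp_jetAt hU (bdryCoef_smooth hχ h j) hfs j hy]
    exact pd_congr hU (fun y hy => congrArg _ (vertScale_jetAt φ t hy)) j hy
  have h2 := lineDeriv_eq_euler_add_bdry hU (h.scoef x₀) (Q := cutDir x₀ χ)
    (fun a => cutDir_smooth hχ a) (z := jetAt f y) hy
  have hE' : ∀ a, eulerCoord a (scoef x₀ lam) (jetAt f y) = 0 := by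
    intro a
    have h3 := (euler_eq_zero_iff h.isSmoothForm (t • φ) (symm_mem hy)).1
      (congrFun hE _) (EuclideanSpace.single a 1)
    rw [ext_symm hy] at h3
    simpa [eulerIn] using h3
  simp only [hE', smul_zero, Finset.sum_const_zero, zero_add] at h2
  simp only [h1]
  refine h2.symm.trans ?_
  -- At the jet of `t φ` the direction `χ u` becomes the section `t χ φ`. This factor `t` is the one
  -- that the fibre homotopy divides out.
  have h4 : ((0 : Rn n), fun aI : Fin m × (Fin n → ℕ) =>
      totalDl (idxList aI.2) (cutDir x₀ χ aI.1) (jetAt f y)) =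
      t • ((0 : Rn n), (jetAt (localSec n m x₀ (mulSec χ hχ φ)) y).2) := by
    refine Prod.ext (by simp) (funext fun aI => ?_)
    change totalDl (idxList aI.2) (cutDir x₀ χ aI.1) (jetAt f y) =
      t * partialDeriv (localSec n m x₀ (mulSec χ hχ φ)) y aI.1 aI.2
    have e : EqOn (fun y => cutDir x₀ χ aI.1 (jetAt f y))
        (fun y => (t • ContinuousLinearMap.id ℝ ℝ) (localSec n m x₀ (mulSec χ hχ φ) y aI.1))
        (coordTarget n m V x₀) := fun y hy => by
      change _ * partialDeriv f y aI.1 0 =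
        t * (localSec n m x₀ (mulSec χ hχ φ) y aI.1)
      rw [partialDeriv_zero, localSec_mulSec hχ φ hy, hf, localSec_smul t φ hy]
      simp only [PiLp.smul_apply, smul_eq_mul]
      change χ ((extChartAt (𝓡 n) x₀).symm y) * _ = _
      ring
    refine (totalDl_comp_jetAt hU (cutDir_smooth (V := V) hχ aI.1) hfs _ hy).symm.trans ?_
    rw [pdl_congr hU e _ hy,
      partialDeriv_eq_pdl hU (localSec_contDiffOn _ x₀) _ _ hy, pdl_clm hU _ _ _ hy]
    · rfl
    · exact (contDiff_apply_euclidean aI.1).comp_contDiffOn (localSec_contDiffOn _ x₀)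
  rw [h4, lineDeriv_smul, variation, smul_eq_mul]

end LocalHomotopy

section LocalHomotopy
open MeasureTheory
variable {k m : ℕ} {M : Type*} [TopologicalSpace M] [ChartedSpace (Rn (k + 1)) M]
  [IsManifold (𝓡 (k + 1)) ∞ M]
  {V : M → Type*} [∀ x, AddCommGroup (V x)] [∀ x, Module ℝ (V x)] [∀ x, TopologicalSpace (V x)]
  [TopologicalSpace (TotalSpace (Rn m) V)] [FiberBundle (Rn m) V] [VectorBundle ℝ (Rn m) V]
  [ContMDiffVectorBundle ∞ (Rn m) V (𝓡 (k + 1))]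

variable {r : ℕ} {x₀ : M} {χ : M → ℝ} {lam : HForm (k + 1) m V (k + 1)}

/-- The part of the primitive of `lam` that belongs to the cut-off `χ`. -/
def homotopyForm (x₀ : M) (χ : M → ℝ) (r : ℕ) (lam : HForm (k + 1) m V (k + 1)) :
    HForm (k + 1) m V k :=
  chartForm x₀ fun z => contractTop fun j => fiberHomotopy (r + 0 + r) (bdryCoef x₀ χ r lam j) z

variable [T2Space M]

theorem fiberHomotopy_bdryCoef_smooth (hχ : ContMDiff (𝓡 (k + 1)) 𝓘(ℝ) ∞ χ)
    (h : IsSmoothFormOfOrder r lam) (j : Fin (k + 1)) :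
    SmoothOfOrder (r + 0 + r) (coordTarget (k + 1) m V x₀)
      (fiberHomotopy (r + 0 + r) (bdryCoef x₀ χ r lam j)) :=
  (bdryCoef_smooth hχ h j).fiberHomotopy (isOpen_coordTarget m V x₀)

theorem isCompact_image_ext (hc : IsCompact (tsupport χ))
    (hs : tsupport χ ⊆ coordSource (k + 1) m V x₀) :
    IsCompact (extChartAt (𝓡 (k + 1)) x₀ '' tsupport χ) :=
  hc.image_of_continuousOn fun _ hx => (contMDiffAt_ext (hs hx)).continuousAt.continuousWithinAt

theorem image_ext_subset (hs : tsupport χ ⊆ coordSource (k + 1) m V x₀) :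
    extChartAt (𝓡 (k + 1)) x₀ '' tsupport χ ⊆ coordTarget (k + 1) m V x₀ := by
  rintro _ ⟨x, hx, rfl⟩
  exact ext_mem (hs hx)

theorem symm_image_image_ext (hs : tsupport χ ⊆ coordSource (k + 1) m V x₀) :
    (extChartAt (𝓡 (k + 1)) x₀).symm '' (extChartAt (𝓡 (k + 1)) x₀ '' tsupport χ) = tsupport χ := by
  rw [image_image]
  refine (image_congr fun x hx => symm_ext (hs hx)).trans (image_id _)

theorem homotopyCoef_eq_zero (hc : IsCompact (tsupport χ))
    (hs : tsupport χ ⊆ coordSource (k + 1) m V x₀) (z : JetCoord (k + 1) m)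
    (hz : z.1 ∈ coordTarget (k + 1) m V x₀)
    (hzK : z.1 ∉ extChartAt (𝓡 (k + 1)) x₀ '' tsupport χ) :
    contractTop (fun j => fiberHomotopy (r + 0 + r) (bdryCoef x₀ χ r lam j) z) = 0 := by
  have hK := (isCompact_image_ext (m := m) (V := V) hc hs).isClosed
  have h0 : ∀ y ∈ coordTarget (k + 1) m V x₀, y ∉ extChartAt (𝓡 (k + 1)) x₀ '' tsupport χ →
      χ ((extChartAt (𝓡 (k + 1)) x₀).symm y) = 0 := fun y hy hyK =>
    image_eq_zero_of_notMem_tsupport fun h => hyK ⟨_, h, ext_symm hy⟩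
  have h1 : ∀ j, fiberHomotopy (r + 0 + r) (bdryCoef x₀ χ r lam j) z = 0 := fun j =>
    fiberHomotopy_eq_zero ((isOpen_coordTarget m V x₀).sdiff hK)
      (fun z hz => bdryCoef_eq_zero hK h0 j hz) ⟨hz, hzK⟩
  simp only [h1]; simp only [contractTop, zero_smul, Finset.sum_const_zero]

theorem isSmoothFormOfOrder_homotopyForm (hχ : ContMDiff (𝓡 (k + 1)) 𝓘(ℝ) ∞ χ)
    (hc : IsCompact (tsupport χ)) (hs : tsupport χ ⊆ coordSource (k + 1) m V x₀)
    (h : IsSmoothFormOfOrder r lam) :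
    IsSmoothFormOfOrder (r + 0 + r) (homotopyForm x₀ χ r lam) :=
  isSmoothFormOfOrder_chartForm (isCompact_image_ext (m := m) (V := V) hc hs) (image_ext_subset hs)
    (SmoothOfOrder.sum _ fun j _ => (fiberHomotopy_bdryCoef_smooth hχ h j).smul
      (SmoothOfOrder.const _)) (homotopyCoef_eq_zero hc hs)

theorem pullSec_homotopyForm_eq_zero (hc : IsCompact (tsupport χ))
    (hs : tsupport χ ⊆ coordSource (k + 1) m V x₀) (φ : Sec (k + 1) m V) {x : M}
    (hx : x ∉ tsupport χ) : pullSec (k + 1) m φ (homotopyForm x₀ χ r lam) x = 0 := by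
  refine pullSec_chartForm_eq_zero (homotopyCoef_eq_zero hc hs) φ ?_
  rwa [symm_image_image_ext hs]

/-- The homotopy form vanishes along a section where the section does. -/
theorem pullSec_homotopyForm_eq_zero_of_sec (φ : Sec (k + 1) m V) {x : M}
    (h0 : ∀ᶠ x' in 𝓝 x, φ x' = 0) : pullSec (k + 1) m φ (homotopyForm x₀ χ r lam) x = 0 := by
  by_cases hx : x ∈ coordSource (k + 1) m V x₀
  · rw [homotopyForm, pullSec_chartForm φ hx]
    -- Where `φ` vanishes near `x` its jet is the zero jet, and every summand of `fiberHomotopy`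
    -- carries a factor from the fibre coordinates.
    have h1 : jetAt (localSec (k + 1) m x₀ φ) (extChartAt (𝓡 (k + 1)) x₀ x) =
        vertScale 0 (jetAt (localSec (k + 1) m x₀ φ) (extChartAt (𝓡 (k + 1)) x₀ x)) := by
      have hz : jet (k + 1) m φ x = jet (k + 1) m ((0 : ℝ) • φ) x := jet_eq_of_eventuallyEq (by
        filter_upwards [h0] with x' hx'
        change φ x' = (0 : ℝ) • φ x'
        rw [zero_smul, hx'])
      rw [vertScale_jetAt φ 0 (ext_mem hx)]
      exact jetAt_eq_of_jet_eq hz hx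
    have h2 : ∀ j, fiberHomotopy (r + 0 + r) (bdryCoef x₀ χ r lam j)
        (jetAt (localSec (k + 1) m x₀ φ) (extChartAt (𝓡 (k + 1)) x₀ x)) = 0 := by
      intro j
      rw [h1]
      refine Finset.sum_eq_zero fun a _ => Finset.sum_eq_zero fun I _ => ?_
      change (0 : ℝ) * _ * _ = 0
      rw [zero_mul, zero_mul]
    simp only [h2]
    simp only [contractTop, zero_smul, Finset.sum_const_zero]
    rfl
  · exact if_neg hx

theorem coef_dH_homotopyForm_self (hχ : ContMDiff (𝓡 (k + 1)) 𝓘(ℝ) ∞ χ)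
    (hc : IsCompact (tsupport χ)) (hs : tsupport χ ⊆ coordSource (k + 1) m V x₀)
    (h : IsSmoothFormOfOrder r lam) (hE : euler (k + 1) m lam = 0) (φ : Sec (k + 1) m V)
    {y : Rn (k + 1)} (hy : y ∈ coordTarget (k + 1) m V x₀) :
    coef x₀ (pullSec (k + 1) m φ (dH (k + 1) m (homotopyForm x₀ χ r lam))) y =
      ∫ t in Icc (0 : ℝ) 1, variation x₀ lam (t • φ) (mulSec χ hχ φ) y := by
  have hU := isOpen_coordTarget (n := k + 1) m V x₀
  have hΓ := (isSmoothFormOfOrder_homotopyForm hχ hc hs h).isSmoothForm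
  have h1 := formIn_dH hΓ (symm_mem hy) φ
  rw [ext_symm hy] at h1
  have hsm : ∀ j, ContDiffOn ℝ ∞ (fun y => fiberHomotopy (r + 0 + r) (bdryCoef x₀ χ r lam j)
      (jetAt (localSec (k + 1) m x₀ φ) y)) (coordTarget (k + 1) m V x₀) := fun j =>
    (fiberHomotopy_bdryCoef_smooth hχ h j).comp_jetAt hU (localSec_contDiffOn φ x₀)
  have h2 : (fun y => formIn x₀ (homotopyForm x₀ χ r lam)
      ((extChartAt (𝓡 (k + 1)) x₀).symm y) φ) =ᶠ[𝓝 y] fun y => contractTop fun j =>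
        fiberHomotopy (r + 0 + r) (bdryCoef x₀ χ r lam j)
          (jetAt (localSec (k + 1) m x₀ φ) y) := by
    filter_upwards [hU.mem_nhds hy] with y' hy'
    exact repOn_chartForm y' hy' φ
  rw [h2.extDeriv_eq] at h1
  refine (congrArg (fun β : Rn (k + 1) [⋀^Fin (k + 1)]→L[ℝ] ℝ => β stdFrame) h1).trans ?_
  rw [extDeriv_contractTop hU hsm hy]
  exact sum_pd_fiberHomotopy hU (fun j => bdryCoef_smooth hχ h j)
    (fun j y hy => bdryCoef_zero_jet (V := V) hχ j hy) (localSec_contDiffOn φ x₀) hy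
    fun t _ => sum_pd_bdryCoef hχ h hE φ hy t

/-- The differential of the homotopy form is the integrated first variation in the direction
`χ φ`, in any chart. -/
theorem coef_dH_homotopyForm (hχ : ContMDiff (𝓡 (k + 1)) 𝓘(ℝ) ∞ χ)
    (hc : IsCompact (tsupport χ)) (hs : tsupport χ ⊆ coordSource (k + 1) m V x₀)
    (h : IsSmoothFormOfOrder r lam) (hE : euler (k + 1) m lam = 0) (φ : Sec (k + 1) m V)
    {x₁ : M} {y : Rn (k + 1)} (hy : y ∈ coordTarget (k + 1) m V x₁) :
    coef x₁ (pullSec (k + 1) m φ (dH (k + 1) m (homotopyForm x₀ χ r lam))) y =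
      ∫ t in Icc (0 : ℝ) 1, variation x₁ lam (t • φ) (mulSec χ hχ φ) y := by
  have hΓ := (isSmoothFormOfOrder_homotopyForm hχ hc hs h).isSmoothForm
  -- The homotopy form depends on the chart at `x₀`, but over that chart its differential and the
  -- variation transform by the same Jacobian. Elsewhere both vanish, because `χ` is zero near the
  -- point.
  by_cases hx : (extChartAt (𝓡 (k + 1)) x₁).symm y ∈ coordSource (k + 1) m V x₀
  · have hyo : y ∈ overlap (k + 1) m V x₁ x₀ := ⟨hy, hx⟩
    rw [coef_transMap hyo, coef_dH_homotopyForm_self hχ hc hs h hE φ (transMap_mem hyo).1,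
      ← integral_const_mul]
    exact setIntegral_congr_fun measurableSet_Icc fun t _ =>
      (variation_transMap h.isSmoothForm _ _ hyo).symm
  · have hx' : (extChartAt (𝓡 (k + 1)) x₁).symm y ∉ tsupport χ := fun h => hx (hs h)
    have hev := (isClosed_tsupport χ).isOpen_compl.eventually_mem hx'
    have h1 : pullSec (k + 1) m φ (dH (k + 1) m (homotopyForm x₀ χ r lam))
        ((extChartAt (𝓡 (k + 1)) x₁).symm y) = 0 := dH_eq_zero hΓ (by
      filter_upwards [hev] with x hx using pullSec_homotopyForm_eq_zero hc hs φ hx)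
    rw [coef_eq_zero h1]
    refine (setIntegral_eq_zero_of_forall_eq_zero fun t _ => ?_).symm
    have h2 : localSec (k + 1) m x₁ (mulSec χ hχ φ) =ᶠ[𝓝 y] fun _ => 0 := by
      filter_upwards [(continuousAt_symm hy).eventually hev,
        (isOpen_coordTarget m V x₁).mem_nhds hy] with y' hy' hyt
      rw [localSec_mulSec hχ φ hyt, image_eq_zero_of_notMem_tsupport hy', zero_smul]
    have h3 : (jetAt (localSec (k + 1) m x₁ (mulSec χ hχ φ)) y).2 = 0 := by
      rw [jetAt_congr_of_eventuallyEq h2]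
      exact jetAt_eq_zero isClosed_empty (fun _ _ => rfl) (notMem_empty y)
    rw [variation, h3]
    simp [lineDeriv]

end LocalHomotopy

section LocallyFiniteSums
open MeasureTheory
variable {n m : ℕ} {M : Type*} [TopologicalSpace M] [ChartedSpace (Rn n) M]
  [IsManifold (𝓡 n) ∞ M]
  {V : M → Type*} [∀ x, AddCommGroup (V x)] [∀ x, Module ℝ (V x)] [∀ x, TopologicalSpace (V x)]
  [TopologicalSpace (TotalSpace (Rn m) V)] [FiberBundle (Rn m) V] [VectorBundle ℝ (Rn m) V]
  [ContMDiffVectorBundle ∞ (Rn m) V (𝓡 n)]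

variable {k : ℕ}

theorem dH_sum [T2Space M] {ι : Type*} (t : Finset ι) {F : ι → HForm n m V k}
    (h : ∀ i ∈ t, IsSmoothForm n m (F i)) :
    IsSmoothForm n m (∑ i ∈ t, F i) ∧ dH n m (∑ i ∈ t, F i) = ∑ i ∈ t, dH n m (F i) := by
  classical
  induction t using Finset.induction_on with
  | empty => exact ⟨IsSmoothForm.zero, dH_zero⟩
  | insert a s ha ih =>
    obtain ⟨h1, h2⟩ := ih fun i hi => h i (Finset.mem_insert_of_mem hi)
    have h3 := h a (Finset.mem_insert_self a s)
    rw [Finset.sum_insert ha, Finset.sum_insert ha, ← h2]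
    exact ⟨h3.add h1, dH_add h3 h1⟩

theorem dH_eq_of_eventuallyEq {α β : HForm n m V k} (hα : IsSmoothForm n m α)
    (hβ : IsSmoothForm n m β) {φ : Sec n m V} {x : M}
    (h : ∀ᶠ x' in 𝓝 x, pullSec n m φ α x' = pullSec n m φ β x') :
    dH n m α (jet n m φ x) = dH n m β (jet n m φ x) := by
  refine toChart_injective (_root_.mem_extChartAt_source x) (x₀ := x) (x := x)
    ((formIn_dH hα (mem_coordSource_self x) φ).trans
      (Eq.trans ?_ (formIn_dH hβ (mem_coordSource_self x) φ).symm))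
  refine Filter.EventuallyEq.extDeriv_eq ?_
  have h' : ∀ᶠ x' in 𝓝 ((extChartAt (𝓡 n) x).symm (extChartAt (𝓡 n) x x)),
      pullSec n m φ α x' = pullSec n m φ β x' := by rwa [extChartAt_to_inv]
  filter_upwards [(continuousAt_symm (V := V) (m := m) (ext_mem (mem_coordSource_self x))).eventually h']
    with y hy
  exact congrArg (toChart n x _) hy

/-- The sum of a locally finite family of forms. -/
def locSum {ι : Type*} (F : ι → HForm n m V k) : HForm n m V k := fun θ => ∑ᶠ i, F i θ

section

variable {ι : Type*} {F : ι → HForm n m V k} {T : ι → Set M}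

theorem pullSec_sum (t : Finset ι) (φ : Sec n m V) (x : M) :
    pullSec n m φ (∑ i ∈ t, F i) x = ∑ i ∈ t, pullSec n m φ (F i) x :=
  Finset.sum_apply _ _ _

theorem pullSec_locSum {t : Finset ι} {φ : Sec n m V} {x : M}
    (h : ∀ i ∉ t, pullSec n m φ (F i) x = 0) :
    pullSec n m φ (locSum F) x = pullSec n m φ (∑ i ∈ t, F i) x := by
  rw [pullSec_sum]
  refine finsum_eq_sum_of_support_subset _ fun i hi => ?_
  by_contra hit
  exact hi (h i hit)

theorem locSum_eventuallyEq (hT : LocallyFinite T) (hc : ∀ i, IsClosed (T i))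
    (h0 : ∀ i, ∀ φ : Sec n m V, ∀ x ∉ T i, pullSec n m φ (F i) x = 0) {x : M} {t : Finset ι}
    (ht : ∀ i, x ∈ T i → i ∈ t) : ∀ᶠ x' in 𝓝 x, ∀ φ : Sec n m V,
      pullSec n m φ (locSum F) x' = pullSec n m φ (∑ i ∈ t, F i) x' := by
  filter_upwards [hT.eventually_subset hc x] with x' hx' φ
  exact pullSec_locSum fun i hi => h0 i φ x' fun h => hi (ht i (hx' h))

/-- Near each point the sum is finite. The common order `r` is essential, as a local form must live
on one finite jet bundle; this is why orders are tracked throughout. -/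
theorem IsSmoothFormOfOrder.locSum [T2Space M] {r : ℕ} (h : ∀ i, IsSmoothFormOfOrder r (F i))
    (hT : LocallyFinite T) (hc : ∀ i, IsClosed (T i))
    (h0 : ∀ i, ∀ φ : Sec n m V, ∀ x ∉ T i, pullSec n m φ (F i) x = 0) :
    IsSmoothFormOfOrder r (locSum F) :=
  IsSmoothFormOfOrder.of_eventuallyEq fun x =>
    ⟨_, IsSmoothFormOfOrder.sum (hT.point_finite x).toFinset fun i _ => h i,
      locSum_eventuallyEq hT hc h0 fun _ hi => (hT.point_finite x).mem_toFinset.2 hi⟩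

theorem pullSec_dH_locSum [T2Space M] {r : ℕ} (h : ∀ i, IsSmoothFormOfOrder r (F i))
    (hT : LocallyFinite T) (hc : ∀ i, IsClosed (T i))
    (h0 : ∀ i, ∀ φ : Sec n m V, ∀ x ∉ T i, pullSec n m φ (F i) x = 0) {x : M} {t : Finset ι}
    (ht : ∀ i, x ∈ T i → i ∈ t) (φ : Sec n m V) :
    pullSec n m φ (dH n m (JetReduction.locSum F)) x =
      ∑ i ∈ t, pullSec n m φ (dH n m (F i)) x := by
  obtain ⟨h1, h2⟩ := dH_sum t fun i _ => (h i).isSmoothForm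
  refine (dH_eq_of_eventuallyEq (IsSmoothFormOfOrder.locSum h hT hc h0).isSmoothForm h1
    ((locSum_eventuallyEq hT hc h0 ht).mono fun x' hx' => hx' φ)).trans ?_
  rw [← pullSec_sum, ← h2]
  rfl

end

/-! ### Partitions of unity supported in cubes -/

theorem exists_cube_subset {U : Set (Rn n)} (hU : IsOpen U) {y : Rn n} (hy : y ∈ U) :
    ∃ R, 0 < R ∧ cube y R ⊆ U := by
  have h1 : IsOpen ((EuclideanSpace.equiv (Fin n) ℝ).symm ⁻¹' U) :=
    hU.preimage (EuclideanSpace.equiv (Fin n) ℝ).symm.continuous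
  obtain ⟨ε, hε, h2⟩ := Metric.isOpen_iff.1 h1 (EuclideanSpace.equiv (Fin n) ℝ y) (by simpa using hy)
  refine ⟨ε / 2, half_pos hε, fun z hz => ?_⟩
  have h3 : EuclideanSpace.equiv (Fin n) ℝ z ∈
      Metric.ball (EuclideanSpace.equiv (Fin n) ℝ y) ε := by
    rw [Metric.mem_ball]
    refine lt_of_le_of_lt ((dist_pi_le_iff (half_pos hε).le).2 fun k => ?_) (half_lt_self hε)
    exact hz k
  simpa using h2 h3

theorem isOpen_openCube (y : Rn n) (R : ℝ) : IsOpen {z : Rn n | ∀ k, |z k - y k| < R} := by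
  simp only [ofPred_forall]
  exact isOpen_iInter_of_finite fun k => isOpen_lt (by fun_prop) continuous_const

theorem convex_cube (y : Rn n) (R : ℝ) : Convex ℝ (cube y R) := by
  intro z hz z' hz' a b ha hb hab k
  have h : (a • z + b • z') k - y k = a * (z k - y k) + b * (z' k - y k) := by
    change a * z k + b * z' k - y k = _
    linear_combination y k * hab
  rw [h]
  calc |a * (z k - y k) + b * (z' k - y k)| ≤ |a * (z k - y k)| + |b * (z' k - y k)| :=
        abs_add_le _ _
    _ = a * |z k - y k| + b * |z' k - y k| := by
        rw [abs_mul, abs_mul, abs_of_nonneg ha, abs_of_nonneg hb]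
    _ ≤ a * R + b * R := by gcongr; exacts [hz k, hz' k]
    _ = R := by rw [← add_mul, hab, one_mul]

variable (n m V) in
/-- A smooth partition of unity whose members are supported inside coordinate cubes. -/
theorem exists_cubePartition [T2Space M] [SigmaCompactSpace M] :
    ∃ (ρ : SmoothPartitionOfUnity M (𝓡 n) M univ) (R : M → ℝ), ∀ x, 0 < R x ∧
      cube (extChartAt (𝓡 n) x x) (R x) ⊆ coordTarget n m V x ∧
      IsCompact (tsupport (ρ x)) ∧ tsupport (ρ x) ⊆ coordSource n m V x ∧
      ∀ x' ∈ tsupport (ρ x), ∀ k, |extChartAt (𝓡 n) x x' k - extChartAt (𝓡 n) x x k| < R x := by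
  choose R hR hRs using fun x : M =>
    exists_cube_subset (isOpen_coordTarget (n := n) m V x) (ext_mem (mem_coordSource_self x))
  have hco : ∀ x : M, ContinuousOn (extChartAt (𝓡 n) x) (coordSource n m V x) := fun x x' hx' =>
    (contMDiffAt_ext hx').continuousAt.continuousWithinAt
  obtain ⟨ρ, hρ⟩ := SmoothPartitionOfUnity.exists_isSubordinate (𝓡 n) (M := M) isClosed_univ
    (fun x => coordSource n m V x ∩
      extChartAt (𝓡 n) x ⁻¹' {z | ∀ k, |z k - extChartAt (𝓡 n) x x k| < R x})
    (fun x => (hco x).isOpen_inter_preimage (isOpen_coordSource m V x) (isOpen_openCube _ _))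
    (fun x _ => mem_iUnion.2 ⟨x, mem_coordSource_self x, fun k => by simpa using hR x⟩)
  refine ⟨ρ, R, fun x => ⟨hR x, hRs x, ?_, fun x' hx' => (hρ x hx').1,
    fun x' hx' => (hρ x hx').2⟩⟩
  refine (isCompact_image_symm (V := V) (m := m) (isCompact_cube _ _) (hRs x)).of_isClosed_subset
    (isClosed_tsupport _) fun x' hx' => ?_
  exact ⟨_, fun k => ((hρ x hx').2 k).le, symm_ext (hρ x hx').1⟩

theorem sum_partition_eq_one {ι : Type*} (ρ : SmoothPartitionOfUnity ι (𝓡 n) M univ) {x : M}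
    {t : Finset ι} (ht : ∀ i, x ∈ tsupport (ρ i) → i ∈ t) : ∑ i ∈ t, ρ i x = 1 := by
  rw [← ρ.sum_eq_one (mem_univ x)]
  refine (finsum_eq_sum_of_support_subset _ fun i hi => ht i ?_).symm
  exact subset_tsupport _ hi

end LocallyFiniteSums

/-! ### Adding up first variations over a partition of unity -/

section VariationSum
open MeasureTheory
variable {n m : ℕ} {M : Type*} [TopologicalSpace M] [ChartedSpace (Rn n) M]
  [IsManifold (𝓡 n) ∞ M]
  {V : M → Type*} [∀ x, AddCommGroup (V x)] [∀ x, Module ℝ (V x)] [∀ x, TopologicalSpace (V x)]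
  [TopologicalSpace (TotalSpace (Rn m) V)] [FiberBundle (Rn m) V] [VectorBundle ℝ (Rn m) V]
  [ContMDiffVectorBundle ∞ (Rn m) V (𝓡 n)]

variable [T2Space M]

theorem continuous_variation_smul {lam : HForm n m V n} (h : IsSmoothForm n m lam)
    (φ η : Sec n m V) {x₁ : M} {y : Rn n} (hy : y ∈ coordTarget n m V x₁) :
    Continuous fun t : ℝ => variation x₁ lam (t • φ) η y := by
  obtain ⟨r, hp⟩ := scoef_smooth h x₁
  have hU := isOpen_coordTarget (n := n) m V x₁
  have h1 : (fun t : ℝ => variation x₁ lam (t • φ) η y) = fun t : ℝ =>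
      ∑ a : Fin m, ∑ I ∈ multiIdx n r, (jetAt (localSec n m x₁ η) y).2 (a, I) *
        dU a I (scoef x₁ lam) (vertScale t (jetAt (localSec n m x₁ φ) y)) := by
    ext t
    rw [variation, ← vertScale_jetAt φ t hy]
    exact lineDeriv_vert_eq_sum hU hp
      (z := vertScale t (jetAt (localSec n m x₁ φ) y)) hy _
  rw [h1]
  exact continuous_finsetSum _ fun a _ => continuous_finsetSum _ fun I _ =>
    (continuous_vertScale (hp.dU hU a I) hy).const_mul _

theorem jetAt_localSec_sum {ι : Type*} (t : Finset ι) (η : ι → Sec n m V) {x₁ : M} {y : Rn n}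
    (hy : y ∈ coordTarget n m V x₁) : (jetAt (localSec n m x₁ (∑ i ∈ t, η i)) y).2 =
      ∑ i ∈ t, (jetAt (localSec n m x₁ (η i)) y).2 := by
  classical
  induction t using Finset.induction_on with
  | empty =>
    have h := vertScale_jetAt (0 : Sec n m V) 0 hy
    rw [zero_smul] at h
    rw [Finset.sum_empty, Finset.sum_empty, ← h]
    exact zero_smul ℝ _
  | insert a s ha ih =>
    have h := congrArg Prod.snd (jetAt_localSec_add_smul (η a) (∑ i ∈ s, η i) 1 hy)
    rw [one_smul, one_smul] at h
    rw [Finset.sum_insert ha, Finset.sum_insert ha, ← ih]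
    exact h

theorem variation_sum {lam : HForm n m V n} (h : IsSmoothForm n m lam) {ι : Type*}
    (t : Finset ι) (φ : Sec n m V) (η : ι → Sec n m V) {x₁ : M} {y : Rn n}
    (hy : y ∈ coordTarget n m V x₁) : variation x₁ lam φ (∑ i ∈ t, η i) y =
      ∑ i ∈ t, variation x₁ lam φ (η i) y := by
  obtain ⟨r, hp⟩ := scoef_smooth h x₁
  have hU := isOpen_coordTarget (n := n) m V x₁
  have h1 : ∀ η : Sec n m V, variation x₁ lam φ η y =
      ∑ a : Fin m, ∑ I ∈ multiIdx n r, (jetAt (localSec n m x₁ η) y).2 (a, I) *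
        dU a I (scoef x₁ lam) (jetAt (localSec n m x₁ φ) y) := fun η =>
    lineDeriv_vert_eq_sum hU hp (z := jetAt (localSec n m x₁ φ) y) hy _
  simp only [h1, jetAt_localSec_sum t η hy, Finset.sum_apply, Finset.sum_mul]
  refine Eq.trans ?_ Finset.sum_comm
  exact Finset.sum_congr rfl fun a _ => Finset.sum_comm

theorem sum_mulSec_apply {ι : Type*} (t : Finset ι) {χ : ι → M → ℝ}
    (hχ : ∀ i, ContMDiff (𝓡 n) 𝓘(ℝ) ∞ (χ i)) (φ : Sec n m V) (x : M) :
    (∑ i ∈ t, mulSec (χ i) (hχ i) φ) x = (∑ i ∈ t, χ i x) • φ x := by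
  have h := congrFun (map_sum (ContMDiffSection.coeAddHom (𝓡 n) (Rn m) ∞ V)
    (fun i => mulSec (χ i) (hχ i) φ) t) x
  rw [Finset.sum_smul]
  exact h.trans (Finset.sum_apply _ _ _)

/-- The integrated first variations in the directions `χ i φ` add up to the change of the form
between the zero section and `φ`, if the functions `χ i` add up to one. -/
theorem sum_integral_variation {lam : HForm n m V n} (h : IsSmoothForm n m lam) {ι : Type*}
    (t : Finset ι) {χ : ι → M → ℝ} (hχ : ∀ i, ContMDiff (𝓡 n) 𝓘(ℝ) ∞ (χ i)) (φ : Sec n m V)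
    {x₁ : M} {y : Rn n} (hy : y ∈ coordTarget n m V x₁)
    (h1 : ∀ᶠ x in 𝓝 ((extChartAt (𝓡 n) x₁).symm y), ∑ i ∈ t, χ i x = 1) :
    ∑ i ∈ t, ∫ s in Icc (0 : ℝ) 1, variation x₁ lam (s • φ) (mulSec (χ i) (hχ i) φ) y =
      coef x₁ (pullSec n m φ lam) y - coef x₁ (pullSec n m (0 : Sec n m V) lam) y := by
  obtain ⟨r, hp⟩ := scoef_smooth h x₁
  rw [← integral_finsetSum _ fun i _ => (continuous_variation_smul h φ
    (mulSec (χ i) (hχ i) φ) hy).continuousOn.integrableOn_compact isCompact_Icc,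
    coef_pullSec h φ hy, coef_pullSec h 0 hy]
  have h0 := vertScale_jetAt φ 0 hy
  rw [zero_smul] at h0
  rw [← h0, sub_eq_integral_lineDeriv (isOpen_coordTarget m V x₁) hp
    (z := jetAt (localSec n m x₁ φ) y) hy]
  refine setIntegral_congr_fun measurableSet_Icc fun s _ => ?_
  -- The directions `χ i φ` add up to `φ` near the point, so the summed variation is the derivative
  -- along `s ↦ s φ`, and the fundamental theorem of calculus applies.
  have h2 : localSec n m x₁ (∑ i ∈ t, mulSec (χ i) (hχ i) φ) =ᶠ[𝓝 y] localSec n m x₁ φ :=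
    localSec_eventuallyEq hy (h1.mono fun x hx => by
      rw [sum_mulSec_apply, hx, one_smul])
  change ∑ i ∈ t, variation x₁ lam (s • φ) (mulSec (χ i) (hχ i) φ) y = _
  rw [← variation_sum h t _ _ hy, variation, jetAt_congr_of_eventuallyEq h2,
    vertScale_jetAt φ s hy]

theorem eq_of_coef {β β' : ∀ x : M, TangentSpace (𝓡 n) x [⋀^Fin n]→L[ℝ] ℝ} {x₁ : M}
    (h : ∀ y ∈ coordTarget n m V x₁, coef x₁ β y = coef x₁ β' y) : β x₁ = β' x₁ := by
  have hx := mem_coordSource_self (n := n) (m := m) (V := V) x₁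
  have h3 := topForm_eq_of_toChart (symm_mem (ext_mem hx)) (h _ (ext_mem hx))
  rwa [symm_ext hx] at h3

end VariationSum

/-! ### A global primitive modulo the zero section -/

section GlobalPrimitive
variable {k m : ℕ} {M : Type*} [TopologicalSpace M] [ChartedSpace (Rn (k + 1)) M]
  [IsManifold (𝓡 (k + 1)) ∞ M]
  {V : M → Type*} [∀ x, AddCommGroup (V x)] [∀ x, Module ℝ (V x)] [∀ x, TopologicalSpace (V x)]
  [TopologicalSpace (TotalSpace (Rn m) V)] [FiberBundle (Rn m) V] [VectorBundle ℝ (Rn m) V]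
  [ContMDiffVectorBundle ∞ (Rn m) V (𝓡 (k + 1))]

/-- A top form that is annihilated by the Euler-Lagrange operator is, up to its values along the
zero section, a horizontal differential. -/
theorem exists_dH_eq_sub_zero [T2Space M] [SigmaCompactSpace M] {r : ℕ}
    {lam : HForm (k + 1) m V (k + 1)} (h : IsSmoothFormOfOrder r lam)
    (hE : euler (k + 1) m lam = 0) : ∃ Γ : HForm (k + 1) m V k, IsCompactForm (k + 1) m Γ ∧
      ∀ (φ : Sec (k + 1) m V) (x : M), pullSec (k + 1) m φ (dH (k + 1) m Γ) x +
        pullSec (k + 1) m (0 : Sec (k + 1) m V) lam x = pullSec (k + 1) m φ lam x := by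
  obtain ⟨ρ, R, hρ⟩ := exists_cubePartition (M := M) (k + 1) m V
  have hc : ∀ i, IsCompact (tsupport (ρ i)) := fun i => (hρ i).2.2.1
  have hs : ∀ i, tsupport (ρ i) ⊆ coordSource (k + 1) m V i := fun i => (hρ i).2.2.2.1
  have hsm : ∀ i, ContMDiff (𝓡 (k + 1)) 𝓘(ℝ) ∞ (ρ i) := fun i => (ρ i).contMDiff
  have hT : LocallyFinite fun i => tsupport (ρ i) := ρ.locallyFinite.closure
  have hcl : ∀ i, IsClosed (tsupport (ρ i)) := fun i => isClosed_tsupport _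
  set F : M → HForm (k + 1) m V k := fun i => homotopyForm i (ρ i) r lam
  have hF : ∀ i, IsSmoothFormOfOrder (r + 0 + r) (F i) := fun i =>
    isSmoothFormOfOrder_homotopyForm (hsm i) (hc i) (hs i) h
  have hF0 : ∀ i, ∀ φ : Sec (k + 1) m V, ∀ x ∉ tsupport (ρ i),
      pullSec (k + 1) m φ (F i) x = 0 := fun i φ x hx =>
    pullSec_homotopyForm_eq_zero (hc i) (hs i) φ hx
  refine ⟨locSum F, ⟨(IsSmoothFormOfOrder.locSum hF hT hcl hF0).isSmoothForm, fun φ hφ => ?_⟩,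
    fun φ x₁ => ?_⟩
  · obtain ⟨K, hK, hφ⟩ := hφ
    refine ⟨K, hK, fun x hx => ?_⟩
    -- Off `K` every homotopy form vanishes along `φ`. The sum over all charts thus has compact
    -- support along `φ`, although it need not have compact support in the base.
    have h0 : ∀ᶠ x' in 𝓝 x, φ x' = 0 :=
      (hK.isClosed.isOpen_compl.eventually_mem hx).mono fun x' hx' => hφ x' hx'
    rw [pullSec_locSum (t := ∅) fun i _ => pullSec_homotopyForm_eq_zero_of_sec φ h0]
    rfl
  · suffices key : ∀ y ∈ coordTarget (k + 1) m V x₁,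
        coef x₁ (pullSec (k + 1) m φ (dH (k + 1) m (locSum F))) y =
          coef x₁ (pullSec (k + 1) m φ lam) y -
            coef x₁ (pullSec (k + 1) m (0 : Sec (k + 1) m V) lam) y from
      eq_of_coef (β := pullSec (k + 1) m φ (dH (k + 1) m (locSum F)) +
        pullSec (k + 1) m (0 : Sec (k + 1) m V) lam) (m := m) (V := V) fun y hy =>
          (coef_add _ _).trans (eq_sub_iff_add_eq.1 (key y hy))
    intro y hy
    set x := (extChartAt (𝓡 (k + 1)) x₁).symm y
    set t := (hT.point_finite x).toFinset
    have ht : ∀ i, x ∈ tsupport (ρ i) → i ∈ t := fun i hi =>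
      (hT.point_finite x).mem_toFinset.2 hi
    have h1 := pullSec_dH_locSum hF hT hcl hF0 ht φ
    have h2 : ∀ᶠ x' in 𝓝 x, ∑ i ∈ t, ρ i x' = 1 := by
      filter_upwards [hT.eventually_subset hcl x] with x' hx'
      exact sum_partition_eq_one ρ fun i hi => ht i (hx' hi)
    rw [← sum_integral_variation h.isSmoothForm t hsm φ hy h2]
    refine (congrArg (fun β => toChart (k + 1) x₁ x β stdFrame) h1).trans ?_
    have h3 : ∀ i, toChart (k + 1) x₁ x (pullSec (k + 1) m φ (dH (k + 1) m (F i)) x) stdFrame =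
        ∫ s in Icc (0 : ℝ) 1, variation x₁ lam (s • φ) (mulSec (ρ i) (hsm i) φ) y := fun i =>
      coef_dH_homotopyForm (hsm i) (hc i) (hs i) h hE φ hy
    rw [Finset.sum_congr rfl fun i _ => (h3 i).symm]
    exact ContinuousAlternatingMap.sum_apply ..

end GlobalPrimitive

/-! ### Exactness of forms with integral zero in a coordinate cube -/

section ChartPrimitive
open MeasureTheory
variable {k m : ℕ} {M : Type*} [TopologicalSpace M] [ChartedSpace (Rn (k + 1)) M]
  [IsManifold (𝓡 (k + 1)) ∞ M]
  {V : M → Type*} [∀ x, AddCommGroup (V x)] [∀ x, Module ℝ (V x)] [∀ x, TopologicalSpace (V x)]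
  [TopologicalSpace (TotalSpace (Rn m) V)] [FiberBundle (Rn m) V] [VectorBundle ℝ (Rn m) V]
  [ContMDiffVectorBundle ∞ (Rn m) V (𝓡 (k + 1))]

/-- A compactly supported top form on a coordinate cube with integral zero is exact. -/
theorem exists_dH_eq_of_integral_eq_zero [T2Space M] [SigmaCompactSpace M]
    {ν β : ∀ x : M, TangentSpace (𝓡 (k + 1)) x [⋀^Fin (k + 1)]→L[ℝ] ℝ}
    (hν : IsVolumeForm (k + 1) ν) {x₀ : M} {R : ℝ} (hR : 0 < R)
    (hRs : cube (extChartAt (𝓡 (k + 1)) x₀ x₀) R ⊆ coordTarget (k + 1) m V x₀)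
    (hβ : IsContForm β) (hβs : ContDiffOn ℝ ∞ (coef x₀ β) (coordTarget (k + 1) m V x₀))
    {T : Set M} (hT : IsCompact T) (hTs : T ⊆ coordSource (k + 1) m V x₀)
    (hTR : ∀ x ∈ T, ∀ j, |extChartAt (𝓡 (k + 1)) x₀ x j - extChartAt (𝓡 (k + 1)) x₀ x₀ j| < R)
    (h0 : ∀ x ∉ T, β x = 0) (hint : formIntegral (k + 1) ν β = 0) :
    ∃ Γ : HForm (k + 1) m V k, IsCompactForm (k + 1) m Γ ∧
      ∀ (φ : Sec (k + 1) m V) (x : M), pullSec (k + 1) m φ (dH (k + 1) m Γ) x = β x := by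
  set U := coordTarget (k + 1) m V x₀
  set y₀ := extChartAt (𝓡 (k + 1)) x₀ x₀
  have hU : IsOpen U := isOpen_coordTarget m V x₀
  have hK' : IsCompact (extChartAt (𝓡 (k + 1)) x₀ '' T) :=
    hT.image_of_continuousOn fun x hx => (contMDiffAt_ext (hTs hx)).continuousAt.continuousWithinAt
  have hK's : extChartAt (𝓡 (k + 1)) x₀ '' T ⊆ U := by
    rintro _ ⟨x, hx, rfl⟩
    exact ext_mem (hTs hx)
  have hcoef : ∀ y ∈ U, y ∉ extChartAt (𝓡 (k + 1)) x₀ '' T → coef x₀ β y = 0 := fun y hy hyT =>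
    coef_eq_zero (h0 _ fun h => hyT ⟨_, h, ext_symm hy⟩)
  set b := U.indicator (coef x₀ β)
  have hb : ContDiff ℝ ∞ b := contDiff_indicator hU hK'.isClosed hK's hβs hcoef
  have hb0 : ∀ y j, R ≤ |y j - y₀ j| → b y = 0 := fun y j hyj => by
    by_cases hy : y ∈ U
    · refine (indicator_of_mem hy _).trans (hcoef y hy ?_)
      rintro ⟨x, hx, rfl⟩
      exact absurd (hTR x hx j) (not_lt.2 hyj)
    · exact indicator_of_notMem hy _
  have hcube : ∀ y ∉ cube y₀ R, ∃ j, R ≤ |y j - y₀ j| := fun y hy => by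
    simp only [cube, mem_ofPred_eq, not_forall, not_le] at hy
    exact hy.imp fun j hj => hj.le
  -- On the cube, which is connected, the integral over `M` is a nonzero multiple of the integral of
  -- the coefficient.
  have hbint : ∫ y, b y = 0 := by
    obtain ⟨s, hs, e⟩ := exists_formIntegral_eq hν (convex_cube y₀ R).isPreconnected
      (isCompact_cube y₀ R).isClosed.measurableSet
      (hRs.trans fun y hy => hy.1)
    have h1 := e β hβ (cube y₀ R) subset_rfl (isCompact_cube y₀ R) fun x hx => h0 x fun hxT =>
      hx ⟨_, fun j => (hTR x hxT j).le, symm_ext (hTs hxT)⟩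
    rw [hint] at h1
    rw [← (mul_eq_zero.1 h1.symm).resolve_left hs,
      ← setIntegral_eq_integral_of_forall_compl_eq_zero (s := cube y₀ R) fun y hy =>
        (hcube y hy).elim fun j hj => hb0 y j hj]
    exact setIntegral_congr_fun (isCompact_cube y₀ R).isClosed.measurableSet fun y hy =>
      indicator_of_mem (hRs hy) _
  -- The primitive is the standard volume form contracted with `v`. It depends on the base point
  -- only, so it has order zero, and it vanishes outside the cube.
  obtain ⟨v, hv, hv0, hdiv⟩ := exists_divergence_eq y₀ hR hb hb0 hbint
  have hp : SmoothOfOrder 0 U fun z : JetCoord (k + 1) m => contractTop fun j => v j z.1 :=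
    ⟨fun w => contractTop fun j => v j w.1,
      ((contractTop_contDiffOn fun j => (hv j).contDiffOn (s := univ)).comp contDiffOn_fst
        fun _ _ => trivial), fun _ _ _ => rfl⟩
  have hp0 : ∀ z : JetCoord (k + 1) m, z.1 ∈ U → z.1 ∉ cube y₀ R →
      (contractTop fun j => v j z.1) = 0 := fun z _ hz => by
    obtain ⟨j, hj⟩ := hcube z.1 hz
    have : (fun i => v i z.1) = 0 := funext fun i => hv0 i z.1 j hj
    rw [this]
    simp [contractTop]
  have hΓ := (isSmoothFormOfOrder_chartForm (V := V) (isCompact_cube y₀ R) hRs hp hp0).isSmoothForm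
  have hKc := isCompact_image_symm (V := V) (isCompact_cube y₀ R) hRs
  refine ⟨chartForm x₀ fun z => contractTop fun j => v j z.1,
    isCompactForm_of_support hΓ hKc fun φ x hx => pullSec_chartForm_eq_zero hp0 φ hx,
    fun φ x => ?_⟩
  by_cases hx : x ∈ coordSource (k + 1) m V x₀
  · have key : ∀ y ∈ U, pullSec (k + 1) m φ (dH (k + 1) m (chartForm x₀ fun z =>
        contractTop fun j => v j z.1)) ((extChartAt (𝓡 (k + 1)) x₀).symm y) =
        β ((extChartAt (𝓡 (k + 1)) x₀).symm y) := fun y hy => by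
      refine topForm_eq_of_toChart (m := m) (V := V) (x₀ := x₀) (symm_mem hy) ?_
      have h1 := formIn_dH hΓ (symm_mem hy) φ
      rw [ext_symm hy] at h1
      have h2 : (fun y => formIn x₀ (chartForm x₀ fun z => contractTop fun j => v j z.1)
          ((extChartAt (𝓡 (k + 1)) x₀).symm y) φ) =ᶠ[𝓝 y] fun y => contractTop fun j => v j y := by
        filter_upwards [hU.mem_nhds hy] with y' hy'
        exact repOn_chartForm y' hy' φ
      rw [h2.extDeriv_eq] at h1
      refine (congrArg (fun β : Rn (k + 1) [⋀^Fin (k + 1)]→L[ℝ] ℝ => β stdFrame) h1).trans ?_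
      rw [extDeriv_contractTop hU (fun j => (hv j).contDiffOn) hy, ← hdiv]
      exact indicator_of_mem hy _
    have := key _ (ext_mem hx)
    rwa [symm_ext hx] at this
  · have hx' : x ∉ (extChartAt (𝓡 (k + 1)) x₀).symm '' cube y₀ R := by
      rintro ⟨y, hy, rfl⟩
      exact hx (symm_mem (hRs hy))
    rw [h0 x fun h => hx (hTs h)]
    exact dH_eq_zero hΓ ((hKc.isClosed.isOpen_compl.eventually_mem hx').mono fun x' hx' =>
      pullSec_chartForm_eq_zero hp0 φ hx')

end ChartPrimitive

/-! ### The jacobiator: locality and stationarity -/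

section Jacobiator
open MeasureTheory
variable {n m : ℕ} {M : Type*} [TopologicalSpace M] [ChartedSpace (Rn n) M]
  [IsManifold (𝓡 n) ∞ M]
  {V : M → Type*} [∀ x, AddCommGroup (V x)] [∀ x, Module ℝ (V x)] [∀ x, TopologicalSpace (V x)]
  [TopologicalSpace (TotalSpace (Rn m) V)] [FiberBundle (Rn m) V] [VectorBundle ℝ (Rn m) V]
  [ContMDiffVectorBundle ∞ (Rn m) V (𝓡 n)]

variable [T2Space M] {om : SkewPairing n m V}
  {ν : ∀ x : M, TangentSpace (𝓡 n) x [⋀^Fin n]→L[ℝ] ℝ} {α α' β γ : HForm n m V n}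

/-- The cyclic sum in the Jacobi identity. -/
def jacobiator (om : SkewPairing n m V) (ν : ∀ x : M, TangentSpace (𝓡 n) x [⋀^Fin n]→L[ℝ] ℝ)
    (α β γ : HForm n m V n) : HForm n m V n :=
  l2 n m om ν (l2 n m om ν α β) γ + l2 n m om ν (l2 n m om ν β γ) α +
    l2 n m om ν (l2 n m om ν γ α) β

theorem IsSmoothForm.jacobiator (hν : IsVolumeForm n ν) (hα : IsSmoothForm n m α)
    (hβ : IsSmoothForm n m β) (hγ : IsSmoothForm n m γ) :
    IsSmoothForm n m (jacobiator om ν α β γ) :=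
  (((hα.l2 hν hβ).l2 hν hγ).add ((hβ.l2 hν hγ).l2 hν hα)).add ((hγ.l2 hν hα).l2 hν hβ)

theorem IsCompactTop.jacobiator (hν : IsVolumeForm n ν) (hα : IsCompactTop n m α)
    (hβ : IsCompactTop n m β) (hγ : IsCompactTop n m γ) :
    IsCompactTop n m (jacobiator om ν α β γ) :=
  (((hα.l2 hν hβ).l2 hν hγ).add ((hβ.l2 hν hγ).l2 hν hα)).add ((hγ.l2 hν hα).l2 hν hβ)

theorem jacobiator_add_left (hν : IsVolumeForm n ν) (hα : IsSmoothForm n m α)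
    (hα' : IsSmoothForm n m α') (hβ : IsSmoothForm n m β) (hγ : IsSmoothForm n m γ) :
    jacobiator om ν (α + α') β γ = jacobiator om ν α β γ + jacobiator om ν α' β γ := by
  simp only [jacobiator]
  rw [l2_add_left hα hα', l2_add_right hα hα', l2_add_right hα hα',
    l2_add_left (hα.l2 hν hβ) (hα'.l2 hν hβ), l2_add_left (hγ.l2 hν hα) (hγ.l2 hν hα')]
  abel

theorem jacobiator_sum_add_left {ι : Type*} (hν : IsVolumeForm n ν) (t : Finset ι)
    {F : ι → HForm n m V n} (hF : ∀ i, IsSmoothForm n m (F i)) (hα : IsSmoothForm n m α)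
    (hβ : IsSmoothForm n m β) (hγ : IsSmoothForm n m γ) :
    IsSmoothForm n m (∑ i ∈ t, F i + α) ∧ jacobiator om ν (∑ i ∈ t, F i + α) β γ =
      ∑ i ∈ t, jacobiator om ν (F i) β γ + jacobiator om ν α β γ := by
  classical
  induction t using Finset.induction_on with
  | empty =>
    rw [Finset.sum_empty, Finset.sum_empty, zero_add, zero_add]
    exact ⟨hα, rfl⟩
  | insert a s ha ih =>
    rw [Finset.sum_insert ha, Finset.sum_insert ha, add_assoc, add_assoc, ← ih.2]
    exact ⟨(hF a).add ih.1, jacobiator_add_left hν (hF a) ih.1 hβ hγ⟩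

theorem pullSec_l2_eq_zero_left {lam mu : HForm n m V n} {φ : Sec n m V} {x : M}
    (h : eulerAt lam φ x = 0) : pullSec n m φ (l2 n m om ν lam mu) x = 0 := by
  rw [pullSec_l2, h, map_zero, LinearMap.zero_apply]
  exact zero_smul ℝ _

theorem pullSec_l2_eq_zero_right {lam mu : HForm n m V n} {φ : Sec n m V} {x : M}
    (h : eulerAt mu φ x = 0) : pullSec n m φ (l2 n m om ν lam mu) x = 0 := by
  rw [pullSec_l2, h, map_zero]
  exact zero_smul ℝ _

theorem pullSec_jacobiator_eq_zero {φ : Sec n m V} {x : M}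
    (h1 : pullSec n m φ (l2 n m om ν (l2 n m om ν α β) γ) x = 0)
    (h2 : pullSec n m φ (l2 n m om ν (l2 n m om ν β γ) α) x = 0)
    (h3 : pullSec n m φ (l2 n m om ν (l2 n m om ν γ α) β) x = 0) :
    pullSec n m φ (jacobiator om ν α β γ) x = 0 := by
  refine (congrArg₂ (· + ·) (congrArg₂ (· + ·) h1 h2) h3).trans ?_
  rw [add_zero, add_zero]

/-- Every term contains `α`, and both `E` and `l2` are local operations. Cutting off `α` therefore
cuts off the support of the jacobiator. -/
theorem pullSec_jacobiator_eq_zero_of_eventually (hν : IsVolumeForm n ν)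
    (hα : IsSmoothForm n m α) (hβ : IsSmoothForm n m β) (hγ : IsSmoothForm n m γ) {x : M}
    (h0 : ∀ᶠ x' in 𝓝 x, ∀ φ : Sec n m V, pullSec n m φ α x' = 0) (φ : Sec n m V) :
    pullSec n m φ (jacobiator om ν α β γ) x = 0 := by
  have hE : ∀ᶠ x' in 𝓝 x, ∀ φ : Sec n m V, eulerAt α φ x' = 0 :=
    h0.eventually_nhds.mono fun x' hx' φ => euler_eq_zero_of_eventually hα φ hx'
  refine pullSec_jacobiator_eq_zero (pullSec_l2_eq_zero_left ?_)
    (pullSec_l2_eq_zero_right (hE.self_of_nhds φ)) (pullSec_l2_eq_zero_left ?_)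
  · exact euler_eq_zero_of_eventually (hα.l2 hν hβ) φ (hE.mono fun x' hx' φ =>
      pullSec_l2_eq_zero_left (hx' φ))
  · exact euler_eq_zero_of_eventually (hγ.l2 hν hα) φ (hE.mono fun x' hx' φ =>
      pullSec_l2_eq_zero_right (hx' φ))

/-- Two terms contain `E(β)` or `E(γ)` as an outer factor; in the third, the inner bracket of `β`
and `γ` has vanishing Euler-Lagrange form. The support along `φ` is thus bounded by data of `β` and
`γ`, uniformly in `α`. -/
theorem pullSec_jacobiator_eq_zero_of_euler (hν : IsVolumeForm n ν)
    (hβ : IsSmoothForm n m β) (hγ : IsSmoothForm n m γ) {x : M} {φ : Sec n m V}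
    (h0 : ∀ᶠ x' in 𝓝 x, eulerAt β φ x' = 0) (h0' : ∀ᶠ x' in 𝓝 x, eulerAt γ φ x' = 0) :
    pullSec n m φ (jacobiator om ν α β γ) x = 0 :=
  pullSec_jacobiator_eq_zero (pullSec_l2_eq_zero_right h0'.self_of_nhds)
    (pullSec_l2_eq_zero_left (euler_l2_eq_zero hν hβ hγ φ h0 h0'))
    (pullSec_l2_eq_zero_right h0.self_of_nhds)

theorem functional_add [SigmaCompactSpace M] (hν : IsVolumeForm n ν) (hα : IsCompactForm n m α)
    (hβ : IsCompactForm n m β) {φ : Sec n m V} (hφ : CompactSec n m φ) :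
    functional n m ν (α + β) φ = functional n m ν α φ + functional n m ν β φ := by
  obtain ⟨K, hK, h⟩ := hα.2 φ hφ
  obtain ⟨K', hK', h'⟩ := hβ.2 φ hφ
  exact formIntegral_add hν (isContForm_pullSec hα.1 φ) (isContForm_pullSec hβ.1 φ) hK h hK' h'

theorem functional_jacobiator [SigmaCompactSpace M] (hν : IsVolumeForm n ν)
    (hJ : PoissonJacobi n m om ν) (hα : IsCompactTop n m α) (hβ : IsCompactTop n m β)
    (hγ : IsCompactTop n m γ) {φ : Sec n m V} (hφ : CompactSec n m φ) :
    functional n m ν (jacobiator om ν α β γ) φ = 0 := by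
  have h1 := (hα.l2 (om := om) hν hβ).l2 (om := om) hν hγ
  have h2 := (hβ.l2 (om := om) hν hγ).l2 (om := om) hν hα
  have h3 := (hγ.l2 (om := om) hν hα).l2 (om := om) hν hβ
  rw [jacobiator, functional_add hν (h1.add h2).1 h3.1 hφ, functional_add hν h1.1 h2.1 hφ]
  exact hJ α β γ hα hβ hγ φ hφ

theorem euler_jacobiator [SigmaCompactSpace M] (hν : IsVolumeForm n ν)
    (hJ : PoissonJacobi n m om ν) (hα : IsCompactTop n m α) (hβ : IsCompactTop n m β)
    (hγ : IsCompactTop n m γ) : euler n m (jacobiator om ν α β γ) = 0 :=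
  euler_eq_zero_of_functional hν (hα.jacobiator hν hβ hγ).1 fun _ hφ =>
    functional_jacobiator hν hJ hα hβ hγ hφ

theorem coef_pullSec_contDiffOn {lam : HForm n m V n} (h : IsSmoothForm n m lam) (φ : Sec n m V)
    (x₀ : M) : ContDiffOn ℝ ∞ (coef x₀ (pullSec n m φ lam)) (coordTarget n m V x₀) := by
  obtain ⟨r, hp⟩ := scoef_smooth h x₀
  exact (hp.comp_jetAt (isOpen_coordTarget m V x₀) (localSec_contDiffOn φ x₀)).congr fun y hy =>
    coef_pullSec h φ hy

theorem IsCompactForm.sum {k : ℕ} {ι : Type*} (t : Finset ι) {F : ι → HForm n m V k}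
    (h : ∀ i, IsCompactForm n m (F i)) : IsCompactForm n m (∑ i ∈ t, F i) := by
  classical
  induction t using Finset.induction_on with
  | empty => exact isCompactForm_of_support IsSmoothForm.zero isCompact_empty fun _ _ _ => rfl
  | insert a s ha ih =>
    rw [Finset.sum_insert ha]
    exact (h a).add ih

/-- The jacobiator along the zero section splits into pieces that live on coordinate cubes. -/
theorem sum_pullSec_jacobiator {ρ : SmoothPartitionOfUnity M (𝓡 n) M univ}
    (hν : IsVolumeForm n ν) (hα : IsSmoothForm n m α) (hβ : IsSmoothForm n m β)
    (hγ : IsSmoothForm n m γ) {φ : Sec n m V} {K : Set M} (hK : IsClosed K)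
    (h0 : ∀ x ∉ K, eulerAt β φ x = 0) (h0' : ∀ x ∉ K, eulerAt γ φ x = 0) {t : Finset M}
    (ht : ∀ i, (tsupport (ρ i) ∩ K).Nonempty → i ∈ t) (x : M) :
    ∑ i ∈ t, pullSec n m φ (jacobiator om ν (baseSmul (ρ i) α) β γ) x =
      pullSec n m φ (jacobiator om ν α β γ) x := by
  have hT : LocallyFinite fun i => tsupport (ρ i) := ρ.locallyFinite.closure
  have hsm : ∀ i, ContMDiff (𝓡 n) 𝓘(ℝ) ∞ (ρ i) := fun i => (ρ i).contMDiff
  have hδ : ContMDiff (𝓡 n) 𝓘(ℝ) ∞ (fun x => 1 - ∑ i ∈ t, ρ i x) :=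
    contMDiff_const.sub (contMDiff_finsetSum fun i _ => hsm i)
  -- What the finitely many pieces leave of `α`. It is zero near `K`, since `t` contains all indices
  -- whose supports meet `K`; off `K` the jacobiator along `φ` vanishes because of `β` and `γ`,
  -- whatever its first argument is.
  set δ : HForm n m V n := baseSmul (fun x => 1 - ∑ i ∈ t, ρ i x) α
  have hδs : IsSmoothForm n m δ := hα.baseSmul hδ
  have hsum : α = ∑ i ∈ t, baseSmul (ρ i) α + δ := by
    refine hform_ext fun φ x => ?_
    refine Eq.trans ?_ (congrArg (· + δ (jet n m φ x))
      (pullSec_sum (F := fun i => baseSmul (ρ i) α) t φ x).symm)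
    change pullSec n m φ α x = ∑ i ∈ t, ρ i x • pullSec n m φ α x +
      (1 - ∑ i ∈ t, ρ i x) • pullSec n m φ α x
    generalize pullSec n m φ α x = b
    ext v
    have h1 := ContinuousAlternatingMap.sum_apply (fun i => ρ i x • b) (s := t) v
    change b v = (∑ i ∈ t, ρ i x • b) v + (1 - ∑ i ∈ t, ρ i x) * b v
    rw [h1]
    change b v = ∑ i ∈ t, ρ i x * b v + (1 - ∑ i ∈ t, ρ i x) * b v
    rw [← Finset.sum_mul]
    ring
  obtain ⟨-, h1⟩ := jacobiator_sum_add_left (om := om) hν t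
    (fun i => hα.baseSmul (hsm i)) hδs hβ hγ
  rw [← hsum] at h1
  have h2 : pullSec n m φ (jacobiator om ν δ β γ) x = 0 := by
    by_cases hx : x ∈ K
    · refine pullSec_jacobiator_eq_zero_of_eventually hν hδs hβ hγ ?_ φ
      filter_upwards [hT.eventually_subset (fun i => isClosed_tsupport _) x] with x' hx' φ
      have h3 : ∑ i ∈ t, ρ i x' = 1 :=
        sum_partition_eq_one ρ fun i hi => ht i ⟨x, hx' hi, hx⟩
      change (1 - ∑ i ∈ t, ρ i x') • pullSec n m φ α x' = 0
      rw [h3, sub_self]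
      exact zero_smul ℝ _
    · have hev := hK.isOpen_compl.eventually_mem hx
      exact pullSec_jacobiator_eq_zero_of_euler hν hβ hγ (hev.mono h0) (hev.mono h0')
  rw [h1]
  refine Eq.trans ?_ (congrArg₂ (· + ·)
    (pullSec_sum (F := fun i => jacobiator om ν (baseSmul (ρ i) α) β γ) t φ x) h2).symm
  exact (add_zero _).symm

end Jacobiator

/-! ### Exactness of the jacobiator in positive dimension -/

section JacobiatorExact
open MeasureTheory
variable {k m : ℕ} {M : Type*} [TopologicalSpace M] [ChartedSpace (Rn (k + 1)) M]
  [IsManifold (𝓡 (k + 1)) ∞ M]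
  {V : M → Type*} [∀ x, AddCommGroup (V x)] [∀ x, Module ℝ (V x)] [∀ x, TopologicalSpace (V x)]
  [TopologicalSpace (TotalSpace (Rn m) V)] [FiberBundle (Rn m) V] [VectorBundle ℝ (Rn m) V]
  [ContMDiffVectorBundle ∞ (Rn m) V (𝓡 (k + 1))]

/-- The jacobiator is an exact horizontal form. -/
theorem exists_dH_eq_jacobiator [T2Space M] [SigmaCompactSpace M]
    {om : SkewPairing (k + 1) m V}
    {ν : ∀ x : M, TangentSpace (𝓡 (k + 1)) x [⋀^Fin (k + 1)]→L[ℝ] ℝ}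
    {α β γ : HForm (k + 1) m V (k + 1)} (hν : IsVolumeForm (k + 1) ν)
    (hJ : PoissonJacobi (k + 1) m om ν) (hα : IsCompactTop (k + 1) m α)
    (hβ : IsCompactTop (k + 1) m β) (hγ : IsCompactTop (k + 1) m γ) :
    ∃ Γ : HForm (k + 1) m V k, IsCompactForm (k + 1) m Γ ∧
      dH (k + 1) m Γ = jacobiator om ν α β γ := by
  obtain ⟨r, hr⟩ := isSmoothForm_iff.1
    (IsSmoothForm.jacobiator (om := om) hν hα.1.1 hβ.1.1 hγ.1.1)
  obtain ⟨Γ₀, hΓ₀, e₀⟩ := exists_dH_eq_sub_zero (r := r) hr (euler_jacobiator hν hJ hα hβ hγ)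
  have h0 : CompactSec (k + 1) m (0 : Sec (k + 1) m V) := ⟨∅, isCompact_empty, fun _ _ => rfl⟩
  obtain ⟨K, hK, hKβ⟩ := hβ.2 0 h0
  obtain ⟨K', hK', hKγ⟩ := hγ.2 0 h0
  obtain ⟨ρ, R, hρ⟩ := exists_cubePartition (M := M) (k + 1) m V
  have hT : LocallyFinite fun i => tsupport (ρ i) := ρ.locallyFinite.closure
  have hsm : ∀ i, ContMDiff (𝓡 (k + 1)) 𝓘(ℝ) ∞ (ρ i) := fun i => (ρ i).contMDiff
  have hvan : ∀ i, ∀ φ : Sec (k + 1) m V, ∀ x ∉ tsupport (ρ i),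
      pullSec (k + 1) m φ (baseSmul (ρ i) α) x = 0 := fun i φ x hx => by
    change ρ i x • pullSec (k + 1) m φ α x = 0
    rw [image_eq_zero_of_notMem_tsupport hx]
    exact zero_smul ℝ _
  have hαi : ∀ i, IsCompactTop (k + 1) m (baseSmul (ρ i) α) := fun i =>
    isCompactTop_of_support (hα.1.1.baseSmul (hsm i)) (hρ i).2.2.1 (hvan i)
  -- Cutting `α` instead of the jacobiator keeps the integrals under control: `baseSmul (ρ i) α` is
  -- again admissible in the Jacobi identity, so along the zero section each piece has integral
  -- zero, as the Poincaré lemma in a cube demands.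
  have hex : ∀ i, ∃ Γ : HForm (k + 1) m V k, IsCompactForm (k + 1) m Γ ∧
      ∀ (φ : Sec (k + 1) m V) (x : M), pullSec (k + 1) m φ (dH (k + 1) m Γ) x =
        pullSec (k + 1) m (0 : Sec (k + 1) m V) (jacobiator om ν (baseSmul (ρ i) α) β γ) x := by
    intro i
    have hs := IsSmoothForm.jacobiator (om := om) hν (hαi i).1.1 hβ.1.1 hγ.1.1
    refine exists_dH_eq_of_integral_eq_zero hν (hρ i).1 (hρ i).2.1 (isContForm_pullSec hs 0)
      (coef_pullSec_contDiffOn hs 0 i) (hρ i).2.2.1 (hρ i).2.2.2.1 (hρ i).2.2.2.2 (fun x hx => ?_)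
      (functional_jacobiator hν hJ (hαi i) hβ hγ h0)
    exact pullSec_jacobiator_eq_zero_of_eventually hν (hαi i).1.1 hβ.1.1 hγ.1.1
      (((isClosed_tsupport _).isOpen_compl.eventually_mem hx).mono fun x' hx' φ =>
        hvan i φ x' hx') 0
  choose Γ hΓ eΓ using hex
  -- Finitely many pieces suffice, because `E(β)` and `E(γ)` have compact support along the zero
  -- section.
  set t := (hT.finite_nonempty_inter_compact (hK.union hK')).toFinset
  have ht : ∀ i, (tsupport (ρ i) ∩ (K ∪ K')).Nonempty → i ∈ t := fun i hi =>
    (hT.finite_nonempty_inter_compact (hK.union hK')).mem_toFinset.2 hi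
  obtain ⟨h1, h2⟩ := dH_sum t fun i _ => (hΓ i).1
  refine ⟨Γ₀ + ∑ i ∈ t, Γ i, hΓ₀.add (IsCompactForm.sum t hΓ), ?_⟩
  rw [dH_add hΓ₀.1 h1, h2]
  refine hform_ext fun φ x => Eq.trans ?_ (e₀ φ x)
  rw [← sum_pullSec_jacobiator hν hα.1.1 hβ.1.1 hγ.1.1 (hK.union hK').isClosed
    (fun x hx => hKβ x fun h => hx (Or.inl h)) (fun x hx => hKγ x fun h => hx (Or.inr h)) ht x,
    Finset.sum_congr rfl fun i _ => (eΓ i φ x).symm, ← pullSec_sum]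
  rfl

end JacobiatorExact

/-! ### The case of a zero-dimensional base -/

section PointDimension
open MeasureTheory
variable {m : ℕ} {M : Type*} [TopologicalSpace M] [ChartedSpace (Rn 0) M]
  [IsManifold (𝓡 0) ∞ M]
  {V : M → Type*} [∀ x, AddCommGroup (V x)] [∀ x, Module ℝ (V x)] [∀ x, TopologicalSpace (V x)]
  [TopologicalSpace (TotalSpace (Rn m) V)] [FiberBundle (Rn m) V] [VectorBundle ℝ (Rn m) V]
  [ContMDiffVectorBundle ∞ (Rn m) V (𝓡 0)]
variable [T2Space M] [SigmaCompactSpace M] {om : SkewPairing 0 m V}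
  {ν : ∀ x : M, TangentSpace (𝓡 0) x [⋀^Fin 0]→L[ℝ] ℝ} {α β γ lam mu : HForm 0 m V 0}

theorem multiIdx_dim_zero (r : ℕ) : multiIdx 0 r = multiIdx 0 0 := by
  ext I
  simp [multiIdx]

/-- Without directions the empty multi-index is the only one, so all forms have order zero and `E`
is linear over functions on the base. -/
theorem IsSmoothForm.order_zero (h : IsSmoothForm 0 m lam) : IsSmoothFormOfOrder 0 lam := by
  obtain ⟨r, h⟩ := isSmoothForm_iff.1 h
  intro x₀
  obtain ⟨p, hp, hr⟩ := h x₀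
  refine ⟨p, ?_, hr⟩
  unfold SmoothOfOrder at hp ⊢
  rwa [multiIdx_dim_zero r] at hp

variable {χ : M → ℝ}

theorem l2_baseSmul_right (h : IsSmoothForm 0 m mu) (hχ : ContMDiff (𝓡 0) 𝓘(ℝ) ∞ χ) :
    l2 0 m om ν lam (baseSmul χ mu) = baseSmul χ (l2 0 m om ν lam mu) :=
  hform_ext fun φ x => pullSec_l2_baseSmul hχ h.order_zero φ x

theorem l2_baseSmul_left (h : IsSmoothForm 0 m lam) (hχ : ContMDiff (𝓡 0) 𝓘(ℝ) ∞ χ) :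
    l2 0 m om ν (baseSmul χ lam) mu = baseSmul χ (l2 0 m om ν lam mu) := by
  rw [l2_skew, l2_baseSmul_right h hχ, l2_skew lam mu]
  exact funext fun θ => (smul_neg _ _).symm

theorem jacobiator_baseSmul (hν : IsVolumeForm 0 ν) (hα : IsSmoothForm 0 m α)
    (hβ : IsSmoothForm 0 m β) (hγ : IsSmoothForm 0 m γ) (hχ : ContMDiff (𝓡 0) 𝓘(ℝ) ∞ χ) :
    jacobiator om ν (baseSmul χ α) β γ = baseSmul χ (jacobiator om ν α β γ) := by
  rw [jacobiator, l2_baseSmul_left hα hχ, l2_baseSmul_right hα hχ, l2_baseSmul_right hα hχ,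
    l2_baseSmul_left (hα.l2 hν hβ) hχ, l2_baseSmul_left (hγ.l2 hν hα) hχ]
  refine funext fun θ => ?_
  have h : ∀ (c : ℝ) (a b d : TangentSpace (𝓡 0) θ.1 [⋀^Fin 0]→L[ℝ] ℝ),
      c • a + c • b + c • d = c • (a + b + d) := fun c a b d => by rw [smul_add, smul_add]
  exact h _ _ _ _

/-- Over a zero-dimensional manifold the jacobiator vanishes. -/
theorem jacobiator_eq_zero (hν : IsVolumeForm 0 ν)
    (hJ : PoissonJacobi 0 m om ν) (hα : IsCompactTop 0 m α) (hβ : IsCompactTop 0 m β)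
    (hγ : IsCompactTop 0 m γ) : jacobiator om ν α β γ = 0 := by
  have hs := IsSmoothForm.jacobiator (om := om) hν hα.1.1 hβ.1.1 hγ.1.1
  refine hform_ext fun φ x => ?_
  obtain ⟨φ', hφ', e⟩ := exists_compactSec_jet φ x
  refine (pullSec_congr _ (jet_eq_of_eventuallyEq e)).symm.trans ?_
  refine form_eq_zero_of_integral hν (isContForm_pullSec hs φ') (fun χ hχ hK => ?_) x
  obtain ⟨K, hK, h0⟩ := hK
  -- The Jacobi identity for `χ α` tests the jacobiator against the arbitrary cut-off `χ`, because
  -- `χ` passes through all brackets here.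
  have hχα : IsCompactTop 0 m (baseSmul χ α) :=
    isCompactTop_of_support (hα.1.1.baseSmul hχ) hK fun φ x hx => by
      change χ x • pullSec 0 m φ α x = 0
      rw [h0 x hx]
      exact zero_smul ℝ _
  have := functional_jacobiator hν hJ hχα hβ hγ hφ'
  rwa [jacobiator_baseSmul hν hα.1.1 hβ.1.1 hγ.1.1 hχ] at this

end PointDimension

/-! ### The reduced complex on the orbit space -/

section Reduction
variable {n m : ℕ} {M : Type*} [TopologicalSpace M] [ChartedSpace (Rn n) M]
  [IsManifold (𝓡 n) ∞ M]
  {V : M → Type*} [∀ x, AddCommGroup (V x)] [∀ x, Module ℝ (V x)] [∀ x, TopologicalSpace (V x)]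
  [TopologicalSpace (TotalSpace (Rn m) V)] [FiberBundle (Rn m) V] [VectorBundle ℝ (Rn m) V]
  [ContMDiffVectorBundle ∞ (Rn m) V (𝓡 n)]

variable {G : Type*} [Group G] (ψ : BundleAction n m V G) {k : ℕ}

namespace BundleAction

theorem isInvariant_pullProj (h : ψ.RedForm k) : ψ.IsInvariant (ψ.pullProj h) := fun g => by
  refine funext fun θ => ?_
  have e : (Quot.mk _ (ψ.onJetAt g θ.1 θ.2) : Quot fun θ' θ'' : Quotient (jetSetoid n m V θ.1) =>
      ∃ g, ψ.onJetAt g θ.1 θ' = θ'') = Quot.mk _ θ.2 := (Quot.sound ⟨g, rfl⟩).symm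
  have key : ∀ q q' : Quot fun θ' θ'' : Quotient (jetSetoid n m V θ.1) =>
      ∃ g, ψ.onJetAt g θ.1 θ' = θ'', q = q' →
        (h ⟨θ.1, q⟩ : TangentSpace (𝓡 n) θ.1 [⋀^Fin k]→L[ℝ] ℝ) = h ⟨θ.1, q'⟩ := by
    rintro q _ rfl
    rfl
  exact key _ _ e

theorem pullProj_injective : Function.Injective (ψ.pullProj (k := k)) := fun h h' e => by
  refine funext fun q => ?_
  obtain ⟨x, q⟩ := q
  induction q using Quot.ind with
  | mk θ => exact congrFun e ⟨x, θ⟩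

/-- Invariant forms are constant on orbits of jets, so they are exactly the image of `π^*`. On them
`Function.invFun` is a true inverse and not a default value. -/
theorem pullProj_pullProjInv {α : HForm n m V k} (h : ψ.IsInvariant α) :
    ψ.pullProj (ψ.pullProjInv α) = α :=
  Function.invFun_eq (f := ψ.pullProj)
    ⟨fun q => Quot.lift (fun θ => α ⟨q.1, θ⟩)
      (fun θ θ' ⟨g, hg⟩ => by
        subst hg
        exact (congrFun (h g) ⟨q.1, θ⟩).symm) q.2, rfl⟩

theorem pullProj_redD {h : ψ.RedForm k} (hh : ψ.IsRedCompact h) :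
    ψ.pullProj (ψ.redD h) = dH n m (ψ.pullProj h) :=
  ψ.pullProj_pullProjInv (BundleAction.IsInvariant.dH ψ hh.1.1 hh.2)

variable {ψ}

theorem IsRedCompact.add {h h' : ψ.RedForm k} (hh : ψ.IsRedCompact h) (hh' : ψ.IsRedCompact h') :
    ψ.IsRedCompact (h + h') := ⟨hh.1.add hh'.1, ψ.isInvariant_pullProj _⟩

theorem IsRedCompact.smul {h : ψ.RedForm k} (hh : ψ.IsRedCompact h) (c : ℝ) :
    ψ.IsRedCompact (c • h) := ⟨hh.1.smul c, ψ.isInvariant_pullProj _⟩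

theorem isRedExact_zero : ψ.IsRedExact (0 : ψ.RedForm k) := by
  cases k with
  | zero => rfl
  | succ k =>
    have h0 : ψ.IsRedCompact (0 : ψ.RedForm k) := ⟨isCompactForm_of_support IsSmoothForm.zero
      isCompact_empty fun _ _ _ => rfl, ψ.isInvariant_pullProj _⟩
    exact ⟨0, h0, ψ.pullProj_injective ((ψ.pullProj_redD h0).trans dH_zero)⟩

section

variable [T2Space M]

theorem IsRedExact.add {h h' : ψ.RedForm k} (hh : ψ.IsRedExact h) (hh' : ψ.IsRedExact h') :
    ψ.IsRedExact (h + h') := by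
  cases k with
  | zero =>
    rw [show h = 0 from hh, show h' = 0 from hh', add_zero]
    rfl
  | succ k =>
    obtain ⟨γ, hγ, rfl⟩ := hh
    obtain ⟨γ', hγ', rfl⟩ := hh'
    refine ⟨γ + γ', hγ.add hγ', ψ.pullProj_injective ((ψ.pullProj_redD (hγ.add hγ')).trans
      ((dH_add hγ.1.1 hγ'.1.1).trans ?_))⟩
    rw [← ψ.pullProj_redD hγ, ← ψ.pullProj_redD hγ']
    rfl

theorem IsRedExact.smul {h : ψ.RedForm k} (hh : ψ.IsRedExact h) (c : ℝ) :
    ψ.IsRedExact (c • h) := by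
  cases k with
  | zero =>
    rw [show h = 0 from hh, smul_zero]
    rfl
  | succ k =>
    obtain ⟨γ, hγ, rfl⟩ := hh
    refine ⟨c • γ, hγ.smul c, ψ.pullProj_injective ((ψ.pullProj_redD (hγ.smul c)).trans
      ((dH_smul hγ.1.1 c).trans ?_))⟩
    rw [← ψ.pullProj_redD hγ]
    rfl

/-- The forms in question are already closed under sums and multiples, since `E` is linear on smooth
forms and a union of two compact sets is compact. Taking the span adds nothing. -/
theorem mem_redTop {h : ψ.RedForm n} : h ∈ ψ.redTop ↔ ψ.IsRedTop h := by
  refine ⟨fun hh => ?_, fun hh => Submodule.subset_span hh⟩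
  induction hh using Submodule.span_induction with
  | mem h hh => exact hh
  | zero => exact ⟨isCompactTop_of_support IsSmoothForm.zero isCompact_empty fun _ _ _ => rfl,
      ψ.isInvariant_pullProj _⟩
  | add h h' _ _ hh hh' => exact ⟨hh.1.add hh'.1, ψ.isInvariant_pullProj _⟩
  | smul c h _ hh => exact ⟨hh.1.smul c, ψ.isInvariant_pullProj _⟩

theorem mem_redExact {h : ψ.redTop} : h ∈ ψ.redExact ↔ ψ.IsRedExact (h : ψ.RedForm n) := by
  refine ⟨fun hh => ?_, fun hh => Submodule.subset_span hh⟩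
  induction hh using Submodule.span_induction with
  | mem h hh => exact hh
  | zero => exact isRedExact_zero
  | add h h' _ _ hh hh' => exact hh.add hh'
  | smul c h _ hh => exact hh.smul c

end

end BundleAction

/-- On the reduced complex, exactness can be tested on `J^∞E`. -/
theorem isRedExact_of_dH {k m : ℕ} {M : Type*} [TopologicalSpace M] [ChartedSpace (Rn (k + 1)) M]
    [IsManifold (𝓡 (k + 1)) ∞ M]
    {V : M → Type*} [∀ x, AddCommGroup (V x)] [∀ x, Module ℝ (V x)] [∀ x, TopologicalSpace (V x)]
    [TopologicalSpace (TotalSpace (Rn m) V)] [FiberBundle (Rn m) V] [VectorBundle ℝ (Rn m) V]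
    [ContMDiffVectorBundle ∞ (Rn m) V (𝓡 (k + 1))] {ψ : BundleAction (k + 1) m V G}
    (hred : ψ.ReductionHypothesis) {h : ψ.RedForm (k + 1)} {Γ : HForm (k + 1) m V k}
    (hΓ : IsCompactForm (k + 1) m Γ) (e : dH (k + 1) m Γ = ψ.pullProj h) : ψ.IsRedExact h := by
  -- As a pullback from the orbit space, `d_H Γ` is invariant. This is where the reduction
  -- hypothesis enters: the primitive itself need not be invariant.
  obtain ⟨Γ', hΓ', hi, e'⟩ := hred k Γ hΓ (e ▸ ψ.isInvariant_pullProj h)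
  have hp := ψ.pullProj_pullProjInv hi
  have hc : ψ.IsRedCompact (ψ.pullProjInv Γ') := ⟨hp.symm ▸ hΓ', hp.symm ▸ hi⟩
  refine ⟨ψ.pullProjInv Γ', hc, ψ.pullProj_injective ((ψ.pullProj_redD hc).trans ?_)⟩
  rw [hp, e', e]

section

variable [T2Space M] {ψ} {om : SkewPairing n m V}
  {ν : ∀ x : M, TangentSpace (𝓡 n) x [⋀^Fin n]→L[ℝ] ℝ}

theorem euler_pullProj_eq_zero {f : ψ.RedForm n} (hf : ψ.IsRedExact f) :
    euler n m (ψ.pullProj f) = 0 := by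
  cases n with
  | zero =>
    rw [show f = 0 from hf]
    have h := euler_smul (IsSmoothForm.zero (n := 0) (m := m) (V := V) (k := 0)) 0
    rw [zero_smul] at h
    refine Eq.trans ?_ (h.trans (zero_smul ℝ _))
    rfl
  | succ k =>
    obtain ⟨γ, hγ, rfl⟩ := hf
    rw [ψ.pullProj_redD hγ, euler_dH hγ.1.1]

theorem isRedExact_of_pullProj_eq_jacobiator [SigmaCompactSpace M] (hν : IsVolumeForm n ν)
    (hJ : PoissonJacobi n m om ν) (hred : ψ.ReductionHypothesis) {α β γ : HForm n m V n}
    (hα : IsCompactTop n m α) (hβ : IsCompactTop n m β) (hγ : IsCompactTop n m γ)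
    {h : ψ.RedForm n} (e : ψ.pullProj h = jacobiator om ν α β γ) : ψ.IsRedExact h := by
  cases n with
  | zero =>
    rw [jacobiator_eq_zero hν hJ hα hβ hγ] at e
    exact ψ.pullProj_injective e
  | succ k =>
    obtain ⟨Γ, hΓ, e'⟩ := exists_dH_eq_jacobiator hν hJ hα hβ hγ
    exact isRedExact_of_dH hred hΓ (e'.trans e.symm)

end
end Reduction

/-! ### The bracket on the reduced top cohomology -/

section Bracket
variable {n m : ℕ} {M : Type*} [TopologicalSpace M] [ChartedSpace (Rn n) M]
  [IsManifold (𝓡 n) ∞ M]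
  {V : M → Type*} [∀ x, AddCommGroup (V x)] [∀ x, Module ℝ (V x)] [∀ x, TopologicalSpace (V x)]
  [TopologicalSpace (TotalSpace (Rn m) V)] [FiberBundle (Rn m) V] [VectorBundle ℝ (Rn m) V]
  [ContMDiffVectorBundle ∞ (Rn m) V (𝓡 n)]

variable {G : Type*} [Group G] {ψ : BundleAction n m V G} [T2Space M] [SigmaCompactSpace M]
  {om : SkewPairing n m V} {ν : ∀ x : M, TangentSpace (𝓡 n) x [⋀^Fin n]→L[ℝ] ℝ}

namespace BundleAction

theorem pullProj_redL2 (hν : IsVolumeForm n ν) (hcan : ψ.IsCanonical om ν) {f h : ψ.RedForm n}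
    (hf : ψ.IsRedTop f) (hh : ψ.IsRedTop h) : ψ.pullProj (ψ.redL2 om ν f h) =
      l2 n m om ν (ψ.pullProj f) (ψ.pullProj h) :=
  ψ.pullProj_pullProjInv (IsInvariant.l2 hν hcan hf.1 hh.1 hf.2 hh.2)

theorem redL2_mem (hν : IsVolumeForm n ν) (hcan : ψ.IsCanonical om ν) (f h : ψ.redTop) :
    ψ.redL2 om ν f h ∈ ψ.redTop := by
  have hf := mem_redTop.1 f.2
  have hh := mem_redTop.1 h.2
  refine mem_redTop.2 ⟨?_, ψ.isInvariant_pullProj _⟩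
  rw [pullProj_redL2 hν hcan hf hh]
  exact hf.1.l2 hν hh.1

/-- The reduced map as a bilinear map on the top forms. -/
def redBracket (hν : IsVolumeForm n ν) (hcan : ψ.IsCanonical om ν) :
    ψ.redTop →ₗ[ℝ] ψ.redTop →ₗ[ℝ] ψ.redTop :=
  -- By injectivity of `π^*`, identities between reduced forms are verified upstairs, where the
  -- reduced map becomes `l2`.
  have key : ∀ {f h g : ψ.redTop}, ψ.pullProj (g : ψ.RedForm n) =
      l2 n m om ν (ψ.pullProj (f : ψ.RedForm n)) (ψ.pullProj (h : ψ.RedForm n)) →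
        (⟨ψ.redL2 om ν f h, redL2_mem hν hcan f h⟩ : ψ.redTop) = g := fun {f h _} e =>
    Subtype.ext (ψ.pullProj_injective
      ((pullProj_redL2 hν hcan (mem_redTop.1 f.2) (mem_redTop.1 h.2)).trans e.symm))
  have hp : ∀ f h : ψ.redTop, ψ.pullProj (ψ.redL2 om ν f h) =
      l2 n m om ν (ψ.pullProj (f : ψ.RedForm n)) (ψ.pullProj (h : ψ.RedForm n)) := fun f h =>
    pullProj_redL2 hν hcan (mem_redTop.1 f.2) (mem_redTop.1 h.2)
  have hs : ∀ f : ψ.redTop, IsSmoothForm n m (ψ.pullProj (f : ψ.RedForm n)) := fun f =>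
    (mem_redTop.1 f.2).1.1.1
  LinearMap.mk₂ ℝ (fun f h => ⟨ψ.redL2 om ν f h, redL2_mem hν hcan f h⟩)
    (fun f f' h => key ((congrArg₂ (· + ·) (hp f h) (hp f' h)).trans
      (l2_add_left (hs f) (hs f')).symm))
    (fun c f h => key ((congrArg (c • ·) (hp f h)).trans (l2_smul_left (hs f) c).symm))
    (fun f h h' => key ((congrArg₂ (· + ·) (hp f h) (hp f h')).trans
      (l2_add_right (hs h) (hs h')).symm))
    (fun c f h => key ((congrArg (c • ·) (hp f h)).trans (l2_smul_right (hs h) c).symm))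

theorem pullProj_redBracket (hν : IsVolumeForm n ν) (hcan : ψ.IsCanonical om ν)
    (f h : ψ.redTop) : ψ.pullProj (redBracket hν hcan f h : ψ.RedForm n) =
      l2 n m om ν (ψ.pullProj (f : ψ.RedForm n)) (ψ.pullProj (h : ψ.RedForm n)) :=
  pullProj_redL2 hν hcan (mem_redTop.1 f.2) (mem_redTop.1 h.2)

theorem redBracket_skew (hν : IsVolumeForm n ν) (hcan : ψ.IsCanonical om ν) (f h : ψ.redTop) :
    redBracket hν hcan f h = - redBracket hν hcan h f :=
  Subtype.ext (ψ.pullProj_injective ((pullProj_redBracket hν hcan f h).trans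
    ((l2_skew _ _).trans (congrArg Neg.neg (pullProj_redBracket hν hcan h f)).symm)))

/-- Exact forms have zero Euler-Lagrange form, so the bracket vanishes identically and not merely
modulo exact forms. -/
theorem redBracket_exact_left (hν : IsVolumeForm n ν) (hcan : ψ.IsCanonical om ν)
    {f : ψ.redTop} (hf : f ∈ ψ.redExact) (h : ψ.redTop) : redBracket hν hcan f h = 0 :=
  Subtype.ext (ψ.pullProj_injective ((pullProj_redBracket hν hcan f h).trans
    (l2_eq_zero_left (euler_pullProj_eq_zero (mem_redExact.1 hf)))))

theorem redBracket_exact_right (hν : IsVolumeForm n ν) (hcan : ψ.IsCanonical om ν)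
    (f : ψ.redTop) {h : ψ.redTop} (hh : h ∈ ψ.redExact) : redBracket hν hcan f h = 0 := by
  rw [redBracket_skew, redBracket_exact_left hν hcan hh, neg_zero]

/-- The cyclic sum pulls back to the jacobiator of the pullbacks, whose primitive can be taken
invariant. In contrast to the other properties, this one holds only modulo exact forms when `n > 0`.
-/
theorem redBracket_jacobi (hν : IsVolumeForm n ν) (hJ : PoissonJacobi n m om ν)
    (hcan : ψ.IsCanonical om ν) (hred : ψ.ReductionHypothesis) (f g h : ψ.redTop) :
    redBracket hν hcan (redBracket hν hcan f g) h + redBracket hν hcan (redBracket hν hcan g h) f +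
      redBracket hν hcan (redBracket hν hcan h f) g ∈ ψ.redExact := by
  have hp : ∀ f g h : ψ.redTop,
      ψ.pullProj (redBracket hν hcan (redBracket hν hcan f g) h : ψ.RedForm n) =
        l2 n m om ν (l2 n m om ν (ψ.pullProj (f : ψ.RedForm n)) (ψ.pullProj (g : ψ.RedForm n)))
          (ψ.pullProj (h : ψ.RedForm n)) := fun f g h => by
    rw [pullProj_redBracket, pullProj_redBracket]
  exact mem_redExact.2 (isRedExact_of_pullProj_eq_jacobiator hν hJ hred (mem_redTop.1 f.2).1
    (mem_redTop.1 g.2).1 (mem_redTop.1 h.2).1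
    (congrArg₂ (· + ·) (congrArg₂ (· + ·) (hp f g h) (hp g h f)) (hp h f g)))

/-- The bracket on the reduced top cohomology. -/
def cohomologyBracket (hν : IsVolumeForm n ν) (hcan : ψ.IsCanonical om ν) :
    ψ.RedCohomology →ₗ[ℝ] ψ.RedCohomology →ₗ[ℝ] ψ.RedCohomology :=
  ψ.redExact.liftQ
    (LinearMap.flip (ψ.redExact.liftQ ((redBracket hν hcan).compr₂ ψ.redExact.mkQ).flip
      fun h hh => LinearMap.ext fun f => by
        change ψ.redExact.mkQ (redBracket hν hcan f h) = 0
        rw [redBracket_exact_right hν hcan f hh, map_zero]))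
    fun f hf => LinearMap.ext fun c => by
      obtain ⟨h, rfl⟩ := ψ.redExact.mkQ_surjective c
      change ψ.redExact.mkQ (redBracket hν hcan f h) = 0
      rw [redBracket_exact_left hν hcan hf, map_zero]

theorem cohomologyBracket_mkQ (hν : IsVolumeForm n ν) (hcan : ψ.IsCanonical om ν)
    (f h : ψ.redTop) : cohomologyBracket hν hcan (ψ.redExact.mkQ f) (ψ.redExact.mkQ h) =
      ψ.redExact.mkQ (redBracket hν hcan f h) := rfl

end BundleAction
end Bracket

end

end JetReduction

theorem mainTheorem4 {n m : ℕ} {M : Type*} [TopologicalSpace M] [ChartedSpace (JetReduction.Rn n) M]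
    [IsManifold (𝓡 n) ∞ M] [T2Space M] [SigmaCompactSpace M]
    {V : M → Type*} [∀ x, AddCommGroup (V x)] [∀ x, Module ℝ (V x)] [∀ x, TopologicalSpace (V x)]
    [TopologicalSpace (TotalSpace (JetReduction.Rn m) V)] [FiberBundle (JetReduction.Rn m) V]
    [VectorBundle ℝ (JetReduction.Rn m) V]
    [ContMDiffVectorBundle ∞ (JetReduction.Rn m) V (𝓡 n)]
    (ν : ∀ x : M, TangentSpace (𝓡 n) x [⋀^Fin n]→L[ℝ] ℝ) (hν : JetReduction.IsVolumeForm n ν)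
    (om : JetReduction.SkewPairing n m V) (hJacobi : JetReduction.PoissonJacobi n m om ν)
    {G : Type*} [Group G] (ψ : JetReduction.BundleAction n m V G)
    (hcan : ψ.IsCanonical om ν) (hred : ψ.ReductionHypothesis) :
    -- the spaces and maps of the reduced complex are well defined
    (∀ h : ψ.RedForm n, h ∈ ψ.redTop ↔ ψ.IsRedTop h) ∧
    (∀ h : ψ.redTop, h ∈ ψ.redExact ↔ ψ.IsRedExact (h : ψ.RedForm n)) ∧
    (∀ (k : ℕ) (h : ψ.RedForm k), ψ.IsRedCompact h →
      ψ.pullProj (ψ.redD h) = JetReduction.dH n m (ψ.pullProj h)) ∧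
    (∀ f h : ψ.RedForm n, ψ.IsRedTop f → ψ.IsRedTop h →
      ψ.pullProj (ψ.redL2 om ν f h) =
        JetReduction.l2 n m om ν (ψ.pullProj f) (ψ.pullProj h)) ∧
    -- the bracket on the top cohomology that is induced by the reduced map
    ∃ (hl : ∀ f h : ψ.redTop, ψ.redL2 om ν f h ∈ ψ.redTop)
      (B : ψ.RedCohomology →ₗ[ℝ] ψ.RedCohomology →ₗ[ℝ] ψ.RedCohomology),
      (∀ f h : ψ.redTop, B (ψ.redExact.mkQ f) (ψ.redExact.mkQ h) =
        ψ.redExact.mkQ ⟨ψ.redL2 om ν f h, hl f h⟩) ∧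
      (∀ a b, B a b = - B b a) ∧
      ∀ a b c, B (B a b) c + B (B b c) a + B (B c a) b = 0 := by
  open JetReduction BundleAction in
  refine ⟨fun h => mem_redTop, fun h => mem_redExact, fun k h hh => ψ.pullProj_redD hh,
    fun f h hf hh => pullProj_redL2 hν hcan hf hh, redL2_mem hν hcan, cohomologyBracket hν hcan,
    fun f h => cohomologyBracket_mkQ hν hcan f h, fun a b => ?_, fun a b c => ?_⟩
  · obtain ⟨f, rfl⟩ := ψ.redExact.mkQ_surjective a
    obtain ⟨h, rfl⟩ := ψ.redExact.mkQ_surjective b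
    rw [JetReduction.BundleAction.cohomologyBracket_mkQ,
      JetReduction.BundleAction.cohomologyBracket_mkQ,
      JetReduction.BundleAction.redBracket_skew, map_neg]
  · obtain ⟨f, rfl⟩ := ψ.redExact.mkQ_surjective a
    obtain ⟨g, rfl⟩ := ψ.redExact.mkQ_surjective b
    obtain ⟨h, rfl⟩ := ψ.redExact.mkQ_surjective c
    simp only [JetReduction.BundleAction.cohomologyBracket_mkQ]
    rw [← map_add, ← map_add, Submodule.mkQ_apply, Submodule.Quotient.mk_eq_zero]
    exact JetReduction.BundleAction.redBracket_jacobi hν hJacobi hcan hred f g h
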